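/- Let $a,b,c>0$, let $F(t)=-a^2t-\frac{b^2}{3}t^2+\frac{2c^2}{3}t^3$ and $s_+=\frac{b^2+\sqrt{b^4+24a^2c^2}}{4c^2}$, and let $u$, continuous on $[0,\infty)$ and $C^2$ on $(0,\infty)$, solve $$u''+\frac2r u'-\frac{6}{r^2}u=F(u)\ \text{ on }(0,\infty),\qquad u(0)=0,\quad u(r)\to s_+\ \text{ as } r\to\infty .$$ Let $\mathcal S_0$ be the space of symmetric traceless real $3\times3$ matrices, with $|A|^2=\operatorname{tr}(A^2)$, and let $H(x)=u(|x|)\big(\frac{x}{|x|}\otimes\frac{x}{|x|}-\frac13\mathrm{Id}\big)$ be the melting hedgehog. The second variation at $H$ of the Landau–de Gennes energy is the quadratic functional $$\mathcal Q(V)=\int_{\mathbb R^3}\Big\{\tfrac12|\nabla V|^2-\tfrac{a^2}{2}|V|^2-b^2\operatorname{tr}(HV^2)+\tfrac{c^2}{2}\big(|H|^2|V|^2+2\operatorname{tr}^2(HV)\big)\Big\}\,dx,\qquad V\in H^1(\mathbb R^3;\mathcal S_0).$$ Use spherical coordinates $x=r(\sin\theta\cos\varphi,\sin\theta\sin\varphi,\cos\theta)$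 and put $$f(u)=-a^2-\tfrac{b^2u}{3}+\tfrac{2c^2u^2}{3},\quad \hat f(u)=-a^2-\tfrac{2b^2u}{3}+2c^2u^2,\quad \tilde f(u)=-a^2+\tfrac{2b^2u}{3}+\tfrac{2c^2u^2}{3}.$$ For $k\in\{0,1,2\}$ and $\varphi$-independent functions $\upsilon_0(r,\theta),\upsilon_2(r,\theta),\upsilon_4(r,\theta)$ in $H^1(\mathbb R^3)$, let $$\begin{aligned}\Phi_k(\upsilon_0,\upsilon_2,\upsilon_4)=\pi\int_0^\infty\!\!\int_0^\pi\Big\{&\tfrac13|\partial_r\upsilon_0|^2+|\partial_r\upsilon_2|^2+|\partial_r\upsilon_4|^2+\tfrac1{r^2}\Big[\tfrac13|\partial_\theta\upsilon_0|^2+|\partial_\theta\upsilon_2|^2+|\partial_\theta\upsilon_4|^2\Big]\\ &+\tfrac1{r^2}\Big[(2+\tfrac13k^2\csc^2\theta)\upsilon_0^2+(5+(\cot\theta+k\csc\theta)^2)\upsilon_2^2+(2+(2\cot\theta+k\csc\theta)^2)\upsilon_4^2\Big]\\ &+\tfrac4{r^2}\Big[-\upsilon_0(\partial_\theta\upsilon_2+\cot\theta\,\upsilon_2+k\csc\theta\,\upsilon_2)+(-\partial_\theta\upsilon_2+\cot\theta\,\upsilon_2+k\csc\theta\,\upsilon_2)\upsilon_4\Big]\\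 &+\tfrac13\hat f(u)\upsilon_0^2+f(u)\upsilon_2^2+\tilde f(u)\upsilon_4^2\Big\}\,r^2\sin\theta\,d\theta\,dr\end{aligned}$$ (equivalently, one half of the integral of $\{\dots\}$ over $\mathbb R^3$ with respect to $dx$) if $$\tfrac1r k\csc\theta\,|\upsilon_0|+\tfrac1r|\cot\theta+k\csc\theta|\,|\upsilon_2|+\tfrac1r|2\cot\theta+k\csc\theta|\,|\upsilon_4|\in L^2(\mathbb R^3),$$ and $\Phi_k(\upsilon_0,\upsilon_2,\upsilon_4)=+\infty$ otherwise. Then $\mathcal Q(V)\ge0$ for all $V\in H^1(\mathbb R^3;\mathcal S_0)$ if and only if, for each $k=0,1,2$, $\Phi_k(\upsilon_0,\upsilon_2,\upsilon_4)\ge0$ for all $\varphi$-independent $\upsilon_0,\upsilon_2,\upsilon_4\in H^1(\mathbb R^3)$. -/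

import Mathlib

open MeasureTheory
open scoped ContDiff

namespace MeltingHedgehog

/-- Physical space `ℝ³` with its Euclidean norm. -/
abbrev E3 : Type := EuclideanSpace ℝ (Fin 3)

/-! ### The Sobolev space `H¹(ℝ³)` -/

/-- The locally integrable function `g` is the weak partial derivative `∂ᵢ f` on `ℝ³`. -/
def IsWeakPartial (i : Fin 3) (f g : E3 → ℝ) : Prop :=
  LocallyIntegrable f volume ∧ LocallyIntegrable g volume ∧
    ∀ η : E3 → ℝ, ContDiff ℝ ∞ η → HasCompactSupport η →
      ∫ x, f x * fderiv ℝ η x (EuclideanSpace.single i 1) = - ∫ x, g x * η x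

/-- Weak partial derivatives are unique almost everywhere. -/
theorem IsWeakPartial.ae_eq {i : Fin 3} {f g h : E3 → ℝ}
    (hg : IsWeakPartial i f g) (hh : IsWeakPartial i f h) : g =ᵐ[volume] h := by
  refine ae_eq_of_integral_contDiff_smul_eq hg.2.1 hh.2.1 fun η hη hc => ?_
  have h1 := hg.2.2 η hη hc
  have h2 := hh.2.2 η hη hc
  simp only [smul_eq_mul, mul_comm (η _)]
  linarith

/-- `f ∈ H¹(ℝ³)`: `f` and its first weak partial derivatives belong to `L²(ℝ³)`. -/
def MemH1 (f : E3 → ℝ) : Prop :=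
  MemLp f 2 volume ∧ ∀ i, ∃ g, MemLp g 2 volume ∧ IsWeakPartial i f g

open Classical in
/-- The weak partial derivative `∂ᵢ f` of a function `f ∈ H¹(ℝ³)`
(a representative of its class; `0` if there is no weak derivative in `L²`). -/
noncomputable def weakPartial (i : Fin 3) (f : E3 → ℝ) : E3 → ℝ :=
  if h : ∃ g, MemLp g 2 volume ∧ IsWeakPartial i f g then h.choose else 0

theorem MemH1.weakPartial_spec {f : E3 → ℝ} (hf : MemH1 f) (i : Fin 3) :
    MemLp (weakPartial i f) 2 volume ∧ IsWeakPartial i f (weakPartial i f) := by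
  unfold weakPartial
  rw [dif_pos (hf.2 i)]
  exact (hf.2 i).choose_spec

/-! ### Spherical coordinates

`x = r (sin θ cos φ, sin θ sin φ, cos θ)`, with `r = ‖x‖`, `0 ≤ θ ≤ π`. -/

/-- The distance `r sin θ` to the axis. -/
noncomputable def axisDist (x : E3) : ℝ := Real.sqrt (x 0 ^ 2 + x 1 ^ 2)

noncomputable def sinTheta (x : E3) : ℝ := axisDist x / ‖x‖
noncomputable def cosTheta (x : E3) : ℝ := x 2 / ‖x‖
noncomputable def cosPhi (x : E3) : ℝ := x 0 / axisDist x
noncomputable def sinPhi (x : E3) : ℝ := x 1 / axisDist x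
noncomputable def cscTheta (x : E3) : ℝ := 1 / sinTheta x
noncomputable def cotTheta (x : E3) : ℝ := cosTheta x / sinTheta x

/-- The unit vector `n = x / |x|`. -/
noncomputable def nVec (x : E3) : Fin 3 → ℝ := fun i => x i / ‖x‖

/-- The unit vector `m = ∂n/∂θ = (cos θ cos φ, cos θ sin φ, -sin θ)`. -/
noncomputable def mVec (x : E3) : Fin 3 → ℝ :=
  ![cosTheta x * cosPhi x, cosTheta x * sinPhi x, - sinTheta x]

theorem nVec_eq {x : E3} (hx : axisDist x ≠ 0) :
    nVec x = ![sinTheta x * cosPhi x, sinTheta x * sinPhi x, cosTheta x] := by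
  have key : ∀ y : ℝ, y / ‖x‖ = axisDist x / ‖x‖ * (y / axisDist x) := fun y => by
    field_simp
  funext i
  fin_cases i
  · exact key (x 0)
  · exact key (x 1)
  · rfl

/-- The radial derivative `∂_r f = n · ∇f`. -/
noncomputable def dr (f : E3 → ℝ) (x : E3) : ℝ := ∑ i, nVec x i * weakPartial i f x

/-- The polar derivative `∂_θ f = r m · ∇f`. -/
noncomputable def dtheta (f : E3 → ℝ) (x : E3) : ℝ :=
  ‖x‖ * ∑ i, mVec x i * weakPartial i f x

/-- `f = f(r, θ)` is independent of the azimuthal angle `φ`. -/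
def IsPhiIndependent (f : E3 → ℝ) : Prop :=
  ∀ x y : E3, ‖x‖ = ‖y‖ → x 2 = y 2 → f x = f y

/-! ### The melting hedgehog -/

/-- The limit `s₊` of the profile at infinity. -/
noncomputable def sPlus (a b c : ℝ) : ℝ :=
  (b ^ 2 + Real.sqrt (b ^ 4 + 24 * a ^ 2 * c ^ 2)) / (4 * c ^ 2)

/-- The scalar nonlinearity `F`. -/
noncomputable def bulkF (a b c t : ℝ) : ℝ :=
  - a ^ 2 * t - b ^ 2 / 3 * t ^ 2 + 2 * c ^ 2 / 3 * t ^ 3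

/-- `u` solves `u'' + (2/r) u' - (6/r²) u = F(u)` on `(0, ∞)`, `u(0) = 0`, `u(∞) = s₊`. -/
structure IsProfile (a b c : ℝ) (u : ℝ → ℝ) : Prop where
  continuousOn : ContinuousOn u (Set.Ici 0)
  contDiffOn : ContDiffOn ℝ 2 u (Set.Ioi 0)
  ode : ∀ r : ℝ, 0 < r →
    deriv (deriv u) r + 2 / r * deriv u r - 6 / r ^ 2 * u r = bulkF a b c (u r)
  zero : u 0 = 0
  tendsto : Filter.Tendsto u Filter.atTop (nhds (sPlus a b c))

/-- The melting hedgehog `H(x) = u(|x|) (n ⊗ n - Id / 3)`. -/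
noncomputable def hedgehog (u : ℝ → ℝ) (x : E3) : Matrix (Fin 3) (Fin 3) ℝ :=
  u ‖x‖ • (Matrix.vecMulVec (nVec x) (nVec x) - (1 / 3 : ℝ) • (1 : Matrix (Fin 3) (Fin 3) ℝ))

/-! ### The second variation -/

/-- The squared Frobenius norm `|A|² = tr (A Aᵀ)`. -/
def frobSq (A : Matrix (Fin 3) (Fin 3) ℝ) : ℝ := ∑ i, ∑ j, A i j ^ 2

/-- The Landau-de Gennes bulk energy density. -/
noncomputable def bulkEnergy (a b c : ℝ) (A : Matrix (Fin 3) (Fin 3) ℝ) : ℝ :=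
  - a ^ 2 / 2 * frobSq A - b ^ 2 / 3 * (A * A * A).trace + c ^ 2 / 4 * frobSq A ^ 2

/-- The zero order part of the second variation at `H`, in the direction `A`. -/
noncomputable def gForm (a b c : ℝ) (H A : Matrix (Fin 3) (Fin 3) ℝ) : ℝ :=
  - a ^ 2 / 2 * frobSq A - b ^ 2 * (H * A * A).trace
    + c ^ 2 / 2 * (frobSq H * frobSq A + 2 * (H * A).trace ^ 2)

/-- `gForm` is half of the second derivative of the bulk energy density. -/
theorem gForm_eq_second_derivative (a b c : ℝ) (H A : Matrix (Fin 3) (Fin 3) ℝ)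
    (hA : A.IsSymm) :
    iteratedDeriv 2 (fun t : ℝ => bulkEnergy a b c (H + t • A)) 0 = 2 * gForm a b c H A := by
  have hA10 : A 1 0 = A 0 1 := hA.apply 0 1
  have hA20 : A 2 0 = A 0 2 := hA.apply 0 2
  have hA21 : A 2 1 = A 1 2 := hA.apply 1 2
  have hex : ∃ p₀ p₁ p₃ p₄ : ℝ, (fun t : ℝ => bulkEnergy a b c (H + t • A)) =
      fun t => p₀ + p₁ * t + gForm a b c H A * t ^ 2 + p₃ * t ^ 3 + p₄ * t ^ 4 := by
    refine ⟨bulkEnergy a b c H,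
      - a ^ 2 * (H * A).trace - b ^ 2 * (H * H * A).trace + c ^ 2 * frobSq H * (H * A).trace,
      - b ^ 2 / 3 * (A * A * A).trace + c ^ 2 * frobSq A * (H * A).trace,
      c ^ 2 / 4 * frobSq A ^ 2, ?_⟩
    funext t
    simp only [bulkEnergy, gForm, frobSq, Matrix.trace, Matrix.diag, Matrix.mul_apply,
      Fin.sum_univ_three, Matrix.add_apply, Matrix.smul_apply, smul_eq_mul, hA10, hA20, hA21]
    ring
  obtain ⟨p₀, p₁, p₃, p₄, h⟩ := hex
  generalize gForm a b c H A = g at h ⊢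
  have hd : ∀ t : ℝ, HasDerivAt (fun t => p₀ + p₁ * t + g * t ^ 2 + p₃ * t ^ 3 + p₄ * t ^ 4)
      (p₁ + g * (2 * t) + p₃ * (3 * t ^ 2) + p₄ * (4 * t ^ 3)) t := fun t => by
    have h1 := (((((hasDerivAt_id t).const_mul p₁).const_add p₀).add
      ((hasDerivAt_pow 2 t).const_mul g)).add ((hasDerivAt_pow 3 t).const_mul p₃)).add
      ((hasDerivAt_pow 4 t).const_mul p₄)
    exact h1.congr_deriv (by norm_num)
  have hd2 : HasDerivAt (fun t : ℝ => p₁ + g * (2 * t) + p₃ * (3 * t ^ 2) + p₄ * (4 * t ^ 3))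
      (2 * g) 0 := by
    have h1 := (((((hasDerivAt_id (0 : ℝ)).const_mul 2).const_mul g).const_add p₁).add
      (((hasDerivAt_pow 2 (0 : ℝ)).const_mul 3).const_mul p₃)).add
      (((hasDerivAt_pow 3 (0 : ℝ)).const_mul 4).const_mul p₄)
    exact h1.congr_deriv (by norm_num; try ring)
  rw [h, iteratedDeriv_succ, iteratedDeriv_one, funext fun t => (hd t).deriv]
  exact hd2.deriv

/-- `V ∈ H¹(ℝ³; 𝒮₀)`, with `𝒮₀` the symmetric traceless `3 × 3` matrices. -/
structure MemH1S0 (V : E3 → Matrix (Fin 3) (Fin 3) ℝ) : Prop where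
  symm : ∀ x, (V x).IsSymm
  trace_eq_zero : ∀ x, (V x).trace = 0
  memH1 : ∀ i j, MemH1 (fun x => V x i j)

/-- `|∇V|²`. -/
noncomputable def gradSq (V : E3 → Matrix (Fin 3) (Fin 3) ℝ) (x : E3) : ℝ :=
  ∑ l, ∑ i, ∑ j, weakPartial l (fun y => V y i j) x ^ 2

/-- The second variation `𝒬(V) = ∫ ½ |∇V|² + g(x, V)` of the Landau-de Gennes energy at the
melting hedgehog, i.e. `½ d²/dt²` at `t = 0` of `∫ ½ |∇(H + tV)|² + bulkEnergy (H + tV)`. -/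
noncomputable def secondVariation (a b c : ℝ) (u : ℝ → ℝ)
    (V : E3 → Matrix (Fin 3) (Fin 3) ℝ) : ℝ :=
  ∫ x, (1 / 2 * gradSq V x + gForm a b c (hedgehog u x) (V x))

/-! ### The reduced functionals -/

/-- `f(t) = F(t) / t`. -/
noncomputable def fMid (a b c t : ℝ) : ℝ := - a ^ 2 - b ^ 2 * t / 3 + 2 * c ^ 2 * t ^ 2 / 3

/-- `f̂(t) = F'(t)`. -/
noncomputable def fHat (a b c t : ℝ) : ℝ := - a ^ 2 - 2 * b ^ 2 * t / 3 + 2 * c ^ 2 * t ^ 2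

/-- `f̃(t)`. -/
noncomputable def fTilde (a b c t : ℝ) : ℝ :=
  - a ^ 2 + 2 * b ^ 2 * t / 3 + 2 * c ^ 2 * t ^ 2 / 3

/-- The expression in the curly bracket in the definition of `Φ_k`. -/
noncomputable def phiDensity (a b c : ℝ) (u : ℝ → ℝ) (k : ℕ) (v₀ v₂ v₄ : E3 → ℝ) (x : E3) : ℝ :=
  1 / 3 * dr v₀ x ^ 2 + dr v₂ x ^ 2 + dr v₄ x ^ 2
  + 1 / ‖x‖ ^ 2 * (1 / 3 * dtheta v₀ x ^ 2 + dtheta v₂ x ^ 2 + dtheta v₄ x ^ 2)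
  + 1 / ‖x‖ ^ 2 *
      ((2 + 1 / 3 * (k : ℝ) ^ 2 * cscTheta x ^ 2) * v₀ x ^ 2
      + (5 + (cotTheta x + k * cscTheta x) ^ 2) * v₂ x ^ 2
      + (2 + (2 * cotTheta x + k * cscTheta x) ^ 2) * v₄ x ^ 2)
  + 4 / ‖x‖ ^ 2 *
      (- v₀ x * (dtheta v₂ x + cotTheta x * v₂ x + k * cscTheta x * v₂ x)
      + (- dtheta v₂ x + cotTheta x * v₂ x + k * cscTheta x * v₂ x) * v₄ x)
  + 1 / 3 * fHat a b c (u ‖x‖) * v₀ x ^ 2 + fMid a b c (u ‖x‖) * v₂ x ^ 2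
  + fTilde a b c (u ‖x‖) * v₄ x ^ 2

/-- The condition under which `Φ_k` is finite. -/
def PhiAdmissible (k : ℕ) (v₀ v₂ v₄ : E3 → ℝ) : Prop :=
  MemLp (fun x : E3 =>
    1 / ‖x‖ * k * cscTheta x * |v₀ x|
    + 1 / ‖x‖ * |cotTheta x + k * cscTheta x| * |v₂ x|
    + 1 / ‖x‖ * |2 * cotTheta x + k * cscTheta x| * |v₄ x|) 2 volume

open Classical in
/-- The functional `Φ_k(v₀, v₂, v₄) = π ∫₀^∞ ∫₀^π {…} r² sin θ dθ dr` on `φ`-independent functions,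
with value `+∞` on the triples that are not admissible. The curly bracket does not depend on `φ`
and `dx = r² sin θ dr dθ dφ` with `0 < φ < 2π`, so `π ∫₀^∞ ∫₀^π {…} r² sin θ dθ dr` is
`½ ∫_{ℝ³} {…} dx`. -/
noncomputable def Phi (a b c : ℝ) (u : ℝ → ℝ) (k : ℕ) (v₀ v₂ v₄ : E3 → ℝ) : EReal :=
  if PhiAdmissible k v₀ v₂ v₄ then
    ((1 / 2 * ∫ x, phiDensity a b c u k v₀ v₂ v₄ x : ℝ) : EReal)
  else ⊤

/-- `𝒬` is nonnegative definite on `H¹(ℝ³; 𝒮₀)`. -/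
def SecondVariationNonneg (a b c : ℝ) (u : ℝ → ℝ) : Prop :=
  ∀ V : E3 → Matrix (Fin 3) (Fin 3) ℝ, MemH1S0 V → 0 ≤ secondVariation a b c u V

/-- `Φ_k` is nonnegative on triples of `φ`-independent functions in `H¹(ℝ³)`. -/
def PhiNonneg (a b c : ℝ) (u : ℝ → ℝ) (k : ℕ) : Prop :=
  ∀ v₀ v₂ v₄ : E3 → ℝ, MemH1 v₀ → MemH1 v₂ → MemH1 v₄ →
    IsPhiIndependent v₀ → IsPhiIndependent v₂ → IsPhiIndependent v₄ →
      0 ≤ Phi a b c u k v₀ v₂ v₄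

end MeltingHedgehog

/-!
Off the axis, a symmetric traceless matrix field has five components in the spherical frame
`n, m, p` (`exists_frameMat_eq`). In these components the density of the second variation is a sum of
squares plus the three bulk terms with `f̂`, `f`, `f̃` (`energy_frameField`), and its coefficients
do not depend on the azimuth `φ`. A line has zero `H¹`-capacity in `ℝ³`; hence fields supported
away from the axis are dense (`exists_test_seq`), and together with Hardy's inequality, which
controls the terms with `1 / r²`, this reduces both sides of the equivalence to smooth functions
with compact support off the axis (`secondVariationNonneg_of_test`, `phiNonneg_of_test`). On these,
integration by parts in `θ` identifies `Φ_k` with the integral of the sum of squares `modeEnergy`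
that the mode `e^{ikφ}` contributes to the second variation (`integral_modeEnergy`).

If `Φ₀, Φ₁, Φ₂ ≥ 0`, Parseval's identity on the circles about the axis writes the second variation
as the sum over `k ∈ ℤ` of the mode energies (`integral_frameEnergy_nonneg`). For `k ≥ 3` the
density of `Φ_k` dominates that of `Φ_{k-1}` pointwise (`modePhi_sub_one_le`), and the antipodal
map exchanges the modes `k` and `-k` (`modePhi_neg`).

Conversely, a real field of azimuthal order `k` has coefficients `(v₀, v₂, v₄)` on the mode `k` and
`(v₀, v₂', v₄')` on the mode `-k`, with the *same* `v₀`, and its energy is proportional to the sum of the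
two mode energies (`SecondVariationNonneg.modes`). For `k = 0` one takes `v₂' = v₂`, `v₄' = v₄`. For
`k = 1, 2` the components `v₂', v₄'` are obtained from `v₂, v₄` by the first order equations
`∂_θ A = k csc θ A + v` along meridians (`pot`, `dualTwo`, `dualFour`) in such a way that the difference of the
two energy densities is a `θ`-divergence (`hasD_dualPrim`); so the two energies agree, and the
energy of `(v₀, v₂, v₄)` is half of a nonnegative number. The transformed components do not vanish
near the axis `θ = 0`, but for `k ≤ 2` they are bounded there (`exists_bound_dual`; they vanish
near `θ = π` by the choice of the primitive), so that cutting them off near the axis costs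
arbitrarily little (`exists_axis_cut`, `modeEnergy_cut_le`).
-/

namespace MeltingHedgehog
open Filter Topology

/-! ### Convergence in `L²` and of integrals -/

section L2

variable {α : Type*} [MeasurableSpace α] {μ : Measure α}

/-- The sequence `f` of square integrable functions converges to `g` in `L²`. -/
structure L2Tendsto (μ : Measure α) (f : ℕ → α → ℝ) (g : α → ℝ) : Prop where
  mem : ∀ n, MemLp (f n) 2 μ
  memLim : MemLp g 2 μ
  tendsto : Tendsto (fun n => eLpNorm (f n - g) 2 μ) atTop (𝓝 0)

theorem eLpNorm_two_eq_sqrt {f : α → ℝ} (hf : MemLp f 2 μ) :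
    eLpNorm f 2 μ = ENNReal.ofReal (Real.sqrt (∫ x, f x ^ 2 ∂μ)) := by
  rw [hf.eLpNorm_eq_integral_rpow_norm (by norm_num) (by norm_num)]
  congr 1
  rw [Real.sqrt_eq_rpow]
  simp

namespace L2Tendsto

variable {f f' : ℕ → α → ℝ} {g g' : α → ℝ}

theorem const (hg : MemLp g 2 μ) : L2Tendsto μ (fun _ => g) g :=
  ⟨fun _ => hg, hg, by simp⟩

theorem congr (h : L2Tendsto μ f g) (hf : ∀ n, f n =ᵐ[μ] f' n) (hg : g =ᵐ[μ] g') :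
    L2Tendsto μ f' g' := by
  refine ⟨fun n => (memLp_congr_ae (hf n)).1 (h.mem n), (memLp_congr_ae hg).1 h.memLim, ?_⟩
  refine h.tendsto.congr fun n => eLpNorm_congr_ae ((hf n).sub hg)

/-- Convergence in `L²` from a pointwise bound of the errors. -/
theorem of_le (hf : ∀ n, MemLp (f n) 2 μ) (hg : MemLp g 2 μ) {C : ℝ} (h : L2Tendsto μ f' g')
    (hle : ∀ n, ∀ᵐ x ∂μ, |f n x - g x| ≤ C * |f' n x - g' x|) : L2Tendsto μ f g := by
  refine ⟨hf, hg, ?_⟩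
  have hlim : Tendsto (fun n => ENNReal.ofReal C * eLpNorm (f' n - g') 2 μ) atTop (𝓝 0) := by
    simpa using ENNReal.Tendsto.const_mul h.tendsto (Or.inr ENNReal.ofReal_ne_top)
  refine tendsto_of_tendsto_of_tendsto_of_le_of_le tendsto_const_nhds hlim
    (fun _ => zero_le) fun n => ?_
  exact eLpNorm_le_mul_eLpNorm_of_ae_le_mul (hle n) 2

theorem add (h : L2Tendsto μ f g) (h' : L2Tendsto μ f' g') :
    L2Tendsto μ (fun n x => f n x + f' n x) (fun x => g x + g' x) := by
  refine ⟨fun n => (h.mem n).add (h'.mem n), h.memLim.add h'.memLim, ?_⟩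
  have hlim : Tendsto (fun n => eLpNorm (f n - g) 2 μ + eLpNorm (f' n - g') 2 μ) atTop (𝓝 0) := by
    simpa using h.tendsto.add h'.tendsto
  refine tendsto_of_tendsto_of_tendsto_of_le_of_le tendsto_const_nhds hlim
    (fun _ => zero_le) fun n => ?_
  have e : (fun x => f n x + f' n x) - (fun x => g x + g' x) = (f n - g) + (f' n - g') := by
    funext x; simp; ring
  simp only [e]
  exact eLpNorm_add_le ((h.mem n).sub h.memLim).1 ((h'.mem n).sub h'.memLim).1 (by norm_num)

theorem bdd_mul {w : α → ℝ} (hw : AEStronglyMeasurable w μ) {C : ℝ} (hC : ∀ᵐ x ∂μ, |w x| ≤ C)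
    (h : L2Tendsto μ f g) : L2Tendsto μ (fun n x => w x * f n x) (fun x => w x * g x) := by
  have key : ∀ {k : α → ℝ}, MemLp k 2 μ → MemLp (fun x => w x * k x) 2 μ := fun {k} hk =>
    hk.of_le_mul (c := C) (hw.mul hk.1) <| hC.mono fun x hx => by
      rw [norm_mul]; exact mul_le_mul_of_nonneg_right hx (norm_nonneg _)
  refine of_le (fun n => key (h.mem n)) (key h.memLim) (C := C) h fun n => hC.mono fun x hx => ?_
  rw [← mul_sub, abs_mul]
  exact mul_le_mul_of_nonneg_right hx (abs_nonneg _)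

theorem const_mul (c : ℝ) (h : L2Tendsto μ f g) :
    L2Tendsto μ (fun n x => c * f n x) (fun x => c * g x) :=
  h.bdd_mul (w := fun _ => c) aestronglyMeasurable_const (C := |c|) (by simp)

theorem sub (h : L2Tendsto μ f g) (h' : L2Tendsto μ f' g') :
    L2Tendsto μ (fun n x => f n x - f' n x) (fun x => g x - g' x) := by
  simpa [sub_eq_add_neg] using h.add (h'.const_mul (-1))

theorem sum {ι : Type*} (s : Finset ι) {f : ι → ℕ → α → ℝ} {g : ι → α → ℝ}
    (h : ∀ i ∈ s, L2Tendsto μ (f i) (g i)) :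
    L2Tendsto μ (fun n x => ∑ i ∈ s, f i n x) (fun x => ∑ i ∈ s, g i x) := by
  classical
  induction s using Finset.induction_on with
  | empty => simpa using L2Tendsto.const (μ := μ) (g := fun _ => (0 : ℝ)) MemLp.zero
  | insert i s hi ih =>
    simp only [Finset.sum_insert hi]
    exact (h i (by simp)).add (ih fun j hj => h j (by simp [hj]))

/-- Dominated convergence in `L²`. -/
theorem of_dominated {b : α → ℝ} (hf : ∀ n, AEStronglyMeasurable (f n) μ) (hg : MemLp g 2 μ)
    (hb : MemLp b 2 μ) (hle : ∀ n, ∀ᵐ x ∂μ, |f n x - g x| ≤ b x)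
    (hlim : ∀ᵐ x ∂μ, Tendsto (fun n => f n x) atTop (𝓝 (g x))) : L2Tendsto μ f g := by
  have hd : ∀ n, MemLp (f n - g) 2 μ := fun n =>
    hb.mono ((hf n).sub hg.1) <| (hle n).mono fun x hx => by
      simpa using hx.trans (le_abs_self _)
  refine ⟨fun n => by simpa using (hd n).add hg, hg, ?_⟩
  simp only [eLpNorm_two_eq_sqrt (hd _)]
  have : Tendsto (fun n => ∫ x, (f n - g) x ^ 2 ∂μ) atTop (𝓝 (∫ _, (0 : ℝ) ∂μ)) := by
    refine tendsto_integral_of_dominated_convergence (fun x => b x ^ 2)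
      (fun n => (hd n).1.pow 2) hb.integrable_sq (fun n => (hle n).mono fun x hx => ?_)
      (hlim.mono fun x hx => ?_)
    · simp only [Pi.sub_apply, norm_pow, Real.norm_eq_abs]
      exact pow_le_pow_left₀ (abs_nonneg _) hx 2
    · simpa using (hx.sub_const (g x)).pow 2
  have h2 := ENNReal.tendsto_ofReal ((Real.continuous_sqrt.tendsto _).comp this)
  simpa using h2

theorem integrable_mul (h : L2Tendsto μ f g) (h' : L2Tendsto μ f' g') :
    Integrable (fun x => g x * g' x) μ := h.memLim.integrable_mul h'.memLim

theorem tendsto_integral_mul (h : L2Tendsto μ f g) (h' : L2Tendsto μ f' g') :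
    Tendsto (fun n => ∫ x, f n x * f' n x ∂μ) atTop (𝓝 (∫ x, g x * g' x ∂μ)) := by
  have key : ∀ {k k' : α → ℝ} (hk : MemLp k 2 μ) (hk' : MemLp k' 2 μ),
      ∫ x, k x * k' x ∂μ = inner ℝ (hk'.toLp k') (hk.toLp k) := by
    intro k k' hk hk'
    rw [L2.inner_def]
    refine integral_congr_ae ?_
    filter_upwards [hk.coeFn_toLp, hk'.coeFn_toLp] with x h1 h2
    simp [h1, h2]
  rw [key h.memLim h'.memLim]
  simp only [fun n => key (h.mem n) (h'.mem n)]
  exact ((Lp.tendsto_Lp_iff_tendsto_eLpNorm'' _ h'.mem _ h'.memLim).2 h'.tendsto).inner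
    ((Lp.tendsto_Lp_iff_tendsto_eLpNorm'' _ h.mem _ h.memLim).2 h.tendsto)

end L2Tendsto

/-- Integrable functions `q n` whose integrals converge to the integral of the integrable `Q`. -/
structure IntTendsto (μ : Measure α) (q : ℕ → α → ℝ) (Q : α → ℝ) : Prop where
  int : ∀ n, Integrable (q n) μ
  intLim : Integrable Q μ
  tendsto : Tendsto (fun n => ∫ x, q n x ∂μ) atTop (𝓝 (∫ x, Q x ∂μ))

namespace IntTendsto

variable {q q' : ℕ → α → ℝ} {Q Q' : α → ℝ}

theorem add (h : IntTendsto μ q Q) (h' : IntTendsto μ q' Q') :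
    IntTendsto μ (fun n x => q n x + q' n x) (fun x => Q x + Q' x) := by
  refine ⟨fun n => (h.int n).add (h'.int n), h.intLim.add h'.intLim, ?_⟩
  simp only [integral_add (h.int _) (h'.int _), integral_add h.intLim h'.intLim]
  exact h.tendsto.add h'.tendsto

theorem const_mul (c : ℝ) (h : IntTendsto μ q Q) :
    IntTendsto μ (fun n x => c * q n x) (fun x => c * Q x) := by
  refine ⟨fun n => (h.int n).const_mul c, h.intLim.const_mul c, ?_⟩
  simp only [integral_const_mul]
  exact h.tendsto.const_mul c

theorem sub (h : IntTendsto μ q Q) (h' : IntTendsto μ q' Q') :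
    IntTendsto μ (fun n x => q n x - q' n x) (fun x => Q x - Q' x) := by
  simpa [sub_eq_add_neg] using h.add (h'.const_mul (-1))

theorem sum {ι : Type*} (s : Finset ι) {q : ι → ℕ → α → ℝ} {Q : ι → α → ℝ}
    (h : ∀ i ∈ s, IntTendsto μ (q i) (Q i)) :
    IntTendsto μ (fun n x => ∑ i ∈ s, q i n x) (fun x => ∑ i ∈ s, Q i x) := by
  classical
  induction s using Finset.induction_on with
  | empty => exact ⟨by simp, by simp, by simp⟩
  | insert i s hi ih =>
    simp only [Finset.sum_insert hi]
    exact (h i (by simp)).add (ih fun j hj => h j (by simp [hj]))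

theorem congr (h : IntTendsto μ q Q) (hq : ∀ n, q n =ᵐ[μ] q' n) (hQ : Q =ᵐ[μ] Q') :
    IntTendsto μ q' Q' := by
  refine ⟨fun n => (h.int n).congr (hq n), h.intLim.congr hQ, ?_⟩
  rw [← integral_congr_ae hQ]
  exact h.tendsto.congr fun n => integral_congr_ae (hq n)

end IntTendsto

theorem L2Tendsto.mul {f f' : ℕ → α → ℝ} {g g' : α → ℝ} (h : L2Tendsto μ f g)
    (h' : L2Tendsto μ f' g') :
    IntTendsto μ (fun n x => f n x * f' n x) (fun x => g x * g' x) :=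
  ⟨fun n => (h.mem n).integrable_mul (h'.mem n), h.integrable_mul h',
    h.tendsto_integral_mul h'⟩

theorem L2Tendsto.sq {f : ℕ → α → ℝ} {g : α → ℝ} (h : L2Tendsto μ f g) :
    IntTendsto μ (fun n x => f n x ^ 2) (fun x => g x ^ 2) := by
  simpa only [pow_two] using h.mul h

/-- Termwise integration of a pointwise convergent series of nonnegative functions. -/
theorem hasSum_integral_of_nonneg {ι : Type*} [Countable ι] {f : ι → α → ℝ} {F : α → ℝ}
    (hf : ∀ i, AEStronglyMeasurable (f i) μ) (h0 : ∀ i, ∀ᵐ x ∂μ, 0 ≤ f i x)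
    (hF : Integrable F μ) (h : ∀ᵐ x ∂μ, HasSum (fun i => f i x) (F x)) :
    (∀ i, Integrable (f i) μ) ∧ HasSum (fun i => ∫ x, f i x ∂μ) (∫ x, F x ∂μ) := by
  have h0' : ∀ᵐ x ∂μ, ∀ i, 0 ≤ f i x := ae_all_iff.2 h0
  refine ⟨fun i => hF.mono' (hf i) ?_, ?_⟩
  · filter_upwards [h0', h] with x hx hs
    rw [Real.norm_of_nonneg (hx i)]
    exact le_hasSum hs i fun j _ => hx j
  · refine hasSum_integral_of_dominated_convergence f hf (fun i => ?_) ?_ ?_ h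
    · filter_upwards [h0 i] with x hx
      rw [Real.norm_of_nonneg hx]
    · exact h.mono fun x hx => hx.summable
    · exact hF.congr (h.mono fun x hx => hx.tsum_eq.symm)

end L2

/-! ### Weak derivatives: calculus -/

/-- The classical partial derivative `∂ᵢ f`. -/
noncomputable def pd (i : Fin 3) (f : E3 → ℝ) (x : E3) : ℝ :=
  fderiv ℝ f x (EuclideanSpace.single i 1)

theorem continuous_pd {f : E3 → ℝ} (hf : ContDiff ℝ 1 f) (i : Fin 3) : Continuous (pd i f) :=
  (hf.continuous_fderiv (by norm_num)).clm_apply continuous_const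

theorem hasCompactSupport_pd {f : E3 → ℝ} (hf : HasCompactSupport f) (i : Fin 3) :
    HasCompactSupport (pd i f) := (hf.fderiv_apply ℝ _)

theorem pd_mul {f g : E3 → ℝ} (hf : Differentiable ℝ f) (hg : Differentiable ℝ g) (i : Fin 3)
    (x : E3) : pd i (fun y => f y * g y) x = f x * pd i g x + pd i f x * g x := by
  simp only [pd]
  rw [fderiv_fun_mul (hf x) (hg x)]
  simp [mul_comm]

theorem memLp_two_of_continuous {f : E3 → ℝ} (hf : Continuous f) (hc : HasCompactSupport f) :
    MemLp f 2 volume := hf.memLp_of_hasCompactSupport hc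

theorem locallyIntegrable_of_memLp {f : E3 → ℝ} (hf : MemLp f 2 volume) :
    LocallyIntegrable f volume := hf.locallyIntegrable (by norm_num)

theorem integrable_mul_of_locallyIntegrable {f g : E3 → ℝ} (hf : LocallyIntegrable f volume)
    (hg : Continuous g) (hc : HasCompactSupport g) : Integrable (fun x => f x * g x) volume := by
  simpa [mul_comm] using hf.integrable_smul_right_of_hasCompactSupport hg hc

theorem isWeakPartial_pd {f : E3 → ℝ} (hf : ContDiff ℝ 1 f) (i : Fin 3) :
    IsWeakPartial i f (pd i f) := by
  refine ⟨hf.continuous.locallyIntegrable, (continuous_pd hf i).locallyIntegrable, ?_⟩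
  intro η hη hc
  have hη1 : ContDiff ℝ 1 η := hη.of_le (by exact_mod_cast le_top)
  refine integral_mul_fderiv_eq_neg_fderiv_mul_of_integrable ?_ ?_ ?_
    (fun x _ => hf.differentiable (by norm_num) x) (fun x _ => hη1.differentiable (by norm_num) x)
  · exact integrable_mul_of_locallyIntegrable (continuous_pd hf i).locallyIntegrable
      hη.continuous hc
  · exact integrable_mul_of_locallyIntegrable hf.continuous.locallyIntegrable
      (continuous_pd hη1 i) (hasCompactSupport_pd hc i)
  · exact integrable_mul_of_locallyIntegrable hf.continuous.locallyIntegrable hη.continuous hc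

theorem MemH1.of_partials {f : E3 → ℝ} (hf : MemLp f 2 volume) {g : Fin 3 → E3 → ℝ}
    (hg : ∀ i, MemLp (g i) 2 volume) (h : ∀ i, IsWeakPartial i f (g i)) : MemH1 f :=
  ⟨hf, fun i => ⟨g i, hg i, h i⟩⟩

/-- The choice in the definition of `weakPartial` plays no role, since weak derivatives are unique
almost everywhere. -/
theorem MemH1.weakPartial_ae_eq {f g : E3 → ℝ} (hf : MemH1 f) {i : Fin 3}
    (h : IsWeakPartial i f g) : weakPartial i f =ᵐ[volume] g :=
  (hf.weakPartial_spec i).2.ae_eq h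

theorem memH1_of_contDiff {f : E3 → ℝ} (hf : ContDiff ℝ 1 f) (hc : HasCompactSupport f) :
    MemH1 f :=
  MemH1.of_partials (memLp_two_of_continuous hf.continuous hc)
    (fun i => memLp_two_of_continuous (continuous_pd hf i) (hasCompactSupport_pd hc i))
    (fun i => isWeakPartial_pd hf i)

theorem weakPartial_ae_eq_pd {f : E3 → ℝ} (hf : ContDiff ℝ 1 f) (hc : HasCompactSupport f)
    (i : Fin 3) : weakPartial i f =ᵐ[volume] pd i f :=
  (memH1_of_contDiff hf hc).weakPartial_ae_eq (isWeakPartial_pd hf i)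

theorem IsWeakPartial.add {i : Fin 3} {f f' g g' : E3 → ℝ} (h : IsWeakPartial i f g)
    (h' : IsWeakPartial i f' g') :
    IsWeakPartial i (fun x => f x + f' x) (fun x => g x + g' x) := by
  refine ⟨h.1.add h'.1, h.2.1.add h'.2.1, fun η hη hc => ?_⟩
  have hη1 : ContDiff ℝ 1 η := hη.of_le (by exact_mod_cast le_top)
  have e1 := h.2.2 η hη hc
  have e2 := h'.2.2 η hη hc
  change ∫ x, f x * pd i η x = _ at e1
  change ∫ x, f' x * pd i η x = _ at e2
  change ∫ x, (f x + f' x) * pd i η x = _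
  simp only [add_mul]
  rw [integral_add (integrable_mul_of_locallyIntegrable h.1 (continuous_pd hη1 i)
      (hasCompactSupport_pd hc i)) (integrable_mul_of_locallyIntegrable h'.1
      (continuous_pd hη1 i) (hasCompactSupport_pd hc i)),
    integral_add (integrable_mul_of_locallyIntegrable h.2.1 hη.continuous hc)
      (integrable_mul_of_locallyIntegrable h'.2.1 hη.continuous hc), e1, e2]
  ring

theorem IsWeakPartial.const_mul {i : Fin 3} {f g : E3 → ℝ} (c : ℝ) (h : IsWeakPartial i f g) :
    IsWeakPartial i (fun x => c * f x) (fun x => c * g x) := by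
  refine ⟨h.1.smul c, h.2.1.smul c, fun η hη hc => ?_⟩
  simp only [mul_assoc, integral_const_mul, h.2.2 η hη hc]
  ring

theorem MemH1.add {f g : E3 → ℝ} (hf : MemH1 f) (hg : MemH1 g) :
    MemH1 (fun x => f x + g x) :=
  .of_partials (hf.1.add hg.1)
    (fun i => (hf.weakPartial_spec i).1.add (hg.weakPartial_spec i).1)
    (fun i => (hf.weakPartial_spec i).2.add (hg.weakPartial_spec i).2)

theorem MemH1.const_mul {f : E3 → ℝ} (c : ℝ) (hf : MemH1 f) : MemH1 (fun x => c * f x) :=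
  .of_partials (hf.1.const_mul c) (fun i => (hf.weakPartial_spec i).1.const_mul c)
    (fun i => (hf.weakPartial_spec i).2.const_mul c)

theorem weakPartial_add {f g : E3 → ℝ} (hf : MemH1 f) (hg : MemH1 g) (i : Fin 3) :
    weakPartial i (fun x => f x + g x) =ᵐ[volume] fun x => weakPartial i f x + weakPartial i g x :=
  (hf.add hg).weakPartial_ae_eq ((hf.weakPartial_spec i).2.add (hg.weakPartial_spec i).2)

theorem weakPartial_const_mul {f : E3 → ℝ} (c : ℝ) (hf : MemH1 f) (i : Fin 3) :
    weakPartial i (fun x => c * f x) =ᵐ[volume] fun x => c * weakPartial i f x :=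
  (hf.const_mul c).weakPartial_ae_eq ((hf.weakPartial_spec i).2.const_mul c)

/-- The product rule for a weak derivative and a smooth factor. -/
theorem IsWeakPartial.smooth_mul {i : Fin 3} {f g χ : E3 → ℝ} (h : IsWeakPartial i f g)
    (hχ : ContDiff ℝ ∞ χ) :
    IsWeakPartial i (fun x => χ x * f x) (fun x => χ x * g x + pd i χ x * f x) := by
  have hχ1 : ContDiff ℝ 1 χ := hχ.of_le (by exact_mod_cast le_top)
  refine ⟨?_, ?_, fun η hη hc => ?_⟩
  · simpa using h.1.continuous_smul hχ.continuous
  · have h1 : LocallyIntegrable (fun x => χ x * g x) volume := by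
      simpa using h.2.1.continuous_smul hχ.continuous
    have h2 : LocallyIntegrable (fun x => pd i χ x * f x) volume := by
      simpa using h.1.continuous_smul (continuous_pd hχ1 i)
    exact h1.add h2
  · have hη1 : ContDiff ℝ 1 η := hη.of_le (by exact_mod_cast le_top)
    have e := h.2.2 (fun x => χ x * η x) (hχ.mul hη) hc.mul_left
    have e2 : ∀ x, fderiv ℝ (fun x => χ x * η x) x (EuclideanSpace.single i 1)
        = χ x * pd i η x + pd i χ x * η x := fun x =>
      pd_mul (hχ1.differentiable (by norm_num)) (hη1.differentiable (by norm_num)) i x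
    simp only [e2] at e
    have i1 : Integrable (fun x => f x * (χ x * pd i η x)) volume :=
      integrable_mul_of_locallyIntegrable h.1 (hχ.continuous.mul (continuous_pd hη1 i))
        (hasCompactSupport_pd hc i).mul_left
    have i2 : Integrable (fun x => f x * (pd i χ x * η x)) volume :=
      integrable_mul_of_locallyIntegrable h.1 ((continuous_pd hχ1 i).mul hη.continuous)
        hc.mul_left
    have i3 : Integrable (fun x => g x * (χ x * η x)) volume :=
      integrable_mul_of_locallyIntegrable h.2.1 (hχ.continuous.mul hη.continuous) hc.mul_left
    have e3 : ∫ x, f x * (χ x * pd i η x + pd i χ x * η x)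
        = (∫ x, f x * (χ x * pd i η x)) + ∫ x, f x * (pd i χ x * η x) := by
      rw [← integral_add i1 i2]; simp only [mul_add]
    have e4 : ∫ x, (χ x * g x + pd i χ x * f x) * η x
        = (∫ x, g x * (χ x * η x)) + ∫ x, f x * (pd i χ x * η x) := by
      rw [← integral_add i3 i2]; refine integral_congr_ae (ae_of_all _ fun x => ?_); simp only; ring
    have e5 : ∫ x, χ x * f x * fderiv ℝ η x (EuclideanSpace.single i 1)
        = ∫ x, f x * (χ x * pd i η x) := by
      refine integral_congr_ae (ae_of_all _ fun x => ?_); simp only [pd]; ring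
    rw [e5, e4]; linarith

/-- A smooth function with bounded values and bounded first derivatives multiplies `H¹`. -/
theorem MemH1.smooth_mul {f χ : E3 → ℝ} (hf : MemH1 f) (hχ : ContDiff ℝ ∞ χ) {C : ℝ}
    (h0 : ∀ x, |χ x| ≤ C) (h1 : ∀ i x, |pd i χ x| ≤ C) : MemH1 (fun x => χ x * f x) := by
  have hχ1 : ContDiff ℝ 1 χ := hχ.of_le (by exact_mod_cast le_top)
  have key : ∀ {k w : E3 → ℝ}, MemLp k 2 volume → Continuous w → (∀ x, |w x| ≤ C) →
      MemLp (fun x => w x * k x) 2 volume := fun {k w} hk hw hC =>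
    hk.of_le_mul (c := C) (hw.aestronglyMeasurable.mul hk.1) <| ae_of_all _ fun x => by
      rw [norm_mul]; exact mul_le_mul_of_nonneg_right (hC x) (norm_nonneg _)
  exact .of_partials (key hf.1 hχ.continuous h0)
    (fun i => (key (hf.weakPartial_spec i).1 hχ.continuous h0).add
      (key hf.1 (continuous_pd hχ1 i) (h1 i)))
    (fun i => (hf.weakPartial_spec i).2.smooth_mul hχ)

theorem weakPartial_smooth_mul {f χ : E3 → ℝ} (hf : MemH1 f) (hχ : ContDiff ℝ ∞ χ) {C : ℝ}
    (h0 : ∀ x, |χ x| ≤ C) (h1 : ∀ i x, |pd i χ x| ≤ C) (i : Fin 3) :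
    weakPartial i (fun x => χ x * f x) =ᵐ[volume]
      fun x => χ x * weakPartial i f x + pd i χ x * f x :=
  (hf.smooth_mul hχ h0 h1).weakPartial_ae_eq ((hf.weakPartial_spec i).2.smooth_mul hχ)

/-! ### Mollification -/

/-- A mollifier of radius `δ`: smooth, nonnegative, radial, of integral one and supported in the
ball of radius `δ`. -/
structure IsMollifier (δ : ℝ) (φ : E3 → ℝ) : Prop where
  contDiff : ContDiff ℝ ∞ φ
  nonneg : ∀ x, 0 ≤ φ x
  integral_eq_one : ∫ x, φ x = 1
  eq_zero : ∀ x, δ ≤ ‖x‖ → φ x = 0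
  radial : ∀ x y, ‖x‖ = ‖y‖ → φ x = φ y

theorem IsMollifier.hasCompactSupport {δ : ℝ} {φ : E3 → ℝ} (h : IsMollifier δ φ) :
    HasCompactSupport φ :=
  HasCompactSupport.intro (isCompact_closedBall 0 δ) fun x hx =>
    h.eq_zero x (by simpa using (not_le.1 (by simpa using hx)).le)

theorem exists_isMollifier {δ : ℝ} (hδ : 0 < δ) : ∃ φ, IsMollifier δ φ := by
  let s : E3 → ℝ := fun x => Real.smoothTransition (1 - ‖x‖ ^ 2 / δ ^ 2)
  have hs : ContDiff ℝ ∞ s :=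
    Real.smoothTransition.contDiff.comp (contDiff_const.sub ((contDiff_norm_sq ℝ).div_const _))
  have hs0 : ∀ x, δ ≤ ‖x‖ → s x = 0 := fun x hx => by
    refine Real.smoothTransition.zero_of_nonpos ?_
    rw [sub_nonpos, one_le_div (by positivity)]
    exact pow_le_pow_left₀ hδ.le hx 2
  have hcs : HasCompactSupport s :=
    HasCompactSupport.intro (isCompact_closedBall 0 δ) fun x hx =>
      hs0 x (by simpa using (not_le.1 (by simpa using hx)).le)
  have hpos : 0 < ∫ x, s x :=
    hs.continuous.integral_pos_of_hasCompactSupport_nonneg_nonzero hcs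
      (fun x => Real.smoothTransition.nonneg _) (x := 0) (by simp [s])
  refine ⟨fun x => s x / ∫ x, s x, hs.div_const _, fun x =>
    div_nonneg (Real.smoothTransition.nonneg _) hpos.le, ?_, fun x hx => by simp [hs0 x hx],
    fun x y hxy => by simp [s, hxy]⟩
  rw [integral_div, div_self hpos.ne']

/-- The mollification `φ * v`. -/
noncomputable def mollify (φ v : E3 → ℝ) (x : E3) : ℝ := ∫ t, φ t * v (x - t)

theorem mollify_eq_convolution (φ v : E3 → ℝ) :
    mollify φ v = convolution φ v (ContinuousLinearMap.lsmul ℝ ℝ) volume := rfl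

theorem mollify_eq_swap (φ v : E3 → ℝ) (x : E3) : mollify φ v x = ∫ t, φ (x - t) * v t := by
  rw [mollify_eq_convolution, convolution_lsmul_swap]; rfl

theorem contDiff_mollify {δ : ℝ} {φ v : E3 → ℝ} (h : IsMollifier δ φ)
    (hv : LocallyIntegrable v volume) : ContDiff ℝ ∞ (mollify φ v) := by
  rw [mollify_eq_convolution]
  exact h.hasCompactSupport.contDiff_convolution_left _ h.contDiff hv

theorem pd_mollify {δ : ℝ} {φ v g : E3 → ℝ} (h : IsMollifier δ φ) {i : Fin 3}
    (hv : IsWeakPartial i v g) : pd i (mollify φ v) = mollify φ g := by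
  have hφ1 : ContDiff ℝ 1 φ := h.contDiff.of_le (by exact_mod_cast le_top)
  funext x
  have h1 := h.hasCompactSupport.hasFDerivAt_convolution_left (μ := volume)
    (ContinuousLinearMap.lsmul ℝ ℝ) hφ1 hv.1 x
  have h2 : pd i (mollify φ v) x = ∫ t, fderiv ℝ φ (x - t) (EuclideanSpace.single i 1) * v t := by
    rw [pd, mollify_eq_convolution, h1.fderiv, convolution_eq_swap]
    have := ContinuousLinearMap.integral_apply (𝕜 := ℝ) (μ := volume)
      (φ := fun t => ContinuousLinearMap.precompL E3 (ContinuousLinearMap.lsmul ℝ ℝ)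
        (fderiv ℝ φ (x - t)) (v t)) ?_ (EuclideanSpace.single i (1 : ℝ))
    · rw [this]; rfl
    · have := (h.hasCompactSupport.fderiv ℝ).convolutionExists_left (μ := volume)
        (ContinuousLinearMap.precompL E3 (ContinuousLinearMap.lsmul ℝ ℝ))
        (hφ1.continuous_fderiv (by norm_num)) hv.1 x
      exact this.integrable_swap
  rw [h2, mollify_eq_swap]
  have hc : HasCompactSupport (fun t => φ (x - t)) :=
    h.hasCompactSupport.comp_homeomorph (Homeomorph.subLeft x)
  have hs : ContDiff ℝ ∞ (fun t => φ (x - t)) := h.contDiff.comp (contDiff_const.sub contDiff_id)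
  have e := hv.2.2 _ hs hc
  have e2 : ∀ t, fderiv ℝ (fun t => φ (x - t)) t (EuclideanSpace.single i 1)
      = - fderiv ℝ φ (x - t) (EuclideanSpace.single i 1) := fun t => by
    have hd : HasFDerivAt (fun t => x - t) (-(ContinuousLinearMap.id ℝ E3)) t :=
      (hasFDerivAt_id t).const_sub x
    have hcomp := (hφ1.differentiable (by norm_num) (x - t)).hasFDerivAt.comp t hd
    rw [show (fun t => φ (x - t)) = φ ∘ fun t => x - t from rfl, hcomp.fderiv]
    simp
  simp only [e2, mul_neg, integral_neg, neg_inj] at e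
  simpa only [mul_comm] using e

theorem tsupport_mollify_subset {δ : ℝ} {φ v : E3 → ℝ} (h : IsMollifier δ φ) :
    tsupport (mollify φ v) ⊆ Metric.cthickening δ (tsupport v) := by
  refine closure_minimal (fun x hx => ?_) Metric.isClosed_cthickening
  by_contra hn
  refine hx ?_
  refine integral_eq_zero_of_ae (ae_of_all _ fun t => ?_)
  by_cases ht : δ ≤ ‖t‖
  · simp [h.eq_zero t ht]
  · have : x - t ∉ tsupport v := fun hm => hn <| by
      refine Metric.mem_cthickening_of_dist_le x (x - t) δ _ hm ?_
      simpa [dist_eq_norm] using (not_le.1 ht).le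
    simp [image_eq_zero_of_notMem_tsupport this]

/-- Continuity of translations in `L²`. -/
theorem exists_translation_close {v : E3 → ℝ} (hv : MemLp v 2 volume) {ε : ENNReal}
    (hε : 0 < ε) : ∃ δ > 0, ∀ t : E3, ‖t‖ < δ →
      eLpNorm (fun x => v (x - t) - v x) 2 volume ≤ ε := by
  have hmp : ∀ t : E3, MeasurePreserving (fun x : E3 => x - t) volume volume := fun t =>
    measurePreserving_sub_right volume t
  let g : E3 → C(E3, E3) := fun t => ⟨fun x => x - t, by fun_prop⟩
  have hg : Continuous g := ContinuousMap.continuous_of_continuous_uncurry _ (by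
    simp only [g]; exact continuous_snd.sub continuous_fst)
  have hcont := (continuous_const (y := hv.toLp v)).compMeasurePreservingLp
    (Z := E3) (μ := volume) (ν := volume) hg hmp (by norm_num)
  have h0 := hcont.tendsto 0
  rw [EMetric.tendsto_nhds] at h0
  obtain ⟨δ, hδ, h⟩ := Metric.eventually_nhds_iff.1 (h0 ε hε)
  refine ⟨δ, hδ, fun t ht => ?_⟩
  have h1 := (h (y := t) (by simpa using ht)).le
  rw [Lp.edist_def] at h1
  refine le_trans (le_of_eq (eLpNorm_congr_ae ?_)) h1
  have a1 := Lp.coeFn_compMeasurePreserving (hv.toLp v) (hmp t)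
  have a2 := Lp.coeFn_compMeasurePreserving (hv.toLp v) (hmp 0)
  have b1 := (hmp t).quasiMeasurePreserving.ae_eq_comp hv.coeFn_toLp
  have b2 := (hmp 0).quasiMeasurePreserving.ae_eq_comp hv.coeFn_toLp
  filter_upwards [a1, a2, b1, b2] with x h1 h2 h3 h4
  simp only [Pi.sub_apply]
  erw [h1, h2]
  rw [h3, h4]
  simp

theorem eLpNorm_two_sq {f : E3 → ℝ} :
    eLpNorm f 2 volume ^ 2 = ∫⁻ x, ‖f x‖ₑ ^ 2 := by
  have := eLpNorm_nnreal_pow_eq_lintegral (μ := (volume : Measure E3)) (f := f) (p := 2)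
    (by norm_num)
  simpa using this

/-- The error of the mollification is an average of translation errors; this is Jensen's inequality
for the probability density `φ`. -/
theorem eLpNorm_mollify_sub_le {δ : ℝ} {φ v : E3 → ℝ} (h : IsMollifier δ φ)
    (hv : MemLp v 2 volume) {ε : ENNReal}
    (hε : ∀ t : E3, ‖t‖ < δ → eLpNorm (fun x => v (x - t) - v x) 2 volume ≤ ε) :
    eLpNorm (mollify φ v - v) 2 volume ≤ ε := by
  have hφm : Measurable φ := h.contDiff.continuous.measurable
  -- replace `v` by a strongly measurable representative
  wlog hvm : Measurable v generalizing v
  · have hae := hv.1.ae_eq_mk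
    have hw : Measurable (hv.1.mk v) := hv.1.stronglyMeasurable_mk.measurable
    have hvw := (memLp_congr_ae hae).1 hv
    have hsh : ∀ t : E3, (fun x => v (x - t)) =ᵐ[volume] fun x => hv.1.mk v (x - t) := fun t =>
      (measurePreserving_sub_right volume t).quasiMeasurePreserving.ae_eq_comp hae
    have := this hvw (fun t ht => by
      exact (eLpNorm_congr_ae ((hsh t).sub hae)).symm.le.trans (hε t ht)) hw
    refine le_trans (le_of_eq (eLpNorm_congr_ae ?_)) this
    refine EventuallyEq.sub ?_ hae
    refine Eventually.of_forall fun x => ?_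
    simp only [mollify_eq_swap]
    refine integral_congr_ae ?_
    filter_upwards [hae] with t ht
    rw [ht]
  let ν : Measure E3 := volume.withDensity fun t => ENNReal.ofReal (φ t)
  have hint : Integrable φ volume :=
    h.contDiff.continuous.integrable_of_hasCompactSupport h.hasCompactSupport
  have : IsProbabilityMeasure ν := ⟨by
    rw [withDensity_apply _ MeasurableSet.univ, setLIntegral_univ,
      ← ofReal_integral_eq_lintegral_ofReal hint (ae_of_all _ h.nonneg), h.integral_eq_one]
    simp⟩
  have hlin : ∀ f : E3 → ENNReal, ∫⁻ t, f t ∂ν = ∫⁻ t, ENNReal.ofReal (φ t) * f t := fun f =>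
    lintegral_withDensity_eq_lintegral_mul_non_measurable _ hφm.ennreal_ofReal
      (ae_of_all _ fun _ => ENNReal.ofReal_lt_top) f
  have hpt : ∀ x, ‖mollify φ v x - v x‖ₑ ^ 2 ≤ ∫⁻ t, ‖v (x - t) - v x‖ₑ ^ 2 ∂ν := by
    intro x
    have e1 : mollify φ v x - v x = ∫ t, φ t * (v (x - t) - v x) := by
      have i1 : Integrable (fun t => φ t * v (x - t)) volume := by
        have := h.hasCompactSupport.convolutionExists_left (μ := volume)
          (ContinuousLinearMap.lsmul ℝ ℝ) h.contDiff.continuous (locallyIntegrable_of_memLp hv) x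
        simpa using this.integrable
      simp only [mul_sub]
      rw [integral_sub i1 (hint.mul_const _), integral_mul_const, h.integral_eq_one, one_mul]
      rfl
    have e2 : ‖mollify φ v x - v x‖ₑ ≤ ∫⁻ t, ‖v (x - t) - v x‖ₑ ∂ν := by
      rw [e1, hlin]
      refine (enorm_integral_le_lintegral_enorm _).trans (le_of_eq ?_)
      refine lintegral_congr fun t => ?_
      rw [enorm_mul, Real.enorm_of_nonneg (h.nonneg t)]
    have hm : AEStronglyMeasurable (fun t => v (x - t) - v x) ν :=
      ((hvm.comp (measurable_const.sub measurable_id)).sub_const _).aestronglyMeasurable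
    have e3 := eLpNorm_le_eLpNorm_of_exponent_le (μ := ν) (p := 1) (q := 2) (by norm_num) hm
    rw [eLpNorm_one_eq_lintegral_enorm] at e3
    have e4 := eLpNorm_nnreal_pow_eq_lintegral (μ := ν) (f := fun t => v (x - t) - v x) (p := 2)
      (by norm_num)
    have e4' : eLpNorm (fun t => v (x - t) - v x) 2 ν ^ 2 = ∫⁻ t, ‖v (x - t) - v x‖ₑ ^ 2 ∂ν := by
      simpa using e4
    rw [← e4']
    exact pow_le_pow_left₀ zero_le (e2.trans e3) 2
  have hsq : eLpNorm (mollify φ v - v) 2 volume ^ 2 ≤ ε ^ 2 := by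
    rw [eLpNorm_two_sq]
    calc ∫⁻ x, ‖(mollify φ v - v) x‖ₑ ^ 2 ≤ ∫⁻ x, ∫⁻ t, ‖v (x - t) - v x‖ₑ ^ 2 ∂ν :=
          lintegral_mono hpt
      _ = ∫⁻ t, (∫⁻ x, ‖v (x - t) - v x‖ₑ ^ 2) ∂ν := by
          refine lintegral_lintegral_swap ?_
          refine Measurable.aemeasurable ?_
          have : Measurable fun p : E3 × E3 => v (p.1 - p.2) - v p.1 :=
            (hvm.comp (measurable_fst.sub measurable_snd)).sub (hvm.comp measurable_fst)
          exact this.enorm.pow_const 2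
      _ ≤ ∫⁻ t, ε ^ 2 ∂ν := by
          rw [hlin, hlin]
          refine lintegral_mono fun t => ?_
          by_cases ht : ‖t‖ < δ
          · refine mul_le_mul' le_rfl ?_
            rw [← eLpNorm_two_sq]
            exact pow_le_pow_left₀ zero_le (hε t ht) 2
          · simp [h.eq_zero t (not_lt.1 ht)]
      _ = ε ^ 2 := by simp
  exact (ENNReal.pow_le_pow_left_iff (by norm_num)).1 hsq

theorem L2Tendsto.comp_subseq {α : Type*} [MeasurableSpace α] {μ : Measure α}
    {f : ℕ → α → ℝ} {g : α → ℝ} (h : L2Tendsto μ f g) {ns : ℕ → ℕ} (hns : StrictMono ns) :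
    L2Tendsto μ (fun n => f (ns n)) g :=
  ⟨fun _ => h.mem _, h.memLim, h.tendsto.comp hns.tendsto_atTop⟩

theorem L2Tendsto.exists_subseq_ae {α : Type*} [MeasurableSpace α] {μ : Measure α}
    {f : ℕ → α → ℝ} {g : α → ℝ} (h : L2Tendsto μ f g) :
    ∃ ns : ℕ → ℕ, StrictMono ns ∧ ∀ᵐ x ∂μ, Tendsto (fun n => f (ns n) x) atTop (𝓝 (g x)) :=
  (tendstoInMeasure_of_tendsto_eLpNorm (by norm_num) (fun n => (h.mem n).1) h.memLim.1
    h.tendsto).exists_seq_tendsto_ae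

theorem exists_mollifier_seq : ∃ φ : ℕ → E3 → ℝ, ∀ n : ℕ, IsMollifier (1 / ((n : ℝ) + 1)) (φ n) :=
  ⟨fun n => (exists_isMollifier (Nat.one_div_pos_of_nat (n := n))).choose,
    fun n => (exists_isMollifier (Nat.one_div_pos_of_nat (n := n))).choose_spec⟩

theorem l2Tendsto_mollify {φ : ℕ → E3 → ℝ} (hφ : ∀ n : ℕ, IsMollifier (1 / ((n : ℝ) + 1)) (φ n))
    {v : E3 → ℝ} (hv : MemLp v 2 volume) : L2Tendsto volume (fun n => mollify (φ n) v) v := by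
  have hle : ∀ ε : ENNReal, 0 < ε → ∀ᶠ n in atTop, eLpNorm (mollify (φ n) v - v) 2 volume ≤ ε := by
    intro ε hε
    obtain ⟨δ, hδ, h⟩ := exists_translation_close hv hε
    have := tendsto_one_div_add_atTop_nhds_zero_nat (𝕜 := ℝ)
    filter_upwards [this.eventually_lt_const hδ] with n hn
    exact eLpNorm_mollify_sub_le (hφ n) hv fun t ht => h t (ht.trans hn)
  refine ⟨fun n => ?_, hv, ENNReal.tendsto_nhds_zero.2 hle⟩
  -- Translations act isometrically on `L²`, which bounds the mollification for every radius.
  have hm := ((contDiff_mollify (hφ n) (locallyIntegrable_of_memLp hv)).continuous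
    |>.aestronglyMeasurable (μ := volume))
  have hd : MemLp (mollify (φ n) v - v) 2 volume := by
    refine ⟨hm.sub hv.1, (eLpNorm_mollify_sub_le (hφ n) hv
      (ε := eLpNorm v 2 volume + eLpNorm v 2 volume) fun t _ => ?_).trans_lt
        (ENNReal.add_lt_top.2 ⟨hv.2, hv.2⟩)⟩
    have hmp := measurePreserving_sub_right (volume : Measure E3) t
    have := eLpNorm_sub_le (μ := volume) (f := fun x => v (x - t)) (g := v) (p := 2)
      (hv.1.comp_measurePreserving hmp) hv.1 (by norm_num)
    refine this.trans (add_le_add (le_of_eq ?_) le_rfl)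
    exact eLpNorm_comp_measurePreserving hv.1 hmp
  simpa using hd.add hv

/-- The chain rule for a weak derivative. -/
theorem isWeakPartial_comp {T : ℝ → ℝ} (hT : ContDiff ℝ 1 T) (hT0 : T 0 = 0)
    (hT1 : ∀ s, |deriv T s| ≤ 1) {v g : E3 → ℝ} {i : Fin 3} (hv : MemLp v 2 volume)
    (hg : MemLp g 2 volume) (h : IsWeakPartial i v g) :
    MemLp (fun x => T (v x)) 2 volume ∧ MemLp (fun x => deriv T (v x) * g x) 2 volume ∧
    IsWeakPartial i (fun x => T (v x)) (fun x => deriv T (v x) * g x) := by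
  have hlip : ∀ s t, |T s - T t| ≤ |s - t| := fun s t => by
    have := Convex.norm_image_sub_le_of_norm_deriv_le (f := T) (C := 1) (s := Set.univ)
      (fun x _ => hT.differentiable (by norm_num) x) (fun x _ => hT1 x) convex_univ
      (Set.mem_univ t) (Set.mem_univ s)
    simpa using this
  have hTd : Continuous (deriv T) := hT.continuous_deriv (by norm_num)
  have hmT : ∀ {w : E3 → ℝ}, MemLp w 2 volume → MemLp (fun x => T (w x)) 2 volume := fun hw =>
    hw.mono (hT.continuous.comp_aestronglyMeasurable hw.1) <| ae_of_all _ fun x => by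
      simpa [hT0] using hlip _ 0
  have hmD : ∀ {w k : E3 → ℝ}, MemLp w 2 volume → MemLp k 2 volume →
      MemLp (fun x => deriv T (w x) * k x) 2 volume := fun hw hk =>
    hk.mono ((hTd.comp_aestronglyMeasurable hw.1).mul hk.1) <| ae_of_all _ fun x => by
      rw [norm_mul]; exact mul_le_of_le_one_left (norm_nonneg _) (hT1 _)
  have m1 := hmT hv
  have m2 := hmD hv hg
  refine ⟨m1, m2, locallyIntegrable_of_memLp m1, locallyIntegrable_of_memLp m2, ?_⟩
  obtain ⟨φ, hφ⟩ := exists_mollifier_seq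
  obtain ⟨ns, hns, hae⟩ := (l2Tendsto_mollify hφ hv).exists_subseq_ae
  have hvn := (l2Tendsto_mollify hφ hv).comp_subseq hns
  have hgn := (l2Tendsto_mollify hφ hg).comp_subseq hns
  have c1 : L2Tendsto volume (fun n x => T (mollify (φ (ns n)) v x)) (fun x => T (v x)) :=
    L2Tendsto.of_le (fun n => hmT (hvn.mem n)) m1 hvn (C := 1)
      fun n => ae_of_all _ fun x => by rw [one_mul]; exact hlip _ _
  have c2 : L2Tendsto volume
      (fun n x => deriv T (mollify (φ (ns n)) v x) * (mollify (φ (ns n)) g x - g x))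
      (fun _ => 0) := by
    refine L2Tendsto.of_le (fun n => hmD (hvn.mem n) ((hgn.mem n).sub hg)) MemLp.zero hgn (C := 1)
      fun n => ae_of_all _ fun x => ?_
    rw [sub_zero, abs_mul]
    exact mul_le_mul_of_nonneg_right (hT1 _) (abs_nonneg _)
  have c3 : L2Tendsto volume (fun n x => deriv T (mollify (φ (ns n)) v x) * g x)
      (fun x => deriv T (v x) * g x) := by
    refine L2Tendsto.of_dominated (b := fun x => 2 * |g x|) (fun n => (hmD (hvn.mem n) hg).1) m2
      (hg.abs.const_mul 2) (fun n => ae_of_all _ fun x => ?_) ?_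
    · rw [← sub_mul, abs_mul]
      refine mul_le_mul_of_nonneg_right ?_ (abs_nonneg _)
      exact (abs_sub _ _).trans (by linarith [hT1 (mollify (φ (ns n)) v x), hT1 (v x)])
    · filter_upwards [hae] with x hx
      exact ((hTd.tendsto _).comp hx).mul_const _
  have c4 : L2Tendsto volume
      (fun n x => deriv T (mollify (φ (ns n)) v x) * mollify (φ (ns n)) g x)
      (fun x => deriv T (v x) * g x) := by
    refine (c2.add c3).congr (fun n => ae_of_all _ fun x => ?_) (ae_of_all _ fun x => ?_)
    · simp only; ring
    · simp
  intro η hη hc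
  have hη1 : ContDiff ℝ 1 η := hη.of_le (by exact_mod_cast le_top)
  have l1 := c1.tendsto_integral_mul (L2Tendsto.const
    (memLp_two_of_continuous (continuous_pd hη1 i) (hasCompactSupport_pd hc i)))
  have l2 := c4.tendsto_integral_mul (L2Tendsto.const (memLp_two_of_continuous hη.continuous hc))
  refine tendsto_nhds_unique l1 (l2.neg.congr fun n => ?_)
  have hsm : ContDiff ℝ 1 (mollify (φ (ns n)) v) :=
    (contDiff_mollify (hφ _) h.1).of_le (by exact_mod_cast le_top)
  have := (isWeakPartial_pd (hT.comp hsm) i).2.2 η hη hc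
  rw [show (∫ x, T (mollify (φ (ns n)) v x) * pd i η x) = _ from this]
  congr 1
  refine integral_congr_ae (ae_of_all _ fun x => ?_)
  simp only
  congr 1
  rw [← pd_mollify (hφ (ns n)) h, pd, pd]
  have h1 := (hT.differentiable (by norm_num) (mollify (φ (ns n)) v x)).hasDerivAt.comp_hasFDerivAt
    x (hsm.differentiable (by norm_num) x).hasFDerivAt
  rw [h1.fderiv]
  simp

/-! ### Cutoff functions -/

/-- The squared distance to the axis. -/
def axisSq (x : E3) : ℝ := x 0 ^ 2 + x 1 ^ 2

/-- The complement of the axis. -/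
def offAxis : Set E3 := {x | 0 < axisSq x}

theorem axisSq_nonneg (x : E3) : 0 ≤ axisSq x := by unfold axisSq; positivity

theorem contDiff_axisSq {n : WithTop ℕ∞} : ContDiff ℝ n axisSq := by
  unfold axisSq; fun_prop

theorem isOpen_offAxis : IsOpen offAxis :=
  isOpen_lt continuous_const (contDiff_axisSq (n := 0)).continuous

theorem norm_sq_eq (x : E3) : ‖x‖ ^ 2 = x 0 ^ 2 + x 1 ^ 2 + x 2 ^ 2 := by
  rw [EuclideanSpace.real_norm_sq_eq, Fin.sum_univ_three]

theorem axisSq_eq (x : E3) : axisSq x = ‖x‖ ^ 2 - x 2 ^ 2 := by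
  rw [norm_sq_eq, axisSq]; ring

theorem axisDist_eq (x : E3) : axisDist x = Real.sqrt (axisSq x) := rfl

theorem norm_pos_of_mem_offAxis {x : E3} (hx : x ∈ offAxis) : 0 < ‖x‖ := by
  refine norm_pos_iff.2 fun h => ?_
  simp [offAxis, axisSq, h] at hx

theorem ae_mem_offAxis : ∀ᵐ x : E3, x ∈ offAxis := by
  let L : E3 →ₗ[ℝ] ℝ := (EuclideanSpace.proj (0 : Fin 3)).toLinearMap
  have h : volume (LinearMap.ker L : Set E3) = 0 := by
    refine Measure.addHaar_submodule _ _ fun ht => ?_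
    have : EuclideanSpace.single (0 : Fin 3) (1 : ℝ) ∈ LinearMap.ker L := by rw [ht]; trivial
    simp [L] at this
  rw [ae_iff]
  refine measure_mono_null (fun x hx => ?_) h
  simp only [offAxis, axisSq, Set.mem_ofPred_eq, not_lt] at hx
  simp only [SetLike.mem_coe, LinearMap.mem_ker, L]
  have : x 0 ^ 2 = 0 := by nlinarith [sq_nonneg (x 0), sq_nonneg (x 1)]
  simpa using this

theorem exists_bound_deriv_smoothTransition :
    ∃ K : ℝ, 0 ≤ K ∧ ∀ s, |deriv Real.smoothTransition s| ≤ K ∧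
      (deriv Real.smoothTransition s ≠ 0 → 0 ≤ s ∧ s ≤ 1) := by
  have hz : ∀ s, deriv Real.smoothTransition s ≠ 0 → 0 ≤ s ∧ s ≤ 1 := by
    intro s hs
    by_contra hn
    refine hs ?_
    by_cases h0 : 0 ≤ s
    · have h1 : 1 < s := not_le.1 fun h => hn ⟨h0, h⟩
      have : Real.smoothTransition =ᶠ[𝓝 s] fun _ => 1 :=
        (eventually_gt_nhds h1).mono fun t ht => Real.smoothTransition.one_of_one_le ht.le
      rw [this.deriv_eq]; simp
    · have : Real.smoothTransition =ᶠ[𝓝 s] fun _ => 0 :=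
        (eventually_lt_nhds (not_le.1 h0)).mono fun t ht =>
          Real.smoothTransition.zero_of_nonpos ht.le
      rw [this.deriv_eq]; simp
  have hc : Continuous (deriv Real.smoothTransition) :=
    (Real.smoothTransition.contDiff (n := 1)).continuous_deriv (by norm_num)
  obtain ⟨K, hK⟩ := isCompact_Icc.exists_bound_of_continuousOn (hc.continuousOn (s := Set.Icc 0 1))
  refine ⟨K, (norm_nonneg _).trans (hK 0 (by simp)), fun s => ⟨?_, hz s⟩⟩
  by_cases hs : deriv Real.smoothTransition s = 0
  · rw [hs, abs_zero]; exact (norm_nonneg _).trans (hK 0 (by simp))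
  · exact hK s (hz s hs)

theorem pd_comp {T : ℝ → ℝ} (hT : Differentiable ℝ T) {f : E3 → ℝ} (hf : Differentiable ℝ f)
    (i : Fin 3) (x : E3) : pd i (fun y => T (f y)) x = deriv T (f x) * pd i f x := by
  have h := (hT (f x)).hasDerivAt.comp_hasFDerivAt x (hf x).hasFDerivAt
  rw [pd, show (fun y => T (f y)) = T ∘ f from rfl, h.fderiv]
  simp [pd]

/-- The `i`-th coordinate as a continuous linear functional. -/
noncomputable def coordL (i : Fin 3) : E3 →L[ℝ] ℝ := PiLp.proj 2 (fun _ : Fin 3 => ℝ) i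

theorem coordL_apply (i : Fin 3) (x : E3) : coordL i x = x i := rfl

theorem hasFDerivAt_coord (i : Fin 3) (x : E3) :
    HasFDerivAt (fun y : E3 => y i) (coordL i) x := (coordL i).hasFDerivAt

theorem pd_axisSq (i : Fin 3) (x : E3) : pd i axisSq x = if i = 2 then 0 else 2 * x i := by
  have h0 := hasFDerivAt_coord 0 x
  have h1 := hasFDerivAt_coord 1 x
  have h := (h0.pow 2).add (h1.pow 2)
  rw [pd, show axisSq = (fun y : E3 => y 0 ^ 2) + (fun y : E3 => y 1 ^ 2) from rfl, h.fderiv]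
  fin_cases i <;> simp [coordL_apply]

/-- The elementary cutoff near the axis at scale `2⁻ʲ`. -/
noncomputable def axisCut (j : ℕ) (x : E3) : ℝ := Real.smoothTransition (4 ^ j * axisSq x - 1)

theorem contDiff_axisCut (j : ℕ) : ContDiff ℝ ∞ (axisCut j) :=
  Real.smoothTransition.contDiff.comp ((contDiff_const.mul contDiff_axisSq).sub contDiff_const)

theorem pd_axisCut (j : ℕ) (i : Fin 3) (x : E3) :
    pd i (axisCut j) x
      = deriv Real.smoothTransition (4 ^ j * axisSq x - 1) * (4 ^ j * pd i axisSq x) := by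
  have hd : Differentiable ℝ axisSq := contDiff_axisSq.differentiable (n := 1) (by norm_num)
  have hd2 : Differentiable ℝ fun x => 4 ^ j * axisSq x - 1 := by fun_prop
  have := pd_comp (Real.smoothTransition.contDiff.differentiable (n := 1) (by norm_num)) hd2 i x
  rw [show axisCut j = fun y => Real.smoothTransition (4 ^ j * axisSq y - 1) from rfl, this]
  congr 1
  rw [pd, fderiv_sub_const, fderiv_const_mul (hd x)]
  simp [pd]

/-- The averaged cutoff near the axis. The gradients of the `axisCut j` have disjoint supports and
`L²` norms bounded on bounded sets, so that the gradient of the average is small in `L²`. -/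
noncomputable def axisCutAvg (N : ℕ) (x : E3) : ℝ := (N : ℝ)⁻¹ * ∑ j ∈ Finset.range N, axisCut j x

theorem contDiff_axisCutAvg (N : ℕ) : ContDiff ℝ ∞ (axisCutAvg N) :=
  contDiff_const.mul (ContDiff.sum fun j _ => contDiff_axisCut j)

theorem axisCutAvg_mem (N : ℕ) (x : E3) : 0 ≤ axisCutAvg N x ∧ axisCutAvg N x ≤ 1 := by
  unfold axisCutAvg
  refine ⟨mul_nonneg (by positivity) (Finset.sum_nonneg fun j _ =>
    Real.smoothTransition.nonneg _), ?_⟩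
  rcases Nat.eq_zero_or_pos N with rfl | hN
  · simp
  · rw [inv_mul_le_iff₀ (by positivity), mul_one]
    calc _ ≤ ∑ j ∈ Finset.range N, (1 : ℝ) :=
          Finset.sum_le_sum fun j _ => Real.smoothTransition.le_one _
      _ = N := by simp

theorem axisCutAvg_eq_zero {N : ℕ} {x : E3} (h : 4 ^ N * axisSq x ≤ 1) : axisCutAvg N x = 0 := by
  unfold axisCutAvg
  rw [Finset.sum_eq_zero fun j hj => ?_, mul_zero]
  refine Real.smoothTransition.zero_of_nonpos ?_
  have : (4 : ℝ) ^ j ≤ 4 ^ N := pow_le_pow_right₀ (by norm_num) (Finset.mem_range.1 hj).le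
  nlinarith [axisSq_nonneg x]

theorem tendsto_axisCutAvg {x : E3} (hx : x ∈ offAxis) :
    Tendsto (fun N => axisCutAvg N x) atTop (𝓝 1) := by
  have h : Tendsto (fun j => axisCut j x) atTop (𝓝 1) := by
    have h4 : Tendsto (fun j : ℕ => (4 : ℝ) ^ j * axisSq x) atTop atTop :=
      (tendsto_pow_atTop_atTop_of_one_lt (by norm_num)).atTop_mul_const hx
    refine tendsto_const_nhds.congr' ?_
    filter_upwards [h4.eventually_ge_atTop 2] with j hj
    exact (Real.smoothTransition.one_of_one_le (by linarith)).symm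
  exact h.cesaro

theorem pd_axisCutAvg (N : ℕ) (i : Fin 3) (x : E3) :
    pd i (axisCutAvg N) x = (N : ℝ)⁻¹ * ∑ j ∈ Finset.range N, pd i (axisCut j) x := by
  have hd : ∀ j, DifferentiableAt ℝ (axisCut j) x := fun j =>
    (contDiff_axisCut j).differentiable (by norm_num) x
  rw [pd, show axisCutAvg N = fun y => (N : ℝ)⁻¹ * ∑ j ∈ Finset.range N, axisCut j y from rfl,
    fderiv_const_mul (DifferentiableAt.fun_sum fun j _ => hd j), fderiv_fun_sum fun j _ => hd j]
  simp [pd]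

theorem exists_bound_pd_axisCut : ∃ K : ℝ, 0 ≤ K ∧ ∀ i j x, |pd i (axisCut j) x| ≤ K * 2 ^ j ∧
    (pd i (axisCut j) x ≠ 0 → 1 ≤ 4 ^ j * axisSq x ∧ 4 ^ j * axisSq x ≤ 2) := by
  obtain ⟨K, hK0, hK⟩ := exists_bound_deriv_smoothTransition
  refine ⟨4 * K, by positivity, fun i j x => ?_⟩
  have hz : pd i (axisCut j) x ≠ 0 → 1 ≤ 4 ^ j * axisSq x ∧ 4 ^ j * axisSq x ≤ 2 := fun h => by
    rw [pd_axisCut] at h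
    have := (hK _).2 (left_ne_zero_of_mul h)
    constructor <;> linarith [this.1, this.2]
  refine ⟨?_, hz⟩
  by_cases h : pd i (axisCut j) x = 0
  · rw [h, abs_zero]; positivity
  obtain ⟨-, h2⟩ := hz h
  rw [pd_axisCut, abs_mul]
  have hx : |pd i axisSq x| * 2 ^ j ≤ 4 := by
    rw [pd_axisSq]
    split_ifs with hi
    · simp
    · have hxi : x i ^ 2 ≤ axisSq x := by
        unfold axisSq
        fin_cases i
        · simp; positivity
        · simp; positivity
        · simp at hi
      have h3 : (|x i| * 2 ^ j) ^ 2 ≤ 2 ^ 2 := by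
        rw [mul_pow, sq_abs, ← pow_mul, mul_comm j 2, pow_mul]
        norm_num
        nlinarith [pow_pos (show (0 : ℝ) < 4 by norm_num) j]
      have h4 := abs_le_of_sq_le_sq h3 (by norm_num)
      rw [abs_mul, abs_two]
      have h5 := (abs_le.1 h4)
      nlinarith [(le_abs_self _).trans h4]
  have h4 : (4 : ℝ) ^ j = 2 ^ j * 2 ^ j := by rw [← mul_pow]; norm_num
  calc |deriv Real.smoothTransition (4 ^ j * axisSq x - 1)| * |4 ^ j * pd i axisSq x|
      ≤ K * |4 ^ j * pd i axisSq x| :=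
        mul_le_mul_of_nonneg_right (hK _).1 (abs_nonneg _)
    _ = K * (|pd i axisSq x| * 2 ^ j) * 2 ^ j := by
        rw [abs_mul, abs_of_pos (show (0 : ℝ) < 4 ^ j by positivity), h4]; ring
    _ ≤ K * 4 * 2 ^ j := by gcongr
    _ = 4 * K * 2 ^ j := by ring

/-- The volume of a bounded part of the neighbourhood of the axis of width `s`. -/
theorem volume_tube (s R : ℝ) (hs : 0 ≤ s) :
    volume {x : E3 | |x 0| ≤ s ∧ |x 1| ≤ s ∧ |x 2| ≤ R} = ENNReal.ofReal (8 * s ^ 2 * R) := by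
  have e : {x : E3 | |x 0| ≤ s ∧ |x 1| ≤ s ∧ |x 2| ≤ R} =
      (MeasurableEquiv.toLp 2 (Fin 3 → ℝ)).symm ⁻¹'
        (Set.univ.pi fun i => Set.Icc (-(![s, s, R] i)) (![s, s, R] i)) := by
    ext x
    simp only [Set.mem_preimage, Set.mem_univ_pi, Fin.forall_fin_succ, Set.mem_Icc, abs_le]
    simp
  rw [e, (EuclideanSpace.volume_preserving_symm_measurableEquiv_toLp (Fin 3)).measure_preimage
    (MeasurableSet.univ_pi fun i => measurableSet_Icc).nullMeasurableSet, volume_pi_pi]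
  simp only [Real.volume_Icc, Fin.prod_univ_three]
  simp only [Matrix.cons_val_zero, Matrix.cons_val_one, Matrix.cons_val, sub_neg_eq_add]
  rw [← ENNReal.ofReal_mul (by positivity), ← ENNReal.ofReal_mul (by positivity)]
  congr 1; ring

theorem L2Tendsto.of_integral_sq {α : Type*} [MeasurableSpace α] {μ : Measure α}
    {f : ℕ → α → ℝ} {g : α → ℝ} (hf : ∀ n, MemLp (f n) 2 μ) (hg : MemLp g 2 μ)
    (h : Tendsto (fun n => ∫ x, (f n x - g x) ^ 2 ∂μ) atTop (𝓝 0)) : L2Tendsto μ f g := by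
  refine ⟨hf, hg, ?_⟩
  simp only [fun n => eLpNorm_two_eq_sqrt ((hf n).sub hg)]
  have h2 := ENNReal.tendsto_ofReal ((Real.continuous_sqrt.tendsto _).comp h)
  simpa using h2

theorem L2Tendsto.cut {α : Type*} [MeasurableSpace α] {μ : Measure α}
    {χ : ℕ → α → ℝ} {f : α → ℝ} (hf : MemLp f 2 μ) (hm : ∀ n, AEStronglyMeasurable (χ n) μ)
    (h01 : ∀ n x, 0 ≤ χ n x ∧ χ n x ≤ 1) (h : ∀ᵐ x ∂μ, Tendsto (fun n => χ n x) atTop (𝓝 1)) :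
    L2Tendsto μ (fun n x => χ n x * f x) f := by
  refine L2Tendsto.of_dominated (b := fun x => |f x|) (fun n => (hm n).mul hf.1) hf hf.abs
    (fun n => ae_of_all _ fun x => ?_) ?_
  · rw [show χ n x * f x - f x = -((1 - χ n x) * f x) by ring, abs_neg, abs_mul,
      abs_of_nonneg (by linarith [(h01 n x).2])]
    exact mul_le_of_le_one_left (abs_nonneg _) (by linarith [(h01 n x).1])
  · filter_upwards [h] with x hx
    simpa using hx.mul_const (f x)

/-- The axis has zero capacity: the gradients of the cutoffs `axisCutAvg N` tend to zero in `L²` on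
bounded sets, with squared norm of order `1 / N`. -/
theorem l2Tendsto_pd_axisCutAvg_mul {v : E3 → ℝ} (hv : MemLp v 2 volume) {M R : ℝ}
    (hM : ∀ x, |v x| ≤ M) (hR : 0 ≤ R) (hsupp : ∀ x, R < ‖x‖ → v x = 0) (i : Fin 3) :
    L2Tendsto volume (fun N x => pd i (axisCutAvg N) x * v x) (fun _ => 0) := by
  obtain ⟨K, hK0, hK⟩ := exists_bound_pd_axisCut
  have hM0 : 0 ≤ M := (abs_nonneg _).trans (hM 0)
  have hcont : ∀ N, Continuous (pd i (axisCutAvg N)) := fun N =>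
    continuous_pd ((contDiff_axisCutAvg N).of_le (by exact_mod_cast le_top)) i
  have hmem : ∀ N, MemLp (fun x => pd i (axisCutAvg N) x * v x) 2 volume := fun N => by
    refine hv.of_le_mul (c := (N : ℝ)⁻¹ * ∑ j ∈ Finset.range N, K * 2 ^ j)
      ((hcont N).aestronglyMeasurable.mul hv.1) (ae_of_all _ fun x => ?_)
    rw [norm_mul]
    refine mul_le_mul_of_nonneg_right ?_ (norm_nonneg _)
    rw [pd_axisCutAvg, norm_mul, Real.norm_of_nonneg (by positivity)]
    refine mul_le_mul_of_nonneg_left ?_ (by positivity)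
    exact (norm_sum_le _ _).trans (Finset.sum_le_sum fun j _ => (hK i j x).1)
  -- the support of the gradient of the `j`-th cutoff has volume of order `4⁻ʲ`
  let tube : ℕ → Set E3 := fun j => {x | |x 0| ≤ 2 * (2 ^ j)⁻¹ ∧ |x 1| ≤ 2 * (2 ^ j)⁻¹ ∧ |x 2| ≤ R}
  have htm : ∀ j, MeasurableSet (tube j) := fun j => by
    refine IsClosed.measurableSet ?_
    have hc : ∀ i : Fin 3, Continuous fun x : E3 => |x i| := fun i => (coordL i).continuous.abs
    exact (isClosed_le (hc 0) continuous_const).inter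
      ((isClosed_le (hc 1) continuous_const).inter (isClosed_le (hc 2) continuous_const))
  have hvol : ∀ j, volume (tube j) = ENNReal.ofReal (8 * (2 * (2 ^ j)⁻¹) ^ 2 * R) := fun j =>
    volume_tube _ _ (by positivity)
  have hpt : ∀ N x, (pd i (axisCutAvg N) x * v x - 0) ^ 2 ≤ (N : ℝ)⁻¹ ^ 2 *
      ∑ j ∈ Finset.range N, (tube j).indicator (fun _ => K ^ 2 * 4 ^ j * M ^ 2) x := by
    intro N x
    by_cases hx : R < ‖x‖
    · rw [hsupp x hx]
      simp only [mul_zero, sub_zero]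
      rw [zero_pow (by norm_num)]
      exact mul_nonneg (by positivity) (Finset.sum_nonneg fun j _ =>
        Set.indicator_nonneg (fun _ _ => by positivity) _)
    -- the gradients of the elementary cutoffs have disjoint supports
    have hcross : (∑ j ∈ Finset.range N, pd i (axisCut j) x) ^ 2
        = ∑ j ∈ Finset.range N, pd i (axisCut j) x ^ 2 := by
      rw [pow_two, Finset.sum_mul_sum]
      refine Finset.sum_congr rfl fun j hj => ?_
      rw [Finset.sum_eq_single j, pow_two]
      · intro l _ hlj
        by_contra hne
        have h1 := (hK i j x).2 (left_ne_zero_of_mul hne)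
        have h2 := (hK i l x).2 (right_ne_zero_of_mul hne)
        rcases lt_or_gt_of_ne hlj with h | h
        · have : (4 : ℝ) ^ (l + 1) ≤ 4 ^ j := pow_le_pow_right₀ (by norm_num) h
          rw [pow_succ] at this
          nlinarith [axisSq_nonneg x]
        · have : (4 : ℝ) ^ (j + 1) ≤ 4 ^ l := pow_le_pow_right₀ (by norm_num) h
          rw [pow_succ] at this
          nlinarith [axisSq_nonneg x]
      · intro h; exact absurd hj h
    rw [sub_zero, mul_pow, pd_axisCutAvg, mul_pow, hcross, mul_assoc, Finset.sum_mul]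
    refine mul_le_mul_of_nonneg_left (Finset.sum_le_sum fun j _ => ?_) (by positivity)
    have hv2 : v x ^ 2 ≤ M ^ 2 := sq_le_sq.2 ((hM x).trans (le_abs_self M))
    by_cases h : pd i (axisCut j) x = 0
    · rw [h]; simp only [ne_eq, OfNat.ofNat_ne_zero, not_false_eq_true, zero_pow, zero_mul]
      exact Set.indicator_nonneg (fun _ _ => by positivity) _
    · obtain ⟨hb, hz⟩ := hK i j x
      have h2 := (hz h).2
      have h4 : (4 : ℝ) ^ j = 2 ^ j * 2 ^ j := by rw [← mul_pow]; norm_num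
      have hxt : x ∈ tube j := by
        have aux : ∀ t : ℝ, t ^ 2 ≤ axisSq x → |t| ≤ 2 * (2 ^ j)⁻¹ := fun t ht => by
          rw [← div_eq_mul_inv, le_div_iff₀ (by positivity)]
          refine (le_abs_self _).trans (abs_le_of_sq_le_sq (a := |t| * 2 ^ j) (b := 2) ?_ (by norm_num))
          rw [mul_pow, sq_abs, pow_two ((2 : ℝ) ^ j), ← h4]
          nlinarith [pow_pos (show (0 : ℝ) < 4 by norm_num) j]
        refine ⟨aux _ ?_, aux _ ?_, ?_⟩
        · unfold axisSq; nlinarith [sq_nonneg (x 1)]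
        · unfold axisSq; nlinarith [sq_nonneg (x 0)]
        · refine (le_abs_self _).trans (abs_le_of_sq_le_sq (a := |x 2|) (b := R) ?_ hR)
          rw [sq_abs]
          nlinarith [norm_sq_eq x, sq_nonneg (x 0), sq_nonneg (x 1), not_lt.1 hx, norm_nonneg x]
      rw [Set.indicator_of_mem hxt]
      have hp2 : pd i (axisCut j) x ^ 2 ≤ K ^ 2 * 4 ^ j := by
        rw [h4, ← pow_two, ← mul_pow]
        exact sq_le_sq.2 (hb.trans (le_abs_self _))
      exact mul_le_mul hp2 hv2 (sq_nonneg _) (by positivity)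
  have hind : ∀ j, Integrable ((tube j).indicator (fun _ => K ^ 2 * 4 ^ j * M ^ 2)) volume :=
    fun j => (integrable_indicator_iff (htm j)).2
      (integrableOn_const (by rw [hvol]; exact ENNReal.ofReal_ne_top))
  have hindint : ∀ j, ∫ x, (tube j).indicator (fun _ => K ^ 2 * 4 ^ j * M ^ 2) x
      = 32 * K ^ 2 * M ^ 2 * R := fun j => by
    rw [integral_indicator (htm j), setIntegral_const, smul_eq_mul, Measure.real, hvol,
      ENNReal.toReal_ofReal (by positivity)]
    have h4 : (4 : ℝ) ^ j = 2 ^ j * 2 ^ j := by rw [← mul_pow]; norm_num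
    rw [h4]; field_simp; ring
  have hle : ∀ N, ∫ x, (pd i (axisCutAvg N) x * v x - 0) ^ 2
      ≤ 32 * K ^ 2 * M ^ 2 * R * (N : ℝ)⁻¹ := by
    intro N
    calc _ ≤ ∫ x, (N : ℝ)⁻¹ ^ 2 *
          ∑ j ∈ Finset.range N, (tube j).indicator (fun _ => K ^ 2 * 4 ^ j * M ^ 2) x := by
            refine integral_mono ?_ ((integrable_finsetSum _ fun j _ => hind j).const_mul _)
              (hpt N)
            simpa using (hmem N).integrable_sq
      _ = _ := by
        rw [integral_const_mul, integral_finsetSum _ fun j _ => hind j]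
        simp only [hindint, Finset.sum_const, Finset.card_range, nsmul_eq_mul]
        rcases Nat.eq_zero_or_pos N with rfl | hN
        · simp
        · field_simp
  refine L2Tendsto.of_integral_sq hmem MemLp.zero ?_
  have hlim : Tendsto (fun N : ℕ => 32 * K ^ 2 * M ^ 2 * R * (N : ℝ)⁻¹) atTop (𝓝 0) := by
    simpa using (tendsto_inv_atTop_nhds_zero_nat (𝕜 := ℝ)).const_mul (32 * K ^ 2 * M ^ 2 * R)
  exact tendsto_of_tendsto_of_tendsto_of_le_of_le tendsto_const_nhds hlim
    (fun N => integral_nonneg fun x => sq_nonneg _) hle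

/-! ### Density of functions supported away from the axis -/

/-- `C¹` functions with compact support off the axis. -/
structure IsTest (w : E3 → ℝ) : Prop where
  contDiff : ContDiff ℝ 1 w
  hasCompactSupport : HasCompactSupport w
  tsupport_subset : tsupport w ⊆ offAxis

theorem IsTest.memH1 {w : E3 → ℝ} (h : IsTest w) : MemH1 w :=
  memH1_of_contDiff h.contDiff h.hasCompactSupport

/-- Convergence in `H¹` and in `L²` with the weight `κ`. -/
structure H1Tendsto (κ : E3 → ℝ) (w : ℕ → E3 → ℝ) (v : E3 → ℝ) : Prop where
  val : L2Tendsto volume w v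
  grad : ∀ i, L2Tendsto volume (fun n => weakPartial i (w n)) (weakPartial i v)
  wt : L2Tendsto volume (fun n x => κ x * w n x) (fun x => κ x * v x)

/-- `v` and `w` differ by at most `ε` in `H¹` and in `L²` with the weight `κ`. -/
structure H1Close (κ : E3 → ℝ) (ε : ENNReal) (v w : E3 → ℝ) : Prop where
  memH1 : MemH1 w
  memWt : MemLp (fun x => κ x * w x) 2 volume
  val : eLpNorm (w - v) 2 volume ≤ ε
  grad : ∀ i, eLpNorm (weakPartial i w - weakPartial i v) 2 volume ≤ ε
  wt : eLpNorm ((fun x => κ x * w x) - fun x => κ x * v x) 2 volume ≤ ε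
  phi : IsPhiIndependent v → IsPhiIndependent w

theorem eLpNorm_sub_le_add {f g h : E3 → ℝ} (hf : MemLp f 2 volume) (hg : MemLp g 2 volume)
    (hh : MemLp h 2 volume) {ε ε' : ENNReal} (h1 : eLpNorm (g - f) 2 volume ≤ ε)
    (h2 : eLpNorm (h - g) 2 volume ≤ ε') : eLpNorm (h - f) 2 volume ≤ ε + ε' := by
  have e : h - f = (g - f) + (h - g) := by abel
  rw [e]
  exact (eLpNorm_add_le (hg.sub hf).1 (hh.sub hg).1 (by norm_num)).trans (add_le_add h1 h2)

theorem H1Close.trans {κ : E3 → ℝ} {ε ε' : ENNReal} {v w z : E3 → ℝ} (hv : MemH1 v)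
    (hκv : MemLp (fun x => κ x * v x) 2 volume) (h : H1Close κ ε v w) (h' : H1Close κ ε' w z) :
    H1Close κ (ε + ε') v z :=
  ⟨h'.memH1, h'.memWt, eLpNorm_sub_le_add hv.1 h.memH1.1 h'.memH1.1 h.val h'.val,
    fun i => eLpNorm_sub_le_add (hv.weakPartial_spec i).1 (h.memH1.weakPartial_spec i).1
      (h'.memH1.weakPartial_spec i).1 (h.grad i) (h'.grad i),
    eLpNorm_sub_le_add hκv h.memWt h'.memWt h.wt h'.wt, fun p => h'.phi (h.phi p)⟩

theorem H1Tendsto.exists_close {κ : E3 → ℝ} {w : ℕ → E3 → ℝ} {v : E3 → ℝ}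
    (h : H1Tendsto κ w v) (hw : ∀ n, MemH1 (w n))
    (hphi : IsPhiIndependent v → ∀ n, IsPhiIndependent (w n)) {ε : ENNReal} (hε : 0 < ε) :
    ∀ᶠ n in atTop, H1Close κ ε v (w n) := by
  filter_upwards [ENNReal.tendsto_nhds_zero.1 h.val.tendsto ε hε,
    eventually_all.2 fun i => ENNReal.tendsto_nhds_zero.1 (h.grad i).tendsto ε hε,
    ENNReal.tendsto_nhds_zero.1 h.wt.tendsto ε hε] with n h1 h2 h3
  exact ⟨hw n, h.wt.mem n, h1, h2, h3, fun p => hphi p n⟩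

/-- Truncation: `M * arctan (v / M)` is bounded and tends to `v` as `M → ∞`. -/
theorem exists_close_bounded {κ v : E3 → ℝ} (hκ : AEStronglyMeasurable κ volume) (hv : MemH1 v)
    (hκv : MemLp (fun x => κ x * v x) 2 volume) {ε : ENNReal} (hε : 0 < ε) :
    ∃ w, H1Close κ ε v w ∧ ∃ M, ∀ x, |w x| ≤ M := by
  let T : ℕ → ℝ → ℝ := fun n s => ((n : ℝ) + 1) * Real.arctan (s / ((n : ℝ) + 1))
  have hn : ∀ n : ℕ, (0 : ℝ) < (n : ℝ) + 1 := fun n => by positivity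
  have hd : ∀ n s, HasDerivAt (T n) (1 / (1 + (s / ((n : ℝ) + 1)) ^ 2)) s := fun n s => by
    have h1 := ((hasDerivAt_id s).div_const ((n : ℝ) + 1)).arctan.const_mul ((n : ℝ) + 1)
    refine h1.congr_deriv ?_
    have := (hn n).ne'
    simp only [id]
    field_simp
  have hT : ∀ n, ContDiff ℝ 1 (T n) := fun n =>
    contDiff_const.mul (Real.contDiff_arctan.comp (contDiff_id.div_const _))
  have hder : ∀ n s, deriv (T n) s = 1 / (1 + (s / ((n : ℝ) + 1)) ^ 2) := fun n s => (hd n s).deriv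
  have hT01 : ∀ n s, 0 ≤ deriv (T n) s ∧ deriv (T n) s ≤ 1 := fun n s => by
    rw [hder]
    exact ⟨by positivity, by rw [div_le_one (by positivity)]; nlinarith [sq_nonneg (s / ((n : ℝ) + 1))]⟩
  have hT1 : ∀ n s, |deriv (T n) s| ≤ 1 := fun n s => by
    rw [abs_of_nonneg (hT01 n s).1]; exact (hT01 n s).2
  have hT0 : ∀ n, T n 0 = 0 := fun n => by simp [T]
  have hTle : ∀ n s, |T n s| ≤ |s| := fun n s => by
    have := Convex.norm_image_sub_le_of_norm_deriv_le (f := T n) (C := 1) (s := Set.univ)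
      (fun x _ => (hT n).differentiable (by norm_num) x) (fun x _ => hT1 n x) convex_univ
      (Set.mem_univ 0) (Set.mem_univ s)
    simpa [hT0] using this
  have hdlim : ∀ s, Tendsto (fun n => deriv (T n) s) atTop (𝓝 1) := fun s => by
    simp only [hder]
    have h1 : Tendsto (fun n : ℕ => s / ((n : ℝ) + 1)) atTop (𝓝 0) := by
      have := (tendsto_one_div_add_atTop_nhds_zero_nat (𝕜 := ℝ)).const_mul s
      simpa [div_eq_mul_inv] using this
    have := (tendsto_const_nhds (x := (1 : ℝ))).div ((tendsto_const_nhds (x := (1 : ℝ))).add (h1.pow 2))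
      (by norm_num)
    simpa [Pi.div_def] using this
  have hTlim : ∀ s, Tendsto (fun n => T n s) atTop (𝓝 s) := fun s => by
    -- `arctan` is differentiable at `0` with derivative `1`
    have h0 : HasDerivAt (fun t => Real.arctan (s * t)) s 0 := by
      have h1 := ((hasDerivAt_id (0 : ℝ)).const_mul s).arctan
      refine h1.congr_deriv (by simp)
    have h1 := h0.tendsto_slope_zero_right
    have h2 : Tendsto (fun n : ℕ => 1 / ((n : ℝ) + 1)) atTop (𝓝[>] 0) :=
      tendsto_nhdsWithin_iff.2 ⟨tendsto_one_div_add_atTop_nhds_zero_nat,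
        Eventually.of_forall fun n => by simp only [Set.mem_Ioi]; have := hn n; positivity⟩
    refine (h1.comp h2).congr fun n => ?_
    simp [T, div_eq_mul_inv]
  have hchain := fun n i => isWeakPartial_comp (hT n) (hT0 n) (hT1 n) hv.1
    (hv.weakPartial_spec i).1 (hv.weakPartial_spec i).2
  have hwH : ∀ n, MemH1 (fun x => T n (v x)) := fun n =>
    MemH1.of_partials (hchain n 0).1 (fun i => (hchain n i).2.1) (fun i => (hchain n i).2.2)
  have dom : ∀ {k : E3 → ℝ} {t : ℕ → E3 → ℝ}, MemLp k 2 volume →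
      (∀ n, AEStronglyMeasurable (t n) volume) → (∀ n x, |t n x| ≤ |k x|) →
      (∀ x, Tendsto (fun n => t n x) atTop (𝓝 (k x))) → L2Tendsto volume t k := by
    intro k t hk ht hle hlim
    refine L2Tendsto.of_dominated (b := fun x => 2 * |k x|) ht hk (hk.abs.const_mul 2)
      (fun n => ae_of_all _ fun x => ?_) (ae_of_all _ hlim)
    have := hle n x
    exact (abs_sub _ _).trans (by linarith)
  have hTm : ∀ n, AEStronglyMeasurable (fun x => T n (v x)) volume := fun n =>
    (hT n).continuous.comp_aestronglyMeasurable hv.1.1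
  have hall : H1Tendsto κ (fun n x => T n (v x)) v := by
    refine ⟨dom hv.1 hTm (fun n x => hTle n _) fun x => hTlim _, fun i => ?_,
      dom hκv (fun n => hκ.mul (hTm n)) (fun n x => ?_) fun x => (hTlim _).const_mul _⟩
    · refine (dom (t := fun n x => deriv (T n) (v x) * weakPartial i v x) (hv.weakPartial_spec i).1
        (fun n => (hchain n i).2.1.1) (fun n x => ?_) (fun x => ?_)).congr
        (fun n => ((hwH n).weakPartial_ae_eq (hchain n i).2.2).symm) (ae_eq_refl _)
      · rw [abs_mul]; exact mul_le_of_le_one_left (abs_nonneg _) (hT1 _ _)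
      · simpa using (hdlim (v x)).mul_const (weakPartial i v x)
    · rw [abs_mul (κ x), abs_mul (κ x)]
      exact mul_le_mul_of_nonneg_left (hTle n _) (abs_nonneg _)
  obtain ⟨n, hclose⟩ := (hall.exists_close hwH
    (fun p n x y h1 h2 => by simp only [p x y h1 h2]) hε).exists
  refine ⟨_, hclose, ((n : ℝ) + 1) * (Real.pi / 2), fun x => ?_⟩
  rw [abs_mul, abs_of_pos (hn n)]
  exact mul_le_mul_of_nonneg_left (abs_le.2 ⟨(Real.neg_pi_div_two_lt_arctan _).le,
    (Real.arctan_lt_pi_div_two _).le⟩) (hn n).le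

/-- The cutoff at infinity at scale `n + 1`. -/
noncomputable def ballCut (n : ℕ) (x : E3) : ℝ :=
  Real.smoothTransition (2 - ‖x‖ ^ 2 / ((n : ℝ) + 1) ^ 2)

theorem contDiff_ballCut (n : ℕ) : ContDiff ℝ ∞ (ballCut n) :=
  Real.smoothTransition.contDiff.comp (contDiff_const.sub ((contDiff_norm_sq ℝ).div_const _))

theorem ballCut_eq_zero {n : ℕ} {x : E3} (h : 2 * ((n : ℝ) + 1) ≤ ‖x‖) : ballCut n x = 0 := by
  refine Real.smoothTransition.zero_of_nonpos ?_
  rw [sub_nonpos, le_div_iff₀ (by positivity)]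
  nlinarith [show (0 : ℝ) < (n : ℝ) + 1 by positivity]

theorem ballCut_eventually (x : E3) : ∀ᶠ n in atTop, ballCut n =ᶠ[𝓝 x] fun _ => 1 := by
  obtain ⟨N, hN⟩ := exists_nat_gt ‖x‖
  filter_upwards [eventually_ge_atTop N] with n hn
  have h1 : ‖x‖ < (n : ℝ) + 1 := by
    have : (N : ℝ) ≤ n := by exact_mod_cast hn
    linarith
  filter_upwards [continuous_norm.continuousAt.eventually_lt_const h1] with y hy
  refine Real.smoothTransition.one_of_one_le ?_
  have : ‖y‖ ^ 2 / ((n : ℝ) + 1) ^ 2 ≤ 1 := by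
    rw [div_le_one (by positivity)]
    exact pow_le_pow_left₀ (norm_nonneg _) hy.le 2
  linarith

theorem exists_bound_pd_ballCut : ∃ C : ℝ, 1 ≤ C ∧ ∀ n i x, |pd i (ballCut n) x| ≤ C := by
  have hc : HasCompactSupport (ballCut 0) :=
    HasCompactSupport.intro (isCompact_closedBall 0 2) fun x hx =>
      ballCut_eq_zero (by simpa using (not_le.1 (by simpa using hx)).le)
  have h1 : ∀ n, ContDiff ℝ 1 (ballCut n) := fun n =>
    (contDiff_ballCut n).of_le (by exact_mod_cast le_top)
  have hb : ∀ i, ∃ C, ∀ x, ‖pd i (ballCut 0) x‖ ≤ C := fun i =>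
    (hasCompactSupport_pd hc i).exists_bound_of_continuous (continuous_pd (h1 0) i)
  choose C hC using hb
  have hC0 : ∀ i, 0 ≤ C i := fun i => (norm_nonneg _).trans (hC i 0)
  refine ⟨1 + ∑ i, C i, by linarith [Finset.sum_nonneg fun i (_ : i ∈ Finset.univ) => hC0 i],
    fun n i x => ?_⟩
  have hn : (0 : ℝ) < (n : ℝ) + 1 := by positivity
  have e : ballCut n = fun x => ballCut 0 (((n : ℝ) + 1)⁻¹ • x) := by
    funext y
    simp only [ballCut, norm_smul, Real.norm_of_nonneg (inv_nonneg.2 hn.le)]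
    congr 1
    simp only [Nat.cast_zero]
    field_simp
    norm_num
  have hd : pd i (ballCut n) x = ((n : ℝ) + 1)⁻¹ * pd i (ballCut 0) (((n : ℝ) + 1)⁻¹ • x) := by
    rw [e, pd, pd]
    have hg : HasFDerivAt (fun x : E3 => ((n : ℝ) + 1)⁻¹ • x)
      (((n : ℝ) + 1)⁻¹ • ContinuousLinearMap.id ℝ E3) x :=
      (((n : ℝ) + 1)⁻¹ • ContinuousLinearMap.id ℝ E3).hasFDerivAt
    have := ((h1 0).differentiable (by norm_num) (((n : ℝ) + 1)⁻¹ • x)).hasFDerivAt.comp x hg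
    rw [show (fun x => ballCut 0 (((n : ℝ) + 1)⁻¹ • x))
      = ballCut 0 ∘ fun x => ((n : ℝ) + 1)⁻¹ • x from rfl, this.fderiv]
    simp
  rw [hd, abs_mul, abs_of_pos (inv_pos.2 hn)]
  have h2 : ((n : ℝ) + 1)⁻¹ ≤ 1 := inv_le_one_of_one_le₀ (by linarith [Nat.cast_nonneg (α := ℝ) n])
  calc _ ≤ 1 * C i := mul_le_mul h2 (hC i _) (abs_nonneg _) zero_le_one
    _ ≤ ∑ i, C i := by
      rw [one_mul]; exact Finset.single_le_sum (fun i _ => hC0 i) (Finset.mem_univ i)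
    _ ≤ _ := by linarith

/-- Cutoff at infinity. -/
theorem exists_close_bddSupport {κ v : E3 → ℝ} (hv : MemH1 v)
    (hκv : MemLp (fun x => κ x * v x) 2 volume) {M : ℝ} (hM : ∀ x, |v x| ≤ M) {ε : ENNReal}
    (hε : 0 < ε) :
    ∃ w, H1Close κ ε v w ∧ (∀ x, |w x| ≤ M) ∧ ∃ R, 0 ≤ R ∧ ∀ x, R < ‖x‖ → w x = 0 := by
  obtain ⟨C, hC1, hC⟩ := exists_bound_pd_ballCut
  have h01 : ∀ n x, 0 ≤ ballCut n x ∧ ballCut n x ≤ 1 := fun n x =>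
    ⟨Real.smoothTransition.nonneg _, Real.smoothTransition.le_one _⟩
  have hbd : ∀ n x, |ballCut n x| ≤ C := fun n x => by
    rw [abs_of_nonneg (h01 n x).1]; exact (h01 n x).2.trans hC1
  have hm : ∀ n, AEStronglyMeasurable (ballCut n) volume := fun n =>
    (contDiff_ballCut n).continuous.aestronglyMeasurable
  have hlim : ∀ x, Tendsto (fun n => ballCut n x) atTop (𝓝 1) := fun x =>
    tendsto_const_nhds.congr' ((ballCut_eventually x).mono fun n hn => hn.self_of_nhds.symm)
  have hw : ∀ n, MemH1 (fun x => ballCut n x * v x) := fun n =>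
    hv.smooth_mul (contDiff_ballCut n) (hbd n) (hC n)
  have hall : H1Tendsto κ (fun n x => ballCut n x * v x) v := by
    refine ⟨L2Tendsto.cut hv.1 hm h01 (ae_of_all _ hlim), fun i => ?_, ?_⟩
    · have hp : L2Tendsto volume (fun n x => pd i (ballCut n) x * v x) (fun _ => 0) := by
        refine L2Tendsto.of_dominated (b := fun x => C * |v x|)
          (fun n => (continuous_pd ((contDiff_ballCut n).of_le (by exact_mod_cast le_top))
            i).aestronglyMeasurable.mul hv.1.1) MemLp.zero (hv.1.abs.const_mul C)
          (fun n => ae_of_all _ fun x => ?_) (ae_of_all _ fun x => ?_)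
        · rw [sub_zero, abs_mul]; exact mul_le_mul_of_nonneg_right (hC n i x) (abs_nonneg _)
        · refine tendsto_const_nhds.congr' ((ballCut_eventually x).mono fun n hn => ?_)
          have : pd i (ballCut n) x = 0 := by rw [pd, hn.fderiv_eq]; simp
          simp only [this, zero_mul]
      refine ((L2Tendsto.cut (hv.weakPartial_spec i).1 hm h01 (ae_of_all _ hlim)).add hp).congr
        (fun n => (weakPartial_smooth_mul hv (contDiff_ballCut n) (hbd n) (hC n) i).symm)
        (ae_of_all _ fun x => by simp)
    · refine (L2Tendsto.cut hκv hm h01 (ae_of_all _ hlim)).congr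
        (fun n => ae_of_all _ fun x => ?_) (ae_eq_refl _)
      simp only; ring
  obtain ⟨n, hclose⟩ := (hall.exists_close hw
    (fun p n x y h1 h2 => by simp only [p x y h1 h2, ballCut, h1]) hε).exists
  refine ⟨_, hclose, fun x => ?_, 2 * ((n : ℝ) + 1), by positivity, fun x hx => ?_⟩
  · rw [abs_mul, abs_of_nonneg (h01 n x).1]
    exact (mul_le_of_le_one_left (abs_nonneg _) (h01 n x).2).trans (hM x)
  · simp only [ballCut_eq_zero hx.le, zero_mul]

/-- Cutoff near the axis, for bounded functions of bounded support. -/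
theorem exists_close_offAxis {κ v : E3 → ℝ} (hv : MemH1 v)
    (hκv : MemLp (fun x => κ x * v x) 2 volume) {M R : ℝ} (hM : ∀ x, |v x| ≤ M) (hR : 0 ≤ R)
    (hsupp : ∀ x, R < ‖x‖ → v x = 0) {ε : ENNReal} (hε : 0 < ε) :
    ∃ w, H1Close κ ε v w ∧ HasCompactSupport w ∧ tsupport w ⊆ offAxis := by
  obtain ⟨K, hK0, hK⟩ := exists_bound_pd_axisCut
  have h01 := axisCutAvg_mem
  let C : ℕ → ℝ := fun N => 1 + (N : ℝ)⁻¹ * ∑ j ∈ Finset.range N, K * 2 ^ j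
  have hC1 : ∀ N : ℕ, 0 ≤ (N : ℝ)⁻¹ * ∑ j ∈ Finset.range N, K * 2 ^ j := fun N => by positivity
  have hbd : ∀ N x, |axisCutAvg N x| ≤ C N := fun N x => by
    rw [abs_of_nonneg (h01 N x).1]; simp only [C]; linarith [(h01 N x).2, hC1 N]
  have hbd' : ∀ N i x, |pd i (axisCutAvg N) x| ≤ C N := fun N i x => by
    rw [pd_axisCutAvg, abs_mul, abs_of_nonneg (by positivity)]
    have : |∑ j ∈ Finset.range N, pd i (axisCut j) x| ≤ ∑ j ∈ Finset.range N, K * 2 ^ j :=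
      (Finset.abs_sum_le_sum_abs _ _).trans (Finset.sum_le_sum fun j _ => (hK i j x).1)
    have := mul_le_mul_of_nonneg_left this (show (0 : ℝ) ≤ (N : ℝ)⁻¹ by positivity)
    simp only [C]; linarith
  have hm : ∀ n, AEStronglyMeasurable (axisCutAvg n) volume := fun n =>
    (contDiff_axisCutAvg n).continuous.aestronglyMeasurable
  have hlim : ∀ᵐ x : E3, Tendsto (fun n => axisCutAvg n x) atTop (𝓝 1) :=
    ae_mem_offAxis.mono fun x hx => tendsto_axisCutAvg hx
  have hw : ∀ n, MemH1 (fun x => axisCutAvg n x * v x) := fun n =>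
    hv.smooth_mul (contDiff_axisCutAvg n) (hbd n) (hbd' n)
  have hall : H1Tendsto κ (fun n x => axisCutAvg n x * v x) v := by
    refine ⟨L2Tendsto.cut hv.1 hm h01 hlim, fun i => ?_, ?_⟩
    · refine ((L2Tendsto.cut (hv.weakPartial_spec i).1 hm h01 hlim).add
        (l2Tendsto_pd_axisCutAvg_mul hv.1 hM hR hsupp i)).congr
        (fun n => (weakPartial_smooth_mul hv (contDiff_axisCutAvg n) (hbd n) (hbd' n) i).symm)
        (ae_of_all _ fun x => by simp)
    · refine (L2Tendsto.cut hκv hm h01 hlim).congr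
        (fun n => ae_of_all _ fun x => ?_) (ae_eq_refl _)
      simp only; ring
  obtain ⟨n, hclose⟩ := (hall.exists_close hw
    (fun p n x y h1 h2 => by
      simp only [p x y h1 h2, axisCutAvg, axisCut, axisSq_eq, h1, h2]) hε).exists
  refine ⟨_, hclose, HasCompactSupport.intro (isCompact_closedBall 0 R) fun x hx => ?_, ?_⟩
  · rw [hsupp x (by simpa using hx), mul_zero]
  · have hcl : IsClosed {x : E3 | 1 ≤ 4 ^ n * axisSq x} :=
      isClosed_le continuous_const (continuous_const.mul (contDiff_axisSq (n := 0)).continuous)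
    refine (closure_minimal (fun x hx => ?_) hcl).trans fun x hx => ?_
    · by_contra hn
      refine hx ?_
      simp only [axisCutAvg_eq_zero (not_le.1 hn).le, zero_mul]
    · by_contra hn
      have h1 : axisSq x ≤ 0 := not_lt.1 hn
      have h2 : (1 : ℝ) ≤ 4 ^ n * axisSq x := hx
      have h3 : (0 : ℝ) < 4 ^ n := by positivity
      nlinarith

/-- The rotation about the axis with cosine `p` and sine `q`. -/
noncomputable def axisRotation (p q : ℝ) (h : p ^ 2 + q ^ 2 = 1) : E3 ≃ₗᵢ[ℝ] E3 :=
  LinearIsometry.toLinearIsometryEquiv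
    { toFun := fun z => !₂[p * z 0 - q * z 1, q * z 0 + p * z 1, z 2]
      map_add' := fun x y => by ext i; fin_cases i <;> simp <;> ring
      map_smul' := fun r x => by ext i; fin_cases i <;> simp <;> ring
      norm_map' := fun z => by
        have : ‖(!₂[p * z 0 - q * z 1, q * z 0 + p * z 1, z 2] : E3)‖ ^ 2 = ‖z‖ ^ 2 := by
          rw [norm_sq_eq, norm_sq_eq]
          simp only [Matrix.cons_val_zero, Matrix.cons_val_one, Matrix.cons_val]
          linear_combination (z 0 ^ 2 + z 1 ^ 2) * h
        exact (pow_left_inj₀ (norm_nonneg _) (norm_nonneg _) (by norm_num)).1 this } rfl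

theorem axisRotation_apply (p q : ℝ) (h : p ^ 2 + q ^ 2 = 1) (z : E3) :
    axisRotation p q h z = !₂[p * z 0 - q * z 1, q * z 0 + p * z 1, z 2] := rfl

theorem exists_axisRotation {x y : E3} (h1 : ‖x‖ = ‖y‖) (h2 : x 2 = y 2) :
    ∃ ρ : E3 ≃ₗᵢ[ℝ] E3, ρ x = y ∧ ∀ z, (ρ z) 2 = z 2 := by
  have hP : axisSq x = axisSq y := by rw [axisSq_eq, axisSq_eq, h1, h2]
  rcases (axisSq_nonneg x).eq_or_lt with h0 | h0
  · have hz : ∀ z : E3, axisSq z = 0 → z 0 = 0 ∧ z 1 = 0 := fun z hz => by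
      unfold axisSq at hz
      constructor <;> nlinarith [sq_nonneg (z 0), sq_nonneg (z 1)]
    refine ⟨LinearIsometryEquiv.refl ℝ E3, ?_, fun z => rfl⟩
    have hx := hz x h0.symm
    have hy := hz y (hP ▸ h0.symm)
    ext i
    fin_cases i
    · simp [hx.1, hy.1]
    · simp [hx.2, hy.2]
    · simpa using h2
  · have hne := h0.ne'
    refine ⟨axisRotation ((x 0 * y 0 + x 1 * y 1) / axisSq x)
      ((x 0 * y 1 - x 1 * y 0) / axisSq x) ?_, ?_, fun z => ?_⟩
    · rw [div_pow, div_pow, ← add_div, div_eq_one_iff_eq (by positivity)]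
      have : (x 0 * y 0 + x 1 * y 1) ^ 2 + (x 0 * y 1 - x 1 * y 0) ^ 2 = axisSq x * axisSq y := by
        unfold axisSq; ring
      rw [this, ← hP]; ring
    · rw [axisRotation_apply]
      ext i
      fin_cases i
      · simp only [Fin.zero_eta, Matrix.cons_val_zero]
        field_simp
        unfold axisSq; ring
      · simp only [Fin.mk_one, Matrix.cons_val_one, Matrix.cons_val_zero]
        field_simp
        unfold axisSq; ring
      · simpa using h2
    · rw [axisRotation_apply]; rfl

/-- Mollification with a radial kernel commutes with rotations about the axis. -/
theorem isPhiIndependent_mollify {δ : ℝ} {φ v : E3 → ℝ} (h : IsMollifier δ φ)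
    (hv : IsPhiIndependent v) : IsPhiIndependent (mollify φ v) := by
  intro x y h1 h2
  obtain ⟨ρ, hρ, hρ2⟩ := exists_axisRotation h1 h2
  have hmp := ρ.measurePreserving
  have := hmp.integral_comp ρ.toHomeomorph.measurableEmbedding (fun t => φ t * v (y - t))
  simp only [mollify]
  rw [← this]
  refine integral_congr_ae (ae_of_all _ fun t => ?_)
  simp only
  rw [h.radial (ρ t) t (ρ.norm_map t), ← hρ, ← map_sub]
  congr 1
  exact hv _ _ (ρ.norm_map _).symm (hρ2 _).symm

/-- Mollification of a function supported away from the axis. -/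
theorem exists_close_test {κ v : E3 → ℝ} (hκ : AEStronglyMeasurable κ volume)
    (hκc : ContinuousOn κ offAxis) (hv : MemH1 v)
    (hc : HasCompactSupport v) (hs : tsupport v ⊆ offAxis) {ε : ENNReal} (hε : 0 < ε) :
    ∃ w, H1Close κ ε v w ∧ IsTest w ∧ ContDiff ℝ ∞ w := by
  have hcK : IsCompact (tsupport v) := hc
  obtain ⟨δ, hδ, hsub⟩ := hcK.exists_cthickening_subset_open isOpen_offAxis hs
  have hK' : IsCompact (Metric.cthickening δ (tsupport v)) := hcK.cthickening
  obtain ⟨B, hB⟩ := hK'.exists_bound_of_continuousOn (hκc.mono hsub)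
  obtain ⟨φ, hφ⟩ := exists_mollifier_seq
  obtain ⟨n₀, hn₀⟩ := exists_nat_one_div_lt hδ
  have hle : ∀ n : ℕ, 1 / (((n + n₀ : ℕ) : ℝ) + 1) ≤ δ := fun n =>
    (one_div_le_one_div_of_le (by positivity) (by push_cast; linarith [Nat.cast_nonneg (α := ℝ) n])).trans
      hn₀.le
  let w : ℕ → E3 → ℝ := fun n => mollify (φ (n + n₀)) v
  have hli := locallyIntegrable_of_memLp hv.1
  have hts : ∀ n, tsupport (w n) ⊆ Metric.cthickening δ (tsupport v) := fun n =>
    (tsupport_mollify_subset (hφ _)).trans (Metric.cthickening_mono (hle n) _)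
  have htest : ∀ n, IsTest (w n) := fun n =>
    ⟨(contDiff_mollify (hφ _) hli).of_le (by exact_mod_cast le_top),
      hK'.of_isClosed_subset (isClosed_tsupport _) (hts n), (hts n).trans hsub⟩
  have hshift : StrictMono fun n : ℕ => n + n₀ := fun a b h => by simpa using h
  have hval : L2Tendsto volume w v := (l2Tendsto_mollify hφ hv.1).comp_subseq hshift
  have hz : ∀ n x, x ∉ Metric.cthickening δ (tsupport v) → w n x = 0 ∧ v x = 0 := fun n x hx =>
    ⟨image_eq_zero_of_notMem_tsupport fun h => hx (hts n h),
      image_eq_zero_of_notMem_tsupport fun h => hx (Metric.self_subset_cthickening _ h)⟩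
  have hmw : ∀ {k : E3 → ℝ}, MemLp k 2 volume →
      (∀ x, x ∉ Metric.cthickening δ (tsupport v) → k x = 0) →
      MemLp (fun x => κ x * k x) 2 volume := fun {k} hk hkz =>
    hk.of_le_mul (c := B) (hκ.mul hk.1) <| ae_of_all _ fun x => by
      by_cases hx : x ∈ Metric.cthickening δ (tsupport v)
      · rw [norm_mul]; exact mul_le_mul_of_nonneg_right (hB x hx) (norm_nonneg _)
      · simp [hkz x hx]
  have hall : H1Tendsto κ w v := by
    refine ⟨hval, fun i => ?_, ?_⟩
    · have hspec := hv.weakPartial_spec i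
      refine ((l2Tendsto_mollify hφ hspec.1).comp_subseq hshift).congr (fun n => ?_) (ae_eq_refl _)
      have := weakPartial_ae_eq_pd (htest n).contDiff (htest n).hasCompactSupport i
      rw [pd_mollify (hφ _) hspec.2] at this
      exact this.symm
    · refine L2Tendsto.of_le (fun n => hmw (hval.mem n) fun x hx => (hz n x hx).1)
        (hmw hv.1 fun x hx => (hz 0 x hx).2) (C := B) hval fun n => ae_of_all _ fun x => ?_
      by_cases hx : x ∈ Metric.cthickening δ (tsupport v)
      · rw [← mul_sub, abs_mul]; exact mul_le_mul_of_nonneg_right (hB x hx) (abs_nonneg _)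
      · simp [(hz n x hx).1, (hz n x hx).2]
  obtain ⟨n, hn⟩ := (hall.exists_close (fun n => (htest n).memH1)
    (fun p n => isPhiIndependent_mollify (hφ _) p) hε).exists
  exact ⟨w n, hn, htest n, contDiff_mollify (hφ _) hli⟩

/-- Functions of `H¹` that are square integrable against a weight, locally bounded off the axis,
are approximated by functions supported off the axis. -/
theorem exists_test_seq {κ v : E3 → ℝ} (hκ : AEStronglyMeasurable κ volume)
    (hκc : ContinuousOn κ offAxis) (hv : MemH1 v)
    (hκv : MemLp (fun x => κ x * v x) 2 volume) :
    ∃ w : ℕ → E3 → ℝ, (∀ n, IsTest (w n) ∧ ContDiff ℝ ∞ (w n)) ∧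
      (IsPhiIndependent v → ∀ n, IsPhiIndependent (w n)) ∧
      H1Tendsto κ w v := by
  have key : ∀ ε : ENNReal, 0 < ε → ∃ w, H1Close κ (ε + ε + ε + ε) v w ∧
      IsTest w ∧ ContDiff ℝ ∞ w := by
    intro ε hε
    obtain ⟨w₁, h₁, M, hM⟩ := exists_close_bounded hκ hv hκv hε
    obtain ⟨w₂, h₂, hM₂, R, hR, hs⟩ := exists_close_bddSupport h₁.memH1 h₁.memWt hM hε
    obtain ⟨w₃, h₃, hc, hts⟩ := exists_close_offAxis h₂.memH1 h₂.memWt hM₂ hR hs hε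
    obtain ⟨w₄, h₄, ht⟩ := exists_close_test hκ hκc h₃.memH1 hc hts hε
    exact ⟨w₄, ((h₁.trans hv hκv h₂).trans hv hκv h₃).trans hv hκv h₄, ht⟩
  have hpos : ∀ n : ℕ, (0 : ENNReal) < ((n : ENNReal) + 1)⁻¹ := fun n =>
    ENNReal.inv_pos.2 (by finiteness)
  choose w hw ht using fun n : ℕ => key _ (hpos n)
  have hlim : Tendsto (fun n : ℕ => ((n : ENNReal) + 1)⁻¹ + ((n : ENNReal) + 1)⁻¹ +
      ((n : ENNReal) + 1)⁻¹ + ((n : ENNReal) + 1)⁻¹) atTop (𝓝 0) := by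
    have h1 : Tendsto (fun n : ℕ => ((n : ENNReal) + 1)⁻¹) atTop (𝓝 0) := by
      have := (tendsto_add_atTop_iff_nat 1).2 ENNReal.tendsto_inv_nat_nhds_zero
      simpa using this
    simpa using ((h1.add h1).add h1).add h1
  have sq : ∀ {f : ℕ → ENNReal}, (∀ n, f n ≤ ((n : ENNReal) + 1)⁻¹ + ((n : ENNReal) + 1)⁻¹ +
      ((n : ENNReal) + 1)⁻¹ + ((n : ENNReal) + 1)⁻¹) → Tendsto f atTop (𝓝 0) := fun h =>
    tendsto_of_tendsto_of_tendsto_of_le_of_le tendsto_const_nhds hlim (fun _ => zero_le) h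
  exact ⟨w, ht, fun p n => (hw n).phi p,
    ⟨fun n => (hw n).memH1.1, hv.1, sq fun n => (hw n).val⟩,
    fun i => ⟨fun n => ((hw n).memH1.weakPartial_spec i).1, (hv.weakPartial_spec i).1,
      sq fun n => (hw n).grad i⟩,
    ⟨fun n => (hw n).memWt, hκv, sq fun n => (hw n).wt⟩⟩

/-! ### The Hardy inequality -/

theorem integrable_of_continuousOn_tsupport {f g : E3 → ℝ} (hc : HasCompactSupport g)
    (hf : ContinuousOn f (tsupport g)) (hz : ∀ x, g x = 0 → f x = 0) : Integrable f volume := by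
  have h1 : IntegrableOn f (tsupport g) volume := hf.integrableOn_compact hc
  refine (integrableOn_iff_integrable_of_support_subset fun x hx => ?_).1 h1
  exact subset_tsupport _ fun h => hx (hz x h)

theorem hasFDerivAt_inv_norm_sq {x : E3} (hx : x ≠ 0) :
    HasFDerivAt (fun y : E3 => (‖y‖ ^ 2)⁻¹) (-((‖x‖ ^ 2) ^ 2)⁻¹ • (2 • innerSL ℝ x)) x := by
  have h1 : HasFDerivAt (fun y : E3 => ‖y‖ ^ 2) (2 • innerSL ℝ x) x :=
    (hasStrictFDerivAt_norm_sq x).hasFDerivAt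
  exact (hasDerivAt_inv (pow_ne_zero 2 (norm_ne_zero_iff.2 hx))).comp_hasFDerivAt x h1

/-- Hardy's inequality for functions supported off the axis, by integrating a sum of squares the
cross terms of which are a divergence up to a multiple of `v² / |x|²`. -/
theorem hardy_integral {v : E3 → ℝ} (hv : IsTest v) :
    ∫ x, (v x / ‖x‖) ^ 2 ≤ 4 * ∑ i, ∫ x, pd i v x ^ 2 := by
  have hne : ∀ x ∈ tsupport v, x ≠ 0 := fun x hx =>
    norm_pos_iff.1 (norm_pos_of_mem_offAxis (hv.tsupport_subset hx))
  have hd := hv.contDiff.differentiable (by norm_num)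
  have hvc := hv.contDiff.continuous
  let h : Fin 3 → E3 → ℝ := fun i x => x i * (‖x‖ ^ 2)⁻¹
  have hcoord : ∀ i : Fin 3, Continuous fun x : E3 => x i := fun i => (coordL i).continuous
  have hinvc : ContinuousOn (fun x : E3 => (‖x‖ ^ 2)⁻¹) (tsupport v) :=
    (continuous_norm.pow 2).continuousOn.inv₀ fun x hx =>
      pow_ne_zero 2 (norm_ne_zero_iff.2 (hne x hx))
  have hhc : ∀ i, ContinuousOn (h i) (tsupport v) := fun i => (hcoord i).continuousOn.mul hinvc
  have hhd : ∀ i, ∀ x ∈ tsupport v, HasFDerivAt (h i)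
      (x i • (-((‖x‖ ^ 2) ^ 2)⁻¹ • (2 • innerSL ℝ x)) + (‖x‖ ^ 2)⁻¹ • coordL i) x :=
    fun i x hx => (hasFDerivAt_coord i x).mul (hasFDerivAt_inv_norm_sq (hne x hx))
  have hpdh : ∀ i, ∀ x ∈ tsupport v,
      pd i (h i) x = (‖x‖ ^ 2)⁻¹ - 2 * x i ^ 2 * ((‖x‖ ^ 2) ^ 2)⁻¹ := fun i x hx => by
    rw [pd, (hhd i x hx).fderiv]
    simp [coordL_apply, EuclideanSpace.inner_single_right]
    ring
  have hpdv2 : ∀ i x, pd i (fun x => v x * v x) x = 2 * (v x * pd i v x) := fun i x => by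
    rw [pd_mul hd hd]; ring
  have hinvsqc : ContinuousOn (fun x : E3 => ((‖x‖ ^ 2) ^ 2)⁻¹) (tsupport v) :=
    ((continuous_norm.pow 2).pow 2).continuousOn.inv₀ fun x hx =>
      pow_ne_zero 2 (pow_ne_zero 2 (norm_ne_zero_iff.2 (hne x hx)))
  have i1 : ∀ i, Integrable (fun x => pd i (h i) x * (v x * v x)) volume := fun i => by
    refine integrable_of_continuousOn_tsupport hv.hasCompactSupport ?_ fun x hx => by simp [hx]
    have : ContinuousOn (fun x : E3 => (‖x‖ ^ 2)⁻¹ - 2 * x i ^ 2 * ((‖x‖ ^ 2) ^ 2)⁻¹) (tsupport v) :=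
      hinvc.sub ((continuous_const.mul ((hcoord i).pow 2)).continuousOn.mul hinvsqc)
    exact (this.congr (hpdh i)).mul (hvc.mul hvc).continuousOn
  have i2 : ∀ i, Integrable (fun x => h i x * (2 * (v x * pd i v x))) volume := fun i => by
    refine integrable_of_continuousOn_tsupport hv.hasCompactSupport ?_ fun x hx => by simp [hx]
    exact (hhc i).mul (continuous_const.mul (hvc.mul (continuous_pd hv.contDiff i))).continuousOn
  have i3 : ∀ i, Integrable (fun x => h i x * (v x * v x)) volume := fun i => by
    refine integrable_of_continuousOn_tsupport hv.hasCompactSupport ?_ fun x hx => by simp [hx]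
    exact (hhc i).mul (hvc.mul hvc).continuousOn
  have i4 : Integrable (fun x => (v x / ‖x‖) ^ 2) volume := by
    refine integrable_of_continuousOn_tsupport hv.hasCompactSupport ?_ fun x hx => by simp [hx]
    exact (hvc.continuousOn.div continuous_norm.continuousOn fun x hx =>
      norm_ne_zero_iff.2 (hne x hx)).pow 2
  have i5 : ∀ i, Integrable (fun x => pd i v x ^ 2) volume := fun i =>
    (memLp_two_of_continuous (continuous_pd hv.contDiff i)
      (hasCompactSupport_pd hv.hasCompactSupport i)).integrable_sq
  -- the divergence theorem for the field `v² x / |x|²`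
  have parts : ∀ i, ∫ x, h i x * (2 * (v x * pd i v x)) = - ∫ x, pd i (h i) x * (v x * v x) := by
    intro i
    have := integral_mul_fderiv_eq_neg_fderiv_mul_of_integrable (μ := (volume : Measure E3))
      (f := h i) (g := fun x => v x * v x) (v := EuclideanSpace.single i (1 : ℝ)) (i1 i)
      ((i2 i).congr (ae_of_all _ fun x => congrArg (h i x * ·) (hpdv2 i x).symm)) (i3 i)
      (fun x hx => (hhd i x (tsupport_mul_subset_left hx)).differentiableAt)
      (fun x _ => (hd x).mul (hd x))
    refine Eq.trans (integral_congr_ae (ae_of_all _ fun x => ?_)) this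
    exact congrArg (h i x * ·) (hpdv2 i x).symm
  have hsum : ∑ i, ∫ x, h i x * (2 * (v x * pd i v x)) = - ∫ x, (v x / ‖x‖) ^ 2 := by
    simp only [parts]
    rw [Finset.sum_neg_distrib, ← integral_finsetSum _ fun i _ => i1 i]
    congr 1
    refine integral_congr_ae (ae_of_all _ fun x => ?_)
    simp only
    by_cases hx : x ∈ tsupport v
    · rw [Finset.sum_congr rfl fun i _ => by rw [hpdh i x hx]]
      have hn := norm_ne_zero_iff.2 (hne x hx)
      have := norm_sq_eq x
      rw [Fin.sum_univ_three]
      field_simp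
      rw [show ‖x‖ ^ 2 - 2 * x 0 ^ 2 + (‖x‖ ^ 2 - 2 * x 1 ^ 2) + (‖x‖ ^ 2 - 2 * x 2 ^ 2)
        = ‖x‖ ^ 2 by rw [this]; ring]
      ring
    · simp [image_eq_zero_of_notMem_tsupport hx]
  have hpt : ∀ x, 0 ≤ (v x / ‖x‖) ^ 2 + 2 * ∑ i, h i x * (2 * (v x * pd i v x))
      + 4 * ∑ i, pd i v x ^ 2 := by
    intro x
    by_cases hx : x ∈ tsupport v
    · have hn := norm_ne_zero_iff.2 (hne x hx)
      have hn2 := norm_sq_eq x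
      have e : (v x / ‖x‖) ^ 2 + 2 * ∑ i, h i x * (2 * (v x * pd i v x)) + 4 * ∑ i, pd i v x ^ 2
          = ∑ i, (x i / ‖x‖ * (v x / ‖x‖) + 2 * pd i v x) ^ 2 := by
        have e1 : (v x / ‖x‖) ^ 2 = (x 0 ^ 2 + x 1 ^ 2 + x 2 ^ 2) * (v x ^ 2 * ((‖x‖ ^ 2)⁻¹) ^ 2) := by
          rw [← hn2]; field_simp
        simp only [Fin.sum_univ_three, h, e1]
        field_simp
        ring
      rw [e]; positivity
    · simp only [image_eq_zero_of_notMem_tsupport hx]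
      simp; positivity
  have hint : 0 ≤ ∫ x, ((v x / ‖x‖) ^ 2 + 2 * ∑ i, h i x * (2 * (v x * pd i v x))
      + 4 * ∑ i, pd i v x ^ 2) := integral_nonneg hpt
  have i6 : Integrable (fun x => ∑ i, h i x * (2 * (v x * pd i v x))) volume :=
    integrable_finsetSum _ fun i _ => i2 i
  have i7 : Integrable (fun x => ∑ i, pd i v x ^ 2) volume := integrable_finsetSum _ fun i _ => i5 i
  have i8 : Integrable (fun x => (v x / ‖x‖) ^ 2 + 2 * ∑ i, h i x * (2 * (v x * pd i v x)))
      volume := i4.add (i6.const_mul 2)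
  rw [integral_add i8 (i7.const_mul 4), integral_add i4 (i6.const_mul 2),
    integral_const_mul, integral_const_mul, integral_finsetSum _ fun i _ => i2 i,
    integral_finsetSum _ fun i _ => i5 i, hsum] at hint
  linarith

theorem measurable_div_norm {v : E3 → ℝ} (hv : AEStronglyMeasurable v volume) :
    AEStronglyMeasurable (fun x => v x / ‖x‖) volume :=
  (hv.aemeasurable.div measurable_norm.aemeasurable).aestronglyMeasurable

theorem hardy_test {v : E3 → ℝ} (hv : IsTest v) :
    eLpNorm (fun x => v x / ‖x‖) 2 volume ≤ 2 * ∑ i, eLpNorm (weakPartial i v) 2 volume := by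
  have hm : MemLp (fun x => v x / ‖x‖) 2 volume := by
    rw [memLp_two_iff_integrable_sq (measurable_div_norm hv.memH1.1.1)]
    refine integrable_of_continuousOn_tsupport hv.hasCompactSupport ?_ fun x hx => by simp [hx]
    exact (hv.contDiff.continuous.continuousOn.div continuous_norm.continuousOn fun x hx =>
      (norm_pos_of_mem_offAxis (hv.tsupport_subset hx)).ne').pow 2
  have hp : ∀ i, MemLp (pd i v) 2 volume := fun i =>
    memLp_two_of_continuous (continuous_pd hv.contDiff i)
      (hasCompactSupport_pd hv.hasCompactSupport i)
  rw [Finset.sum_congr rfl fun i _ => eLpNorm_congr_ae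
    (weakPartial_ae_eq_pd hv.contDiff hv.hasCompactSupport i), eLpNorm_two_eq_sqrt hm,
    Finset.sum_congr rfl fun i _ => eLpNorm_two_eq_sqrt (hp i),
    ← ENNReal.ofReal_sum_of_nonneg fun i _ => Real.sqrt_nonneg _,
    two_mul, ← ENNReal.ofReal_add (by positivity) (by positivity), ← two_mul]
  refine ENNReal.ofReal_le_ofReal ?_
  refine Real.sqrt_le_iff.2 ⟨by positivity, (hardy_integral hv).trans ?_⟩
  rw [mul_pow]
  have h0 : ∀ i, 0 ≤ ∫ x, pd i v x ^ 2 := fun i => integral_nonneg fun x => sq_nonneg _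
  have hle : ∑ i, ∫ x, pd i v x ^ 2 ≤ (∑ i, Real.sqrt (∫ x, pd i v x ^ 2)) ^ 2 := by
    have h1 : ∀ i, ∫ x, pd i v x ^ 2 = Real.sqrt (∫ x, pd i v x ^ 2) ^ 2 := fun i =>
      (Real.sq_sqrt (h0 i)).symm
    rw [Finset.sum_congr rfl fun i _ => h1 i]
    exact Finset.sum_sq_le_sq_sum_of_nonneg fun i _ => Real.sqrt_nonneg _
  linarith

/-- The Hardy inequality in `H¹(ℝ³)`. -/
theorem hardy {v : E3 → ℝ} (hv : MemH1 v) :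
    eLpNorm (fun x => v x / ‖x‖) 2 volume ≤ 2 * ∑ i, eLpNorm (weakPartial i v) 2 volume := by
  obtain ⟨w, hw, -, h⟩ := exists_test_seq (κ := fun _ => 0) (v := v)
    aestronglyMeasurable_const continuousOn_const hv (by simp)
  obtain ⟨ns, hns, hae⟩ := h.val.exists_subseq_ae
  have hlim : Tendsto (fun n => 2 * ∑ i, eLpNorm (weakPartial i (w (ns n))) 2 volume) atTop
      (𝓝 (2 * ∑ i, eLpNorm (weakPartial i v) 2 volume)) := by
    refine ENNReal.Tendsto.const_mul (tendsto_finsetSum _ fun i _ => ?_) (Or.inr (by norm_num))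
    have h1 := ((Lp.tendsto_Lp_iff_tendsto_eLpNorm'' _ (h.grad i).mem _ (h.grad i).memLim).2
      (h.grad i).tendsto).comp hns.tendsto_atTop
    have h2 := h1.enorm
    simp only [Lp.enorm_def] at h2
    rw [eLpNorm_congr_ae (h.grad i).memLim.coeFn_toLp] at h2
    refine h2.congr fun n => ?_
    simp only [Function.comp]
    rw [eLpNorm_congr_ae ((h.grad i).mem (ns n)).coeFn_toLp]
  have hfatou := Lp.eLpNorm_lim_le_liminf_eLpNorm (μ := (volume : Measure E3)) (p := 2)
    (f := fun n x => w (ns n) x / ‖x‖) (fun n => measurable_div_norm (hw _).1.memH1.1.1)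
    (fun x => v x / ‖x‖) (hae.mono fun x hx => hx.div_const _)
  refine hfatou.trans ?_
  rw [← hlim.liminf_eq]
  exact liminf_le_liminf (Eventually.of_forall fun n => hardy_test (hw _).1)

theorem memLp_div_norm {v : E3 → ℝ} (hv : MemH1 v) : MemLp (fun x => v x / ‖x‖) 2 volume :=
  ⟨measurable_div_norm hv.1.1, (hardy hv).trans_lt (ENNReal.mul_lt_top (by norm_num)
    (ENNReal.sum_lt_top.2 fun i _ => (hv.weakPartial_spec i).1.2))⟩

theorem H1Tendsto.div_norm {κ : E3 → ℝ} {w : ℕ → E3 → ℝ} {v : E3 → ℝ} (h : H1Tendsto κ w v)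
    (hw : ∀ n, MemH1 (w n)) (hv : MemH1 v) :
    L2Tendsto volume (fun n x => w n x / ‖x‖) (fun x => v x / ‖x‖) := by
  refine ⟨fun n => memLp_div_norm (hw n), memLp_div_norm hv, ?_⟩
  have hlim : Tendsto (fun n => 2 * ∑ i, eLpNorm (weakPartial i (w n) - weakPartial i v) 2 volume)
      atTop (𝓝 0) := by
    have := ENNReal.Tendsto.const_mul (a := 2)
      (tendsto_finsetSum Finset.univ fun i _ => (h.grad i).tendsto) (Or.inr (by norm_num))
    simpa using this
  refine tendsto_of_tendsto_of_tendsto_of_le_of_le tendsto_const_nhds hlim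
    (fun _ => zero_le) fun n => ?_
  have hd : MemH1 (fun x => w n x + (-1) * v x) := (hw n).add (hv.const_mul (-1))
  refine le_trans (le_of_eq ?_) ((hardy hd).trans (le_of_eq ?_))
  · congr 1; funext x; simp only [Pi.sub_apply]; ring
  · congr 1
    refine Finset.sum_congr rfl fun i _ => eLpNorm_congr_ae ?_
    filter_upwards [weakPartial_add (hw n) (hv.const_mul (-1)) i,
      weakPartial_const_mul (-1) hv i] with x h1 h2
    rw [h1, h2, Pi.sub_apply]; ring

/-! ### Directional derivatives along the spherical frame -/

/-- The function `f` is differentiable at `x`, with derivative `d` in the direction `e`. -/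
def HasD (e : E3) (f : E3 → ℝ) (d : ℝ) (x : E3) : Prop :=
  DifferentiableAt ℝ f x ∧ fderiv ℝ f x e = d

namespace HasD

variable {e x : E3} {f g : E3 → ℝ} {d d' : ℝ}

theorem of_hasFDerivAt {L : E3 →L[ℝ] ℝ} (h : HasFDerivAt f L x) : HasD e f (L e) x :=
  ⟨h.differentiableAt, by rw [h.fderiv]⟩

theorem eq (h : HasD e f d x) : fderiv ℝ f x e = d := h.2

theorem congr_d (h : HasD e f d x) (hd : d = d') : HasD e f d' x := hd ▸ h

theorem congr (h : HasD e f d x) (hg : g =ᶠ[𝓝 x] f) : HasD e g d x :=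
  ⟨h.1.congr_of_eventuallyEq hg, by rw [hg.fderiv_eq, h.2]⟩

theorem const (r : ℝ) : HasD e (fun _ => r) 0 x := ⟨differentiableAt_const _, by simp⟩

theorem add (hf : HasD e f d x) (hg : HasD e g d' x) : HasD e (fun y => f y + g y) (d + d') x :=
  ⟨hf.1.add hg.1, by rw [fderiv_fun_add hf.1 hg.1, ← hf.2, ← hg.2]; rfl⟩

theorem sub (hf : HasD e f d x) (hg : HasD e g d' x) : HasD e (fun y => f y - g y) (d - d') x :=
  ⟨hf.1.sub hg.1, by rw [fderiv_fun_sub hf.1 hg.1, ← hf.2, ← hg.2]; rfl⟩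

theorem neg (hf : HasD e f d x) : HasD e (fun y => - f y) (-d) x :=
  ⟨hf.1.neg, by rw [fderiv_fun_neg, ← hf.2]; rfl⟩

theorem mul (hf : HasD e f d x) (hg : HasD e g d' x) :
    HasD e (fun y => f y * g y) (d * g x + f x * d') x :=
  ⟨hf.1.mul hg.1, by
    rw [fderiv_fun_mul hf.1 hg.1, ← hf.2, ← hg.2]
    simp only [add_apply, smul_apply, smul_eq_mul]
    ring⟩

theorem const_mul (r : ℝ) (hf : HasD e f d x) : HasD e (fun y => r * f y) (r * d) x :=
  ((const r).mul hf).congr_d (by ring)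

theorem comp {T : ℝ → ℝ} {T' : ℝ} (hT : HasDerivAt T T' (f x)) (hf : HasD e f d x) :
    HasD e (fun y => T (f y)) (T' * d) x := by
  have h := hT.comp_hasFDerivAt x hf.1.hasFDerivAt
  refine (of_hasFDerivAt (e := e) h).congr_d ?_
  rw [← hf.2]; rfl

theorem div (hf : HasD e f d x) (hg : HasD e g d' x) (h0 : g x ≠ 0) :
    HasD e (fun y => f y / g y) ((d * g x - f x * d') / g x ^ 2) x := by
  simp only [div_eq_mul_inv]
  refine (hf.mul (comp (hasDerivAt_inv h0) hg)).congr_d ?_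
  field_simp
  ring

theorem pow (n : ℕ) (hf : HasD e f d x) :
    HasD e (fun y => f y ^ n) (n * f x ^ (n - 1) * d) x :=
  comp (T := fun t => t ^ n) (hasDerivAt_pow n (f x)) hf

theorem coord (i : Fin 3) : HasD e (fun y => y i) (e i) x := of_hasFDerivAt (hasFDerivAt_coord i x)

theorem axisDist (hx : x ∈ offAxis) :
    HasD e axisDist ((x 0 * e 0 + x 1 * e 1) / MeltingHedgehog.axisDist x) x := by
  have h := ((coord (e := e) (x := x) 0).pow 2).add ((coord (e := e) (x := x) 1).pow 2)
  have h2 := comp (T := Real.sqrt) (Real.hasDerivAt_sqrt (ne_of_gt hx)) h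
  refine h2.congr_d ?_
  have : Real.sqrt (x 0 ^ 2 + x 1 ^ 2) ≠ 0 := Real.sqrt_ne_zero'.2 hx
  simp only [MeltingHedgehog.axisDist, axisSq]
  field_simp
  push_cast
  ring

theorem norm (hx : x ≠ 0) :
    HasD e (fun y => ‖y‖) ((x 0 * e 0 + x 1 * e 1 + x 2 * e 2) / ‖x‖) x := by
  have h := (((coord (e := e) (x := x) 0).pow 2).add ((coord (e := e) (x := x) 1).pow 2)).add
    ((coord (e := e) (x := x) 2).pow 2)
  have hx' : ‖x‖ ≠ 0 := norm_ne_zero_iff.2 hx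
  have hp : x 0 ^ 2 + x 1 ^ 2 + x 2 ^ 2 ≠ 0 := by rw [← norm_sq_eq]; positivity
  have h2 := comp (T := Real.sqrt) (Real.hasDerivAt_sqrt hp) h
  have e1 : ∀ y : E3, ‖y‖ = Real.sqrt (y 0 ^ 2 + y 1 ^ 2 + y 2 ^ 2) := fun y => by
    rw [← norm_sq_eq, Real.sqrt_sq (norm_nonneg _)]
  refine (h2.congr (Eventually.of_forall e1)).congr_d ?_
  rw [← e1]
  field_simp
  push_cast
  ring

end HasD

/-- The direction `∂x/∂r = n`. -/
noncomputable def eR (x : E3) : E3 := WithLp.toLp 2 (nVec x)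

/-- The direction `∂x/∂θ = r m`. -/
noncomputable def eT (x : E3) : E3 := WithLp.toLp 2 fun i => ‖x‖ * mVec x i

/-- The direction `∂x/∂φ`. -/
noncomputable def eP (x : E3) : E3 := !₂[- x 1, x 0, 0]

/-- The derivative `∂_r`. -/
noncomputable def Dr (f : E3 → ℝ) (x : E3) : ℝ := fderiv ℝ f x (eR x)

/-- The derivative `∂_θ`. -/
noncomputable def Dt (f : E3 → ℝ) (x : E3) : ℝ := fderiv ℝ f x (eT x)

/-- The derivative `∂_φ`. -/
noncomputable def Dp (f : E3 → ℝ) (x : E3) : ℝ := fderiv ℝ f x (eP x)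

/-- The unit vector `p = (-sin φ, cos φ, 0)`. -/
noncomputable def pVec (x : E3) : Fin 3 → ℝ := ![- sinPhi x, cosPhi x, 0]

theorem axisDist_pos {x : E3} (hx : x ∈ offAxis) : 0 < axisDist x := Real.sqrt_pos.2 hx

theorem ne_zero_of_mem_offAxis {x : E3} (hx : x ∈ offAxis) : x ≠ 0 :=
  norm_pos_iff.1 (norm_pos_of_mem_offAxis hx)

theorem sinTheta_pos {x : E3} (hx : x ∈ offAxis) : 0 < sinTheta x :=
  div_pos (axisDist_pos hx) (norm_pos_of_mem_offAxis hx)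

theorem coord_zero_eq {x : E3} (hx : x ∈ offAxis) : x 0 = ‖x‖ * sinTheta x * cosPhi x := by
  have := (axisDist_pos hx).ne'
  have := (norm_pos_of_mem_offAxis hx).ne'
  rw [sinTheta, cosPhi]; field_simp

theorem coord_one_eq {x : E3} (hx : x ∈ offAxis) : x 1 = ‖x‖ * sinTheta x * sinPhi x := by
  have := (axisDist_pos hx).ne'
  have := (norm_pos_of_mem_offAxis hx).ne'
  rw [sinTheta, sinPhi]; field_simp

theorem coord_two_eq {x : E3} (hx : x ∈ offAxis) : x 2 = ‖x‖ * cosTheta x := by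
  have := (norm_pos_of_mem_offAxis hx).ne'
  rw [cosTheta]; field_simp

theorem axisDist_eq_mul {x : E3} (hx : x ∈ offAxis) : axisDist x = ‖x‖ * sinTheta x := by
  have := (norm_pos_of_mem_offAxis hx).ne'
  rw [sinTheta]; field_simp

theorem cosPhi_sq_add {x : E3} (hx : x ∈ offAxis) : cosPhi x ^ 2 + sinPhi x ^ 2 = 1 := by
  have h : axisDist x ^ 2 = x 0 ^ 2 + x 1 ^ 2 := Real.sq_sqrt (le_of_lt hx)
  have := (axisDist_pos hx).ne'
  rw [cosPhi, sinPhi]; field_simp; rw [h]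

theorem sinTheta_sq_add {x : E3} (hx : x ∈ offAxis) : sinTheta x ^ 2 + cosTheta x ^ 2 = 1 := by
  have h : axisDist x ^ 2 = x 0 ^ 2 + x 1 ^ 2 := Real.sq_sqrt (le_of_lt hx)
  have := (norm_pos_of_mem_offAxis hx).ne'
  rw [sinTheta, cosTheta]; field_simp; rw [h, norm_sq_eq]

theorem eR_apply {x : E3} (hx : x ∈ offAxis) :
    eR x 0 = sinTheta x * cosPhi x ∧ eR x 1 = sinTheta x * sinPhi x ∧
    eR x 2 = cosTheta x := by
  simp only [eR]
  rw [nVec_eq (axisDist_pos hx).ne']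
  simp

theorem eT_apply {x : E3} : eT x 0 = ‖x‖ * (cosTheta x * cosPhi x) ∧
    eT x 1 = ‖x‖ * (cosTheta x * sinPhi x) ∧ eT x 2 = ‖x‖ * -sinTheta x := by
  simp [eT, mVec]

theorem eP_apply {x : E3} (hx : x ∈ offAxis) : eP x 0 = -(‖x‖ * sinTheta x * sinPhi x) ∧
    eP x 1 = ‖x‖ * sinTheta x * cosPhi x ∧ eP x 2 = 0 := by
  rw [← coord_zero_eq hx, ← coord_one_eq hx]
  simp [eP]

theorem hasD_norm_frame {x : E3} (hx : x ∈ offAxis) :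
    HasD (eR x) (fun y => ‖y‖) 1 x ∧ HasD (eT x) (fun y => ‖y‖) 0 x ∧
    HasD (eP x) (fun y => ‖y‖) 0 x := by
  have hr := (norm_pos_of_mem_offAxis hx).ne'
  have h := fun e => HasD.norm (e := e) (ne_zero_of_mem_offAxis hx)
  have h1 := sinTheta_sq_add hx
  have h2 := cosPhi_sq_add hx
  refine ⟨(h _).congr_d ?_, (h _).congr_d ?_, (h _).congr_d ?_⟩
  · rw [(eR_apply hx).1, (eR_apply hx).2.1, (eR_apply hx).2.2, coord_zero_eq hx, coord_one_eq hx,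
      coord_two_eq hx]
    field_simp
    linear_combination h1 + sinTheta x ^ 2 * h2
  · rw [eT_apply.1, eT_apply.2.1, eT_apply.2.2, coord_zero_eq hx, coord_one_eq hx,
      coord_two_eq hx]
    field_simp
    linear_combination ‖x‖ * sinTheta x * cosTheta x * h2
  · rw [(eP_apply hx).1, (eP_apply hx).2.1, (eP_apply hx).2.2, coord_zero_eq hx, coord_one_eq hx]
    field_simp
    ring

theorem hasD_axisDist_frame {x : E3} (hx : x ∈ offAxis) : HasD (eR x) axisDist (sinTheta x) x ∧
    HasD (eT x) axisDist (‖x‖ * cosTheta x) x ∧ HasD (eP x) axisDist 0 x := by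
  have hr := (norm_pos_of_mem_offAxis hx).ne'
  have hs := (sinTheta_pos hx).ne'
  have h := fun e => HasD.axisDist (e := e) hx
  have h2 := cosPhi_sq_add hx
  refine ⟨(h _).congr_d ?_, (h _).congr_d ?_, (h _).congr_d ?_⟩
  · rw [(eR_apply hx).1, (eR_apply hx).2.1, axisDist_eq_mul hx, coord_zero_eq hx, coord_one_eq hx]
    field_simp
    linear_combination h2
  · rw [eT_apply.1, eT_apply.2.1, axisDist_eq_mul hx, coord_zero_eq hx, coord_one_eq hx]
    field_simp
    linear_combination cosTheta x * h2
  · rw [(eP_apply hx).1, (eP_apply hx).2.1, coord_zero_eq hx, coord_one_eq hx]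
    field_simp
    ring

theorem hasD_sinTheta {x : E3} (hx : x ∈ offAxis) :
    HasD (eR x) sinTheta 0 x ∧ HasD (eT x) sinTheta (cosTheta x) x ∧
    HasD (eP x) sinTheta 0 x := by
  have hr := (norm_pos_of_mem_offAxis hx).ne'
  obtain ⟨a1, a2, a3⟩ := hasD_axisDist_frame hx
  obtain ⟨n1, n2, n3⟩ := hasD_norm_frame hx
  refine ⟨(a1.div n1 hr).congr_d ?_, (a2.div n2 hr).congr_d ?_, (a3.div n3 hr).congr_d ?_⟩
  · rw [axisDist_eq_mul hx]; ring
  · field_simp; ring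
  · simp

theorem hasD_cosTheta {x : E3} (hx : x ∈ offAxis) :
    HasD (eR x) cosTheta 0 x ∧ HasD (eT x) cosTheta (-sinTheta x) x ∧
    HasD (eP x) cosTheta 0 x := by
  have hr := (norm_pos_of_mem_offAxis hx).ne'
  have a := fun e => HasD.coord (e := e) (x := x) 2
  obtain ⟨n1, n2, n3⟩ := hasD_norm_frame hx
  refine ⟨((a _).div n1 hr).congr_d ?_, ((a _).div n2 hr).congr_d ?_, ((a _).div n3 hr).congr_d ?_⟩
  · rw [coord_two_eq hx, (eR_apply hx).2.2]; ring
  · rw [eT_apply.2.2]; field_simp; ring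
  · rw [(eP_apply hx).2.2]; simp

theorem hasD_cosPhi {x : E3} (hx : x ∈ offAxis) : HasD (eR x) cosPhi 0 x ∧ HasD (eT x) cosPhi 0 x ∧
    HasD (eP x) cosPhi (-sinPhi x) x := by
  have hr := (norm_pos_of_mem_offAxis hx).ne'
  have hs := (sinTheta_pos hx).ne'
  have hρ := (axisDist_pos hx).ne'
  have a := fun e => HasD.coord (e := e) (x := x) 0
  obtain ⟨n1, n2, n3⟩ := hasD_axisDist_frame hx
  refine ⟨((a _).div n1 hρ).congr_d ?_, ((a _).div n2 hρ).congr_d ?_, ((a _).div n3 hρ).congr_d ?_⟩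
  · rw [(eR_apply hx).1, coord_zero_eq hx, axisDist_eq_mul hx]; ring
  · rw [eT_apply.1, coord_zero_eq hx, axisDist_eq_mul hx]; ring
  · rw [(eP_apply hx).1, axisDist_eq_mul hx]; field_simp; ring

theorem hasD_sinPhi {x : E3} (hx : x ∈ offAxis) : HasD (eR x) sinPhi 0 x ∧ HasD (eT x) sinPhi 0 x ∧
    HasD (eP x) sinPhi (cosPhi x) x := by
  have hr := (norm_pos_of_mem_offAxis hx).ne'
  have hs := (sinTheta_pos hx).ne'
  have hρ := (axisDist_pos hx).ne'
  have a := fun e => HasD.coord (e := e) (x := x) 1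
  obtain ⟨n1, n2, n3⟩ := hasD_axisDist_frame hx
  refine ⟨((a _).div n1 hρ).congr_d ?_, ((a _).div n2 hρ).congr_d ?_, ((a _).div n3 hρ).congr_d ?_⟩
  · rw [(eR_apply hx).2.1, coord_one_eq hx, axisDist_eq_mul hx]; ring
  · rw [eT_apply.2.1, coord_one_eq hx, axisDist_eq_mul hx]; ring
  · rw [(eP_apply hx).2.1, axisDist_eq_mul hx]; field_simp; ring

/-! ### Symmetric traceless matrices in the spherical frame -/

/-- The symmetric traceless matrix with components `w` in the frame `n, m, p`. The component `w 0`
is that of `Id / 3 - n ⊗ n`, with the sign for which the reduced functionals come out as `Φ_k`; the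
even components are coupled to `cos kφ` when the odd ones are coupled to `sin kφ`. -/
noncomputable def frameMat (w : Fin 5 → ℝ) (n m p : Fin 3 → ℝ) : Matrix (Fin 3) (Fin 3) ℝ :=
  fun i j => - w 0 * (n i * n j - (1 / 3) * (1 : Matrix (Fin 3) (Fin 3) ℝ) i j)
    + w 1 * (n i * p j + p i * n j) + w 2 * (n i * m j + m i * n j)
    + w 3 * (m i * p j + p i * m j) + w 4 * (m i * m j - p i * p j)

/-- The vectors `n, m, p` form an orthonormal basis. -/
structure IsFrame (n m p : Fin 3 → ℝ) : Prop where
  nn : n 0 * n 0 + n 1 * n 1 + n 2 * n 2 = 1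
  mm : m 0 * m 0 + m 1 * m 1 + m 2 * m 2 = 1
  pp : p 0 * p 0 + p 1 * p 1 + p 2 * p 2 = 1
  nm : n 0 * m 0 + n 1 * m 1 + n 2 * m 2 = 0
  np : n 0 * p 0 + n 1 * p 1 + n 2 * p 2 = 0
  mp : m 0 * p 0 + m 1 * p 1 + m 2 * p 2 = 0
  complete : ∀ i j, (1 : Matrix (Fin 3) (Fin 3) ℝ) i j = n i * n j + m i * m j + p i * p j

theorem frobSq_frameMat {w : Fin 5 → ℝ} {n m p : Fin 3 → ℝ} (h : IsFrame n m p) :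
    frobSq (frameMat w n m p) =
      2 * (1 / 3 * w 0 ^ 2 + w 1 ^ 2 + w 2 ^ 2 + w 3 ^ 2 + w 4 ^ 2) := by
  have key : ∀ a b : ℝ, ∀ N M P X Y Z : ℝ, N = n 0 * n 0 + n 1 * n 1 + n 2 * n 2 →
      M = m 0 * m 0 + m 1 * m 1 + m 2 * m 2 → P = p 0 * p 0 + p 1 * p 1 + p 2 * p 2 →
      X = n 0 * m 0 + n 1 * m 1 + n 2 * m 2 → Y = n 0 * p 0 + n 1 * p 1 + n 2 * p 2 →
      Z = m 0 * p 0 + m 1 * p 1 + m 2 * p 2 →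
      frobSq (fun i j => a * (n i * n j) + b * (m i * m j) + (-a - b) * (p i * p j)
        + w 1 * (n i * p j + p i * n j) + w 2 * (n i * m j + m i * n j)
        + w 3 * (m i * p j + p i * m j)) =
      a ^ 2 * N ^ 2 + b ^ 2 * M ^ 2 + (-a - b) ^ 2 * P ^ 2 + 2 * w 1 ^ 2 * (N * P + Y ^ 2)
        + 2 * w 2 ^ 2 * (N * M + X ^ 2) + 2 * w 3 ^ 2 * (M * P + Z ^ 2)
        + 2 * (a * b * X ^ 2 + a * (-a - b) * Y ^ 2 + b * (-a - b) * Z ^ 2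
          + 2 * a * w 1 * N * Y + 2 * a * w 2 * N * X + 2 * a * w 3 * X * Y
          + 2 * b * w 1 * X * Z + 2 * b * w 2 * M * X + 2 * b * w 3 * M * Z
          + 2 * (-a - b) * w 1 * Y * P + 2 * (-a - b) * w 2 * Y * Z + 2 * (-a - b) * w 3 * Z * P
          + 2 * w 1 * w 2 * (N * Z + X * Y) + 2 * w 1 * w 3 * (X * P + Y * Z)
          + 2 * w 2 * w 3 * (X * Z + Y * M)) := by
    intro a b N M P X Y Z hN hM hP hX hY hZ
    subst hN hM hP hX hY hZ
    simp only [frobSq, Fin.sum_univ_three]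
    ring
  have e : frameMat w n m p = fun i j => (-(2 / 3) * w 0) * (n i * n j)
      + (1 / 3 * w 0 + w 4) * (m i * m j)
      + (-(-(2 / 3) * w 0) - (1 / 3 * w 0 + w 4)) * (p i * p j)
      + w 1 * (n i * p j + p i * n j) + w 2 * (n i * m j + m i * n j)
      + w 3 * (m i * p j + p i * m j) := by
    funext i j
    simp only [frameMat, h.complete i j]
    ring
  rw [e, key _ _ 1 1 1 0 0 0 h.nn.symm h.mm.symm h.pp.symm h.nm.symm h.np.symm h.mp.symm]
  ring

theorem isSymm_frameMat (w : Fin 5 → ℝ) (n m p : Fin 3 → ℝ) : (frameMat w n m p).IsSymm := by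
  ext i j
  simp only [Matrix.transpose_apply, frameMat]
  rw [← Matrix.transpose_apply (1 : Matrix (Fin 3) (Fin 3) ℝ), Matrix.transpose_one]
  ring

theorem trace_frameMat {w : Fin 5 → ℝ} {n m p : Fin 3 → ℝ} (h : IsFrame n m p) :
    (frameMat w n m p).trace = 0 := by
  simp only [Matrix.trace, Matrix.diag, frameMat, Fin.sum_univ_three, Matrix.one_apply_eq]
  linear_combination - w 0 * h.nn + w 1 * (2 * h.np) + w 2 * (2 * h.nm) + w 3 * (2 * h.mp)
    + w 4 * (h.mm - h.pp)

theorem frameMat_mulVec {w : Fin 5 → ℝ} {n m p : Fin 3 → ℝ} (h : IsFrame n m p) (i : Fin 3) :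
    ∑ j, frameMat w n m p i j * n j = -(2 / 3) * w 0 * n i + w 1 * p i + w 2 * m i := by
  simp only [Fin.sum_univ_three, frameMat, h.complete]
  linear_combination (-(2 / 3) * w 0 * n i + w 1 * p i + w 2 * m i) * h.nn
    + (1 / 3 * w 0 * m i + w 2 * n i + w 3 * p i + w 4 * m i) * h.nm
    + (1 / 3 * w 0 * p i + w 1 * n i + w 3 * m i - w 4 * p i) * h.np

theorem gForm_frameMat (a b c t : ℝ) {w : Fin 5 → ℝ} {n m p : Fin 3 → ℝ} (h : IsFrame n m p) :
    gForm a b c (t • (Matrix.vecMulVec n n - (1 / 3 : ℝ) • (1 : Matrix (Fin 3) (Fin 3) ℝ)))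
      (frameMat w n m p) = 1 / 3 * fHat a b c t * w 0 ^ 2 + fMid a b c t * (w 1 ^ 2 + w 2 ^ 2)
        + fTilde a b c t * (w 3 ^ 2 + w 4 ^ 2) := by
  have hF := frobSq_frameMat (w := w) h
  have hv := frameMat_mulVec (w := w) h
  have hs := isSymm_frameMat w n m p
  set A := frameMat w n m p with hA
  have h10 : A 1 0 = A 0 1 := hs.apply 0 1
  have h20 : A 2 0 = A 0 2 := hs.apply 0 2
  have h21 : A 2 1 = A 1 2 := hs.apply 1 2
  have v0 := hv 0
  have v1 := hv 1
  have v2 := hv 2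
  simp only [Fin.sum_univ_three] at v0 v1 v2
  have htr := trace_frameMat (w := w) h
  rw [← hA] at htr
  simp only [Matrix.trace, Matrix.diag, Fin.sum_univ_three] at htr
  -- `n · A n`
  have hq : (A 0 0 * n 0 + A 0 1 * n 1 + A 0 2 * n 2) * n 0
      + (A 1 0 * n 0 + A 1 1 * n 1 + A 1 2 * n 2) * n 1
      + (A 2 0 * n 0 + A 2 1 * n 1 + A 2 2 * n 2) * n 2 = -(2 / 3) * w 0 := by
    rw [v0, v1, v2]
    linear_combination (-(2 / 3) * w 0) * h.nn + w 1 * h.np + w 2 * h.nm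
  -- `|A n|²`
  have hq2 : (A 0 0 * n 0 + A 0 1 * n 1 + A 0 2 * n 2) ^ 2
      + (A 1 0 * n 0 + A 1 1 * n 1 + A 1 2 * n 2) ^ 2
      + (A 2 0 * n 0 + A 2 1 * n 1 + A 2 2 * n 2) ^ 2
      = 4 / 9 * w 0 ^ 2 + w 1 ^ 2 + w 2 ^ 2 := by
    rw [v0, v1, v2]
    linear_combination (4 / 9 * w 0 ^ 2) * h.nn + w 1 ^ 2 * h.pp + w 2 ^ 2 * h.mm
      - (4 / 3 * w 0 * w 1) * h.np - (4 / 3 * w 0 * w 2) * h.nm + (2 * w 1 * w 2) * h.mp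
  have hH : frobSq (t • (Matrix.vecMulVec n n - (1 / 3 : ℝ) • (1 : Matrix (Fin 3) (Fin 3) ℝ)))
      = 2 / 3 * t ^ 2 := by
    have : ∀ N : ℝ, N = n 0 * n 0 + n 1 * n 1 + n 2 * n 2 →
        frobSq (t • (Matrix.vecMulVec n n - (1 / 3 : ℝ) • (1 : Matrix (Fin 3) (Fin 3) ℝ)))
        = t ^ 2 * (N ^ 2 - 2 / 3 * N + 1 / 3) := by
      intro N hN
      subst hN
      simp [frobSq, Fin.sum_univ_three, Matrix.vecMulVec_apply, Matrix.one_apply]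
      ring
    rw [this 1 h.nn.symm]; ring
  have hT : (t • (Matrix.vecMulVec n n - (1 / 3 : ℝ) • (1 : Matrix (Fin 3) (Fin 3) ℝ)) * A).trace
      = t * (-(2 / 3) * w 0) := by
    rw [← hq]
    simp [Matrix.trace, Matrix.diag, Fin.sum_univ_three, Matrix.mul_apply,
      Matrix.vecMulVec_apply, Matrix.one_apply, h10, h20, h21]
    linear_combination -(t / 3) * htr
  have hTT : (t • (Matrix.vecMulVec n n - (1 / 3 : ℝ) • (1 : Matrix (Fin 3) (Fin 3) ℝ)) * A
      * A).trace = t * (4 / 9 * w 0 ^ 2 + w 1 ^ 2 + w 2 ^ 2 - 1 / 3 * frobSq A) := by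
    rw [← hq2]
    simp [frobSq, Matrix.trace, Matrix.diag, Fin.sum_univ_three, Matrix.mul_apply,
      Matrix.vecMulVec_apply, Matrix.one_apply, h10, h20, h21]
    ring
  rw [gForm, hTT, hT, hH, hF, fHat, fMid, fTilde]
  ring

theorem isFrame_frame {x : E3} (hx : x ∈ offAxis) : IsFrame (nVec x) (mVec x) (pVec x) := by
  have h1 := sinTheta_sq_add hx
  have h2 := cosPhi_sq_add hx
  have hn := nVec_eq (axisDist_pos hx).ne'
  rw [hn]
  constructor <;> simp only [mVec, pVec, Matrix.cons_val_zero, Matrix.cons_val_one, Matrix.cons_val]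
  · linear_combination h1 + sinTheta x ^ 2 * h2
  · linear_combination h1 + cosTheta x ^ 2 * h2
  · linear_combination h2
  · linear_combination sinTheta x * cosTheta x * h2
  · ring
  · ring
  · intro i j
    fin_cases i <;> fin_cases j <;> simp
    · linear_combination -h2 - cosPhi x ^ 2 * h1
    · linear_combination -(cosPhi x * sinPhi x) * h1
    · ring
    · linear_combination -(cosPhi x * sinPhi x) * h1
    · linear_combination -h2 - sinPhi x ^ 2 * h1
    · ring
    · ring
    · ring
    · linear_combination -h1

/-- Every symmetric traceless matrix has components in the frame. -/
theorem exists_frameMat_eq {A : Matrix (Fin 3) (Fin 3) ℝ} {n m p : Fin 3 → ℝ}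
    (hA : A.IsSymm) (htr : A.trace = 0) (h : IsFrame n m p) :
    A = frameMat ![-(3 / 2) * ∑ i, ∑ j, n i * A i j * n j, ∑ i, ∑ j, n i * A i j * p j,
      ∑ i, ∑ j, n i * A i j * m j, ∑ i, ∑ j, m i * A i j * p j,
      1 / 2 * ∑ i, ∑ j, (m i * A i j * m j - p i * A i j * p j)] n m p := by
  have h10 : A 1 0 = A 0 1 := hA.apply 0 1
  have h20 : A 2 0 = A 0 2 := hA.apply 0 2
  have h21 : A 2 1 = A 1 2 := hA.apply 1 2
  have e1 : ∀ i j, A i j = ∑ k, ∑ l, (1 : Matrix (Fin 3) (Fin 3) ℝ) i k * A k l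
      * (1 : Matrix (Fin 3) (Fin 3) ℝ) l j := fun i j => by
    simp [Matrix.one_apply]
  have e2 : ∑ k, ∑ l, (1 : Matrix (Fin 3) (Fin 3) ℝ) k l * A k l = 0 := by
    rw [← htr]
    simp [Matrix.one_apply, Matrix.trace]
  simp only [h.complete] at e1 e2
  simp only [Fin.sum_univ_three, h10, h20, h21] at e1 e2
  ext i j
  simp only [frameMat, h.complete i j]
  rw [e1 i j]
  simp only [Fin.sum_univ_three, h10, h20, h21, Matrix.cons_val_zero, Matrix.cons_val_one,
    Matrix.cons_val]
  linear_combination (1 / 2 * (m i * m j + p i * p j)) * e2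

/-! ### The second variation in the spherical frame -/

theorem mem_offAxis_nhds {x : E3} (hx : x ∈ offAxis) : offAxis ∈ 𝓝 x := isOpen_offAxis.mem_nhds hx

theorem hasD_nVec {x : E3} (hx : x ∈ offAxis) (i : Fin 3) :
    HasD (eR x) (fun y => nVec y i) 0 x ∧ HasD (eT x) (fun y => nVec y i) (mVec x i) x ∧
    HasD (eP x) (fun y => nVec y i) (sinTheta x * pVec x i) x := by
  obtain ⟨s1, s2, s3⟩ := hasD_sinTheta hx
  obtain ⟨c1, c2, c3⟩ := hasD_cosTheta hx
  obtain ⟨C1, C2, C3⟩ := hasD_cosPhi hx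
  obtain ⟨S1, S2, S3⟩ := hasD_sinPhi hx
  have hev : ∀ᶠ y in 𝓝 x, nVec y = ![sinTheta y * cosPhi y, sinTheta y * sinPhi y, cosTheta y] := by
    filter_upwards [mem_offAxis_nhds hx] with y hy using nVec_eq (axisDist_pos hy).ne'
  have hev' := fun i => hev.mono fun y hy => congrFun hy i
  fin_cases i
  · exact ⟨((s1.mul C1).congr (hev' 0)).congr_d (by ring),
      ((s2.mul C2).congr (hev' 0)).congr_d (by simp [mVec]),
      ((s3.mul C3).congr (hev' 0)).congr_d (by simp [pVec])⟩
  · exact ⟨((s1.mul S1).congr (hev' 1)).congr_d (by ring),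
      ((s2.mul S2).congr (hev' 1)).congr_d (by simp [mVec]),
      ((s3.mul S3).congr (hev' 1)).congr_d (by simp [pVec])⟩
  · exact ⟨(c1.congr (hev' 2)), (c2.congr (hev' 2)).congr_d (by simp [mVec]),
      (c3.congr (hev' 2)).congr_d (by simp [pVec])⟩

theorem hasD_mVec {x : E3} (hx : x ∈ offAxis) (i : Fin 3) :
    HasD (eR x) (fun y => mVec y i) 0 x ∧ HasD (eT x) (fun y => mVec y i) (-nVec x i) x ∧
    HasD (eP x) (fun y => mVec y i) (cosTheta x * pVec x i) x := by
  obtain ⟨s1, s2, s3⟩ := hasD_sinTheta hx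
  obtain ⟨c1, c2, c3⟩ := hasD_cosTheta hx
  obtain ⟨C1, C2, C3⟩ := hasD_cosPhi hx
  obtain ⟨S1, S2, S3⟩ := hasD_sinPhi hx
  have hn := nVec_eq (axisDist_pos hx).ne'
  rw [hn]
  fin_cases i
  · exact ⟨(c1.mul C1).congr_d (by ring), (c2.mul C2).congr_d (by simp),
      (c3.mul C3).congr_d (by simp [pVec])⟩
  · exact ⟨(c1.mul S1).congr_d (by ring), (c2.mul S2).congr_d (by simp),
      (c3.mul S3).congr_d (by simp [pVec])⟩
  · exact ⟨s1.neg.congr_d (by ring), s2.neg.congr_d (by simp), s3.neg.congr_d (by simp [pVec])⟩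

theorem hasD_pVec {x : E3} (hx : x ∈ offAxis) (i : Fin 3) :
    HasD (eR x) (fun y => pVec y i) 0 x ∧ HasD (eT x) (fun y => pVec y i) 0 x ∧
    HasD (eP x) (fun y => pVec y i) (-(sinTheta x * nVec x i + cosTheta x * mVec x i)) x := by
  obtain ⟨C1, C2, C3⟩ := hasD_cosPhi hx
  obtain ⟨S1, S2, S3⟩ := hasD_sinPhi hx
  have h1 := sinTheta_sq_add hx
  rw [nVec_eq (axisDist_pos hx).ne']
  fin_cases i
  · refine ⟨S1.neg.congr_d (by ring), S2.neg.congr_d (by ring), S3.neg.congr_d ?_⟩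
    simp [mVec]
    linear_combination (cosPhi x) * h1
  · refine ⟨C1, C2, C3.congr_d ?_⟩
    simp [mVec]
    linear_combination (sinPhi x) * h1
  · refine ⟨HasD.const 0, HasD.const 0, (HasD.const 0).congr_d ?_⟩
    simp [mVec]
    ring

theorem hasD_frameMat {e x : E3} {w : Fin 5 → E3 → ℝ} {w' : Fin 5 → ℝ} {n m p : E3 → Fin 3 → ℝ}
    {n' m' p' : Fin 3 → ℝ} (hw : ∀ a, HasD e (w a) (w' a) x)
    (hn : ∀ i, HasD e (fun y => n y i) (n' i) x) (hm : ∀ i, HasD e (fun y => m y i) (m' i) x)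
    (hp : ∀ i, HasD e (fun y => p y i) (p' i) x) (i j : Fin 3) :
    HasD e (fun y => frameMat (fun a => w a y) (n y) (m y) (p y) i j)
      (frameMat w' (n x) (m x) (p x) i j
        - w 0 x * (n' i * n x j + n x i * n' j)
        + w 1 x * (n' i * p x j + n x i * p' j + (p' i * n x j + p x i * n' j))
        + w 2 x * (n' i * m x j + n x i * m' j + (m' i * n x j + m x i * n' j))
        + w 3 x * (m' i * p x j + m x i * p' j + (p' i * m x j + p x i * m' j))
        + w 4 x * (m' i * m x j + m x i * m' j - (p' i * p x j + p x i * p' j))) x := by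
  refine ((((((hw 0).neg.mul (((hn i).mul (hn j)).sub (HasD.const _))).add
    ((hw 1).mul (((hn i).mul (hp j)).add ((hp i).mul (hn j))))).add
    ((hw 2).mul (((hn i).mul (hm j)).add ((hm i).mul (hn j))))).add
    ((hw 3).mul (((hm i).mul (hp j)).add ((hp i).mul (hm j))))).add
    ((hw 4).mul (((hm i).mul (hm j)).sub ((hp i).mul (hp j))))).congr_d ?_
  simp only [frameMat]
  ring

/-- The matrix field with components `w` in the spherical frame. -/
noncomputable def frameField (w : Fin 5 → E3 → ℝ) (x : E3) : Matrix (Fin 3) (Fin 3) ℝ :=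
  frameMat (fun a => w a x) (nVec x) (mVec x) (pVec x)

/-- The components of `∂_r V`. -/
noncomputable def compR (w : Fin 5 → E3 → ℝ) (x : E3) : Fin 5 → ℝ := fun a => Dr (w a) x

/-- The components of `∂_θ V`. -/
noncomputable def compT (w : Fin 5 → E3 → ℝ) (x : E3) : Fin 5 → ℝ :=
  ![Dt (w 0) x + 3 * w 2 x, Dt (w 1) x - w 3 x, Dt (w 2) x - w 4 x - w 0 x, Dt (w 3) x + w 1 x,
    Dt (w 4) x + w 2 x]

/-- The components of `(sin θ)⁻¹ ∂_φ V`. -/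
noncomputable def compP (w : Fin 5 → E3 → ℝ) (x : E3) : Fin 5 → ℝ :=
  ![cscTheta x * Dp (w 0) x + 3 * w 1 x,
    cscTheta x * Dp (w 1) x + w 4 x - w 0 x + cotTheta x * w 2 x,
    cscTheta x * Dp (w 2) x - w 3 x - cotTheta x * w 1 x,
    cscTheta x * Dp (w 3) x + 2 * cotTheta x * w 4 x + w 2 x,
    cscTheta x * Dp (w 4) x - 2 * cotTheta x * w 3 x - w 1 x]

theorem fderiv_frameField {w : Fin 5 → E3 → ℝ} {x : E3} (hx : x ∈ offAxis)
    (hw : ∀ a, DifferentiableAt ℝ (w a) x) (i j : Fin 3) :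
    fderiv ℝ (fun y => frameField w y i j) x (eR x)
      = frameMat (compR w x) (nVec x) (mVec x) (pVec x) i j ∧
    fderiv ℝ (fun y => frameField w y i j) x (eT x)
      = frameMat (compT w x) (nVec x) (mVec x) (pVec x) i j ∧
    fderiv ℝ (fun y => frameField w y i j) x (eP x)
      = sinTheta x * frameMat (compP w x) (nVec x) (mVec x) (pVec x) i j := by
  have hc := (isFrame_frame hx).complete i j
  have hs := (sinTheta_pos hx).ne'
  refine ⟨?_, ?_, ?_⟩
  · rw [show (fun y => frameField w y i j) = fun y => frameMat (fun a => w a y) (nVec y) (mVec y)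
      (pVec y) i j from rfl, (hasD_frameMat (fun a => ⟨hw a, rfl⟩) (fun i => (hasD_nVec hx i).1)
        (fun i => (hasD_mVec hx i).1) (fun i => (hasD_pVec hx i).1) i j).eq]
    simp
    rfl
  · rw [show (fun y => frameField w y i j) = fun y => frameMat (fun a => w a y) (nVec y) (mVec y)
      (pVec y) i j from rfl, (hasD_frameMat (fun a => ⟨hw a, rfl⟩) (fun i => (hasD_nVec hx i).2.1)
        (fun i => (hasD_mVec hx i).2.1) (fun i => (hasD_pVec hx i).2.1) i j).eq]
    simp only [frameMat, compT, Dt, hc, Matrix.cons_val_zero, Matrix.cons_val_one, Matrix.cons_val]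
    ring
  · rw [show (fun y => frameField w y i j) = fun y => frameMat (fun a => w a y) (nVec y) (mVec y)
      (pVec y) i j from rfl, (hasD_frameMat (fun a => ⟨hw a, rfl⟩) (fun i => (hasD_nVec hx i).2.2)
        (fun i => (hasD_mVec hx i).2.2) (fun i => (hasD_pVec hx i).2.2) i j).eq]
    simp only [frameMat, compP, Dp, hc, Matrix.cons_val_zero, Matrix.cons_val_one, Matrix.cons_val,
      cscTheta, cotTheta]
    field_simp
    ring

/-- The gradient in spherical coordinates. -/
theorem sum_sq_pd {f : E3 → ℝ} {x : E3} (hx : x ∈ offAxis) :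
    ∑ l, pd l f x ^ 2 = fderiv ℝ f x (eR x) ^ 2 + 1 / ‖x‖ ^ 2 * fderiv ℝ f x (eT x) ^ 2
      + 1 / ‖x‖ ^ 2 * (fderiv ℝ f x (eP x) / sinTheta x) ^ 2 := by
  have hexp : ∀ v : E3, fderiv ℝ f x v = v 0 * pd 0 f x + v 1 * pd 1 f x + v 2 * pd 2 f x := by
    intro v
    have hv : v = v 0 • EuclideanSpace.single (0 : Fin 3) (1 : ℝ)
        + v 1 • EuclideanSpace.single (1 : Fin 3) (1 : ℝ)
        + v 2 • EuclideanSpace.single (2 : Fin 3) (1 : ℝ) := by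
      ext i; fin_cases i <;> simp
    conv_lhs => rw [hv]
    simp [pd]
  have hr := (norm_pos_of_mem_offAxis hx).ne'
  have hs := (sinTheta_pos hx).ne'
  have h1 := sinTheta_sq_add hx
  have h2 := cosPhi_sq_add hx
  rw [hexp (eR x), hexp (eT x), hexp (eP x), (eR_apply hx).1, (eR_apply hx).2.1, (eR_apply hx).2.2,
    eT_apply.1, eT_apply.2.1, eT_apply.2.2, (eP_apply hx).1, (eP_apply hx).2.1,
    (eP_apply hx).2.2, Fin.sum_univ_three]
  have e3 : (-(‖x‖ * sinTheta x * sinPhi x) * pd 0 f x + ‖x‖ * sinTheta x * cosPhi x * pd 1 f x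
      + 0 * pd 2 f x) / sinTheta x = ‖x‖ * (-sinPhi x * pd 0 f x + cosPhi x * pd 1 f x) := by
    field_simp; ring
  have e2 : ‖x‖ * (cosTheta x * cosPhi x) * pd 0 f x + ‖x‖ * (cosTheta x * sinPhi x) * pd 1 f x
      + ‖x‖ * -sinTheta x * pd 2 f x = ‖x‖ * (cosTheta x * cosPhi x * pd 0 f x
        + cosTheta x * sinPhi x * pd 1 f x - sinTheta x * pd 2 f x) := by ring
  have e4 : ∀ t : ℝ, 1 / ‖x‖ ^ 2 * (‖x‖ * t) ^ 2 = t ^ 2 := fun t => by field_simp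
  rw [e2, e3, e4, e4]
  linear_combination (-(pd 2 f x) ^ 2 - cosPhi x ^ 2 * pd 0 f x ^ 2 - sinPhi x ^ 2 * pd 1 f x ^ 2
    - 2 * cosPhi x * sinPhi x * pd 0 f x * pd 1 f x) * h1
    + (-(pd 0 f x ^ 2) - pd 1 f x ^ 2) * h2

/-- The quadratic form `½ |A|²` in frame components. -/
noncomputable def compSq (w : Fin 5 → ℝ) : ℝ :=
  1 / 3 * w 0 ^ 2 + w 1 ^ 2 + w 2 ^ 2 + w 3 ^ 2 + w 4 ^ 2

/-- The zero order part of the second variation in frame components. -/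
noncomputable def compBulk (a b c t : ℝ) (w : Fin 5 → ℝ) : ℝ :=
  1 / 3 * fHat a b c t * w 0 ^ 2 + fMid a b c t * (w 1 ^ 2 + w 2 ^ 2)
        + fTilde a b c t * (w 3 ^ 2 + w 4 ^ 2)

/-- The density of the second variation in frame components. -/
noncomputable def frameEnergy (a b c : ℝ) (u : ℝ → ℝ) (w : Fin 5 → E3 → ℝ) (x : E3) : ℝ :=
  compSq (compR w x) + 1 / ‖x‖ ^ 2 * (compSq (compT w x) + compSq (compP w x))
    + compBulk a b c (u ‖x‖) (fun i => w i x)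

/-- The density of the second variation in terms of the components in the spherical frame. -/
theorem energy_frameField (a b c : ℝ) (u : ℝ → ℝ) {w : Fin 5 → E3 → ℝ} {x : E3} (hx : x ∈ offAxis)
    (hw : ∀ a, DifferentiableAt ℝ (w a) x) :
    1 / 2 * (∑ l, ∑ i, ∑ j, pd l (fun y => frameField w y i j) x ^ 2)
      + gForm a b c (hedgehog u x) (frameField w x) = frameEnergy a b c u w x := by
  have hF := isFrame_frame hx
  have hs := (sinTheta_pos hx).ne'
  have h1 : ∑ l, ∑ i, ∑ j, pd l (fun y => frameField w y i j) x ^ 2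
      = frobSq (frameMat (compR w x) (nVec x) (mVec x) (pVec x))
        + 1 / ‖x‖ ^ 2 * frobSq (frameMat (compT w x) (nVec x) (mVec x) (pVec x))
        + 1 / ‖x‖ ^ 2 * frobSq (frameMat (compP w x) (nVec x) (mVec x) (pVec x)) := by
    rw [Finset.sum_comm]
    simp only [frobSq, Finset.mul_sum, ← Finset.sum_add_distrib]
    refine Finset.sum_congr rfl fun i _ => ?_
    rw [Finset.sum_comm]
    refine Finset.sum_congr rfl fun j _ => ?_
    rw [sum_sq_pd hx]
    obtain ⟨d1, d2, d3⟩ := fderiv_frameField hx hw i j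
    rw [d1, d2, d3, mul_div_cancel_left₀ _ hs]
  rw [h1, frobSq_frameMat hF, frobSq_frameMat hF, frobSq_frameMat hF]
  rw [show gForm a b c (hedgehog u x) (frameField w x) = _ from gForm_frameMat a b c (u ‖x‖) hF]
  simp only [frameEnergy, compSq, compBulk]
  ring

/-! ### Smooth functions off the axis -/

/-- The function `g` is of class `C^n` off the axis. -/
def SmoothOff (n : WithTop ℕ∞) (g : E3 → ℝ) : Prop := ∀ x ∈ offAxis, ContDiffAt ℝ n g x

namespace SmoothOff

variable {n : WithTop ℕ∞} {f g : E3 → ℝ}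

theorem of_contDiff (h : ContDiff ℝ n f) : SmoothOff n f := fun _ _ => h.contDiffAt

theorem const (r : ℝ) : SmoothOff n (fun _ => r) := of_contDiff contDiff_const

theorem mul (hf : SmoothOff n f) (hg : SmoothOff n g) : SmoothOff n (fun x => f x * g x) :=
  fun x hx => (hf x hx).mul (hg x hx)

theorem add (hf : SmoothOff n f) (hg : SmoothOff n g) : SmoothOff n (fun x => f x + g x) :=
  fun x hx => (hf x hx).add (hg x hx)

theorem sub (hf : SmoothOff n f) (hg : SmoothOff n g) : SmoothOff n (fun x => f x - g x) :=
  fun x hx => (hf x hx).sub (hg x hx)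

theorem neg (hf : SmoothOff n f) : SmoothOff n (fun x => - f x) := fun x hx => (hf x hx).neg

theorem pow (k : ℕ) (hf : SmoothOff n f) : SmoothOff n (fun x => f x ^ k) :=
  fun x hx => (hf x hx).pow k

theorem div (hf : SmoothOff n f) (hg : SmoothOff n g) (h0 : ∀ x ∈ offAxis, g x ≠ 0) :
    SmoothOff n (fun y => f y / g y) := fun x hx => (hf x hx).div (hg x hx) (h0 x hx)

theorem coord (i : Fin 3) : SmoothOff n (fun x : E3 => x i) := of_contDiff (coordL i).contDiff

theorem norm : SmoothOff n (fun y : E3 => ‖y‖) := fun _ hx =>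
  contDiffAt_norm ℝ (ne_zero_of_mem_offAxis hx)

theorem axisDist : SmoothOff n axisDist := fun _ hx =>
  (contDiff_axisSq (n := n)).contDiffAt.sqrt (ne_of_gt hx)

theorem sinTheta : SmoothOff n sinTheta :=
  axisDist.div norm fun _ hx => (norm_pos_of_mem_offAxis hx).ne'

theorem cosTheta : SmoothOff n cosTheta :=
  (coord 2).div norm fun _ hx => (norm_pos_of_mem_offAxis hx).ne'

theorem cosPhi : SmoothOff n cosPhi := (coord 0).div axisDist fun _ hx => (axisDist_pos hx).ne'

theorem sinPhi : SmoothOff n sinPhi := (coord 1).div axisDist fun _ hx => (axisDist_pos hx).ne'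

theorem cscTheta : SmoothOff n cscTheta := (const 1).div sinTheta fun _ hx => (sinTheta_pos hx).ne'

theorem cotTheta : SmoothOff n cotTheta := cosTheta.div sinTheta fun _ hx => (sinTheta_pos hx).ne'

theorem nVec (i : Fin 3) : SmoothOff n (fun x => nVec x i) :=
  (coord i).div norm fun _ hx => (norm_pos_of_mem_offAxis hx).ne'

theorem mVec (i : Fin 3) : SmoothOff n (fun x => mVec x i) := by
  fin_cases i
  · exact cosTheta.mul cosPhi
  · exact cosTheta.mul sinPhi
  · exact sinTheta.neg

theorem pVec (i : Fin 3) : SmoothOff n (fun x => pVec x i) := by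
  fin_cases i
  · exact sinPhi.neg
  · exact cosPhi
  · exact const 0

theorem differentiableAt (hf : SmoothOff 1 f) {x : E3} (hx : x ∈ offAxis) :
    DifferentiableAt ℝ f x := (hf x hx).differentiableAt (by norm_num)

theorem continuousOn (hf : SmoothOff n f) : ContinuousOn f offAxis := fun x hx =>
  (hf x hx).continuousAt.continuousWithinAt

theorem eR (i : Fin 3) : SmoothOff n (fun x => eR x i) := nVec i

theorem eT (i : Fin 3) : SmoothOff n (fun x => eT x i) := norm.mul (mVec i)

theorem eP (i : Fin 3) : SmoothOff n (fun x => eP x i) := by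
  fin_cases i
  · exact (coord 1).neg
  · exact coord 0
  · exact const 0

end SmoothOff

theorem fderiv_eq_sum_pd (f : E3 → ℝ) (x v : E3) : fderiv ℝ f x v = ∑ i, v i * pd i f x := by
  have hv : v = v 0 • EuclideanSpace.single (0 : Fin 3) (1 : ℝ)
      + v 1 • EuclideanSpace.single (1 : Fin 3) (1 : ℝ)
      + v 2 • EuclideanSpace.single (2 : Fin 3) (1 : ℝ) := by
    ext i; fin_cases i <;> simp
  conv_lhs => rw [hv]
  simp [pd, Fin.sum_univ_three]

theorem SmoothOff.pd {f : E3 → ℝ} {n m : WithTop ℕ∞} (hf : SmoothOff m f) (hnm : n + 1 ≤ m)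
    (i : Fin 3) : SmoothOff n (pd i f) := fun x hx =>
  ((hf x hx).fderiv_right hnm).clm_apply contDiffAt_const

theorem SmoothOff.dir {f : E3 → ℝ} {e : E3 → E3} {n m : WithTop ℕ∞} (hf : SmoothOff m f)
    (hnm : n + 1 ≤ m) (he : ∀ i, SmoothOff n (fun x => e x i)) :
    SmoothOff n (fun x => fderiv ℝ f x (e x)) := by
  simp only [fderiv_eq_sum_pd, Fin.sum_univ_three]
  exact (((he 0).mul (hf.pd hnm 0)).add ((he 1).mul (hf.pd hnm 1))).add
    ((he 2).mul (hf.pd hnm 2))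

theorem SmoothOff.Dr {f : E3 → ℝ} {n m : WithTop ℕ∞} (hf : SmoothOff m f) (hnm : n + 1 ≤ m) :
    SmoothOff n (Dr f) := hf.dir hnm SmoothOff.eR

theorem SmoothOff.Dt {f : E3 → ℝ} {n m : WithTop ℕ∞} (hf : SmoothOff m f) (hnm : n + 1 ≤ m) :
    SmoothOff n (Dt f) := hf.dir hnm SmoothOff.eT

theorem SmoothOff.Dp {f : E3 → ℝ} {n m : WithTop ℕ∞} (hf : SmoothOff m f) (hnm : n + 1 ≤ m) :
    SmoothOff n (Dp f) := hf.dir hnm SmoothOff.eP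

/-- The function `g` vanishes outside a compact subset of the complement of the axis. -/
def CptOff (g : E3 → ℝ) : Prop := ∃ K : Set E3, IsCompact K ∧ K ⊆ offAxis ∧ ∀ x ∉ K, g x = 0

theorem IsTest.cptOff {w : E3 → ℝ} (h : IsTest w) : CptOff w :=
  ⟨tsupport w, h.hasCompactSupport, h.tsupport_subset, fun _ hx =>
    image_eq_zero_of_notMem_tsupport hx⟩

theorem CptOff.tsupport_subset {g : E3 → ℝ} (h : CptOff g) :
    HasCompactSupport g ∧ tsupport g ⊆ offAxis := by
  obtain ⟨K, hK, hKo, hz⟩ := h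
  have hsub : tsupport g ⊆ K := closure_minimal (fun x hx => by
    by_contra hn; exact hx (hz x hn)) hK.isClosed
  exact ⟨hK.of_isClosed_subset (isClosed_tsupport _) hsub, hsub.trans hKo⟩

theorem CptOff.contDiff {g : E3 → ℝ} {n : WithTop ℕ∞} (h : CptOff g) (hs : SmoothOff n g) :
    ContDiff ℝ n g := contDiff_iff_contDiffAt.2 fun x => by
  by_cases hx : x ∈ tsupport g
  · exact hs x (h.tsupport_subset.2 hx)
  · exact contDiffAt_const.congr_of_eventuallyEq (notMem_tsupport_iff_eventuallyEq.1 hx)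

theorem CptOff.continuous {g : E3 → ℝ} (h : CptOff g) (hs : ContinuousOn g offAxis) :
    Continuous g := by
  refine contDiff_zero.1 (h.contDiff fun x hx => ?_)
  exact contDiffAt_zero.2 ⟨offAxis, mem_offAxis_nhds hx, hs⟩

theorem CptOff.isTest {g : E3 → ℝ} (h : CptOff g) (hs : SmoothOff 1 g) : IsTest g :=
  ⟨h.contDiff hs, h.tsupport_subset.1, h.tsupport_subset.2⟩

theorem CptOff.mul_left {f g : E3 → ℝ} (h : CptOff g) : CptOff fun x => f x * g x := by
  obtain ⟨K, hK, hKo, hz⟩ := h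
  exact ⟨K, hK, hKo, fun x hx => by simp only [hz x hx, mul_zero]⟩

theorem CptOff.add {f g : E3 → ℝ} (hf : CptOff f) (h : CptOff g) : CptOff fun x => f x + g x := by
  obtain ⟨K, hK, hKo, hz⟩ := h
  obtain ⟨L, hL, hLo, hy⟩ := hf
  exact ⟨K ∪ L, hK.union hL, Set.union_subset hKo hLo, fun x hx => by
    simp only [hz x fun h => hx (Or.inl h), hy x fun h => hx (Or.inr h), add_zero]⟩

theorem CptOff.zero : CptOff fun _ => 0 := ⟨∅, isCompact_empty, Set.empty_subset _, fun _ _ => rfl⟩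

theorem CptOff.of_eq_zero {f g : E3 → ℝ} (hf : CptOff f) (h : ∀ x, f x = 0 → g x = 0) :
    CptOff g := by
  obtain ⟨K, hK, hKo, hz⟩ := hf
  exact ⟨K, hK, hKo, fun x hx => h x (hz x hx)⟩

theorem CptOff.of_forall_eq_zero {ι : Type*} [Finite ι] {w : ι → E3 → ℝ} {g : E3 → ℝ}
    (hw : ∀ a, CptOff (w a)) (h : ∀ x, (∀ a, w a x = 0) → g x = 0) : CptOff g := by
  choose K hK hKo hz using hw
  exact ⟨⋃ a, K a, isCompact_iUnion hK, Set.iUnion_subset hKo, fun x hx => h x fun a =>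
    hz a x fun hxa => hx (Set.mem_iUnion.2 ⟨a, hxa⟩)⟩

theorem CptOff.dir {f : E3 → ℝ} (h : CptOff f) (e : E3 → E3) :
    CptOff fun x => fderiv ℝ f x (e x) :=
  ⟨tsupport f, h.tsupport_subset.1, h.tsupport_subset.2, fun x hx => by
    have : fderiv ℝ f x = 0 := by
      rw [(notMem_tsupport_iff_eventuallyEq.1 hx).fderiv_eq]; simp
    simp [this]⟩

theorem CptOff.Dr {f : E3 → ℝ} (h : CptOff f) : CptOff (Dr f) := h.dir _
theorem CptOff.Dt {f : E3 → ℝ} (h : CptOff f) : CptOff (Dt f) := h.dir _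
theorem CptOff.Dp {f : E3 → ℝ} (h : CptOff f) : CptOff (Dp f) := h.dir _

theorem CptOff.integrable {g : E3 → ℝ} (h : CptOff g) (hs : ContinuousOn g offAxis) :
    Integrable g volume := (h.continuous hs).integrable_of_hasCompactSupport h.tsupport_subset.1

theorem IsTest.smoothOff {w : E3 → ℝ} (h : IsTest w) : SmoothOff 1 w := .of_contDiff h.contDiff

theorem IsTest.mul_left {f g : E3 → ℝ} (hf : SmoothOff 1 f) (hg : IsTest g) :
    IsTest fun x => f x * g x := hg.cptOff.mul_left.isTest (hf.mul hg.smoothOff)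

theorem IsTest.add {f g : E3 → ℝ} (hf : IsTest f) (hg : IsTest g) : IsTest fun x => f x + g x :=
  (hf.cptOff.add hg.cptOff).isTest (hf.smoothOff.add hg.smoothOff)

theorem IsTest.const_mul {g : E3 → ℝ} (r : ℝ) (hg : IsTest g) : IsTest fun x => r * g x :=
  IsTest.mul_left (.const r) hg

theorem IsTest.neg {g : E3 → ℝ} (hg : IsTest g) : IsTest fun x => - g x := by
  simpa using hg.const_mul (-1)

theorem IsTest.sub {f g : E3 → ℝ} (hf : IsTest f) (hg : IsTest g) : IsTest fun x => f x - g x := by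
  simpa [sub_eq_add_neg] using hf.add hg.neg

/-! ### The second variation of a test field -/

theorem isTest_frameField {w : Fin 5 → E3 → ℝ} (hw : ∀ a, IsTest (w a)) (i j : Fin 3) :
    IsTest fun x => frameField w x i j := by
  have hn := fun i => SmoothOff.nVec (n := 1) i
  have hm := fun i => SmoothOff.mVec (n := 1) i
  have hp := fun i => SmoothOff.pVec (n := 1) i
  refine (CptOff.of_forall_eq_zero (fun a => (hw a).cptOff) fun x hx => ?_).isTest ?_
  · simp [frameField, frameMat, hx]
  · exact (((((hw 0).smoothOff.neg.mul (((hn i).mul (hn j)).sub (.const _))).add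
      ((hw 1).smoothOff.mul (((hn i).mul (hp j)).add ((hp i).mul (hn j))))).add
      ((hw 2).smoothOff.mul (((hn i).mul (hm j)).add ((hm i).mul (hn j))))).add
      ((hw 3).smoothOff.mul (((hm i).mul (hp j)).add ((hp i).mul (hm j))))).add
      ((hw 4).smoothOff.mul (((hm i).mul (hm j)).sub ((hp i).mul (hp j))))

theorem memH1S0_frameField {w : Fin 5 → E3 → ℝ} (hw : ∀ a, IsTest (w a)) :
    MemH1S0 (frameField w) := by
  refine ⟨fun x => isSymm_frameMat _ _ _ _, fun x => ?_, fun i j => (isTest_frameField hw i j).memH1⟩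
  by_cases hx : x ∈ offAxis
  · exact trace_frameMat (isFrame_frame hx)
  · have hz : ∀ a, w a x = 0 := fun a => by
      by_contra h
      exact hx ((hw a).tsupport_subset (subset_tsupport _ h))
    have : frameField w x = 0 := by
      ext i j; simp [frameField, frameMat, hz]
    simp [this]

/-- The second variation of a field supported off the axis. -/
theorem secondVariation_frameField (a b c : ℝ) (u : ℝ → ℝ) {w : Fin 5 → E3 → ℝ}
    (hw : ∀ a, IsTest (w a)) :
    secondVariation a b c u (frameField w) = ∫ x, frameEnergy a b c u w x := by
  refine integral_congr_ae ?_
  have h : ∀ᵐ x : E3, ∀ l i j, weakPartial l (fun y => frameField w y i j) x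
      = pd l (fun y => frameField w y i j) x := by
    simp only [ae_all_iff]
    exact fun l i j => weakPartial_ae_eq_pd (isTest_frameField hw i j).contDiff
      (isTest_frameField hw i j).hasCompactSupport l
  filter_upwards [h, ae_mem_offAxis] with x hx ho
  rw [← energy_frameField a b c u ho fun a => (hw a).smoothOff.differentiableAt ho]
  simp only [gradSq, hx]

/-! ### Integration by parts in the polar angle -/

theorem integral_pd_eq_zero {g : E3 → ℝ} (hg : IsTest g) (i : Fin 3) : ∫ x, pd i g x = 0 := by
  have hd := hg.contDiff.differentiable (by norm_num)
  have i1 : Integrable (fun x => fderiv ℝ g x (EuclideanSpace.single i 1)) volume :=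
    (continuous_pd hg.contDiff i).integrable_of_hasCompactSupport
      (hasCompactSupport_pd hg.hasCompactSupport i)
  have i2 : Integrable g volume :=
    hg.contDiff.continuous.integrable_of_hasCompactSupport hg.hasCompactSupport
  have h := integral_mul_fderiv_eq_neg_fderiv_mul_of_integrable (μ := (volume : Measure E3))
    (f := fun _ => (1 : ℝ)) (g := g) (v := EuclideanSpace.single i (1 : ℝ)) (by simp)
    (by simpa using i1) (by simpa using i2)
    (fun x _ => differentiableAt_const _) (fun x _ => hd x)
  simpa [pd] using h

theorem Dr_eq_dir (f : E3 → ℝ) (x : E3) : Dr f x = ∑ i, nVec x i * pd i f x :=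
  fderiv_eq_sum_pd f x _

theorem Dt_eq_dir (f : E3 → ℝ) (x : E3) : Dt f x = ‖x‖ * ∑ i, mVec x i * pd i f x := by
  rw [Dt, fderiv_eq_sum_pd, Finset.mul_sum]
  simp [eT, mul_assoc]

theorem sum_pd_mVec {x : E3} (hx : x ∈ offAxis) :
    ∑ i, pd i (fun y => mVec y i / ‖y‖) x = cotTheta x / ‖x‖ ^ 2 := by
  have hr := (norm_pos_of_mem_offAxis hx).ne'
  have hρ := (axisDist_pos hx).ne'
  have h0 := ne_zero_of_mem_offAxis hx
  have c := fun i j : Fin 3 => HasD.coord (e := EuclideanSpace.single i (1 : ℝ)) (x := x) j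
  have n := fun i : Fin 3 => HasD.norm (e := EuclideanSpace.single i (1 : ℝ)) h0
  have a := fun i : Fin 3 => HasD.axisDist (e := EuclideanSpace.single i (1 : ℝ)) hx
  have d0 := ((((c 0 2).div (n 0) hr).mul ((c 0 0).div (a 0) hρ)).div (n 0) hr).eq
  have d1 := ((((c 1 2).div (n 1) hr).mul ((c 1 1).div (a 1) hρ)).div (n 1) hr).eq
  have d2 := ((((a 2).div (n 2) hr).neg).div (n 2) hr).eq
  have e0 : pd 0 (fun y => mVec y 0 / ‖y‖) x = _ := d0
  have e1 : pd 1 (fun y => mVec y 1 / ‖y‖) x = _ := d1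
  have e2 : pd 2 (fun y => mVec y 2 / ‖y‖) x = _ := d2
  rw [Fin.sum_univ_three, e0, e1, e2]
  have hρ2 : axisDist x ^ 2 = x 0 ^ 2 + x 1 ^ 2 := Real.sq_sqrt (le_of_lt hx)
  have hr2 : ‖x‖ ^ 2 = axisDist x ^ 2 + x 2 ^ 2 := by rw [hρ2, norm_sq_eq]
  simp [cotTheta, cosTheta, sinTheta]
  field_simp
  have h1 : x 1 ^ 2 = axisDist x ^ 2 - x 0 ^ 2 := by rw [hρ2]; ring
  ring_nf
  simp only [h1]
  ring_nf

/-- The divergence theorem for the field `X m / r`, the divergence of which is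
`(∂_θ X + cot θ X) / r²`. -/
theorem integral_Dt_add_cot {X : E3 → ℝ} (hX : IsTest X) :
    ∫ x, 1 / ‖x‖ ^ 2 * (Dt X x + cotTheta x * X x) = 0 := by
  have hm : ∀ i, SmoothOff 1 fun y => mVec y i / ‖y‖ := fun i =>
    (SmoothOff.mVec i).div SmoothOff.norm fun _ hx => (norm_pos_of_mem_offAxis hx).ne'
  have ht : ∀ i, IsTest fun y => mVec y i / ‖y‖ * X y := fun i => IsTest.mul_left (hm i) hX
  have hs : ∫ x, ∑ i, pd i (fun y => mVec y i / ‖y‖ * X y) x = 0 := by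
    rw [integral_finsetSum _ fun i _ => (continuous_pd (ht i).contDiff i).integrable_of_hasCompactSupport
      (hasCompactSupport_pd (ht i).hasCompactSupport i)]
    exact Finset.sum_eq_zero fun i _ => integral_pd_eq_zero (ht i) i
  rw [← hs]
  refine integral_congr_ae ?_
  filter_upwards [ae_mem_offAxis] with x hx
  have hr := (norm_pos_of_mem_offAxis hx).ne'
  have h1 : ∀ i, pd i (fun y => mVec y i / ‖y‖ * X y) x
      = pd i (fun y => mVec y i / ‖y‖) x * X x + mVec x i / ‖x‖ * pd i X x := fun i =>
    (HasD.mul ⟨(hm i).differentiableAt hx, rfl⟩ ⟨hX.smoothOff.differentiableAt hx, rfl⟩).eq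
  simp only [h1, Finset.sum_add_distrib, ← Finset.sum_mul, sum_pd_mVec hx]
  rw [Dt_eq_dir]
  simp only [Fin.sum_univ_three]
  field_simp
  ring

/-! ### The reduced functionals on smooth functions -/

/-- The density of the reduced functional, with classical derivatives and a real parameter `k`. -/
noncomputable def modePhi (a b c : ℝ) (u : ℝ → ℝ) (k : ℝ) (v₀ v₂ v₄ : E3 → ℝ) (x : E3) : ℝ :=
  1 / 3 * Dr v₀ x ^ 2 + Dr v₂ x ^ 2 + Dr v₄ x ^ 2
  + 1 / ‖x‖ ^ 2 * (1 / 3 * Dt v₀ x ^ 2 + Dt v₂ x ^ 2 + Dt v₄ x ^ 2)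
  + 1 / ‖x‖ ^ 2 *
      ((2 + 1 / 3 * k ^ 2 * cscTheta x ^ 2) * v₀ x ^ 2
      + (5 + (cotTheta x + k * cscTheta x) ^ 2) * v₂ x ^ 2
      + (2 + (2 * cotTheta x + k * cscTheta x) ^ 2) * v₄ x ^ 2)
  + 4 / ‖x‖ ^ 2 *
      (- v₀ x * (Dt v₂ x + cotTheta x * v₂ x + k * cscTheta x * v₂ x)
      + (- Dt v₂ x + cotTheta x * v₂ x + k * cscTheta x * v₂ x) * v₄ x)
  + 1 / 3 * fHat a b c (u ‖x‖) * v₀ x ^ 2 + fMid a b c (u ‖x‖) * v₂ x ^ 2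
  + fTilde a b c (u ‖x‖) * v₄ x ^ 2

/-- The angular part of the second variation on the mode `e^{ikφ}`, as a sum of squares. -/
noncomputable def modeAng (k : ℝ) (v₀ v₂ v₄ : E3 → ℝ) (x : E3) : ℝ :=
  1 / 3 * (Dt v₀ x - k * cscTheta x * v₀ x + 3 * v₂ x) ^ 2 + (Dt v₂ x - v₀ x - v₄ x) ^ 2
  + ((k * cscTheta x + cotTheta x) * v₂ x - v₀ x + v₄ x) ^ 2 + (Dt v₄ x + v₂ x) ^ 2
  + ((k * cscTheta x + 2 * cotTheta x) * v₄ x + v₂ x) ^ 2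

/-- The density of the second variation on the mode `e^{ikφ}`. -/
noncomputable def modeEnergy (a b c : ℝ) (u : ℝ → ℝ) (k : ℝ) (v₀ v₂ v₄ : E3 → ℝ) (x : E3) : ℝ :=
  1 / 3 * Dr v₀ x ^ 2 + Dr v₂ x ^ 2 + Dr v₄ x ^ 2 + 1 / ‖x‖ ^ 2 * modeAng k v₀ v₂ v₄ x
  + (1 / 3 * fHat a b c (u ‖x‖) * v₀ x ^ 2 + fMid a b c (u ‖x‖) * v₂ x ^ 2
  + fTilde a b c (u ‖x‖) * v₄ x ^ 2)

/-- The sum of squares and the density of `Φ_k` differ by a divergence. -/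
theorem modeEnergy_eq (a b c : ℝ) (u : ℝ → ℝ) (k : ℝ) {v₀ v₂ v₄ : E3 → ℝ} {x : E3}
    (hx : x ∈ offAxis) (h0 : DifferentiableAt ℝ v₀ x) (h2 : DifferentiableAt ℝ v₂ x)
    (h4 : DifferentiableAt ℝ v₄ x) :
    modeEnergy a b c u k v₀ v₂ v₄ x = modePhi a b c u k v₀ v₂ v₄ x
      + 1 / ‖x‖ ^ 2 * (Dt (fun y => -(k / 3) * cscTheta y * (v₀ y * v₀ y) + 2 * (v₀ y * v₂ y)
          + 2 * (v₂ y * v₄ y)) x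
        + cotTheta x * (-(k / 3) * cscTheta x * (v₀ x * v₀ x) + 2 * (v₀ x * v₂ x)
          + 2 * (v₂ x * v₄ x))) := by
  have d0 : HasD (eT x) v₀ (Dt v₀ x) x := ⟨h0, rfl⟩
  have d2 : HasD (eT x) v₂ (Dt v₂ x) x := ⟨h2, rfl⟩
  have d4 : HasD (eT x) v₄ (Dt v₄ x) x := ⟨h4, rfl⟩
  have hs := (sinTheta_pos hx).ne'
  have hr := (norm_pos_of_mem_offAxis hx).ne'
  have dc := (HasD.const (e := eT x) (x := x) 1).div (hasD_sinTheta hx).2.1 hs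
  have hD := (((dc.const_mul (-(k / 3))).mul (d0.mul d0)).add ((d0.mul d2).const_mul 2)).add
    ((d2.mul d4).const_mul 2)
  rw [show Dt (fun y => -(k / 3) * cscTheta y * (v₀ y * v₀ y) + 2 * (v₀ y * v₂ y)
          + 2 * (v₂ y * v₄ y)) x = _ from hD.eq]
  simp only [modeEnergy, modeAng, modePhi, cscTheta, cotTheta]
  field_simp
  ring

theorem SmoothOff.of_continuous {f : E3 → ℝ} (h : Continuous f) : SmoothOff 0 f :=
  .of_contDiff (contDiff_zero.2 h)

/-! ### The profile is bounded -/

theorem IsProfile.exists_bound {a b c : ℝ} {u : ℝ → ℝ} (hu : IsProfile a b c u) :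
    ∃ M, ∀ r, 0 ≤ r → |u r| ≤ M := by
  obtain ⟨R, hR⟩ := (hu.tendsto.eventually (Metric.closedBall_mem_nhds _ one_pos)).exists_forall_of_atTop
  obtain ⟨M, hM⟩ := (isCompact_Icc (a := (0 : ℝ)) (b := R)).exists_bound_of_continuousOn
    (hu.continuousOn.mono Set.Icc_subset_Ici_self)
  refine ⟨max M (|sPlus a b c| + 1), fun r hr => ?_⟩
  rcases le_total r R with h | h
  · exact (hM r ⟨hr, h⟩).trans (le_max_left _ _)
  · refine le_trans ?_ (le_max_right _ _)
    have := hR r h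
    rw [Real.dist_eq] at this
    calc |u r| = |sPlus a b c + (u r - sPlus a b c)| := by ring_nf
      _ ≤ _ := (abs_add_le _ _).trans (by linarith)

theorem IsProfile.continuous_comp_norm {a b c : ℝ} {u : ℝ → ℝ} (hu : IsProfile a b c u) :
    Continuous fun x : E3 => u ‖x‖ :=
  hu.continuousOn.comp_continuous continuous_norm fun x => norm_nonneg x

theorem IsProfile.exists_bound_comp {a b c : ℝ} {u : ℝ → ℝ} (hu : IsProfile a b c u) {g : ℝ → ℝ}
    (hg : Continuous g) : ∃ M, ∀ x : E3, |g (u ‖x‖)| ≤ M := by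
  obtain ⟨R, hR⟩ := hu.exists_bound
  obtain ⟨M, hM⟩ := (isCompact_Icc (a := -R) (b := R)).exists_bound_of_continuousOn hg.continuousOn
  exact ⟨M, fun x => hM _ (abs_le.1 (hR _ (norm_nonneg x)))⟩

theorem continuous_fHat (a b c : ℝ) : Continuous (fHat a b c) := by unfold fHat; fun_prop
theorem continuous_fMid (a b c : ℝ) : Continuous (fMid a b c) := by unfold fMid; fun_prop
theorem continuous_fTilde (a b c : ℝ) : Continuous (fTilde a b c) := by unfold fTilde; fun_prop

/-! ### The reduced functionals on test functions -/

theorem SmoothOff.inv_norm_sq {n : WithTop ℕ∞} : SmoothOff n fun x : E3 => 1 / ‖x‖ ^ 2 :=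
  (SmoothOff.const 1).div (SmoothOff.norm.pow 2) fun _ hx =>
    pow_ne_zero 2 (norm_pos_of_mem_offAxis hx).ne'

theorem smoothOff_modeAng (k : ℝ) {v₀ v₂ v₄ : E3 → ℝ} (h0 : SmoothOff 1 v₀) (h2 : SmoothOff 1 v₂)
    (h4 : SmoothOff 1 v₄) : SmoothOff 0 (modeAng k v₀ v₂ v₄) := by
  have h01 : (0 : WithTop ℕ∞) + 1 ≤ 1 := by norm_num
  have le : (0 : WithTop ℕ∞) ≤ 1 := by norm_num
  have t0 := h0.Dt h01
  have t2 := h2.Dt h01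
  have t4 := h4.Dt h01
  have z0 : SmoothOff 0 v₀ := fun x hx => (h0 x hx).of_le le
  have z2 : SmoothOff 0 v₂ := fun x hx => (h2 x hx).of_le le
  have z4 : SmoothOff 0 v₄ := fun x hx => (h4 x hx).of_le le
  have cs : SmoothOff 0 fun x => k * cscTheta x := (SmoothOff.const k).mul .cscTheta
  have ct : SmoothOff 0 cotTheta := .cotTheta
  exact (((((SmoothOff.const (1 / 3)).mul (((t0.sub (cs.mul z0)).add
    ((SmoothOff.const 3).mul z2)).pow 2)).add (((t2.sub z0).sub z4).pow 2)).add
    (((((cs.add ct).mul z2).sub z0).add z4).pow 2)).add ((t4.add z2).pow 2)).add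
    ((((cs.add ((SmoothOff.const 2).mul ct)).mul z4).add z2).pow 2)

theorem smoothOff_modeEnergy {a b c : ℝ} {u : ℝ → ℝ} (hu : IsProfile a b c u) (k : ℝ)
    {v₀ v₂ v₄ : E3 → ℝ} (h0 : SmoothOff 1 v₀) (h2 : SmoothOff 1 v₂)
    (h4 : SmoothOff 1 v₄) : SmoothOff 0 (modeEnergy a b c u k v₀ v₂ v₄) := by
  have h01 : (0 : WithTop ℕ∞) + 1 ≤ 1 := by norm_num
  have le : (0 : WithTop ℕ∞) ≤ 1 := by norm_num
  have z0 : SmoothOff 0 v₀ := fun x hx => (h0 x hx).of_le le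
  have z2 : SmoothOff 0 v₂ := fun x hx => (h2 x hx).of_le le
  have z4 : SmoothOff 0 v₄ := fun x hx => (h4 x hx).of_le le
  have f0 := SmoothOff.of_continuous ((continuous_fHat a b c).comp hu.continuous_comp_norm)
  have f2 := SmoothOff.of_continuous ((continuous_fMid a b c).comp hu.continuous_comp_norm)
  have f4 := SmoothOff.of_continuous ((continuous_fTilde a b c).comp hu.continuous_comp_norm)
  exact (((((SmoothOff.const (1 / 3)).mul ((h0.Dr h01).pow 2)).add ((h2.Dr h01).pow 2)).add
    ((h4.Dr h01).pow 2)).add (SmoothOff.inv_norm_sq.mul (smoothOff_modeAng k h0 h2 h4))).add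
    (((((SmoothOff.const (1 / 3)).mul f0).mul (z0.pow 2)).add (f2.mul (z2.pow 2))).add
      (f4.mul (z4.pow 2)))

theorem cptOff_modeEnergy (a b c : ℝ) (u : ℝ → ℝ) (k : ℝ) {v₀ v₂ v₄ : E3 → ℝ} (h0 : CptOff v₀)
    (h2 : CptOff v₂) (h4 : CptOff v₄) : CptOff (modeEnergy a b c u k v₀ v₂ v₄) := by
  have h : ∀ i : Fin 9, CptOff (![v₀, v₂, v₄, Dr v₀, Dr v₂, Dr v₄, Dt v₀, Dt v₂, Dt v₄] i) := by
    intro i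
    fin_cases i
    exacts [h0, h2, h4, h0.Dr, h2.Dr, h4.Dr, h0.Dt, h2.Dt, h4.Dt]
  refine CptOff.of_forall_eq_zero h fun x hx => ?_
  have e0 : v₀ x = 0 := hx 0
  have e1 : v₂ x = 0 := hx 1
  have e2 : v₄ x = 0 := hx 2
  have e3 : Dr v₀ x = 0 := hx 3
  have e4 : Dr v₂ x = 0 := hx 4
  have e5 : Dr v₄ x = 0 := hx 5
  have e6 : Dt v₀ x = 0 := hx 6
  have e7 : Dt v₂ x = 0 := hx 7
  have e8 : Dt v₄ x = 0 := hx 8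
  simp [modeEnergy, modeAng, e0, e1, e2, e3, e4, e5, e6, e7, e8]

theorem integrable_modeEnergy {a b c : ℝ} {u : ℝ → ℝ} (hu : IsProfile a b c u) (k : ℝ)
    {v₀ v₂ v₄ : E3 → ℝ} (h0 : IsTest v₀) (h2 : IsTest v₂) (h4 : IsTest v₄) :
    Integrable (modeEnergy a b c u k v₀ v₂ v₄) volume :=
  (cptOff_modeEnergy a b c u k h0.cptOff h2.cptOff h4.cptOff).integrable
    (smoothOff_modeEnergy hu k h0.smoothOff h2.smoothOff h4.smoothOff).continuousOn

/-- Integration by parts in `θ` turns the reduced functional into a sum of squares and the bulk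
terms. -/
theorem integral_modeEnergy {a b c : ℝ} {u : ℝ → ℝ} (hu : IsProfile a b c u) (k : ℝ)
    {v₀ v₂ v₄ : E3 → ℝ} (h0 : IsTest v₀) (h2 : IsTest v₂) (h4 : IsTest v₄) :
    Integrable (modePhi a b c u k v₀ v₂ v₄) volume ∧
    ∫ x, modeEnergy a b c u k v₀ v₂ v₄ x = ∫ x, modePhi a b c u k v₀ v₂ v₄ x := by
  let X : E3 → ℝ := fun y => -(k / 3) * cscTheta y * (v₀ y * v₀ y) + 2 * (v₀ y * v₂ y)
          + 2 * (v₂ y * v₄ y)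
  have hX : IsTest X := by
    have a0 : IsTest fun y => -(k / 3) * cscTheta y * (v₀ y * v₀ y) :=
      IsTest.mul_left ((SmoothOff.const _).mul .cscTheta) (IsTest.mul_left h0.smoothOff h0)
    exact (a0.add ((IsTest.mul_left h0.smoothOff h2).const_mul 2)).add
      ((IsTest.mul_left h2.smoothOff h4).const_mul 2)
  have hae : ∀ᵐ x : E3, modeEnergy a b c u k v₀ v₂ v₄ x
      - 1 / ‖x‖ ^ 2 * (Dt X x + cotTheta x * X x) = modePhi a b c u k v₀ v₂ v₄ x := by
    filter_upwards [ae_mem_offAxis] with x hx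
    rw [modeEnergy_eq a b c u k hx (h0.smoothOff.differentiableAt hx)
      (h2.smoothOff.differentiableAt hx) (h4.smoothOff.differentiableAt hx)]
    exact add_sub_cancel_right _ _
  have hi := integrable_modeEnergy hu k h0 h2 h4
  have hiX : Integrable (fun x => 1 / ‖x‖ ^ 2 * (Dt X x + cotTheta x * X x)) volume := by
    refine CptOff.integrable (CptOff.mul_left (hX.cptOff.Dt.add hX.cptOff.mul_left)) ?_
    have hX0 : SmoothOff 0 X := fun x hx => (hX.smoothOff x hx).of_le (by norm_num)
    exact (SmoothOff.inv_norm_sq.mul ((hX.smoothOff.Dt (by norm_num)).add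
      (SmoothOff.cotTheta.mul hX0))).continuousOn (n := 0)
  refine ⟨(hi.sub hiX).congr hae, ?_⟩
  rw [← integral_congr_ae hae, integral_sub hi hiX, integral_Dt_add_cot hX, sub_zero]

theorem dr_ae_eq {v : E3 → ℝ} (hv : IsTest v) : dr v =ᵐ[volume] Dr v := by
  have h : ∀ᵐ x : E3, ∀ i, weakPartial i v x = pd i v x := by
    simp only [ae_all_iff]
    exact fun i => weakPartial_ae_eq_pd hv.contDiff hv.hasCompactSupport i
  filter_upwards [h] with x hx
  simp only [dr, hx, Dr_eq_dir]

theorem dtheta_ae_eq {v : E3 → ℝ} (hv : IsTest v) : dtheta v =ᵐ[volume] Dt v := by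
  have h : ∀ᵐ x : E3, ∀ i, weakPartial i v x = pd i v x := by
    simp only [ae_all_iff]
    exact fun i => weakPartial_ae_eq_pd hv.contDiff hv.hasCompactSupport i
  filter_upwards [h] with x hx
  simp only [dtheta, hx, Dt_eq_dir]

theorem phiDensity_ae_eq (a b c : ℝ) (u : ℝ → ℝ) (k : ℕ) {v₀ v₂ v₄ : E3 → ℝ} (h0 : IsTest v₀)
    (h2 : IsTest v₂) (h4 : IsTest v₄) :
    phiDensity a b c u k v₀ v₂ v₄ =ᵐ[volume] modePhi a b c u k v₀ v₂ v₄ := by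
  filter_upwards [dr_ae_eq h0, dr_ae_eq h2, dr_ae_eq h4, dtheta_ae_eq h0, dtheta_ae_eq h2,
    dtheta_ae_eq h4] with x a0 a2 a4 b0 b2 b4
  simp only [phiDensity, modePhi, a0, a2, a4, b0, b2, b4]

/-- Test functions vanish near the axis, so that the singular weights do not matter. -/
theorem phiAdmissible_of_isTest (k : ℕ) {v₀ v₂ v₄ : E3 → ℝ} (h0 : IsTest v₀)
    (h2 : IsTest v₂) (h4 : IsTest v₄) : PhiAdmissible k v₀ v₂ v₄ := by
  have ab : ∀ {f : E3 → ℝ}, SmoothOff 0 f → SmoothOff 0 fun x => |f x| := fun {f} hf x hx => by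
    have := (hf.continuousOn.abs)
    exact contDiffAt_zero.2 ⟨offAxis, mem_offAxis_nhds hx, this⟩
  have z : ∀ {f : E3 → ℝ}, IsTest f → SmoothOff 0 f := fun hf x hx =>
    (hf.smoothOff x hx).of_le (by norm_num)
  have zc : ∀ {f : E3 → ℝ}, IsTest f → CptOff fun x => |f x| := fun hf =>
    hf.cptOff.of_eq_zero fun x hx => by simp [hx]
  have i : SmoothOff 0 fun x : E3 => 1 / ‖x‖ :=
    (SmoothOff.const 1).div .norm fun _ hx => (norm_pos_of_mem_offAxis hx).ne'
  have cs : SmoothOff 0 fun x => (k : ℝ) * cscTheta x := (SmoothOff.const _).mul .cscTheta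
  have hc : CptOff (fun x : E3 => 1 / ‖x‖ * k * cscTheta x * |v₀ x|
    + 1 / ‖x‖ * |cotTheta x + k * cscTheta x| * |v₂ x|
    + 1 / ‖x‖ * |2 * cotTheta x + k * cscTheta x| * |v₄ x|) :=
    ((zc h0).mul_left.add (zc h2).mul_left).add (zc h4).mul_left
  have hs := ((((i.mul (.const (k : ℝ))).mul .cscTheta).mul (ab (z h0))).add
    ((i.mul (ab (SmoothOff.cotTheta.add cs))).mul (ab (z h2)))).add
    ((i.mul (ab (((SmoothOff.const 2).mul .cotTheta).add cs))).mul (ab (z h4)))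
  exact memLp_two_of_continuous (hc.continuous hs.continuousOn) hc.tsupport_subset.1

/-- Nonnegativity of `Φ_k` on test functions. -/
theorem PhiNonneg.integral_nonneg {a b c : ℝ} {u : ℝ → ℝ} {k : ℕ}
    (h : PhiNonneg a b c u k) {v₀ v₂ v₄ : E3 → ℝ} (h0 : IsTest v₀)
    (h2 : IsTest v₂) (h4 : IsTest v₄) (p0 : IsPhiIndependent v₀) (p2 : IsPhiIndependent v₂)
    (p4 : IsPhiIndependent v₄) : 0 ≤ ∫ x, modePhi a b c u k v₀ v₂ v₄ x := by
  have := h v₀ v₂ v₄ h0.memH1 h2.memH1 h4.memH1 p0 p2 p4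
  rw [Phi, if_pos (phiAdmissible_of_isTest k h0 h2 h4), EReal.coe_nonneg,
    integral_congr_ae (phiDensity_ae_eq a b c u k h0 h2 h4)] at this
  linarith

/-! ### Approximation by test functions -/

theorem measurable_axisDist : Measurable axisDist :=
  ((contDiff_axisSq (n := 0)).continuous.sqrt).measurable

theorem measurable_sinTheta : Measurable sinTheta := measurable_axisDist.div measurable_norm

theorem measurable_coord (i : Fin 3) : Measurable fun x : E3 => x i :=
  (coordL i).continuous.measurable

theorem measurable_cosTheta : Measurable cosTheta := (measurable_coord 2).div measurable_norm

theorem measurable_cscTheta : Measurable cscTheta := measurable_const.div measurable_sinTheta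

theorem measurable_cotTheta : Measurable cotTheta := measurable_cosTheta.div measurable_sinTheta

theorem measurable_nVec (i : Fin 3) : Measurable fun x => nVec x i :=
  (measurable_coord i).div measurable_norm

theorem measurable_mVec (i : Fin 3) : Measurable fun x => mVec x i := by
  fin_cases i
  · exact measurable_cosTheta.mul ((measurable_coord 0).div measurable_axisDist)
  · exact measurable_cosTheta.mul ((measurable_coord 1).div measurable_axisDist)
  · exact measurable_sinTheta.neg

theorem abs_le_one_of_frame {n : Fin 3 → ℝ} (h : n 0 * n 0 + n 1 * n 1 + n 2 * n 2 = 1)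
    (i : Fin 3) : |n i| ≤ 1 := by
  refine abs_le_one_iff_mul_self_le_one.2 ?_
  fin_cases i <;> simp <;> nlinarith [mul_self_nonneg (n 0), mul_self_nonneg (n 1),
    mul_self_nonneg (n 2)]

theorem ae_abs_frame_le (i : Fin 3) :
    ∀ᵐ x : E3, |nVec x i| ≤ 1 ∧ |mVec x i| ≤ 1 ∧ |pVec x i| ≤ 1 := by
  filter_upwards [ae_mem_offAxis] with x hx
  have hF := isFrame_frame hx
  exact ⟨abs_le_one_of_frame hF.nn i, abs_le_one_of_frame hF.mm i, abs_le_one_of_frame hF.pp i⟩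

theorem H1Tendsto.dr {κ : E3 → ℝ} {w : ℕ → E3 → ℝ} {v : E3 → ℝ} (h : H1Tendsto κ w v) :
    L2Tendsto volume (fun n x => dr (w n) x) (dr v) :=
  L2Tendsto.sum Finset.univ fun i _ => (h.grad i).bdd_mul (measurable_nVec i).aestronglyMeasurable
    ((ae_abs_frame_le i).mono fun _ hx => hx.1)

theorem H1Tendsto.dtheta {κ : E3 → ℝ} {w : ℕ → E3 → ℝ} {v : E3 → ℝ} (h : H1Tendsto κ w v) :
    L2Tendsto volume (fun n x => dtheta (w n) x / ‖x‖) (fun x => dtheta v x / ‖x‖) := by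
  have := L2Tendsto.sum Finset.univ fun i _ => (h.grad i).bdd_mul
    (measurable_mVec i).aestronglyMeasurable ((ae_abs_frame_le i).mono fun _ hx => hx.2.1)
  refine this.congr (fun n => ?_) ?_
  · filter_upwards [ae_mem_offAxis] with x hx
    rw [MeltingHedgehog.dtheta, mul_div_cancel_left₀ _ (norm_pos_of_mem_offAxis hx).ne']
  · filter_upwards [ae_mem_offAxis] with x hx
    rw [MeltingHedgehog.dtheta, mul_div_cancel_left₀ _ (norm_pos_of_mem_offAxis hx).ne']

/-- The density of `Φ_k` in terms of the functions the squares of which are integrable: the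
components divided by `r` and the components with the weights of the admissibility condition. -/
theorem phiDensity_eq_offAxis (a b c : ℝ) (u : ℝ → ℝ) (k : ℕ) (v₀ v₂ v₄ : E3 → ℝ) {x : E3}
    (hx : x ∈ offAxis) :
    phiDensity a b c u k v₀ v₂ v₄ x =
      1 / 3 * dr v₀ x ^ 2 + dr v₂ x ^ 2 + dr v₄ x ^ 2
      + (1 / 3 * (dtheta v₀ x / ‖x‖) ^ 2 + (dtheta v₂ x / ‖x‖) ^ 2 + (dtheta v₄ x / ‖x‖) ^ 2)
      + (2 * (v₀ x / ‖x‖) ^ 2 + 1 / 3 * (k * cscTheta x / ‖x‖ * v₀ x) ^ 2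
        + (5 * (v₂ x / ‖x‖) ^ 2 + ((cotTheta x + k * cscTheta x) / ‖x‖ * v₂ x) ^ 2)
        + (2 * (v₄ x / ‖x‖) ^ 2 + ((2 * cotTheta x + k * cscTheta x) / ‖x‖ * v₄ x) ^ 2))
      + 4 * (((cotTheta x + k * cscTheta x) / ‖x‖ * v₂ x - dtheta v₂ x / ‖x‖) * (v₄ x / ‖x‖)
        - (v₀ x / ‖x‖) * (dtheta v₂ x / ‖x‖ + (cotTheta x + k * cscTheta x) / ‖x‖ * v₂ x))
      + (1 / 3 * ((fHat a b c (u ‖x‖) * v₀ x) * v₀ x) + (fMid a b c (u ‖x‖) * v₂ x) * v₂ x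
        + (fTilde a b c (u ‖x‖) * v₄ x) * v₄ x) := by
  have hr := (norm_pos_of_mem_offAxis hx).ne'
  simp only [phiDensity]
  field_simp
  ring

/-- It suffices to test `Φ_k` on smooth functions supported off the axis. -/
theorem phiNonneg_of_test {a b c : ℝ} {u : ℝ → ℝ} (hu : IsProfile a b c u) {k : ℕ}
    (h : ∀ v₀ v₂ v₄ : E3 → ℝ, IsTest v₀ → IsTest v₂ → IsTest v₄ → ContDiff ℝ ∞ v₀ →
      ContDiff ℝ ∞ v₂ → ContDiff ℝ ∞ v₄ → IsPhiIndependent v₀ → IsPhiIndependent v₂ →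
      IsPhiIndependent v₄ → 0 ≤ ∫ x, modePhi a b c u k v₀ v₂ v₄ x) :
    PhiNonneg a b c u k := by
  intro v₀ v₂ v₄ h0 h2 h4 p0 p2 p4
  rw [Phi]
  split_ifs with hadm
  swap
  · exact le_top
  rw [EReal.coe_nonneg]
  have hko : ∀ {f : E3 → ℝ}, SmoothOff 0 f → ContinuousOn (fun x => f x / ‖x‖) offAxis :=
    fun hf => hf.continuousOn.div continuous_norm.continuousOn fun x hx =>
      (norm_pos_of_mem_offAxis hx).ne'
  have cs : SmoothOff 0 fun x => (k : ℝ) * cscTheta x := (SmoothOff.const _).mul .cscTheta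
  have mcs : Measurable fun x => (k : ℝ) * cscTheta x := measurable_cscTheta.const_mul _
  have m0 : Measurable fun x => (k : ℝ) * cscTheta x / ‖x‖ := mcs.div measurable_norm
  have m2 : Measurable fun x => (cotTheta x + (k : ℝ) * cscTheta x) / ‖x‖ :=
    (measurable_cotTheta.add mcs).div measurable_norm
  have m4 : Measurable fun x => (2 * cotTheta x + (k : ℝ) * cscTheta x) / ‖x‖ :=
    ((measurable_cotTheta.const_mul 2).add mcs).div measurable_norm
  have hcs : ∀ x, 0 ≤ cscTheta x := fun x => by
    unfold cscTheta sinTheta axisDist; positivity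
  have a0 : MemLp (fun x => (k : ℝ) * cscTheta x / ‖x‖ * v₀ x) 2 volume :=
    hadm.mono (m0.aestronglyMeasurable.mul h0.1.1) <| ae_of_all _ fun x => by
      have := hcs x
      have e : ‖(k : ℝ) * cscTheta x / ‖x‖ * v₀ x‖ = 1 / ‖x‖ * k * cscTheta x * |v₀ x| := by
        rw [norm_mul, Real.norm_of_nonneg (by positivity), Real.norm_eq_abs]
        ring
      rw [e, Real.norm_eq_abs, abs_of_nonneg (a := _ + _ + _) (by positivity), add_assoc]
      exact le_add_of_nonneg_right (by positivity)
  have a2 : MemLp (fun x => (cotTheta x + (k : ℝ) * cscTheta x) / ‖x‖ * v₂ x) 2 volume :=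
    hadm.mono (m2.aestronglyMeasurable.mul h2.1.1) <| ae_of_all _ fun x => by
      have := hcs x
      simp only [Real.norm_eq_abs]
      rw [abs_of_nonneg (a := _ + _ + _) (by positivity), abs_mul, abs_div, abs_norm,
        show |cotTheta x + k * cscTheta x| / ‖x‖ * |v₂ x|
        = 1 / ‖x‖ * |cotTheta x + k * cscTheta x| * |v₂ x| by ring, add_right_comm]
      exact le_add_of_nonneg_left (by positivity)
  have a4 : MemLp (fun x => (2 * cotTheta x + (k : ℝ) * cscTheta x) / ‖x‖ * v₄ x) 2 volume :=
    hadm.mono (m4.aestronglyMeasurable.mul h4.1.1) <| ae_of_all _ fun x => by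
      have := hcs x
      simp only [Real.norm_eq_abs]
      rw [abs_of_nonneg (a := _ + _ + _) (by positivity), abs_mul, abs_div, abs_norm,
        show |2 * cotTheta x + k * cscTheta x| / ‖x‖ * |v₄ x|
        = 1 / ‖x‖ * |2 * cotTheta x + k * cscTheta x| * |v₄ x| by ring]
      exact le_add_of_nonneg_left (by positivity)
  obtain ⟨w₀, t0, q0, H0⟩ := exists_test_seq m0.aestronglyMeasurable (hko cs) h0 a0
  obtain ⟨w₂, t2, q2, H2⟩ := exists_test_seq m2.aestronglyMeasurable
    (hko (SmoothOff.cotTheta.add cs)) h2 a2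
  obtain ⟨w₄, t4, q4, H4⟩ := exists_test_seq m4.aestronglyMeasurable
    (hko (((SmoothOff.const 2).mul .cotTheta).add cs)) h4 a4
  have D0 := H0.div_norm (fun n => (t0 n).1.memH1) h0
  have D2 := H2.div_norm (fun n => (t2 n).1.memH1) h2
  have D4 := H4.div_norm (fun n => (t4 n).1.memH1) h4
  obtain ⟨C0, hC0⟩ := hu.exists_bound_comp (continuous_fHat a b c)
  obtain ⟨C2, hC2⟩ := hu.exists_bound_comp (continuous_fMid a b c)
  obtain ⟨C4, hC4⟩ := hu.exists_bound_comp (continuous_fTilde a b c)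
  have B0 := (H0.val.bdd_mul ((continuous_fHat a b c).comp
    hu.continuous_comp_norm).aestronglyMeasurable (ae_of_all _ hC0)).mul H0.val
  have B2 := (H2.val.bdd_mul ((continuous_fMid a b c).comp
    hu.continuous_comp_norm).aestronglyMeasurable (ae_of_all _ hC2)).mul H2.val
  have B4 := (H4.val.bdd_mul ((continuous_fTilde a b c).comp
    hu.continuous_comp_norm).aestronglyMeasurable (ae_of_all _ hC4)).mul H4.val
  have hlim := (((((H0.dr.sq.const_mul (1 / 3)).add H2.dr.sq).add H4.dr.sq).add
    (((H0.dtheta.sq.const_mul (1 / 3)).add H2.dtheta.sq).add H4.dtheta.sq)).add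
    ((((D0.sq.const_mul 2).add (H0.wt.sq.const_mul (1 / 3))).add
      ((D2.sq.const_mul 5).add H2.wt.sq)).add ((D4.sq.const_mul 2).add H4.wt.sq))).add
    ((((H2.wt.sub H2.dtheta).mul D4).sub (D0.mul (H2.dtheta.add H2.wt))).const_mul 4)
  have hlim2 := hlim.add (((B0.const_mul (1 / 3)).add B2).add B4)
  have hfin : IntTendsto volume (fun n => phiDensity a b c u k (w₀ n) (w₂ n) (w₄ n))
      (phiDensity a b c u k v₀ v₂ v₄) := by
    refine hlim2.congr (fun n => ?_) ?_
    · filter_upwards [ae_mem_offAxis] with x hx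
      exact (phiDensity_eq_offAxis a b c u k _ _ _ hx).symm
    · filter_upwards [ae_mem_offAxis] with x hx
      exact (phiDensity_eq_offAxis a b c u k _ _ _ hx).symm
  have hnn : 0 ≤ ∫ x, phiDensity a b c u k v₀ v₂ v₄ x := by
    refine ge_of_tendsto' hfin.tendsto fun n => ?_
    rw [integral_congr_ae (phiDensity_ae_eq a b c u k (t0 n).1 (t2 n).1 (t4 n).1)]
    exact h _ _ _ (t0 n).1 (t2 n).1 (t4 n).1 (t0 n).2 (t2 n).2 (t4 n).2 (q0 p0 n) (q2 p2 n) (q4 p4 n)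
  linarith

theorem H1Tendsto.add {κ : E3 → ℝ} {w w' : ℕ → E3 → ℝ} {v v' : E3 → ℝ} (h : H1Tendsto κ w v)
    (h' : H1Tendsto κ w' v') (hw : ∀ n, MemH1 (w n)) (hw' : ∀ n, MemH1 (w' n)) (hv : MemH1 v)
    (hv' : MemH1 v') : H1Tendsto κ (fun n x => w n x + w' n x) (fun x => v x + v' x) :=
  ⟨h.val.add h'.val, fun i => ((h.grad i).add (h'.grad i)).congr
    (fun n => (weakPartial_add (hw n) (hw' n) i).symm) (weakPartial_add hv hv' i).symm,
    (h.wt.add h'.wt).congr (fun _ => ae_of_all _ fun _ => (mul_add _ _ _).symm)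
      (ae_of_all _ fun _ => (mul_add _ _ _).symm)⟩

theorem H1Tendsto.const_mul {κ : E3 → ℝ} {w : ℕ → E3 → ℝ} {v : E3 → ℝ} (r : ℝ)
    (h : H1Tendsto κ w v) (hw : ∀ n, MemH1 (w n)) (hv : MemH1 v) :
    H1Tendsto κ (fun n x => r * w n x) (fun x => r * v x) :=
  ⟨h.val.const_mul r, fun i => ((h.grad i).const_mul r).congr
    (fun n => (weakPartial_const_mul r (hw n) i).symm) (weakPartial_const_mul r hv i).symm,
    (h.wt.const_mul r).congr (fun _ => ae_of_all _ fun _ => mul_left_comm _ _ _)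
      (ae_of_all _ fun _ => mul_left_comm _ _ _)⟩

theorem exists_hedgehog_bound {a b c : ℝ} {u : ℝ → ℝ} (hu : IsProfile a b c u) :
    (∀ i j, AEStronglyMeasurable (fun x => hedgehog u x i j) volume) ∧
    ∃ C, ∀ᵐ x : E3, ∀ i j, |hedgehog u x i j| ≤ C := by
  have e : ∀ i j x, hedgehog u x i j = u ‖x‖ * (nVec x i * nVec x j
      - 1 / 3 * (1 : Matrix (Fin 3) (Fin 3) ℝ) i j) := fun i j x => by
    simp [hedgehog, Matrix.vecMulVec_apply]
  refine ⟨fun i j => ?_, ?_⟩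
  · simp only [e]
    exact (hu.continuous_comp_norm.measurable.mul (((measurable_nVec i).mul
      (measurable_nVec j)).sub measurable_const)).aestronglyMeasurable
  · obtain ⟨M, hM⟩ := hu.exists_bound
    refine ⟨M * 2, ?_⟩
    filter_upwards [ae_all_iff.2 ae_abs_frame_le] with x hx i j
    rw [e, abs_mul]
    have h1 : |(1 : Matrix (Fin 3) (Fin 3) ℝ) i j| ≤ 1 := by
      rw [Matrix.one_apply]; split_ifs <;> simp
    have h2 : |nVec x i * nVec x j - 1 / 3 * (1 : Matrix (Fin 3) (Fin 3) ℝ) i j| ≤ 2 := by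
      refine (abs_sub _ _).trans ?_
      rw [abs_mul, abs_mul, abs_of_nonneg (by norm_num : (0 : ℝ) ≤ 1 / 3)]
      have := mul_le_one₀ (hx i).1 (abs_nonneg _) (hx j).1
      linarith
    exact mul_le_mul (hM _ (norm_nonneg x)) h2 (abs_nonneg _)
      ((abs_nonneg _).trans (hM _ (norm_nonneg x)))

/-- The second variation is continuous in `H¹`. -/
theorem tendsto_secondVariation {a b c : ℝ} {u : ℝ → ℝ} (hu : IsProfile a b c u) {κ : E3 → ℝ}
    {W : ℕ → E3 → Matrix (Fin 3) (Fin 3) ℝ} {V : E3 → Matrix (Fin 3) (Fin 3) ℝ}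
    (h : ∀ i j, H1Tendsto κ (fun n x => W n x i j) (fun x => V x i j)) :
    Tendsto (fun n => secondVariation a b c u (W n)) atTop (𝓝 (secondVariation a b c u V)) := by
  obtain ⟨hm, C, hC⟩ := exists_hedgehog_bound hu
  have hHA : ∀ i k, L2Tendsto volume (fun n x => ∑ j, hedgehog u x i j * W n x j k)
      (fun x => ∑ j, hedgehog u x i j * V x j k) := fun i k =>
    L2Tendsto.sum Finset.univ fun j _ => (h j k).val.bdd_mul (hm i j)
      (hC.mono fun x hx => hx i j)
  have hfm : AEStronglyMeasurable (fun x => frobSq (hedgehog u x)) volume := by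
    simp only [frobSq, Fin.sum_univ_three]
    exact (((((hm 0 0).pow 2).add ((hm 0 1).pow 2)).add ((hm 0 2).pow 2)).add
      ((((hm 1 0).pow 2).add ((hm 1 1).pow 2)).add ((hm 1 2).pow 2))).add
      ((((hm 2 0).pow 2).add ((hm 2 1).pow 2)).add ((hm 2 2).pow 2))
  have hfb : ∀ᵐ x : E3, |frobSq (hedgehog u x)| ≤ 9 * C ^ 2 := by
    filter_upwards [hC] with x hx
    have h2 : ∀ i j, hedgehog u x i j ^ 2 ≤ C ^ 2 := fun i j => sq_le_sq' (abs_le.1 (hx i j)).1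
      (abs_le.1 (hx i j)).2
    rw [abs_of_nonneg (by unfold frobSq; positivity)]
    calc frobSq (hedgehog u x) ≤ ∑ _i : Fin 3, ∑ _j : Fin 3, C ^ 2 :=
          Finset.sum_le_sum fun i _ => Finset.sum_le_sum fun j _ => h2 i j
      _ = 9 * C ^ 2 := by simp; ring
  have hgrad : IntTendsto volume (fun n => gradSq (W n)) (gradSq V) :=
    IntTendsto.sum _ fun l _ => IntTendsto.sum _ fun i _ => IntTendsto.sum _ fun j _ =>
      ((h i j).grad l).sq
  have hfrob : IntTendsto volume (fun n x => frobSq (W n x)) (fun x => frobSq (V x)) :=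
    IntTendsto.sum _ fun i _ => IntTendsto.sum _ fun j _ => (h i j).val.sq
  have hfrob2 : IntTendsto volume (fun n x => ∑ i, ∑ j, frobSq (hedgehog u x) * W n x i j * W n x i j)
      (fun x => ∑ i, ∑ j, frobSq (hedgehog u x) * V x i j * V x i j) :=
    IntTendsto.sum _ fun i _ => IntTendsto.sum _ fun j _ =>
      ((h i j).val.bdd_mul hfm hfb).mul (h i j).val
  have htr : IntTendsto volume (fun n x => ∑ i, ∑ k, (∑ j, hedgehog u x i j * W n x j k) * W n x k i)
      (fun x => ∑ i, ∑ k, (∑ j, hedgehog u x i j * V x j k) * V x k i) :=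
    IntTendsto.sum _ fun i _ => IntTendsto.sum _ fun k _ => (hHA i k).mul (h k i).val
  have htr2 : IntTendsto volume (fun n x => (∑ i, ∑ j, hedgehog u x i j * W n x j i) ^ 2)
      (fun x => (∑ i, ∑ j, hedgehog u x i j * V x j i) ^ 2) :=
    (L2Tendsto.sum Finset.univ fun i _ => hHA i i).sq
  have hall := (hgrad.const_mul (1 / 2)).add (((hfrob.const_mul (-a ^ 2 / 2)).sub
    (htr.const_mul (b ^ 2))).add ((hfrob2.add (htr2.const_mul 2)).const_mul (c ^ 2 / 2)))
  have e : ∀ (A : E3 → Matrix (Fin 3) (Fin 3) ℝ) x,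
      1 / 2 * gradSq A x + (-a ^ 2 / 2 * frobSq (A x)
        - b ^ 2 * (∑ i, ∑ k, (∑ j, hedgehog u x i j * A x j k) * A x k i)
        + c ^ 2 / 2 * ((∑ i, ∑ j, frobSq (hedgehog u x) * A x i j * A x i j)
          + 2 * (∑ i, ∑ j, hedgehog u x i j * A x j i) ^ 2))
      = 1 / 2 * gradSq A x + gForm a b c (hedgehog u x) (A x) := fun A x => by
    have : frobSq (hedgehog u x) * frobSq (A x)
        = ∑ i, ∑ j, frobSq (hedgehog u x) * A x i j * A x i j := by
      generalize frobSq (hedgehog u x) = t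
      simp only [frobSq, Finset.mul_sum]
      exact Finset.sum_congr rfl fun i _ => Finset.sum_congr rfl fun j _ => by ring
    rw [gForm, this]
    simp only [Matrix.trace, Matrix.diag, Matrix.mul_apply]
  have hfin := hall.congr (fun n => ae_of_all _ (e (W n))) (ae_of_all _ (e V))
  exact hfin.tendsto

/-- The frame components of a matrix field. -/
noncomputable def components (V : E3 → Matrix (Fin 3) (Fin 3) ℝ) (a : Fin 5) (x : E3) : ℝ :=
  ![-(3 / 2) * ∑ i, ∑ j, nVec x i * V x i j * nVec x j, ∑ i, ∑ j, nVec x i * V x i j * pVec x j,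
      ∑ i, ∑ j, nVec x i * V x i j * mVec x j, ∑ i, ∑ j, mVec x i * V x i j * pVec x j,
      1 / 2 * ∑ i, ∑ j, (mVec x i * V x i j * mVec x j - pVec x i * V x i j * pVec x j)] a

theorem isTest_components {V : E3 → Matrix (Fin 3) (Fin 3) ℝ}
    (h : ∀ i j, IsTest fun x => V x i j) (a : Fin 5) : IsTest (components V a) := by
  have key : ∀ e f : E3 → Fin 3 → ℝ, (∀ i, SmoothOff 1 fun x => e x i) →
      (∀ i, SmoothOff 1 fun x => f x i) → ∀ i j, IsTest fun x => e x i * V x i j * f x j :=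
    fun e f he hf i j => by
      have := IsTest.mul_left ((he i).mul (hf j)) (h i j)
      refine (funext fun x => ?_ : (fun x => e x i * V x i j * f x j)
        = fun x => e x i * f x j * V x i j) ▸ this
      ring
  have hs : ∀ g : Fin 3 → Fin 3 → E3 → ℝ, (∀ i j, IsTest (g i j)) →
      IsTest fun x => ∑ i, ∑ j, g i j x := fun g hg => by
    simp only [Fin.sum_univ_three]
    exact ((((hg 0 0).add (hg 0 1)).add (hg 0 2)).add (((hg 1 0).add (hg 1 1)).add (hg 1 2))).add
      (((hg 2 0).add (hg 2 1)).add (hg 2 2))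
  have hn := fun i => SmoothOff.nVec (n := 1) i
  have hm := fun i => SmoothOff.mVec (n := 1) i
  have hp := fun i => SmoothOff.pVec (n := 1) i
  fin_cases a
  · exact (hs _ fun i j => key _ _ hn hn i j).const_mul _
  · exact hs _ fun i j => key _ _ hn hp i j
  · exact hs _ fun i j => key _ _ hn hm i j
  · exact hs _ fun i j => key _ _ hm hp i j
  · exact (hs _ fun i j => (key _ _ hm hm i j).sub (key _ _ hp hp i j)).const_mul _

theorem frameField_components {V : E3 → Matrix (Fin 3) (Fin 3) ℝ}
    (h : ∀ i j, IsTest fun x => V x i j) (hs : ∀ x, (V x).IsSymm) (ht : ∀ x, (V x).trace = 0) :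
    frameField (components V) = V := by
  funext x
  by_cases hx : x ∈ offAxis
  · exact (exists_frameMat_eq (hs x) (ht x) (isFrame_frame hx)).symm
  · have hz : ∀ {f : E3 → ℝ}, IsTest f → f x = 0 := fun {f} hf => by
      by_contra hne
      exact hx (hf.tsupport_subset (subset_tsupport _ hne))
    ext i j
    rw [hz (h i j)]
    simp [frameField, frameMat, fun a => hz (isTest_components h a)]

/-- It suffices to test the second variation on fields supported off the axis. -/
theorem secondVariationNonneg_of_test {a b c : ℝ} {u : ℝ → ℝ} (hu : IsProfile a b c u)
    (h : ∀ w : Fin 5 → E3 → ℝ, (∀ a, IsTest (w a)) → 0 ≤ ∫ x, frameEnergy a b c u w x) :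
    SecondVariationNonneg a b c u := by
  intro V hV
  have hex : ∀ i j, ∃ w : ℕ → E3 → ℝ, (∀ n, IsTest (w n) ∧ ContDiff ℝ ∞ (w n)) ∧
      (IsPhiIndependent (fun x => V x i j) → ∀ n, IsPhiIndependent (w n)) ∧
      H1Tendsto (fun _ => 0) w (fun x => V x i j) := fun i j =>
    exists_test_seq aestronglyMeasurable_const continuousOn_const (hV.memH1 i j) (by simp)
  choose w hw _ hlim using hex
  let W : ℕ → E3 → Matrix (Fin 3) (Fin 3) ℝ := fun n x =>
    !![w 0 0 n x, w 0 1 n x, w 0 2 n x; w 0 1 n x, w 1 1 n x, w 1 2 n x;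
      w 0 2 n x, w 1 2 n x, (-1) * w 0 0 n x + (-1) * w 1 1 n x]
  have hmem : ∀ i j n, MemH1 (w i j n) := fun i j n => (hw i j n).1.memH1
  have s10 : (fun x => V x 1 0) = fun x => V x 0 1 := funext fun x => (hV.symm x).apply 0 1
  have s20 : (fun x => V x 2 0) = fun x => V x 0 2 := funext fun x => (hV.symm x).apply 0 2
  have s21 : (fun x => V x 2 1) = fun x => V x 1 2 := funext fun x => (hV.symm x).apply 1 2
  have s22 : (fun x => V x 2 2) = fun x => (-1) * V x 0 0 + (-1) * V x 1 1 := funext fun x => by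
    have := hV.trace_eq_zero x
    rw [Matrix.trace_fin_three] at this
    linarith
  have hW : ∀ i j, H1Tendsto (fun _ => 0) (fun n x => W n x i j) (fun x => V x i j) := by
    intro i j
    fin_cases i <;> fin_cases j
    · exact hlim 0 0
    · exact hlim 0 1
    · exact hlim 0 2
    · exact s10 ▸ hlim 0 1
    · exact hlim 1 1
    · exact hlim 1 2
    · exact s20 ▸ hlim 0 2
    · exact s21 ▸ hlim 1 2
    · exact s22 ▸ ((hlim 0 0).const_mul (-1) (hmem 0 0) (hV.memH1 0 0)).add
        ((hlim 1 1).const_mul (-1) (hmem 1 1) (hV.memH1 1 1))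
        (fun n => (hmem 0 0 n).const_mul _) (fun n => (hmem 1 1 n).const_mul _)
        ((hV.memH1 0 0).const_mul _) ((hV.memH1 1 1).const_mul _)
  have hWt : ∀ n i j, IsTest fun x => W n x i j := by
    intro n i j
    fin_cases i <;> fin_cases j
    exacts [(hw 0 0 n).1, (hw 0 1 n).1, (hw 0 2 n).1, (hw 0 1 n).1, (hw 1 1 n).1, (hw 1 2 n).1,
      (hw 0 2 n).1, (hw 1 2 n).1, ((hw 0 0 n).1.const_mul _).add ((hw 1 1 n).1.const_mul _)]
  refine ge_of_tendsto' (tendsto_secondVariation hu hW) fun n => ?_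
  have hWs : ∀ x, (W n x).IsSymm := fun x => by
    ext i j; fin_cases i <;> fin_cases j <;> rfl
  have hW0 : ∀ x, (W n x).trace = 0 := fun x => by
    rw [Matrix.trace_fin_three]
    simp [W]
    ring
  rw [← frameField_components (hWt n) hWs hW0, secondVariation_frameField a b c u
    (isTest_components (hWt n))]
  exact h _ (isTest_components (hWt n))

/-! ### Circles about the axis -/

/-- The point with azimuthal angle `α` on the circle about the axis through `x`. -/
noncomputable def axisPoint (α : ℝ) (x : E3) : E3 :=
  !₂[axisDist x * Real.cos α, axisDist x * Real.sin α, x 2]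

section

variable (α : ℝ) (x : E3)

theorem axisPoint_zero : axisPoint α x 0 = axisDist x * Real.cos α := rfl
theorem axisPoint_one : axisPoint α x 1 = axisDist x * Real.sin α := rfl
theorem axisPoint_two : axisPoint α x 2 = x 2 := rfl

theorem axisDist_sq : axisDist x ^ 2 = axisSq x := Real.sq_sqrt (axisSq_nonneg x)

theorem axisSq_axisPoint : axisSq (axisPoint α x) = axisSq x := by
  rw [axisSq, axisPoint_zero, axisPoint_one, ← axisDist_sq x]
  linear_combination axisDist x ^ 2 * Real.sin_sq_add_cos_sq α

theorem axisDist_axisPoint : axisDist (axisPoint α x) = axisDist x := by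
  rw [axisDist_eq, axisDist_eq, axisSq_axisPoint]

theorem norm_axisPoint : ‖axisPoint α x‖ = ‖x‖ := by
  have h : ‖axisPoint α x‖ ^ 2 = ‖x‖ ^ 2 := by
    have h1 := axisSq_eq (axisPoint α x)
    have h2 := axisSq_eq x
    rw [axisSq_axisPoint, axisPoint_two] at h1
    linarith
  exact (pow_left_inj₀ (norm_nonneg _) (norm_nonneg _) (by norm_num)).1 h

theorem axisPoint_mem_offAxis : axisPoint α x ∈ offAxis ↔ x ∈ offAxis := by
  simp only [offAxis, Set.mem_ofPred_eq, axisSq_axisPoint]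

theorem sinTheta_axisPoint : sinTheta (axisPoint α x) = sinTheta x := by
  rw [sinTheta, sinTheta, axisDist_axisPoint, norm_axisPoint]

theorem cosTheta_axisPoint : cosTheta (axisPoint α x) = cosTheta x := by
  rw [cosTheta, cosTheta, axisPoint_two, norm_axisPoint]

theorem cscTheta_axisPoint : cscTheta (axisPoint α x) = cscTheta x := by
  rw [cscTheta, cscTheta, sinTheta_axisPoint]

theorem cotTheta_axisPoint : cotTheta (axisPoint α x) = cotTheta x := by
  rw [cotTheta, cotTheta, sinTheta_axisPoint, cosTheta_axisPoint]

end

theorem cosPhi_axisPoint (α : ℝ) {x : E3} (hx : x ∈ offAxis) :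
    cosPhi (axisPoint α x) = Real.cos α := by
  have := (axisDist_pos hx).ne'
  rw [cosPhi, axisDist_axisPoint, axisPoint_zero]; field_simp

theorem sinPhi_axisPoint (α : ℝ) {x : E3} (hx : x ∈ offAxis) :
    sinPhi (axisPoint α x) = Real.sin α := by
  have := (axisDist_pos hx).ne'
  rw [sinPhi, axisDist_axisPoint, axisPoint_one]; field_simp

theorem axisPoint_eq_of (α : ℝ) {x y : E3} (h1 : ‖x‖ = ‖y‖) (h2 : x 2 = y 2) :
    axisPoint α x = axisPoint α y := by
  have : axisDist x = axisDist y := by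
    rw [axisDist_eq, axisDist_eq, axisSq_eq, axisSq_eq, h1, h2]
  rw [axisPoint, axisPoint, this, h2]

theorem IsPhiIndependent.axisPoint {v : E3 → ℝ} (hv : IsPhiIndependent v) (α : ℝ) (x : E3) :
    v (axisPoint α x) = v x := hv _ _ (norm_axisPoint α x) rfl

/-- The angle of a point off the axis. -/
theorem exists_angle {x : E3} (hx : x ∈ offAxis) : ∃ β, ∀ α,
    axisRotation (Real.cos α) (Real.sin α) (Real.cos_sq_add_sin_sq α) x = axisPoint (α + β) x := by
  have hn : ‖(⟨cosPhi x, sinPhi x⟩ : ℂ)‖ = 1 := by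
    rw [Complex.norm_def, Complex.normSq_mk, ← pow_two, ← pow_two, cosPhi_sq_add hx, Real.sqrt_one]
  have h0 : (⟨cosPhi x, sinPhi x⟩ : ℂ) ≠ 0 := norm_ne_zero_iff.1 (by rw [hn]; norm_num)
  have hρ := (axisDist_pos hx).ne'
  refine ⟨Complex.arg ⟨cosPhi x, sinPhi x⟩, fun α => ?_⟩
  have hc := Complex.cos_arg h0
  have hs := Complex.sin_arg (⟨cosPhi x, sinPhi x⟩ : ℂ)
  rw [hn, div_one] at hc hs
  have e0 : x 0 = axisDist x * cosPhi x := by rw [cosPhi]; field_simp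
  have e1 : x 1 = axisDist x * sinPhi x := by rw [sinPhi]; field_simp
  rw [axisRotation_apply, axisPoint, Real.cos_add, Real.sin_add, hc, hs]
  ext i
  fin_cases i
  · simp [e0, e1]; ring
  · simp [e0, e1]; ring
  · rfl

theorem periodic_axisPoint (x : E3) : Function.Periodic (fun α => axisPoint α x) (2 * Real.pi) :=
  fun α => by simp [axisPoint]

/-- Averages over circles about the axis are invariant under rotations. -/
theorem integral_axisRotation {F : E3 → ℝ} {x : E3} (hx : x ∈ offAxis) :
    ∫ α in (0 : ℝ)..(2 * Real.pi),
      F (axisRotation (Real.cos α) (Real.sin α) (Real.cos_sq_add_sin_sq α) x)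
      = ∫ α in (0 : ℝ)..(2 * Real.pi), F (axisPoint α x) := by
  obtain ⟨β, hβ⟩ := exists_angle hx
  simp only [hβ]
  rw [intervalIntegral.integral_comp_add_right (fun α => F (axisPoint α x)) β, zero_add,
    add_comm (2 * Real.pi)]
  have hp : Function.Periodic (fun α => F (axisPoint α x)) (2 * Real.pi) := fun α =>
    congrArg F (periodic_axisPoint x α)
  simpa using hp.intervalIntegral_add_eq β 0

theorem CptOff.iff {g : E3 → ℝ} : CptOff g ↔
    ∃ δ R : ℝ, 0 < δ ∧ ∀ x, g x ≠ 0 → δ ≤ axisSq x ∧ ‖x‖ ≤ R := by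
  constructor
  · rintro ⟨K, hK, hKo, hz⟩
    obtain ⟨R, hR⟩ := hK.isBounded.exists_norm_le
    rcases K.eq_empty_or_nonempty with rfl | hne
    · exact ⟨1, 0, one_pos, fun x hx => (hx (hz x (by simp))).elim⟩
    · obtain ⟨y, hy, hmin⟩ := hK.exists_isMinOn hne (contDiff_axisSq (n := 0)).continuous.continuousOn
      refine ⟨axisSq y, R, hKo hy, fun x hx => ?_⟩
      have hxK : x ∈ K := by by_contra h; exact hx (hz x h)
      exact ⟨hmin hxK, hR x hxK⟩
  · rintro ⟨δ, R, hδ, h⟩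
    refine ⟨Metric.closedBall 0 R ∩ {x | δ ≤ axisSq x}, ?_, fun x hx => hδ.trans_le hx.2,
      fun x hx => ?_⟩
    · exact (isCompact_closedBall _ _).inter_right
        (isClosed_le continuous_const (contDiff_axisSq (n := 0)).continuous)
    · by_contra hn
      exact hx ⟨by simpa using (h x hn).2, (h x hn).1⟩

/-- Lebesgue measure is invariant under rotations about the axis. -/
theorem integral_eq_integral_axisPoint {F : E3 → ℝ} (hF : Continuous F)
    (hc : HasCompactSupport F) :
    ∫ x, F x = ∫ x, (2 * Real.pi)⁻¹ * ∫ α in (0 : ℝ)..(2 * Real.pi), F (axisPoint α x) := by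
  have hpi : (0 : ℝ) ≤ 2 * Real.pi := by positivity
  let R : ℝ → E3 → E3 := fun α => axisRotation (Real.cos α) (Real.sin α) (Real.cos_sq_add_sin_sq α)
  have hRc : Continuous fun p : E3 × ℝ => R p.2 p.1 := by
    simp only [R, axisRotation_apply]
    have hcoord : ∀ i : Fin 3, Continuous fun x : E3 => x i := fun i => (coordL i).continuous
    refine (PiLp.continuous_toLp 2 _).comp (continuous_pi fun i => ?_)
    fin_cases i <;> simp <;> fun_prop
  have hnorm : ∀ α x, ‖R α x‖ = ‖x‖ := fun α x => LinearIsometryEquiv.norm_map _ _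
  obtain ⟨C, hC⟩ := hc.exists_bound_of_continuous hF
  obtain ⟨ρ, hρ⟩ := hc.isCompact.isBounded.exists_norm_le
  have hint : Integrable (fun p : E3 × ℝ => F (R p.2 p.1))
      (volume.prod (volume.restrict (Set.Ioc 0 (2 * Real.pi)))) := by
    have hb : Integrable (Set.indicator (Metric.closedBall (0 : E3) ρ) fun _ => C) volume :=
      (integrable_indicator_iff Metric.isClosed_closedBall.measurableSet).2
        (integrableOn_const (measure_closedBall_lt_top).ne)
    refine (hb.comp_fst (volume.restrict (Set.Ioc 0 (2 * Real.pi)))).mono'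
      (hF.comp hRc).aestronglyMeasurable (ae_of_all _ fun p => ?_)
    by_cases hp : p.1 ∈ Metric.closedBall (0 : E3) ρ
    · rw [Set.indicator_of_mem hp]; exact hC _
    · rw [Set.indicator_of_notMem hp]
      have : F (R p.2 p.1) = 0 := by
        by_contra hn
        refine hp ?_
        have := hρ _ (subset_tsupport _ hn)
        rw [hnorm] at this
        simpa using this
      simp [this]
  have h1 : ∀ α, ∫ x, F (R α x) = ∫ x, F x := fun α => by
    exact (axisRotation (Real.cos α) (Real.sin α) (Real.cos_sq_add_sin_sq α)).measurePreserving.integral_comp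
      (axisRotation (Real.cos α) (Real.sin α)
        (Real.cos_sq_add_sin_sq α)).toHomeomorph.measurableEmbedding F
  have h2 : ∫ x, ∫ α in (0 : ℝ)..(2 * Real.pi), F (R α x) = 2 * Real.pi * ∫ x, F x := by
    simp only [intervalIntegral.integral_of_le hpi]
    rw [integral_integral_swap hint]
    simp only [h1]
    simp [Real.pi_nonneg]
  rw [integral_const_mul, eq_inv_mul_iff_mul_eq₀ (by positivity), ← h2]
  refine integral_congr_ae ?_
  filter_upwards [ae_mem_offAxis] with x hx
  exact integral_axisRotation hx

/-! ### Fourier coefficients in the azimuthal angle -/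

section parametric

variable {E : Type*} [NormedAddCommGroup E] [NormedSpace ℝ E] [ProperSpace E]

theorem hasFDerivAt_intervalIntegral {G : E × ℝ → ℝ} (hG : ContDiff ℝ 1 G) (a b : ℝ) (x : E) :
    HasFDerivAt (fun y => ∫ α in a..b, G (y, α))
      (∫ α in a..b, (fderiv ℝ G (x, α)).comp (ContinuousLinearMap.inl ℝ E ℝ)) x := by
  have hc : Continuous fun p : E × ℝ => (fderiv ℝ G p).comp (ContinuousLinearMap.inl ℝ E ℝ) :=
    (hG.continuous_fderiv (by norm_num)).clm_comp continuous_const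
  obtain ⟨C, hC⟩ := ((isCompact_closedBall x 1).prod
    (isCompact_uIcc (a := a) (b := b))).exists_bound_of_continuousOn hc.continuousOn
  have hsec : ∀ y : E, Continuous fun α : ℝ => (y, α) := fun y => by fun_prop
  refine intervalIntegral.hasFDerivAt_integral_of_dominated_of_fderiv_le (μ := volume)
    (F := fun y α => G (y, α))
    (F' := fun y α => (fderiv ℝ G (y, α)).comp (ContinuousLinearMap.inl ℝ E ℝ))
    (bound := fun _ => C) (Metric.ball_mem_nhds x one_pos)
    (Eventually.of_forall fun y => (hG.continuous.comp (hsec y)).aestronglyMeasurable)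
    ((hG.continuous.comp (hsec x)).intervalIntegrable _ _)
    (hc.comp (hsec x)).aestronglyMeasurable
    (ae_of_all _ fun α hα y hy => hC (y, α) ⟨Metric.ball_subset_closedBall hy,
      Set.uIoc_subset_uIcc hα⟩) intervalIntegrable_const
    (ae_of_all _ fun α _ y _ => ?_)
  exact ((hG.differentiable (by norm_num)) (y, α)).hasFDerivAt.comp y
    ((hasFDerivAt_id y).prodMk (hasFDerivAt_const α y))

theorem contDiff_intervalIntegral {G : E × ℝ → ℝ} (hG : ContDiff ℝ 1 G) (a b : ℝ) :
    ContDiff ℝ 1 (fun y => ∫ α in a..b, G (y, α)) := by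
  rw [contDiff_one_iff_fderiv]
  refine ⟨fun x => (hasFDerivAt_intervalIntegral hG a b x).differentiableAt, ?_⟩
  rw [show fderiv ℝ (fun y => ∫ α in a..b, G (y, α)) = _ from
    funext fun x => (hasFDerivAt_intervalIntegral hG a b x).fderiv]
  refine intervalIntegral.continuous_parametric_intervalIntegral_of_continuous' ?_ a b
  exact ((hG.continuous_fderiv (by norm_num)).clm_comp continuous_const)

theorem fderiv_intervalIntegral {G : E × ℝ → ℝ} (hG : ContDiff ℝ 1 G) (a b : ℝ) (x v : E) :
    fderiv ℝ (fun y => ∫ α in a..b, G (y, α)) x v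
      = ∫ α in a..b, fderiv ℝ (fun y => G (y, α)) x v := by
  have hc : Continuous fun α : ℝ =>
      (fderiv ℝ G (x, α)).comp (ContinuousLinearMap.inl ℝ E ℝ) :=
    ((hG.continuous_fderiv (by norm_num)).comp (by fun_prop)).clm_comp continuous_const
  rw [(hasFDerivAt_intervalIntegral hG a b x).fderiv,
    ContinuousLinearMap.intervalIntegral_apply (hc.intervalIntegrable _ _)]
  refine intervalIntegral.integral_congr fun α _ => ?_
  have h1 : HasFDerivAt (fun y : E => G (y, α))
      ((fderiv ℝ G (x, α)).comp (ContinuousLinearMap.inl ℝ E ℝ)) x :=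
    ((hG.differentiable (by norm_num)) (x, α)).hasFDerivAt.comp x
      ((hasFDerivAt_id x).prodMk (hasFDerivAt_const α x))
  rw [h1.fderiv]

end parametric

/-- The derivative of `axisPoint α`. -/
noncomputable def axisPointL (α : ℝ) (x : E3) : E3 →L[ℝ] E3 :=
  (fderiv ℝ axisDist x).smulRight (!₂[Real.cos α, Real.sin α, 0] : E3)
    + (coordL 2).smulRight (!₂[0, 0, 1] : E3)

theorem axisPoint_eq (α : ℝ) (x : E3) : axisPoint α x =
    axisDist x • (!₂[Real.cos α, Real.sin α, 0] : E3) + coordL 2 x • (!₂[0, 0, 1] : E3) := by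
  ext i
  fin_cases i <;> simp [axisPoint, coordL_apply]

theorem hasFDerivAt_axisPoint (α : ℝ) {x : E3} (hx : x ∈ offAxis) :
    HasFDerivAt (axisPoint α) (axisPointL α x) x := by
  have h1 : HasFDerivAt axisDist (fderiv ℝ axisDist x) x :=
    (SmoothOff.axisDist.differentiableAt hx).hasFDerivAt
  have h := (h1.smul_const (!₂[Real.cos α, Real.sin α, 0] : E3)).add
    ((coordL 2).hasFDerivAt (x := x) |>.smul_const (!₂[0, 0, 1] : E3))
  exact h.congr_of_eventuallyEq (Eventually.of_forall fun y => axisPoint_eq α y)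

theorem axisPointL_eR (α : ℝ) {x : E3} (hx : x ∈ offAxis) :
    axisPointL α x (eR x) = eR (axisPoint α x) := by
  have h := (hasD_axisDist_frame hx).1.eq
  have hP := (axisPoint_mem_offAxis α x).2 hx
  ext i
  fin_cases i
  · simp [axisPointL, h, (eR_apply hP).1, sinTheta_axisPoint, cosPhi_axisPoint α hx]
  · simp [axisPointL, h, (eR_apply hP).2.1, sinTheta_axisPoint, sinPhi_axisPoint α hx]
  · simp [axisPointL, (eR_apply hP).2.2, (eR_apply hx).2.2, cosTheta_axisPoint, coordL_apply]

theorem axisPointL_eT (α : ℝ) {x : E3} (hx : x ∈ offAxis) :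
    axisPointL α x (eT x) = eT (axisPoint α x) := by
  have h := (hasD_axisDist_frame hx).2.1.eq
  ext i
  fin_cases i
  · simp [axisPointL, h, eT_apply.1, cosTheta_axisPoint, cosPhi_axisPoint α hx, norm_axisPoint,
      mul_assoc]
  · simp [axisPointL, h, eT_apply.2.1, cosTheta_axisPoint, sinPhi_axisPoint α hx, norm_axisPoint,
      mul_assoc]
  · simp [axisPointL, eT_apply.2.2, sinTheta_axisPoint, norm_axisPoint, coordL_apply]

theorem hasDerivAt_axisPoint (α : ℝ) (x : E3) :
    HasDerivAt (fun t => axisPoint t x) (eP (axisPoint α x)) α := by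
  have h : HasDerivAt (fun t => (![axisDist x * Real.cos t, axisDist x * Real.sin t, x 2] : Fin 3 → ℝ))
      ![-(axisDist x * Real.sin α), axisDist x * Real.cos α, 0] α := by
    rw [hasDerivAt_pi]
    intro i
    fin_cases i
    · simpa using (Real.hasDerivAt_cos α).const_mul (axisDist x)
    · simpa using (Real.hasDerivAt_sin α).const_mul (axisDist x)
    · simpa using hasDerivAt_const α (x 2)
  exact ((PiLp.continuousLinearEquiv 2 ℝ (fun _ : Fin 3 => ℝ)).symm.toContinuousLinearMap.hasFDerivAt
    (x := (![axisDist x * Real.cos α, axisDist x * Real.sin α, x 2] : Fin 3 → ℝ))).comp_hasDerivAt α h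

theorem contDiffAt_axisPoint {x : E3} (hx : x ∈ offAxis) (α : ℝ) :
    ContDiffAt ℝ 1 (fun p : E3 × ℝ => axisPoint p.2 p.1) (x, α) := by
  have h1 : ContDiffAt ℝ 1 (fun p : E3 × ℝ => axisDist p.1) (x, α) :=
    ContDiffAt.comp (g := axisDist) (x, α) (SmoothOff.axisDist x hx) contDiffAt_fst
  have h2 : ContDiffAt ℝ 1 (fun p : E3 × ℝ => (coordL 2) p.1) (x, α) :=
    ((coordL 2).contDiff.comp contDiff_fst).contDiffAt
  have h3 : ContDiff ℝ 1 (fun p : E3 × ℝ => (!₂[Real.cos p.2, Real.sin p.2, 0] : E3)) := by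
    refine contDiff_piLp' 2 fun i => ?_
    fin_cases i <;> simp <;> fun_prop
  have := (h1.smul h3.contDiffAt).add (h2.smul (contDiffAt_const (c := (!₂[0, 0, 1] : E3))))
  exact this.congr_of_eventuallyEq (Eventually.of_forall fun p => axisPoint_eq p.2 p.1)

/-- The integral of `f` against `τ` over the circles about the axis, divided by `2π`. -/
noncomputable def angInt (τ : ℝ → ℝ) (f : E3 → ℝ) (x : E3) : ℝ :=
  (2 * Real.pi)⁻¹ * ∫ α in (0 : ℝ)..(2 * Real.pi), τ α * f (axisPoint α x)

theorem isPhiIndependent_angInt (τ : ℝ → ℝ) (f : E3 → ℝ) : IsPhiIndependent (angInt τ f) :=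
  fun x y h1 h2 => by simp only [angInt, fun α => axisPoint_eq_of α h1 h2]

theorem CptOff.angInt (τ : ℝ → ℝ) {f : E3 → ℝ} (hf : CptOff f) : CptOff (angInt τ f) := by
  obtain ⟨δ, R, hδ, h⟩ := CptOff.iff.1 hf
  refine CptOff.iff.2 ⟨δ, R, hδ, fun x hx => ?_⟩
  by_contra hn
  refine hx ?_
  have : ∀ α, f (axisPoint α x) = 0 := fun α => by
    by_contra hne
    have := h _ hne
    rw [axisSq_axisPoint, norm_axisPoint] at this
    exact hn this
  simp [MeltingHedgehog.angInt, this]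

theorem contDiff_axisPoint_comp {τ : ℝ → ℝ} (hτ : ContDiff ℝ 1 τ) {f : E3 → ℝ} (hf : IsTest f) :
    ContDiff ℝ 1 fun p : E3 × ℝ => τ p.2 * f (axisPoint p.2 p.1) := by
  refine contDiff_iff_contDiffAt.2 fun ⟨x, α⟩ => ?_
  obtain ⟨δ, R, hδ, h⟩ := CptOff.iff.1 hf.cptOff
  by_cases hx : x ∈ offAxis
  · have h1 : ContDiffAt ℝ 1 (fun p : E3 × ℝ => f (axisPoint p.2 p.1)) (x, α) :=
      hf.contDiff.contDiffAt.comp (x, α) (contDiffAt_axisPoint hx α)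
    exact (hτ.comp contDiff_snd).contDiffAt.mul h1
  · have hopen : IsOpen {p : E3 × ℝ | axisSq p.1 < δ} :=
      isOpen_lt ((contDiff_axisSq (n := 0)).continuous.comp continuous_fst) continuous_const
    have hmem : (x, α) ∈ {p : E3 × ℝ | axisSq p.1 < δ} := by
      have : axisSq x ≤ 0 := not_lt.1 hx
      exact this.trans_lt hδ
    refine contDiffAt_const (c := (0 : ℝ)) |>.congr_of_eventuallyEq ?_
    filter_upwards [hopen.mem_nhds hmem] with p hp
    have : f (axisPoint p.2 p.1) = 0 := by
      by_contra hne
      have := (h _ hne).1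
      rw [axisSq_axisPoint] at this
      exact absurd hp (not_lt.2 this)
    rw [this, mul_zero]

theorem isTest_angInt {τ : ℝ → ℝ} (hτ : ContDiff ℝ 1 τ) {f : E3 → ℝ} (hf : IsTest f) :
    IsTest (angInt τ f) :=
  (hf.cptOff.angInt τ).isTest (.of_contDiff
    (contDiff_const.mul (contDiff_intervalIntegral (contDiff_axisPoint_comp hτ hf) _ _)))

/-- Averages over circles about the axis commute with derivatives along vector fields that are
invariant under rotations. -/
theorem fderiv_angInt {τ : ℝ → ℝ} (hτ : ContDiff ℝ 1 τ) {f : E3 → ℝ} (hf : IsTest f) {x : E3}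
    (hx : x ∈ offAxis) {e : E3 → E3} (he : ∀ α, axisPointL α x (e x) = e (axisPoint α x)) :
    fderiv ℝ (angInt τ f) x (e x) = angInt τ (fun y => fderiv ℝ f y (e y)) x := by
  have hG := contDiff_axisPoint_comp hτ hf
  have hd : DifferentiableAt ℝ
      (fun y => ∫ α in (0 : ℝ)..(2 * Real.pi), τ α * f (axisPoint α y)) x :=
    (contDiff_intervalIntegral hG _ _).differentiable (by norm_num) x
  have e1 : angInt τ f = fun y => (2 * Real.pi)⁻¹ *
      ∫ α in (0 : ℝ)..(2 * Real.pi), τ α * f (axisPoint α y) := rfl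
  rw [e1, fderiv_const_mul hd, smul_apply, smul_eq_mul,
    fderiv_intervalIntegral hG]
  refine congrArg _ (intervalIntegral.integral_congr fun α _ => ?_)
  have h1 : HasFDerivAt (fun y => f (axisPoint α y)) _ x :=
    (hf.contDiff.differentiable (by norm_num) (axisPoint α x)).hasFDerivAt.comp x
      (hasFDerivAt_axisPoint α hx)
  simp only
  rw [(h1.const_mul (τ α)).fderiv, smul_apply, smul_eq_mul,
    ContinuousLinearMap.comp_apply, he]

theorem Dr_angInt {τ : ℝ → ℝ} (hτ : ContDiff ℝ 1 τ) {f : E3 → ℝ} (hf : IsTest f) {x : E3}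
    (hx : x ∈ offAxis) : Dr (angInt τ f) x = angInt τ (Dr f) x :=
  fderiv_angInt hτ hf hx fun α => axisPointL_eR α hx

theorem Dt_angInt {τ : ℝ → ℝ} (hτ : ContDiff ℝ 1 τ) {f : E3 → ℝ} (hf : IsTest f) {x : E3}
    (hx : x ∈ offAxis) : Dt (angInt τ f) x = angInt τ (Dt f) x :=
  fderiv_angInt hτ hf hx fun α => axisPointL_eT α hx

theorem continuous_axisPoint (x : E3) : Continuous fun α => axisPoint α x :=
  continuous_iff_continuousAt.2 fun α => (hasDerivAt_axisPoint α x).continuousAt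

/-- Integration by parts in the azimuthal angle. -/
theorem angInt_Dp {τ τ' : ℝ → ℝ} (hτ : ∀ t, HasDerivAt τ (τ' t) t) (hc : Continuous τ')
    (hper : τ (2 * Real.pi) = τ 0) {f : E3 → ℝ} (hf : IsTest f) (x : E3) :
    angInt τ (Dp f) x = - angInt τ' f x := by
  have hcτ : Continuous τ := continuous_iff_continuousAt.2 fun t => (hτ t).continuousAt
  have hD : Continuous (Dp f) :=
    hf.cptOff.Dp.continuous (hf.smoothOff.Dp (n := 0) (by norm_num)).continuousOn
  have hfd : ∀ t, HasDerivAt (fun α => f (axisPoint α x)) (Dp f (axisPoint t x)) t := fun t =>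
    (hf.contDiff.differentiable (by norm_num) _).hasFDerivAt.comp_hasDerivAt t
      (hasDerivAt_axisPoint t x)
  have h := intervalIntegral.integral_mul_deriv_eq_deriv_mul (a := 0) (b := 2 * Real.pi)
    (u := τ) (u' := τ') (v := fun α => f (axisPoint α x)) (v' := fun α => Dp f (axisPoint α x))
    (fun t _ => hτ t) (fun t _ => hfd t) (hc.intervalIntegrable _ _)
    ((hD.comp (continuous_axisPoint x)).intervalIntegrable _ _)
  have hend : axisPoint (2 * Real.pi) x = axisPoint 0 x := by simp [axisPoint]
  rw [angInt, h, hper, hend, angInt]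
  ring

/-- The cosine coefficient of order `k`. -/
noncomputable def cosCoef (k : ℤ) (f : E3 → ℝ) : E3 → ℝ := angInt (fun α => Real.cos (k * α)) f

/-- The sine coefficient of order `k`. -/
noncomputable def sinCoef (k : ℤ) (f : E3 → ℝ) : E3 → ℝ := angInt (fun α => Real.sin (k * α)) f

theorem contDiff_cos_mul (k : ℤ) : ContDiff ℝ 1 fun α : ℝ => Real.cos (k * α) := by fun_prop

theorem contDiff_sin_mul (k : ℤ) : ContDiff ℝ 1 fun α : ℝ => Real.sin (k * α) := by fun_prop

theorem cosCoef_Dp (k : ℤ) {f : E3 → ℝ} (hf : IsTest f) (x : E3) :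
    cosCoef k (Dp f) x = k * sinCoef k f x := by
  have h := angInt_Dp (τ := fun α => Real.cos (k * α)) (τ' := fun α => -(k * Real.sin (k * α)))
    (fun t => ((Real.hasDerivAt_cos _).comp t ((hasDerivAt_id t).const_mul (k : ℝ))).congr_deriv
      (by simp; ring)) (by fun_prop)
    (by simp [Real.cos_int_mul_two_pi k]) hf x
  rw [cosCoef, h, sinCoef, angInt, angInt]
  simp only [neg_mul, mul_assoc, intervalIntegral.integral_neg, intervalIntegral.integral_const_mul]
  ring

theorem sinCoef_Dp (k : ℤ) {f : E3 → ℝ} (hf : IsTest f) (x : E3) :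
    sinCoef k (Dp f) x = -(k * cosCoef k f x) := by
  have h := angInt_Dp (τ := fun α => Real.sin (k * α)) (τ' := fun α => k * Real.cos (k * α))
    (fun t => ((Real.hasDerivAt_sin _).comp t ((hasDerivAt_id t).const_mul (k : ℝ))).congr_deriv
      (by simp; ring)) (by fun_prop)
    (by
      have := Real.sin_int_mul_pi (k * 2)
      push_cast at this
      simp only [mul_zero, Real.sin_zero]
      rw [← this]; ring_nf) hf x
  rw [sinCoef, h, cosCoef, angInt, angInt]
  simp only [mul_assoc, intervalIntegral.integral_const_mul]
  ring

section linear

variable {τ : ℝ → ℝ} {f g : E3 → ℝ} {x : E3}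

theorem intervalIntegrable_angInt (hτ : Continuous τ) (hf : ContinuousOn f offAxis)
    (hx : x ∈ offAxis) (a b : ℝ) :
    IntervalIntegrable (fun α => τ α * f (axisPoint α x)) volume a b := by
  refine Continuous.intervalIntegrable (hτ.mul ?_) _ _
  exact hf.comp_continuous (continuous_axisPoint x) fun α => (axisPoint_mem_offAxis α x).2 hx

theorem angInt_add (hτ : Continuous τ) (hf : ContinuousOn f offAxis)
    (hg : ContinuousOn g offAxis) (hx : x ∈ offAxis) :
    angInt τ (fun y => f y + g y) x = angInt τ f x + angInt τ g x := by
  simp only [angInt, mul_add]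
  rw [intervalIntegral.integral_add (intervalIntegrable_angInt hτ hf hx _ _)
    (intervalIntegrable_angInt hτ hg hx _ _)]
  ring

theorem angInt_sub (hτ : Continuous τ) (hf : ContinuousOn f offAxis)
    (hg : ContinuousOn g offAxis) (hx : x ∈ offAxis) :
    angInt τ (fun y => f y - g y) x = angInt τ f x - angInt τ g x := by
  simp only [angInt, mul_sub]
  rw [intervalIntegral.integral_sub (intervalIntegrable_angInt hτ hf hx _ _)
    (intervalIntegrable_angInt hτ hg hx _ _)]
  ring

theorem angInt_mul_left (hg : ∀ α, g (axisPoint α x) = g x) :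
    angInt τ (fun y => g y * f y) x = g x * angInt τ f x := by
  simp only [angInt, hg, mul_left_comm (τ _) (g x), intervalIntegral.integral_const_mul]
  ring

end linear

/-- Parseval's identity for the complex function `f + i g` on a circle about the axis. -/
theorem hasSum_sq_coef {f g : E3 → ℝ} (hf : ContinuousOn f offAxis) (hg : ContinuousOn g offAxis)
    {x : E3} (hx : x ∈ offAxis) :
    HasSum (fun k : ℤ => (cosCoef k f x + sinCoef k g x) ^ 2 + (cosCoef k g x - sinCoef k f x) ^ 2)
      ((2 * Real.pi)⁻¹ * ∫ α in (0 : ℝ)..(2 * Real.pi),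
        (f (axisPoint α x) ^ 2 + g (axisPoint α x) ^ 2)) := by
  have hab : (0 : ℝ) < 2 * Real.pi := by positivity
  let t : ℝ → ℂ := fun α => f (axisPoint α x) + Complex.I * g (axisPoint α x)
  have cf : Continuous fun α => f (axisPoint α x) :=
    hf.comp_continuous (continuous_axisPoint x) fun α => (axisPoint_mem_offAxis α x).2 hx
  have cg : Continuous fun α => g (axisPoint α x) :=
    hg.comp_continuous (continuous_axisPoint x) fun α => (axisPoint_mem_offAxis α x).2 hx
  have ct : Continuous t := by
    exact (Complex.continuous_ofReal.comp cf).add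
      (continuous_const.mul (Complex.continuous_ofReal.comp cg))
  have hL2 : MemLp t 2 (volume.restrict (Set.Ioc 0 (2 * Real.pi))) := by
    obtain ⟨C, hC⟩ := (isCompact_Icc (a := (0 : ℝ)) (b := 2 * Real.pi)).exists_bound_of_continuousOn
      ct.continuousOn
    exact MemLp.of_bound ct.aestronglyMeasurable C ((ae_restrict_iff' measurableSet_Ioc).2
      (ae_of_all _ fun α hα => hC α (Set.Ioc_subset_Icc_self hα)))
  have h := hasSum_sq_fourierCoeffOn hab hL2
  have hn : ∀ α, ‖t α‖ ^ 2 = f (axisPoint α x) ^ 2 + g (axisPoint α x) ^ 2 := fun α => by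
    rw [← Complex.normSq_eq_norm_sq, Complex.normSq_apply]
    simp [t]; ring
  simp only [hn, sub_zero, smul_eq_mul] at h
  convert h using 2 with k
  have hk : fourierCoeffOn hab t k
      = ((cosCoef k f x + sinCoef k g x : ℝ) : ℂ)
        + Complex.I * ((cosCoef k g x - sinCoef k f x : ℝ) : ℂ) := by
    rw [fourierCoeffOn_eq_integral]
    have e : ∀ α : ℝ, fourier (-k) (α : AddCircle (2 * Real.pi - 0)) • t α
        = ((Real.cos (k * α) * f (axisPoint α x) + Real.sin (k * α) * g (axisPoint α x) : ℝ) : ℂ)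
          + Complex.I * ((Real.cos (k * α) * g (axisPoint α x)
            - Real.sin (k * α) * f (axisPoint α x) : ℝ) : ℂ) := fun α => by
      rw [fourier_coe_apply]
      have hexp : 2 * (Real.pi : ℂ) * Complex.I * ((-k : ℤ) : ℂ) * (α : ℂ)
          / ((2 * Real.pi - 0 : ℝ) : ℂ) = ((-(k * α) : ℝ) : ℂ) * Complex.I := by
        have : (Real.pi : ℂ) ≠ 0 := by exact_mod_cast Real.pi_ne_zero
        push_cast
        field_simp
        ring
      rw [hexp, Complex.exp_mul_I, ← Complex.ofReal_cos, ← Complex.ofReal_sin, Real.cos_neg,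
        Real.sin_neg]
      simp only [t, smul_eq_mul]
      push_cast
      ring_nf
      rw [Complex.I_sq]
      ring
    have i1 := fun (h : E3 → ℝ) (hh : ContinuousOn h offAxis) =>
      intervalIntegrable_angInt (τ := fun α => Real.cos (k * α)) (by fun_prop) hh hx 0 (2 * Real.pi)
    have i2 := fun (h : E3 → ℝ) (hh : ContinuousOn h offAxis) =>
      intervalIntegrable_angInt (τ := fun α => Real.sin (k * α)) (by fun_prop) hh hx 0 (2 * Real.pi)
    have cc : Continuous fun α : ℝ => Real.cos (k * α) := by fun_prop
    have cs : Continuous fun α : ℝ => Real.sin (k * α) := by fun_prop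
    have c1 : Continuous fun α : ℝ => ((Real.cos (k * α) * f (axisPoint α x)
        + Real.sin (k * α) * g (axisPoint α x) : ℝ) : ℂ) :=
      Complex.continuous_ofReal.comp ((cc.mul cf).add (cs.mul cg))
    have c2 : Continuous fun α : ℝ => Complex.I * ((Real.cos (k * α) * g (axisPoint α x)
        - Real.sin (k * α) * f (axisPoint α x) : ℝ) : ℂ) :=
      continuous_const.mul (Complex.continuous_ofReal.comp ((cc.mul cg).sub (cs.mul cf)))
    simp only [e]
    rw [intervalIntegral.integral_add (c1.intervalIntegrable _ _) (c2.intervalIntegrable _ _),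
      intervalIntegral.integral_const_mul, intervalIntegral.integral_ofReal,
      intervalIntegral.integral_ofReal,
      intervalIntegral.integral_add (i1 f hf) (i2 g hg),
      intervalIntegral.integral_sub (i1 g hg) (i2 f hf)]
    simp only [cosCoef, sinCoef, angInt, Complex.real_smul]
    push_cast
    rw [sub_zero]
    ring
  rw [hk, ← Complex.normSq_eq_norm_sq, Complex.normSq_apply]
  simp
  ring

theorem continuous_axisPoint_uncurry : Continuous fun p : E3 × ℝ => axisPoint p.2 p.1 := by
  have h1 : Continuous fun p : E3 × ℝ => axisDist p.1 :=
    ((contDiff_axisSq (n := 0)).continuous.sqrt).comp continuous_fst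
  have h2 : Continuous fun p : E3 × ℝ => p.1 2 := (coordL 2).continuous.comp continuous_fst
  refine (PiLp.continuous_toLp 2 _).comp (continuous_pi fun i => ?_)
  fin_cases i <;> simp <;> fun_prop

theorem continuous_angInt {τ : ℝ → ℝ} (hτ : Continuous τ) {f : E3 → ℝ} (hf : Continuous f) :
    Continuous (angInt τ f) :=
  continuous_const.mul (intervalIntegral.continuous_parametric_intervalIntegral_of_continuous'
    ((hτ.comp continuous_snd).mul (hf.comp continuous_axisPoint_uncurry)) _ _)

theorem aestronglyMeasurable_of_continuousOn_offAxis {f : E3 → ℝ} (hf : ContinuousOn f offAxis) :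
    AEStronglyMeasurable f volume := by
  have h := hf.aestronglyMeasurable (μ := volume) isOpen_offAxis.measurableSet
  rwa [Measure.restrict_eq_self_of_ae_mem ae_mem_offAxis] at h

/-- Parseval's identity, integrated against a weight. -/
theorem hasSum_integral_coef {κ f g : E3 → ℝ} (hκ : ContinuousOn κ offAxis)
    (hκp : ∀ α x, κ (axisPoint α x) = κ x) {M : ℝ} (hM : ∀ x, -M ≤ κ x) (hf : Continuous f)
    (hg : Continuous g) (cf : CptOff f) (cg : CptOff g) :
    (∀ k : ℤ, Integrable (fun x => κ x * ((cosCoef k f x + sinCoef k g x) ^ 2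
        + (cosCoef k g x - sinCoef k f x) ^ 2)) volume) ∧
    HasSum (fun k : ℤ => ∫ x, κ x * ((cosCoef k f x + sinCoef k g x) ^ 2
        + (cosCoef k g x - sinCoef k f x) ^ 2)) (∫ x, κ x * (f x ^ 2 + g x ^ 2)) := by
  have main : ∀ κ : E3 → ℝ, ContinuousOn κ offAxis → (∀ α x, κ (axisPoint α x) = κ x) →
      (∀ x, 0 ≤ κ x) → (Integrable (fun x => κ x * (f x ^ 2 + g x ^ 2)) volume) ∧
      (∀ k : ℤ, Integrable (fun x => κ x * ((cosCoef k f x + sinCoef k g x) ^ 2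
        + (cosCoef k g x - sinCoef k f x) ^ 2)) volume) ∧
      HasSum (fun k : ℤ => ∫ x, κ x * ((cosCoef k f x + sinCoef k g x) ^ 2
        + (cosCoef k g x - sinCoef k f x) ^ 2)) (∫ x, κ x * (f x ^ 2 + g x ^ 2)) := by
    intro κ hκ hκp h0
    have hc : CptOff fun x => κ x * (f x ^ 2 + g x ^ 2) :=
      CptOff.mul_left ((cf.of_eq_zero fun x hx => by simp [hx]).add
        (cg.of_eq_zero fun x hx => by simp [hx]))
    have hcont : Continuous fun x => κ x * (f x ^ 2 + g x ^ 2) :=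
      hc.continuous (hκ.mul ((hf.pow 2).add (hg.pow 2)).continuousOn)
    have e := integral_eq_integral_axisPoint hcont hc.tsupport_subset.1
    have ang : ∀ x, (2 * Real.pi)⁻¹ * ∫ α in (0 : ℝ)..(2 * Real.pi), κ (axisPoint α x) *
        (f (axisPoint α x) ^ 2 + g (axisPoint α x) ^ 2)
        = κ x * ((2 * Real.pi)⁻¹ * ∫ α in (0 : ℝ)..(2 * Real.pi),
          (f (axisPoint α x) ^ 2 + g (axisPoint α x) ^ 2)) := fun x => by
      simp only [hκp, intervalIntegral.integral_const_mul]
      ring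
    have hint : Integrable (fun x => (2 * Real.pi)⁻¹ * ∫ α in (0 : ℝ)..(2 * Real.pi),
        κ (axisPoint α x) * (f (axisPoint α x) ^ 2 + g (axisPoint α x) ^ 2)) volume := by
      have h1 := continuous_angInt (τ := fun _ => 1) continuous_const hcont
      have h2 := hc.angInt (fun _ => 1)
      have h3 : Integrable (angInt (fun _ => 1) fun x => κ x * (f x ^ 2 + g x ^ 2)) volume :=
        h1.integrable_of_hasCompactSupport h2.tsupport_subset.1
      exact h3.congr (ae_of_all _ fun x => by simp only [angInt, one_mul])
    rw [e]
    refine ⟨hcont.integrable_of_hasCompactSupport hc.tsupport_subset.1, ?_⟩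
    have hcos := fun (k : ℤ) (h : E3 → ℝ) (hh : Continuous h) =>
      continuous_angInt (contDiff_cos_mul k).continuous hh
    have hsin := fun (k : ℤ) (h : E3 → ℝ) (hh : Continuous h) =>
      continuous_angInt (contDiff_sin_mul k).continuous hh
    refine hasSum_integral_of_nonneg (fun k => ?_) (fun k => ae_of_all _ fun x => ?_) hint ?_
    · refine (aestronglyMeasurable_of_continuousOn_offAxis hκ).mul ?_
      exact ((((hcos k f hf).add (hsin k g hg)).pow 2).add
        (((hcos k g hg).sub (hsin k f hf)).pow 2)).aestronglyMeasurable
    · exact mul_nonneg (h0 x) (by positivity)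
    · filter_upwards [ae_mem_offAxis] with x hx
      rw [ang]
      exact (hasSum_sq_coef hf.continuousOn hg.continuousOn hx).mul_left _
  have hMκ : -M ≤ |M| := neg_le_abs M
  obtain ⟨i1, j1, s1⟩ := main (fun x => κ x + |M|) (hκ.add continuousOn_const)
    (fun α x => by rw [hκp]) fun x => by linarith [hM x, le_abs_self M]
  obtain ⟨i2, j2, s2⟩ := main (fun _ => |M|) continuousOn_const (fun _ _ => rfl)
    fun _ => abs_nonneg M
  have e1 : ∀ t : ℝ, ∀ x, (κ x + |M|) * t - |M| * t = κ x * t := fun t x => by ring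
  refine ⟨fun k => ((j1 k).sub (j2 k)).congr (ae_of_all _ fun x => e1 _ x), ?_⟩
  have hs := s1.sub s2
  rw [← integral_sub i1 i2] at hs
  simp only [e1] at hs
  refine hs.congr_fun fun k => ?_
  rw [← integral_sub (j1 k) (j2 k)]
  simp only [e1]

/-! ### Decomposition of the second variation into modes -/

/-- The integral of `D` is the sum of the integrals of the `T k`. The functions are to be integrable
as well, so that the relation is additive. -/
structure Decomposes (D : E3 → ℝ) (T : ℤ → E3 → ℝ) : Prop where
  integrable : Integrable D volume
  integrable_term : ∀ k, Integrable (T k) volume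
  hasSum : HasSum (fun k => ∫ x, T k x) (∫ x, D x)

namespace Decomposes

variable {D D' : E3 → ℝ} {T T' : ℤ → E3 → ℝ}

theorem add (h : Decomposes D T) (h' : Decomposes D' T') :
    Decomposes (fun x => D x + D' x) (fun k x => T k x + T' k x) where
  integrable := h.integrable.add h'.integrable
  integrable_term k := (h.integrable_term k).add (h'.integrable_term k)
  hasSum := by
    have e : ∀ k, ∫ x, (T k x + T' k x) = (∫ x, T k x) + ∫ x, T' k x := fun k =>
      integral_add (h.integrable_term k) (h'.integrable_term k)
    simp only [e]
    rw [integral_add h.integrable h'.integrable]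
    exact h.hasSum.add h'.hasSum

theorem integral_nonneg (h : Decomposes D T) {D₁ : E3 → ℝ} {T₁ : ℤ → E3 → ℝ}
    (hD : ∀ x ∈ offAxis, D₁ x = D x) (hT : ∀ k, ∀ x ∈ offAxis, T₁ k x = T k x)
    (h0 : ∀ k, 0 ≤ ∫ x, T₁ k x) : 0 ≤ ∫ x, D₁ x := by
  have e1 : ∫ x, D₁ x = ∫ x, D x := integral_congr_ae (by
    filter_upwards [ae_mem_offAxis] with x hx using hD x hx)
  rw [e1]
  refine h.hasSum.nonneg fun k => ?_
  have e2 : ∫ x, T₁ k x = ∫ x, T k x := integral_congr_ae (by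
    filter_upwards [ae_mem_offAxis] with x hx using hT k x hx)
  rw [← e2]
  exact h0 k

end Decomposes

/-- The squared modulus of the coefficient of order `k` of `f + i g`. -/
noncomputable def coefSq (f g : E3 → ℝ) (k : ℤ) (x : E3) : ℝ :=
  (cosCoef k f x + sinCoef k g x) ^ 2 + (cosCoef k g x - sinCoef k f x) ^ 2

/-- Continuous functions off the axis with compact support there. -/
structure ContCpt (f : E3 → ℝ) : Prop where
  cpt : CptOff f
  cont : ContinuousOn f offAxis

namespace ContCpt

variable {f g : E3 → ℝ}

theorem zero : ContCpt fun _ => 0 := ⟨.zero, continuousOn_const⟩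
theorem add (hf : ContCpt f) (hg : ContCpt g) : ContCpt fun x => f x + g x :=
  ⟨hf.cpt.add hg.cpt, hf.cont.add hg.cont⟩
theorem mul_left {κ : E3 → ℝ} (hκ : ContinuousOn κ offAxis) (hf : ContCpt f) :
    ContCpt fun x => κ x * f x := ⟨hf.cpt.mul_left, hκ.mul hf.cont⟩
theorem sub (hf : ContCpt f) (hg : ContCpt g) : ContCpt fun x => f x - g x := by
  simpa [sub_eq_add_neg] using hf.add (hg.mul_left (κ := fun _ => -1) continuousOn_const)
theorem _root_.MeltingHedgehog.IsTest.contCpt (hf : IsTest f) : ContCpt f :=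
  ⟨hf.cptOff, hf.contDiff.continuous.continuousOn⟩
theorem _root_.MeltingHedgehog.IsTest.contCpt_Dr (hf : IsTest f) : ContCpt (Dr f) :=
  ⟨hf.cptOff.Dr, (hf.smoothOff.Dr (n := 0) (by norm_num)).continuousOn⟩
theorem _root_.MeltingHedgehog.IsTest.contCpt_Dt (hf : IsTest f) : ContCpt (Dt f) :=
  ⟨hf.cptOff.Dt, (hf.smoothOff.Dt (n := 0) (by norm_num)).continuousOn⟩
theorem _root_.MeltingHedgehog.IsTest.contCpt_Dp (hf : IsTest f) : ContCpt (Dp f) :=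
  ⟨hf.cptOff.Dp, (hf.smoothOff.Dp (n := 0) (by norm_num)).continuousOn⟩

end ContCpt

/-- Parseval's identity for `κ (f² + g²)`, where the weight `κ` does not depend on the azimuth. -/
theorem decomposes_coefSq {κ f g : E3 → ℝ} (hκ : ContinuousOn κ offAxis)
    (hκp : ∀ α x, κ (axisPoint α x) = κ x) {M : ℝ} (hM : ∀ x, |κ x| ≤ M ∨ 0 ≤ κ x)
    (hf : ContCpt f) (hg : ContCpt g) :
    Decomposes (fun x => κ x * (f x ^ 2 + g x ^ 2)) (fun k x => κ x * coefSq f g k x) := by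
  have h := hasSum_integral_coef hκ hκp (M := |M|) (fun x => by
    rcases hM x with h | h
    · linarith [(abs_le.1 h).1, le_abs_self M]
    · linarith [abs_nonneg M]) (hf.cpt.continuous hf.cont) (hg.cpt.continuous hg.cont) hf.cpt hg.cpt
  refine ⟨?_, h.1, h.2⟩
  refine CptOff.integrable (CptOff.mul_left ((hf.cpt.of_eq_zero fun x hx => by simp [hx]).add
    (hg.cpt.of_eq_zero fun x hx => by simp [hx]))) (hκ.mul ((hf.cont.pow 2).add (hg.cont.pow 2)))

/-- `f` is continuous off the axis, with cosine and sine coefficients of order `k` at `x` equal to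
`A` and `B`. -/
structure HasCoef (k : ℤ) (x : E3) (f : E3 → ℝ) (A B : ℝ) : Prop where
  cont : ContinuousOn f offAxis
  cos : cosCoef k f x = A
  sin : sinCoef k f x = B

namespace HasCoef

variable {k : ℤ} {x : E3} {f g : E3 → ℝ} {A B A' B' : ℝ}

theorem add (hx : x ∈ offAxis) (hf : HasCoef k x f A B) (hg : HasCoef k x g A' B') :
    HasCoef k x (fun y => f y + g y) (A + A') (B + B') where
  cont := hf.cont.add hg.cont
  cos := by
    rw [← hf.cos, ← hg.cos]
    exact angInt_add (contDiff_cos_mul k).continuous hf.cont hg.cont hx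
  sin := by
    rw [← hf.sin, ← hg.sin]
    exact angInt_add (contDiff_sin_mul k).continuous hf.cont hg.cont hx

theorem sub (hx : x ∈ offAxis) (hf : HasCoef k x f A B) (hg : HasCoef k x g A' B') :
    HasCoef k x (fun y => f y - g y) (A - A') (B - B') where
  cont := hf.cont.sub hg.cont
  cos := by
    rw [← hf.cos, ← hg.cos]
    exact angInt_sub (contDiff_cos_mul k).continuous hf.cont hg.cont hx
  sin := by
    rw [← hf.sin, ← hg.sin]
    exact angInt_sub (contDiff_sin_mul k).continuous hf.cont hg.cont hx

theorem mul_left {κ : E3 → ℝ} (hκ : ContinuousOn κ offAxis)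
    (hκp : ∀ α, κ (axisPoint α x) = κ x) (hf : HasCoef k x f A B) :
    HasCoef k x (fun y => κ y * f y) (κ x * A) (κ x * B) where
  cont := hκ.mul hf.cont
  cos := by rw [← hf.cos]; exact angInt_mul_left hκp
  sin := by rw [← hf.sin]; exact angInt_mul_left hκp

theorem zero : HasCoef k x (fun _ => 0) 0 0 where
  cont := continuousOn_const
  cos := by simp [cosCoef, angInt]
  sin := by simp [sinCoef, angInt]

theorem of_isTest (hf : IsTest f) : HasCoef k x f (cosCoef k f x) (sinCoef k f x) :=
  ⟨hf.contCpt.cont, rfl, rfl⟩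

theorem of_Dr (hx : x ∈ offAxis) (hf : IsTest f) :
    HasCoef k x (Dr f) (Dr (cosCoef k f) x) (Dr (sinCoef k f) x) :=
  ⟨hf.contCpt_Dr.cont, (Dr_angInt (contDiff_cos_mul k) hf hx).symm,
    (Dr_angInt (contDiff_sin_mul k) hf hx).symm⟩

theorem of_Dt (hx : x ∈ offAxis) (hf : IsTest f) :
    HasCoef k x (Dt f) (Dt (cosCoef k f) x) (Dt (sinCoef k f) x) :=
  ⟨hf.contCpt_Dt.cont, (Dt_angInt (contDiff_cos_mul k) hf hx).symm,
    (Dt_angInt (contDiff_sin_mul k) hf hx).symm⟩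

theorem of_Dp (hf : IsTest f) :
    HasCoef k x (Dp f) (k * sinCoef k f x) (-(k * cosCoef k f x)) :=
  ⟨hf.contCpt_Dp.cont, cosCoef_Dp k hf x, sinCoef_Dp k hf x⟩

theorem coefSq_eq (hf : HasCoef k x f A B) (hg : HasCoef k x g A' B') :
    coefSq f g k x = (A + B') ^ 2 + (A' - B) ^ 2 := by
  rw [coefSq, hf.cos, hf.sin, hg.cos, hg.sin]

end HasCoef

theorem isTest_cosCoef (k : ℤ) {f : E3 → ℝ} (hf : IsTest f) : IsTest (cosCoef k f) :=
  isTest_angInt (contDiff_cos_mul k) hf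

theorem isTest_sinCoef (k : ℤ) {f : E3 → ℝ} (hf : IsTest f) : IsTest (sinCoef k f) :=
  isTest_angInt (contDiff_sin_mul k) hf

theorem IsPhiIndependent.add {f g : E3 → ℝ} (hf : IsPhiIndependent f) (hg : IsPhiIndependent g) :
    IsPhiIndependent fun x => f x + g x := fun x y h1 h2 => by
  simp only [hf x y h1 h2, hg x y h1 h2]

theorem IsPhiIndependent.sub {f g : E3 → ℝ} (hf : IsPhiIndependent f) (hg : IsPhiIndependent g) :
    IsPhiIndependent fun x => f x - g x := fun x y h1 h2 => by
  simp only [hf x y h1 h2, hg x y h1 h2]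

theorem IsPhiIndependent.neg {f : E3 → ℝ} (hf : IsPhiIndependent f) :
    IsPhiIndependent fun x => - f x := fun x y h1 h2 => by
  simp only [hf x y h1 h2]

/-- Fourier decomposition in the azimuth: if the second variation is nonnegative on every mode,
it is nonnegative. -/
theorem integral_frameEnergy_nonneg {a b c : ℝ} {u : ℝ → ℝ} (hu : IsProfile a b c u)
    (h : ∀ k : ℤ, ∀ v₀ v₂ v₄ : E3 → ℝ, IsTest v₀ → IsTest v₂ → IsTest v₄ → IsPhiIndependent v₀ →
      IsPhiIndependent v₂ → IsPhiIndependent v₄ → 0 ≤ ∫ x, modeEnergy a b c u k v₀ v₂ v₄ x)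
    {w : Fin 5 → E3 → ℝ} (hw : ∀ i, IsTest (w i)) : 0 ≤ ∫ x, frameEnergy a b c u w x := by
  have cκ : ContinuousOn (fun x : E3 => 1 / ‖x‖ ^ 2) offAxis :=
    (SmoothOff.inv_norm_sq (n := 0)).continuousOn
  have cs : ContinuousOn cscTheta offAxis := (SmoothOff.cscTheta (n := 0)).continuousOn
  have ct : ContinuousOn cotTheta offAxis := (SmoothOff.cotTheta (n := 0)).continuousOn
  have cc : ∀ r : ℝ, ContinuousOn (fun _ : E3 => r) offAxis := fun r => continuousOn_const
  have c2t : ContinuousOn (fun x => 2 * cotTheta x) offAxis := (cc 2).mul ct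
  -- constant, angular and bulk weights
  have D1 : ∀ (r : ℝ) {f g : E3 → ℝ}, ContCpt f → ContCpt g →
      Decomposes (fun x => r * (f x ^ 2 + g x ^ 2)) (fun k x => r * coefSq f g k x) :=
    fun r f g hf hg => decomposes_coefSq (κ := fun _ => r) (M := |r|) (cc r) (fun _ _ => rfl)
      (fun _ => Or.inl le_rfl) hf hg
  have D2 : ∀ (r : ℝ), 0 ≤ r → ∀ {f g : E3 → ℝ}, ContCpt f → ContCpt g →
      Decomposes (fun x => (r * (1 / ‖x‖ ^ 2)) * (f x ^ 2 + g x ^ 2))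
        (fun k x => (r * (1 / ‖x‖ ^ 2)) * coefSq f g k x) :=
    fun r hr f g hf hg => decomposes_coefSq (κ := fun x => r * (1 / ‖x‖ ^ 2)) (M := 0)
      ((cc r).mul cκ) (fun _ _ => by rw [norm_axisPoint]) (fun _ => Or.inr (by positivity)) hf hg
  have D3 : ∀ (q : ℝ → ℝ), Continuous q → ∀ {f g : E3 → ℝ}, ContCpt f → ContCpt g →
      Decomposes (fun x => q (u ‖x‖) * (f x ^ 2 + g x ^ 2))
        (fun k x => q (u ‖x‖) * coefSq f g k x) := fun q hq f g hf hg => by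
    obtain ⟨M, hM⟩ := hu.exists_bound_comp hq
    exact decomposes_coefSq (κ := fun x => q (u ‖x‖)) (M := M)
      (hq.comp hu.continuous_comp_norm).continuousOn (fun _ _ => by rw [norm_axisPoint])
      (fun x => Or.inl (hM x)) hf hg
  have T := fun i => (hw i).contCpt
  have R := fun i => (hw i).contCpt_Dr
  have Θ := fun i => (hw i).contCpt_Dt
  have P := fun i => (hw i).contCpt_Dp.mul_left cs
  have key := (((((((((((D1 (1 / 3) (R 0) .zero).add (D1 1 (R 2) (R 1))).add (D1 1 (R 4) (R 3))).add
    (D2 (1 / 3) (by norm_num) ((Θ 0).add ((T 2).mul_left (cc 3)))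
      ((P 0).add ((T 1).mul_left (cc 3))))).add
    (D2 1 one_pos.le (((Θ 2).sub (T 4)).sub (T 0)) ((Θ 1).sub (T 3)))).add
    (D2 1 one_pos.le ((((T 2).mul_left ct).add ((T 4).sub (T 0))).add (P 1))
      ((((T 1).mul_left ct).add (T 3)).sub (P 2)))).add
    (D2 1 one_pos.le ((Θ 4).add (T 2)) ((Θ 3).add (T 1)))).add
    (D2 1 one_pos.le (((T 4).mul_left c2t).add (T 2) |>.add (P 3))
      ((((T 3).mul_left c2t).add (T 1)).sub (P 4)))).add
    (D3 (fun t => 1 / 3 * fHat a b c t) (continuous_const.mul (continuous_fHat a b c))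
      (T 0) .zero)).add
    (D3 _ (continuous_fMid a b c) (T 2) (T 1))).add
    (D3 _ (continuous_fTilde a b c) (T 4) (T 3)))
  -- The modes are complex: `T₁` is the energy of the real part plus that of the imaginary part.
  refine key.integral_nonneg (T₁ := fun k x =>
    modeEnergy a b c u k (cosCoef k (w 0)) (fun y => cosCoef k (w 2) y + sinCoef k (w 1) y)
      (fun y => cosCoef k (w 4) y + sinCoef k (w 3) y) x
    + modeEnergy a b c u k (fun y => - sinCoef k (w 0) y)
      (fun y => cosCoef k (w 1) y - sinCoef k (w 2) y)
      (fun y => cosCoef k (w 3) y - sinCoef k (w 4) y) x) (fun x hx => ?_) (fun k x hx => ?_)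
    (fun k => ?_)
  · simp only [frameEnergy, compSq, compBulk, compR, compT, compP, Matrix.cons_val_zero,
      Matrix.cons_val_one, Matrix.cons_val]
    ring
  · have t := fun i => HasCoef.of_isTest (k := k) (x := x) (hw i)
    have r := fun i => HasCoef.of_Dr (k := k) hx (hw i)
    have θ := fun i => HasCoef.of_Dt (k := k) hx (hw i)
    have it : ∀ α, cotTheta (axisPoint α x) = cotTheta x := fun α => cotTheta_axisPoint α x
    have p := fun i => (HasCoef.of_Dp (k := k) (x := x) (hw i)).mul_left cs
      (fun α => cscTheta_axisPoint α x)
    have z := HasCoef.zero (k := k) (x := x)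
    rw [(r 0).coefSq_eq z, (r 2).coefSq_eq (r 1), (r 4).coefSq_eq (r 3),
      ((θ 0).add hx ((t 2).mul_left (cc 3) fun _ => rfl)).coefSq_eq
        ((p 0).add hx ((t 1).mul_left (cc 3) fun _ => rfl)),
      (((θ 2).sub hx (t 4)).sub hx (t 0)).coefSq_eq ((θ 1).sub hx (t 3)),
      ((((t 2).mul_left ct it).add hx ((t 4).sub hx (t 0))).add hx (p 1)).coefSq_eq
        ((((t 1).mul_left ct it).add hx (t 3)).sub hx (p 2)),
      ((θ 4).add hx (t 2)).coefSq_eq ((θ 3).add hx (t 1)),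
      ((((t 4).mul_left c2t fun α => by rw [it]).add hx (t 2)).add hx (p 3)).coefSq_eq
        ((((t 3).mul_left c2t fun α => by rw [it]).add hx (t 1)).sub hx (p 4)),
      (t 0).coefSq_eq z, (t 2).coefSq_eq (t 1), (t 4).coefSq_eq (t 3)]
    have dA : ∀ i, DifferentiableAt ℝ (cosCoef k (w i)) x := fun i =>
      (isTest_cosCoef k (hw i)).smoothOff.differentiableAt hx
    have dB : ∀ i, DifferentiableAt ℝ (sinCoef k (w i)) x := fun i =>
      (isTest_sinCoef k (hw i)).smoothOff.differentiableAt hx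
    have ea : ∀ (e : E3 → E3) i j, fderiv ℝ (fun y => cosCoef k (w i) y + sinCoef k (w j) y) x (e x)
        = fderiv ℝ (cosCoef k (w i)) x (e x) + fderiv ℝ (sinCoef k (w j)) x (e x) :=
      fun e i j => by rw [fderiv_fun_add (dA i) (dB j)]; rfl
    have es : ∀ (e : E3 → E3) i j, fderiv ℝ (fun y => cosCoef k (w i) y - sinCoef k (w j) y) x (e x)
        = fderiv ℝ (cosCoef k (w i)) x (e x) - fderiv ℝ (sinCoef k (w j)) x (e x) :=
      fun e i j => by rw [fderiv_fun_sub (dA i) (dB j)]; rfl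
    have en : ∀ (e : E3 → E3) i, fderiv ℝ (fun y => - sinCoef k (w i) y) x (e x)
        = - fderiv ℝ (sinCoef k (w i)) x (e x) :=
      fun e i => by rw [fderiv_fun_neg]; rfl
    simp only [modeEnergy, modeAng, Dr, Dt, ea, es, en]
    ring
  · have tA := fun i => isTest_cosCoef k (hw i)
    have tB := fun i => isTest_sinCoef k (hw i)
    have pA : ∀ i, IsPhiIndependent (cosCoef k (w i)) := fun i => isPhiIndependent_angInt _ _
    have pB : ∀ i, IsPhiIndependent (sinCoef k (w i)) := fun i => isPhiIndependent_angInt _ _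
    rw [integral_add (integrable_modeEnergy hu k (tA 0) ((tA 2).add (tB 1)) ((tA 4).add (tB 3)))
      (integrable_modeEnergy hu k (tB 0).neg ((tA 1).sub (tB 2)) ((tA 3).sub (tB 4)))]
    exact add_nonneg
      (h k _ _ _ (tA 0) ((tA 2).add (tB 1)) ((tA 4).add (tB 3)) (pA 0) ((pA 2).add (pB 1))
        ((pA 4).add (pB 3)))
      (h k _ _ _ (tB 0).neg ((tA 1).sub (tB 2)) ((tA 3).sub (tB 4)) (pB 0).neg
        ((pA 1).sub (pB 2)) ((pA 3).sub (pB 4)))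

/-! ### Monotonicity and reflection of the modes -/

/-- The zero order terms in `v₂`, `v₄` gained in passing from the mode `k - 1` to the mode `k ≥ 3`
dominate the change of the coupling terms. -/
theorem modePhi_sub_one_le (a b c : ℝ) (u : ℝ → ℝ) {k : ℝ} (hk : 3 ≤ k) {v₀ v₂ v₄ : E3 → ℝ}
    {x : E3} (hx : x ∈ offAxis) :
    modePhi a b c u (k - 1) v₀ v₂ v₄ x ≤ modePhi a b c u k v₀ v₂ v₄ x := by
  have hs := sinTheta_pos hx
  have hr := norm_pos_of_mem_offAxis hx
  have h1 := sinTheta_sq_add hx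
  set s := sinTheta x
  set t := cosTheta x
  have hdiff : modePhi a b c u k v₀ v₂ v₄ x - modePhi a b c u (k - 1) v₀ v₂ v₄ x
      = 1 / (‖x‖ ^ 2 * s ^ 2) * ((2 * k - 6) * (1 / 3 * v₀ x ^ 2 + v₂ x ^ 2 + v₄ x ^ 2)
        + (5 * (1 / 3 * v₀ x ^ 2 + v₂ x ^ 2 + v₄ x ^ 2) + 2 * t * (v₂ x ^ 2 + 2 * v₄ x ^ 2)
          + 4 * s * v₂ x * (v₄ x - v₀ x))) := by
    simp only [modePhi, cscTheta, cotTheta]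
    change _ = 1 / (‖x‖ ^ 2 * sinTheta x ^ 2) * ((2 * k - 6) * (1 / 3 * v₀ x ^ 2 + v₂ x ^ 2 + v₄ x ^ 2)
        + (5 * (1 / 3 * v₀ x ^ 2 + v₂ x ^ 2 + v₄ x ^ 2)
          + 2 * cosTheta x * (v₂ x ^ 2 + 2 * v₄ x ^ 2)
          + 4 * sinTheta x * v₂ x * (v₄ x - v₀ x)))
    have hs' := hs.ne'
    change sinTheta x ≠ 0 at hs'
    field_simp
    ring
  have ht : -1 ≤ t := by nlinarith [sq_nonneg s, sq_nonneg (t - 1)]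
  have h54 : 0 < 5 + 4 * t := by linarith
  have hquad : 0 ≤ 5 * (1 / 3 * v₀ x ^ 2 + v₂ x ^ 2 + v₄ x ^ 2)
      + 2 * t * (v₂ x ^ 2 + 2 * v₄ x ^ 2) + 4 * s * v₂ x * (v₄ x - v₀ x) := by
    have hcub : 0 ≤ 15 + 34 * t + 40 * t ^ 2 + 16 * t ^ 3 := by
      have h0 : 0 ≤ (1 + t) * (1 + (2 * (2 * t + 2) - 1) ^ 2) :=
        mul_nonneg (by linarith) (by positivity)
      nlinarith
    -- completion of squares, first in `v₀`, then in `v₄`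
    have e : (5 + 4 * t) * (5 * (1 / 3 * v₀ x ^ 2 + v₂ x ^ 2 + v₄ x ^ 2)
        + 2 * t * (v₂ x ^ 2 + 2 * v₄ x ^ 2) + 4 * s * v₂ x * (v₄ x - v₀ x))
        = (5 + 4 * t) * (5 / 3) * (v₀ x - 6 / 5 * s * v₂ x) ^ 2
          + ((5 + 4 * t) * v₄ x + 2 * s * v₂ x) ^ 2
          + 3 / 5 * (15 + 34 * t + 40 * t ^ 2 + 16 * t ^ 3) * v₂ x ^ 2 := by
      linear_combination (-(12 / 5) * (5 + 4 * t) - 4) * v₂ x ^ 2 * h1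
    have h3 : 0 ≤ (5 + 4 * t) * (5 * (1 / 3 * v₀ x ^ 2 + v₂ x ^ 2 + v₄ x ^ 2)
        + 2 * t * (v₂ x ^ 2 + 2 * v₄ x ^ 2) + 4 * s * v₂ x * (v₄ x - v₀ x)) := by
      rw [e]; positivity
    exact nonneg_of_mul_nonneg_right h3 h54
  have : 0 ≤ modePhi a b c u k v₀ v₂ v₄ x - modePhi a b c u (k - 1) v₀ v₂ v₄ x := by
    rw [hdiff]
    refine mul_nonneg (by positivity) (add_nonneg (mul_nonneg (by linarith) (by positivity)) hquad)
  linarith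

section reflection

theorem axisDist_neg (x : E3) : axisDist (-x) = axisDist x := by simp [axisDist]

theorem neg_mem_offAxis {x : E3} (hx : x ∈ offAxis) : -x ∈ offAxis := by
  simpa [offAxis, axisSq] using hx

theorem sinTheta_neg (x : E3) : sinTheta (-x) = sinTheta x := by
  simp [sinTheta, axisDist_neg]

theorem cosTheta_neg (x : E3) : cosTheta (-x) = - cosTheta x := by
  simp [cosTheta, neg_div]

theorem eR_neg (x : E3) : eR (-x) = - eR x := by
  ext i; simp [eR, nVec, neg_div]

theorem eT_neg (x : E3) : eT (-x) = eT x := by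
  ext i
  fin_cases i <;> simp [eT, mVec, sinTheta_neg, cosTheta_neg, cosPhi, sinPhi, axisDist_neg, neg_div]

theorem fderiv_comp_neg' (f : E3 → ℝ) (x v : E3) :
    fderiv ℝ (fun y => f (-y)) x v = - fderiv ℝ f (-x) v := by
  have h := (ContinuousLinearEquiv.neg ℝ (M := E3)).comp_right_fderiv (f := f) (x := x)
  have h' := congrArg (fun L => L v) h
  simpa [Function.comp_def] using h'

theorem Dr_comp_neg (f : E3 → ℝ) (x : E3) : Dr (fun y => f (-y)) x = Dr f (-x) := by
  rw [Dr, Dr, fderiv_comp_neg', eR_neg, map_neg]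

theorem Dt_comp_neg (f : E3 → ℝ) (x : E3) : Dt (fun y => f (-y)) x = - Dt f (-x) := by
  rw [Dt, Dt, fderiv_comp_neg', eT_neg]

theorem IsTest.comp_neg {f : E3 → ℝ} (hf : IsTest f) : IsTest fun x => f (-x) := by
  obtain ⟨K, hK, hKo, h0⟩ := hf.cptOff
  refine CptOff.isTest ⟨-K, hK.neg, fun x hx => ?_, fun x hx => h0 _ (by simpa using hx)⟩
    (.of_contDiff (hf.contDiff.comp contDiff_neg))
  simpa using neg_mem_offAxis (hKo hx)

theorem IsPhiIndependent.comp_neg {f : E3 → ℝ} (hf : IsPhiIndependent f) :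
    IsPhiIndependent fun x => f (-x) := fun x y h1 h2 =>
  hf _ _ (by simpa using h1) (by simpa using h2)

/-- The antipodal map exchanges the modes `k` and `-k`. -/
theorem modePhi_neg (a b c : ℝ) (u : ℝ → ℝ) (k : ℝ) (v₀ v₂ v₄ : E3 → ℝ) (x : E3) :
    modePhi a b c u (-k) v₀ v₂ v₄ (-x)
      = modePhi a b c u k (fun y => v₀ (-y)) (fun y => - v₂ (-y)) (fun y => v₄ (-y)) x := by
  have e1 : Dr (fun y => - v₂ (-y)) x = - Dr v₂ (-x) := by
    rw [← Dr_comp_neg, Dr, Dr, fderiv_fun_neg]; rfl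
  have e2 : Dt (fun y => - v₂ (-y)) x = Dt v₂ (-x) := by
    rw [← neg_neg (Dt v₂ (-x)), ← Dt_comp_neg, Dt, Dt, fderiv_fun_neg]; rfl
  simp only [modePhi, e1, e2, Dr_comp_neg, Dt_comp_neg, norm_neg, cscTheta, cotTheta, sinTheta_neg,
    cosTheta_neg]
  ring

end reflection

/-- If the second variation is nonnegative on the modes `0, 1, 2`, then it is on every mode. -/
theorem integral_modeEnergy_nonneg {a b c : ℝ} {u : ℝ → ℝ} (hu : IsProfile a b c u)
    (h : ∀ k : ℕ, k ≤ 2 → PhiNonneg a b c u k) (k : ℤ) {v₀ v₂ v₄ : E3 → ℝ} (h0 : IsTest v₀)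
    (h2 : IsTest v₂) (h4 : IsTest v₄) (p0 : IsPhiIndependent v₀) (p2 : IsPhiIndependent v₂)
    (p4 : IsPhiIndependent v₄) : 0 ≤ ∫ x, modeEnergy a b c u k v₀ v₂ v₄ x := by
  have nat : ∀ n : ℕ, ∀ {v₀ v₂ v₄ : E3 → ℝ}, IsTest v₀ → IsTest v₂ → IsTest v₄ →
      IsPhiIndependent v₀ → IsPhiIndependent v₂ → IsPhiIndependent v₄ →
      0 ≤ ∫ x, modePhi a b c u n v₀ v₂ v₄ x := by
    intro n
    induction n with
    | zero => exact fun h0 h2 h4 p0 p2 p4 => (h 0 (by norm_num)).integral_nonneg h0 h2 h4 p0 p2 p4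
    | succ n ih =>
      intro v₀ v₂ v₄ h0 h2 h4 p0 p2 p4
      by_cases hn : n + 1 ≤ 2
      · exact (h _ hn).integral_nonneg h0 h2 h4 p0 p2 p4
      refine (ih h0 h2 h4 p0 p2 p4).trans (integral_mono_ae
        (integral_modeEnergy hu _ h0 h2 h4).1 (integral_modeEnergy hu _ h0 h2 h4).1 ?_)
      filter_upwards [ae_mem_offAxis] with x hx
      have hk : (3 : ℝ) ≤ ((n + 1 : ℕ) : ℝ) := by exact_mod_cast (by omega : 3 ≤ n + 1)
      have := modePhi_sub_one_le a b c u hk (v₀ := v₀) (v₂ := v₂) (v₄ := v₄) hx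
      push_cast at this ⊢
      rwa [add_sub_cancel_right] at this
  rw [(integral_modeEnergy hu k h0 h2 h4).2]
  obtain ⟨n, rfl | rfl⟩ := k.eq_nat_or_neg
  · exact_mod_cast nat n h0 h2 h4 p0 p2 p4
  · rw [← integral_neg_eq_self]
    push_cast
    simp only [modePhi_neg]
    exact nat n h0.comp_neg h2.comp_neg.neg h4.comp_neg p0.comp_neg p2.comp_neg.neg p4.comp_neg

/-- Nonnegativity of `Φ₀, Φ₁, Φ₂` implies that of the second variation. -/
theorem secondVariationNonneg_of_phiNonneg {a b c : ℝ} {u : ℝ → ℝ} (hu : IsProfile a b c u)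
    (h : ∀ k : ℕ, k ≤ 2 → PhiNonneg a b c u k) : SecondVariationNonneg a b c u :=
  secondVariationNonneg_of_test hu fun _ hw => integral_frameEnergy_nonneg hu
    (fun k _ _ _ h0 h2 h4 p0 p2 p4 => integral_modeEnergy_nonneg hu h k h0 h2 h4 p0 p2 p4) hw

/-! ### Primitives along meridians -/

/-- The point with spherical coordinates `(r, t, 0)`. -/
noncomputable def meridian (p : ℝ × ℝ) : E3 := !₂[p.1 * Real.sin p.2, 0, p.1 * Real.cos p.2]

theorem contDiff_meridian {n : WithTop ℕ∞} : ContDiff ℝ n meridian := by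
  refine (PiLp.contDiff_toLp (p := 2)).comp (contDiff_pi.2 fun i => ?_)
  fin_cases i <;> simp <;> fun_prop

theorem axisSq_meridian (p : ℝ × ℝ) : axisSq (meridian p) = p.1 ^ 2 * Real.sin p.2 ^ 2 := by
  simp [axisSq, meridian]; ring

theorem norm_meridian (p : ℝ × ℝ) : ‖meridian p‖ = |p.1| := by
  rw [← Real.sqrt_sq_eq_abs, ← Real.sqrt_sq (norm_nonneg _), norm_sq_eq]
  congr 1
  simp [meridian]
  linear_combination p.1 ^ 2 * Real.sin_sq_add_cos_sq p.2

/-- The polar angle `θ`. -/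
noncomputable def polar (x : E3) : ℝ := Real.arccos (cosTheta x)

section polar

variable {x : E3}

theorem abs_cosTheta_lt_one (hx : x ∈ offAxis) : -1 < cosTheta x ∧ cosTheta x < 1 := by
  have h1 := sinTheta_sq_add hx
  have h2 := sinTheta_pos hx
  constructor <;> nlinarith

theorem cos_polar (hx : x ∈ offAxis) : Real.cos (polar x) = cosTheta x :=
  Real.cos_arccos (abs_cosTheta_lt_one hx).1.le (abs_cosTheta_lt_one hx).2.le

theorem sin_polar (hx : x ∈ offAxis) : Real.sin (polar x) = sinTheta x := by
  rw [polar, Real.sin_arccos, ← sinTheta_sq_add hx, add_sub_cancel_right,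
    Real.sqrt_sq (sinTheta_pos hx).le]

theorem polar_mem (hx : x ∈ offAxis) : 0 < polar x ∧ polar x < Real.pi := by
  refine ⟨Real.arccos_pos.2 (abs_cosTheta_lt_one hx).2, lt_of_le_of_ne (Real.arccos_le_pi _) ?_⟩
  intro h
  have := sin_polar hx
  rw [show polar x = Real.pi from h, Real.sin_pi] at this
  exact (sinTheta_pos hx).ne this

theorem hasD_polar (hx : x ∈ offAxis) : HasD (eR x) polar 0 x ∧ HasD (eT x) polar 1 x := by
  obtain ⟨h1, h2⟩ := abs_cosTheta_lt_one hx
  have hT := Real.hasDerivAt_arccos h1.ne' h2.ne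
  have hs := (sinTheta_pos hx).ne'
  have e : Real.sqrt (1 - cosTheta x ^ 2) = sinTheta x := by
    rw [← sinTheta_sq_add hx, add_sub_cancel_right, Real.sqrt_sq (sinTheta_pos hx).le]
  refine ⟨(HasD.comp hT (hasD_cosTheta hx).1).congr_d (by simp),
    (HasD.comp hT (hasD_cosTheta hx).2.1).congr_d ?_⟩
  rw [e]; field_simp

theorem SmoothOff.polar {n : WithTop ℕ∞} : SmoothOff n polar := fun x hx =>
  (Real.contDiffAt_arccos (abs_cosTheta_lt_one hx).1.ne' (abs_cosTheta_lt_one hx).2.ne).comp x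
    (SmoothOff.cosTheta x hx)

theorem norm_meridian_polar : ‖meridian (‖x‖, polar x)‖ = ‖x‖ := by
  rw [norm_meridian, abs_of_nonneg (norm_nonneg x)]

theorem meridian_polar_two (hx : x ∈ offAxis) : meridian (‖x‖, polar x) 2 = x 2 := by
  rw [coord_two_eq hx, ← cos_polar hx]; rfl

theorem IsPhiIndependent.meridian_polar {v : E3 → ℝ} (hv : IsPhiIndependent v) (hx : x ∈ offAxis) :
    v (meridian (‖x‖, polar x)) = v x :=
  hv _ _ norm_meridian_polar (meridian_polar_two hx)

end polar

theorem sinTheta_eq_of {x y : E3} (h1 : ‖x‖ = ‖y‖) (h2 : x 2 = y 2) : sinTheta x = sinTheta y := by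
  rw [sinTheta, sinTheta, axisDist_eq, axisDist_eq, axisSq_eq, axisSq_eq, h1, h2]

theorem cosTheta_eq_of {x y : E3} (h1 : ‖x‖ = ‖y‖) (h2 : x 2 = y 2) : cosTheta x = cosTheta y := by
  rw [cosTheta, cosTheta, h1, h2]

theorem HasD.comp₂ {G : ℝ × ℝ → ℝ} {f g : E3 → ℝ} {e x : E3} {d d' : ℝ}
    (hG : DifferentiableAt ℝ G (f x, g x)) (hf : HasD e f d x) (hg : HasD e g d' x) :
    HasD e (fun y => G (f y, g y)) (fderiv ℝ G (f x, g x) (d, d')) x := by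
  have h := hG.hasFDerivAt.comp x (hf.1.hasFDerivAt.prodMk hg.1.hasFDerivAt)
  refine (HasD.of_hasFDerivAt (e := e) h).congr_d ?_
  rw [← hf.2, ← hg.2]
  rfl

/-- `f` vanishes outside `{δ ≤ x₀² + x₁², ‖x‖ ≤ R}`. -/
def SuppIn (δ R : ℝ) (f : E3 → ℝ) : Prop := ∀ x, f x ≠ 0 → δ ≤ axisSq x ∧ ‖x‖ ≤ R

theorem SuppIn.of_eq_zero {δ R : ℝ} {f g : E3 → ℝ} (hf : SuppIn δ R f)
    (h : ∀ x, f x = 0 → g x = 0) : SuppIn δ R g := fun x hx => hf x fun h0 => hx (h x h0)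

theorem SuppIn.eventually {δ R : ℝ} {f : E3 → ℝ} (hf : SuppIn δ R f) {x : E3}
    (hx : axisSq x < δ ∨ R < ‖x‖) : f =ᶠ[𝓝 x] fun _ => 0 := by
  rcases hx with h | h
  · have ho : IsOpen {y : E3 | axisSq y < δ} :=
      isOpen_lt (contDiff_axisSq (n := 0)).continuous continuous_const
    filter_upwards [ho.mem_nhds h] with y hy
    by_contra hne
    exact absurd (hf y hne).1 (not_le.2 hy)
  · have ho : IsOpen {y : E3 | R < ‖y‖} := isOpen_lt continuous_const continuous_norm
    filter_upwards [ho.mem_nhds h] with y hy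
    by_contra hne
    exact absurd (hf y hne).2 (not_le.2 hy)

theorem SuppIn.fderiv_eq_zero {δ R : ℝ} {f : E3 → ℝ} (hf : SuppIn δ R f) {x : E3}
    (hx : axisSq x < δ ∨ R < ‖x‖) : fderiv ℝ f x = 0 := by
  rw [(hf.eventually hx).fderiv_eq]; simp

theorem SuppIn.dir {δ R : ℝ} {f : E3 → ℝ} (hf : SuppIn δ R f) (e : E3 → E3) :
    SuppIn δ R fun x => fderiv ℝ f x (e x) := fun x hx => by
  by_contra hn
  refine hx ?_
  have : axisSq x < δ ∨ R < ‖x‖ := by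
    by_contra h
    push Not at h
    exact hn h
  simp [hf.fderiv_eq_zero this]

/-- The integrand of `meridianInt`. -/
noncomputable def meridianFun (k : ℕ) (v : E3 → ℝ) (p : ℝ × ℝ) : ℝ :=
  ((1 + Real.cos p.2) / Real.sin p.2) ^ k * v (meridian p)

theorem meridianFun_eq_zero {k : ℕ} {v : E3 → ℝ} {δ R : ℝ} (hv : SuppIn δ R v) {p : ℝ × ℝ}
    (hp : p.1 ^ 2 * Real.sin p.2 ^ 2 < δ ∨ R < |p.1|) : meridianFun k v p = 0 := by
  rw [meridianFun]
  have : v (meridian p) = 0 := by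
    by_contra hne
    have := hv _ hne
    rw [axisSq_meridian, norm_meridian] at this
    rcases hp with h | h
    · exact absurd this.1 (not_le.2 h)
    · exact absurd this.2 (not_le.2 h)
  rw [this, mul_zero]

theorem contDiff_meridianFun (k : ℕ) {v : E3 → ℝ} (hv : IsTest v) :
    ContDiff ℝ 1 (meridianFun k v) := by
  obtain ⟨δ, R, hδ, h⟩ := CptOff.iff.1 hv.cptOff
  refine contDiff_iff_contDiffAt.2 fun p => ?_
  by_cases hp : Real.sin p.2 = 0
  · have hopen : IsOpen {p : ℝ × ℝ | p.1 ^ 2 * Real.sin p.2 ^ 2 < δ} :=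
      isOpen_lt (by fun_prop) continuous_const
    refine contDiffAt_const (c := (0 : ℝ)) |>.congr_of_eventuallyEq ?_
    filter_upwards [hopen.mem_nhds (show p.1 ^ 2 * Real.sin p.2 ^ 2 < δ by simp [hp, hδ])] with q hq
    exact meridianFun_eq_zero h (Or.inl hq)
  · have h1 : ContDiffAt ℝ 1 (fun p : ℝ × ℝ => (1 + Real.cos p.2) / Real.sin p.2) p :=
      ContDiffAt.div (by fun_prop) (by fun_prop) hp
    exact (h1.pow k).mul (hv.contDiff.comp contDiff_meridian).contDiffAt

/-- The integral of `cot (t / 2) ^ k v` over the part `θ ≤ t ≤ π` of a meridian. -/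
noncomputable def meridianInt (k : ℕ) (v : E3 → ℝ) (p : ℝ × ℝ) : ℝ :=
  ∫ t in p.2..Real.pi, meridianFun k v (p.1, t)

theorem contDiff_meridianInt (k : ℕ) {v : E3 → ℝ} (hv : IsTest v) :
    ContDiff ℝ 1 (meridianInt k v) := by
  have hψ := contDiff_meridianFun k hv
  have e : meridianInt k v = fun p => (Real.pi - p.2) *
      ∫ σ in (0 : ℝ)..1, meridianFun k v (p.1, p.2 + (Real.pi - p.2) * σ) := by
    funext p
    have := intervalIntegral.mul_integral_comp_add_mul (a := 0) (b := 1)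
      (f := fun t => meridianFun k v (p.1, t)) (Real.pi - p.2) p.2
    rw [this, meridianInt]
    simp
  rw [e]
  refine ContDiff.mul (by fun_prop) ?_
  exact contDiff_intervalIntegral (E := ℝ × ℝ)
    (G := fun q => meridianFun k v (q.1.1, q.1.2 + (Real.pi - q.1.2) * q.2))
    (hψ.comp (by fun_prop)) 0 1

theorem fderiv_meridianInt_angle (k : ℕ) {v : E3 → ℝ} (hv : IsTest v) (p : ℝ × ℝ) :
    fderiv ℝ (meridianInt k v) p (0, 1) = - meridianFun k v p := by
  have hψ := (contDiff_meridianFun k hv).continuous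
  have hd := ((contDiff_meridianInt k hv).differentiable (by norm_num) p).hasFDerivAt
  have h1 : HasDerivAt (fun t => meridianInt k v (p.1, t)) (fderiv ℝ (meridianInt k v) p (0, 1))
      p.2 := HasFDerivAt.comp_hasDerivAt (f := fun t => (p.1, t)) p.2 hd
        ((hasDerivAt_const p.2 p.1).prodMk (hasDerivAt_id p.2))
  have hc : Continuous fun t => meridianFun k v (p.1, t) := hψ.comp (by fun_prop)
  have h2 : HasDerivAt (fun t => meridianInt k v (p.1, t)) (- meridianFun k v p) p.2 :=
    intervalIntegral.integral_hasDerivAt_left (hc.intervalIntegrable _ _)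
      (hc.stronglyMeasurableAtFilter _ _) hc.continuousAt
  exact h1.unique h2

theorem fderiv_meridianFun_radius (k : ℕ) {v : E3 → ℝ} (hv : IsTest v) {p : ℝ × ℝ} (hp : 0 < p.1) :
    fderiv ℝ (fun r => meridianFun k v (r, p.2)) p.1 1 = meridianFun k (Dr v) p := by
  have h1 : HasDerivAt (fun r => meridian (r, p.2)) (eR (meridian p)) p.1 := by
    have hn : ‖meridian p‖ = p.1 := by rw [norm_meridian, abs_of_pos hp]
    rw [hasDerivAt_iff_hasFDerivAt]
    have := hp.ne'
    refine HasDerivAt.hasFDerivAt ?_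
    have h2 : HasDerivAt (fun r : ℝ => (![r * Real.sin p.2, 0, r * Real.cos p.2] : Fin 3 → ℝ))
        ![Real.sin p.2, 0, Real.cos p.2] p.1 := by
      rw [hasDerivAt_pi]
      intro i
      fin_cases i
      · simpa using (hasDerivAt_id p.1).mul_const (Real.sin p.2)
      · simpa using hasDerivAt_const p.1 (0 : ℝ)
      · simpa using (hasDerivAt_id p.1).mul_const (Real.cos p.2)
    have e : eR (meridian p) = WithLp.toLp 2 (![Real.sin p.2, 0, Real.cos p.2] : Fin 3 → ℝ) := by
      ext i
      simp only [eR, nVec, hn]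
      fin_cases i <;> simp [meridian] <;> field_simp
    rw [e]
    exact ((PiLp.continuousLinearEquiv 2 ℝ (fun _ : Fin 3 => ℝ)).symm.toContinuousLinearMap.hasFDerivAt).comp_hasDerivAt
      p.1 h2
  have h3 : HasDerivAt (fun r => v (meridian (r, p.2))) (Dr v (meridian p)) p.1 :=
    HasFDerivAt.comp_hasDerivAt (f := fun r => meridian (r, p.2)) p.1
      (hv.contDiff.differentiable (by norm_num) (meridian p)).hasFDerivAt h1
  have h4 := h3.const_mul (((1 + Real.cos p.2) / Real.sin p.2) ^ k)
  rw [meridianFun, ← h4.deriv, ← fderiv_apply_one_eq_deriv]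
  rfl

theorem fderiv_meridianInt_radius (k : ℕ) {v : E3 → ℝ} (hv : IsTest v) {p : ℝ × ℝ} (hp : 0 < p.1) :
    fderiv ℝ (meridianInt k v) p (1, 0) = meridianInt k (Dr v) p := by
  have hd := ((contDiff_meridianInt k hv).differentiable (by norm_num) p).hasFDerivAt
  have h1 : HasDerivAt (fun r => meridianInt k v (r, p.2)) (fderiv ℝ (meridianInt k v) p (1, 0))
      p.1 := HasFDerivAt.comp_hasDerivAt (f := fun r => (r, p.2)) p.1 hd
        ((hasDerivAt_id p.1).prodMk (hasDerivAt_const p.1 p.2))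
  rw [← h1.deriv, ← fderiv_apply_one_eq_deriv]
  have h2 := fderiv_intervalIntegral (contDiff_meridianFun k hv) p.2 Real.pi p.1 1
  rw [show (fun r => meridianInt k v (r, p.2))
    = fun r => ∫ α in p.2..Real.pi, meridianFun k v (r, α) from rfl, h2, meridianInt]
  exact intervalIntegral.integral_congr fun t _ => fderiv_meridianFun_radius k hv (p := (p.1, t)) hp

/-- `tan (θ / 2)`. -/
noncomputable def tanHalf (x : E3) : ℝ := sinTheta x / (1 + cosTheta x)

section tanHalf

variable {x : E3}

theorem one_add_cosTheta_pos (hx : x ∈ offAxis) : 0 < 1 + cosTheta x := by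
  linarith [(abs_cosTheta_lt_one hx).1]

theorem tanHalf_pos (hx : x ∈ offAxis) : 0 < tanHalf x :=
  div_pos (sinTheta_pos hx) (one_add_cosTheta_pos hx)

theorem sinTheta_eq_tanHalf (hx : x ∈ offAxis) :
    sinTheta x = 2 * tanHalf x / (1 + tanHalf x ^ 2) := by
  have h1 := sinTheta_sq_add hx
  have h2 := one_add_cosTheta_pos hx
  have h3 : (1 + cosTheta x) ^ 2 + sinTheta x ^ 2 = 2 * (1 + cosTheta x) := by
    linear_combination h1
  have h4 : 1 + tanHalf x ^ 2 = 2 / (1 + cosTheta x) := by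
    rw [tanHalf, div_pow, eq_div_iff h2.ne']
    field_simp
    linear_combination h3
  rw [h4, tanHalf]
  field_simp

theorem cosTheta_eq_tanHalf (hx : x ∈ offAxis) :
    cosTheta x = (1 - tanHalf x ^ 2) / (1 + tanHalf x ^ 2) := by
  have h2 := one_add_cosTheta_pos hx
  have h5 : sinTheta x = tanHalf x * (1 + cosTheta x) := by rw [tanHalf]; field_simp
  have h6 := sinTheta_eq_tanHalf hx
  have ht := tanHalf_pos hx
  rw [h5] at h6
  field_simp at h6 ⊢
  linear_combination h6

theorem hasD_tanHalf (hx : x ∈ offAxis) :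
    HasD (eR x) tanHalf 0 x ∧ HasD (eT x) tanHalf (cscTheta x * tanHalf x) x := by
  have h2 := (one_add_cosTheta_pos hx).ne'
  have hs := (sinTheta_pos hx).ne'
  refine ⟨((hasD_sinTheta hx).1.div ((HasD.const 1).add (hasD_cosTheta hx).1) h2).congr_d (by simp),
    ((hasD_sinTheta hx).2.1.div ((HasD.const 1).add (hasD_cosTheta hx).2.1) h2).congr_d ?_⟩
  rw [cscTheta, tanHalf]
  field_simp
  linear_combination sinTheta_sq_add hx

theorem SmoothOff.tanHalf {n : WithTop ℕ∞} : SmoothOff n tanHalf :=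
  SmoothOff.sinTheta.div ((SmoothOff.const 1).add .cosTheta) fun _ hx => (one_add_cosTheta_pos hx).ne'

end tanHalf

/-- The solution of `∂_θ A = k csc θ A + v` that vanishes near `θ = π`. -/
noncomputable def pot (k : ℕ) (v : E3 → ℝ) (x : E3) : ℝ :=
  -(tanHalf x ^ k * meridianInt k v (‖x‖, polar x))

theorem smoothOff_pot (k : ℕ) {v : E3 → ℝ} (hv : IsTest v) : SmoothOff 1 (pot k v) :=
  ((SmoothOff.tanHalf.pow k).mul fun x hx => (contDiff_meridianInt k hv).contDiffAt.comp x
    ((SmoothOff.norm x hx).prodMk (SmoothOff.polar x hx))).neg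

theorem isPhiIndependent_pot (k : ℕ) (v : E3 → ℝ) : IsPhiIndependent (pot k v) :=
    fun x y h1 h2 => by
  rw [pot, pot, tanHalf, tanHalf, polar, polar, sinTheta_eq_of h1 h2, cosTheta_eq_of h1 h2, h1]

theorem hasD_pot_angle (k : ℕ) {v : E3 → ℝ} (hv : IsTest v) (pv : IsPhiIndependent v) {x : E3}
    (hx : x ∈ offAxis) : HasD (eT x) (pot k v) (k * cscTheta x * pot k v x + v x) x := by
  have h1 := HasD.comp₂ ((contDiff_meridianInt k hv).differentiable (by norm_num) _)
    (hasD_norm_frame hx).2.1 (hasD_polar hx).2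
  rw [fderiv_meridianInt_angle k hv] at h1
  refine ((((hasD_tanHalf hx).2.pow k).mul h1).neg).congr_d ?_
  have hs := (sinTheta_pos hx).ne'
  have h2 := (one_add_cosTheta_pos hx).ne'
  have e : tanHalf x ^ k * meridianFun k v (‖x‖, polar x) = v x := by
    rw [meridianFun, pv.meridian_polar hx, cos_polar hx, sin_polar hx, ← mul_assoc, ← mul_pow,
      tanHalf]
    field_simp
    simp
  have e2 : (k : ℝ) * tanHalf x ^ (k - 1) * (cscTheta x * tanHalf x)
      = k * cscTheta x * tanHalf x ^ k := by
    cases k with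
    | zero => simp
    | succ n => simp [pow_succ]; ring
  rw [pot]
  linear_combination e - meridianInt k v (‖x‖, polar x) * e2

theorem hasD_pot_radius (k : ℕ) {v : E3 → ℝ} (hv : IsTest v) {x : E3}
    (hx : x ∈ offAxis) : HasD (eR x) (pot k v) (pot k (Dr v) x) x := by
  have h1 := HasD.comp₂ ((contDiff_meridianInt k hv).differentiable (by norm_num) _)
    (hasD_norm_frame hx).1 (hasD_polar hx).1
  rw [fderiv_meridianInt_radius k hv (norm_pos_of_mem_offAxis hx)] at h1
  refine ((((hasD_tanHalf hx).1.pow k).mul h1).neg).congr_d ?_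
  rw [pot]
  ring

/-- Near the axis, `pot k v` is a multiple of `tan (θ / 2) ^ k`. -/
theorem exists_pot_eq (k : ℕ) {v : E3 → ℝ} (hv : IsTest v) {δ R : ℝ} (h : SuppIn δ R v) :
    ∃ M, ∀ x ∈ offAxis, axisSq x < δ → ∃ α, |α| ≤ M ∧ pot k v x = α * tanHalf x ^ k ∧
      (cosTheta x ≤ 0 → α = 0) := by
  have hψ := contDiff_meridianFun k hv
  have hc : Continuous fun r : ℝ => meridianInt k v (r, 0) :=
    (contDiff_meridianInt k hv).continuous.comp (by fun_prop)
  obtain ⟨M, hM⟩ := (isCompact_Icc (a := 0) (b := R)).exists_bound_of_continuousOn hc.continuousOn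
  refine ⟨max M 0, fun x hx hδ => ?_⟩
  have hr := norm_pos_of_mem_offAxis hx
  obtain ⟨p0, p1⟩ := polar_mem hx
  have hs := sin_polar hx
  have hs0 := sinTheta_pos hx
  have hsq : ‖x‖ ^ 2 * sinTheta x ^ 2 = axisSq x := by
    rw [← mul_pow, ← axisDist_eq_mul hx]
    exact Real.sq_sqrt (le_of_lt hx)
  have hzero : ∀ t, 0 ≤ Real.sin t → Real.sin t ≤ sinTheta x → meridianFun k v (‖x‖, t) = 0 :=
    fun t h0 h1 => by
      refine meridianFun_eq_zero h (Or.inl (lt_of_le_of_lt ?_ hδ))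
      rw [← hsq]
      exact mul_le_mul_of_nonneg_left (pow_le_pow_left₀ h0 h1 2) (by positivity)
  have hcos := cos_polar hx
  by_cases hc0 : cosTheta x ≤ 0
  · refine ⟨0, by simp, ?_, fun _ => rfl⟩
    have hp2 : Real.pi / 2 ≤ polar x := by
      by_contra hlt
      have := Real.cos_pos_of_mem_Ioo (x := polar x) ⟨by linarith, by linarith⟩
      rw [hcos] at this
      linarith
    have : meridianInt k v (‖x‖, polar x) = 0 := by
      rw [meridianInt]
      refine intervalIntegral.integral_zero_ae (ae_of_all _ fun t ht => ?_)
      rw [Set.uIoc_of_le p1.le] at ht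
      refine hzero t (Real.sin_nonneg_of_nonneg_of_le_pi (by linarith [ht.1]) ht.2) ?_
      rw [← hs, ← Real.sin_pi_sub t, ← Real.sin_pi_sub (polar x)]
      exact Real.sin_le_sin_of_le_of_le_pi_div_two (by linarith [ht.2]) (by linarith)
        (by linarith [ht.1])
    rw [pot, this]; simp
  · push Not at hc0
    have hp2 : polar x ≤ Real.pi / 2 := Real.arccos_le_pi_div_two.2 hc0.le
    have e : meridianInt k v (‖x‖, 0) = meridianInt k v (‖x‖, polar x) := by
      have hcc : Continuous fun t => meridianFun k v (‖x‖, t) := hψ.continuous.comp (by fun_prop)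
      rw [meridianInt, meridianInt, ← intervalIntegral.integral_add_adjacent_intervals
        (hcc.intervalIntegrable 0 (polar x)) (hcc.intervalIntegrable (polar x) Real.pi)]
      simp only [add_eq_right]
      refine intervalIntegral.integral_zero_ae (ae_of_all _ fun t ht => ?_)
      rw [Set.uIoc_of_le p0.le] at ht
      refine hzero t (Real.sin_nonneg_of_nonneg_of_le_pi ht.1.le (by linarith [ht.2])) ?_
      rw [← hs]
      exact Real.sin_le_sin_of_le_of_le_pi_div_two (by linarith [ht.1]) hp2 ht.2
    refine ⟨- meridianInt k v (‖x‖, 0), ?_, ?_, fun hh => absurd hc0 (not_lt.2 hh)⟩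
    · rw [abs_neg]
      by_cases hR : R < ‖x‖
      · have hz : ∀ t, meridianFun k v (‖x‖, t) = 0 := fun t =>
          meridianFun_eq_zero h (Or.inr (by simpa using hR))
        simp [meridianInt, hz]
      · exact (hM _ ⟨norm_nonneg _, not_lt.1 hR⟩).trans (le_max_left _ _)
    · rw [e, pot]; ring

theorem pot_eq_zero (k : ℕ) {v : E3 → ℝ} {δ R : ℝ} (h : SuppIn δ R v) {x : E3}
    (hx : ‖x‖ ^ 2 < δ ∨ R < ‖x‖) : pot k v x = 0 := by
  have : ∀ t, meridianFun k v (‖x‖, t) = 0 := fun t => by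
    refine meridianFun_eq_zero h ?_
    rcases hx with hh | hh
    · refine Or.inl (lt_of_le_of_lt ?_ hh)
      exact mul_le_of_le_one_right (by positivity) (Real.sin_sq_le_one t)
    · exact Or.inr (by simpa using hh)
  simp [pot, meridianInt, this]

/-! ### The radial derivative of a `φ`-independent test function -/

theorem IsPhiIndependent.Dr {v : E3 → ℝ} (hv : IsTest v) (pv : IsPhiIndependent v) :
    IsPhiIndependent (Dr v) := fun x y h1 h2 => by
  have hpi : (2 * Real.pi) ≠ 0 := by positivity
  have e : angInt (fun _ => 1) v = v := funext fun z => by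
    simp only [angInt, fun α => pv.axisPoint α z, one_mul, intervalIntegral.integral_const,
      sub_zero, smul_eq_mul]
    field_simp
  by_cases hx : x ∈ offAxis
  · have hy : y ∈ offAxis := by
      have : 0 < axisSq x := hx
      rw [axisSq_eq, h1, h2, ← axisSq_eq] at this
      exact this
    rw [← e, Dr_angInt contDiff_const hv hx, Dr_angInt contDiff_const hv hy]
    exact isPhiIndependent_angInt _ _ x y h1 h2
  · have hx0 : axisSq x = 0 := le_antisymm (not_lt.1 hx) (axisSq_nonneg x)
    have hy0 : axisSq y = 0 := by rw [axisSq_eq, ← h1, ← h2, ← axisSq_eq, hx0]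
    obtain ⟨δ, R, hδ, h⟩ := CptOff.iff.1 hv.cptOff
    rw [MeltingHedgehog.Dr, MeltingHedgehog.Dr,
      SuppIn.fderiv_eq_zero h (Or.inl (by rw [hx0]; exact hδ)),
      SuppIn.fderiv_eq_zero h (Or.inl (by rw [hy0]; exact hδ))]
    rfl

theorem isTest_Dr {v : E3 → ℝ} (hv : IsTest v) (sv : SmoothOff 2 v) : IsTest (Dr v) :=
  hv.cptOff.Dr.isTest (sv.Dr (by norm_num))

/-! ### The transformation between the modes `k` and `-k` -/

/-- The derivatives along the meridian through `x` of the potentials `A`, `B`, `C` of `v₂`,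
`csc θ v₄`, `cot θ v₄`. -/
structure PotAt (k : ℝ) (v₂ v₄ A B C : E3 → ℝ) (x : E3) : Prop where
  A : HasD (eT x) A (k * cscTheta x * A x + v₂ x) x
  B : HasD (eT x) B (k * cscTheta x * B x + cscTheta x * v₄ x) x
  C : HasD (eT x) C (k * cscTheta x * C x + cotTheta x * v₄ x) x

/-- The component `v₂'` on the mode `-k` for which the energies of the modes `k` and `-k` agree;
here `A` is the potential of `v₂`. -/
noncomputable def conjTwo (k : ℝ) (v₂ A : E3 → ℝ) (x : E3) : ℝ := v₂ x + 2 * k * (cscTheta x * A x)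

/-- The component `v₄'` on the mode `-k` for which the energies of the modes `k` and `-k` agree;
here `B` and `C` are the potentials of `csc θ v₄` and `cot θ v₄`. -/
noncomputable def conjFour (k : ℝ) (v₄ B C : E3 → ℝ) (x : E3) : ℝ :=
  v₄ x + 4 * k * B x
    + 4 * k * (cscTheta x * (k * cscTheta x - cotTheta x) * (C x - cosTheta x * B x))

/-- A primitive of `sin θ ((conjFour k v₄ B C)² - v₄²)` along meridians. -/
noncomputable def primFour (k : ℝ) (v₄ B C : E3 → ℝ) (x : E3) : ℝ :=
  sinTheta x * (sinTheta x * B x + 2 * k * (cscTheta x * (C x - cosTheta x * B x)))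
      * conjFour k v₄ B C x
    - sinTheta x * (sinTheta x * B x) * v₄ x
    - 2 * k * ((C x - cosTheta x * B x) * (v₄ x + 2 * k * B x + 2 * C x))

/-- The boundary terms of the angular energy of the mode `k`. -/
noncomputable def angBoundary (k : ℝ) (v₀ v₂ v₄ : E3 → ℝ) (x : E3) : ℝ :=
  -((cosTheta x + k) * (v₂ x * v₂ x)) - 2 * (sinTheta x * (v₂ x * v₄ x))
    - (2 * cosTheta x + k) * (v₄ x * v₄ x) - k / 3 * (v₀ x * v₀ x)
    + 2 * (sinTheta x * (v₀ x * v₂ x))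

/-- A primitive along meridians of `sin θ` times the difference of the angular energies of the
modes `-k` and `k`. -/
noncomputable def primAng (k : ℝ) (v₀ v₂ v₄ A B C : E3 → ℝ) (x : E3) : ℝ :=
  angBoundary (-k) v₀ (conjTwo k v₂ A) (conjFour k v₄ B C) x - angBoundary k v₀ v₂ v₄ x
    + 2 * k * ((2 * A x + (v₄ x + 2 * k * B x + 2 * C x))
      * (2 * A x + (v₄ x + 2 * k * B x + 2 * C x)))

section prim

variable {k : ℝ} {v₀ v₂ v₄ A B C : E3 → ℝ} {x : E3}

theorem hasD_cscTheta (hx : x ∈ offAxis) : HasD (eT x) cscTheta (-(cscTheta x * cotTheta x)) x :=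
  ((HasD.const 1).div (hasD_sinTheta hx).2.1 (sinTheta_pos hx).ne').congr_d (by
    rw [cscTheta, cotTheta]; have := (sinTheta_pos hx).ne'; field_simp; ring)

theorem hasD_cotTheta (hx : x ∈ offAxis) : HasD (eT x) cotTheta (-(cscTheta x ^ 2)) x :=
  ((hasD_cosTheta hx).2.1.div (hasD_sinTheta hx).2.1 (sinTheta_pos hx).ne').congr_d (by
    rw [cscTheta]; have := (sinTheta_pos hx).ne'; field_simp
    linear_combination -sinTheta_sq_add hx)

theorem hasD_conjTwo (hx : x ∈ offAxis) (h : PotAt k v₂ v₄ A B C x) {d₂ : ℝ}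
    (h2 : HasD (eT x) v₂ d₂ x) : HasD (eT x) (conjTwo k v₂ A)
      (d₂ + 2 * k * (cscTheta x * ((k * cscTheta x - cotTheta x) * A x + v₂ x))) x :=
  (h2.add (((hasD_cscTheta hx).mul h.A).const_mul (2 * k))).congr_d (by ring)

theorem hasD_conjFour (hx : x ∈ offAxis) (h : PotAt k v₂ v₄ A B C x) {d₄ : ℝ}
    (h4 : HasD (eT x) v₄ d₄ x) : HasD (eT x) (conjFour k v₄ B C)
      (d₄ + 4 * k * (k * cscTheta x * B x + cscTheta x * v₄ x)
        + 4 * k * ((-(cscTheta x * cotTheta x) * (k * cscTheta x - cotTheta x)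
            + cscTheta x * (cscTheta x ^ 2 - k * (cscTheta x * cotTheta x)))
              * (C x - cosTheta x * B x)
          + cscTheta x * (k * cscTheta x - cotTheta x)
            * (k * cscTheta x * (C x - cosTheta x * B x) + sinTheta x * B x))) x := by
  refine (((h4.add (h.B.const_mul (4 * k))).add ((((hasD_cscTheta hx).mul
    (((hasD_cscTheta hx).const_mul k).sub (hasD_cotTheta hx))).mul
    (h.C.sub ((hasD_cosTheta hx).2.1.mul h.B))).const_mul (4 * k)))).congr_d ?_
  have hs := (sinTheta_pos hx).ne'
  simp only [cscTheta, cotTheta]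
  field_simp
  ring

theorem hasD_primTwo (hx : x ∈ offAxis) (h : PotAt k v₂ v₄ A B C x) :
    HasD (eT x) (fun y => 2 * k * (A y * A y))
      (sinTheta x * (conjTwo k v₂ A x ^ 2 - v₂ x ^ 2)) x :=
  ((h.A.mul h.A).const_mul (2 * k)).congr_d (by
    have hs := (sinTheta_pos hx).ne'
    simp only [conjTwo, cscTheta]; field_simp; ring)

theorem hasD_primFour (hx : x ∈ offAxis) (h : PotAt k v₂ v₄ A B C x) {d₄ : ℝ}
    (h4 : HasD (eT x) v₄ d₄ x) :
    HasD (eT x) (primFour k v₄ B C) (sinTheta x * (conjFour k v₄ B C x ^ 2 - v₄ x ^ 2)) x := by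
  have ds := (hasD_sinTheta hx).2.1
  have dh := h.C.sub ((hasD_cosTheta hx).2.1.mul h.B)
  have hd := (((ds.mul ((ds.mul h.B).add (((hasD_cscTheta hx).mul dh).const_mul (2 * k)))).mul
    (hasD_conjFour hx h h4)).sub ((ds.mul (ds.mul h.B)).mul h4)).sub
    ((dh.mul ((h4.add (h.B.const_mul (2 * k))).add (h.C.const_mul 2))).const_mul (2 * k))
  refine HasD.congr_d hd ?_
  have ht := (tanHalf_pos hx).ne'
  simp only [conjFour, cscTheta, cotTheta]
  rw [sinTheta_eq_tanHalf hx, cosTheta_eq_tanHalf hx]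
  field_simp
  ring

theorem hasD_angBoundary (hx : x ∈ offAxis) {d₀ d₂ d₄ : ℝ} (h0 : HasD (eT x) v₀ d₀ x)
    (h2 : HasD (eT x) v₂ d₂ x) (h4 : HasD (eT x) v₄ d₄ x) :
    HasD (eT x) (angBoundary k v₀ v₂ v₄)
      (sinTheta x * v₂ x ^ 2 - 2 * (cosTheta x + k) * (v₂ x * d₂)
        - 2 * (cosTheta x * (v₂ x * v₄ x) + sinTheta x * (d₂ * v₄ x + v₂ x * d₄))
        + 2 * sinTheta x * v₄ x ^ 2 - 2 * (2 * cosTheta x + k) * (v₄ x * d₄)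
        - 2 * k / 3 * (v₀ x * d₀)
        + 2 * (cosTheta x * (v₀ x * v₂ x) + sinTheta x * (d₀ * v₂ x + v₀ x * d₂))) x := by
  have ds := (hasD_sinTheta hx).2.1
  have dc := (hasD_cosTheta hx).2.1
  refine ((((((dc.add (.const k)).mul (h2.mul h2)).neg.sub ((ds.mul (h2.mul h4)).const_mul 2)).sub
    (((dc.const_mul 2).add (.const k)).mul (h4.mul h4))).sub ((h0.mul h0).const_mul (k / 3))).add
    ((ds.mul (h0.mul h2)).const_mul 2)).congr_d ?_
  ring

theorem hasD_primAng (hx : x ∈ offAxis) (h : PotAt k v₂ v₄ A B C x) {d₀ d₂ d₄ : ℝ}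
    (h0 : HasD (eT x) v₀ d₀ x) (h2 : HasD (eT x) v₂ d₂ x) (h4 : HasD (eT x) v₄ d₄ x) :
    HasD (eT x) (primAng k v₀ v₂ v₄ A B C)
      (sinTheta x * (modeAng (-k) v₀ (conjTwo k v₂ A) (conjFour k v₄ B C) x
        - modeAng k v₀ v₂ v₄ x)) x := by
  have dw := (h.A.const_mul 2).add ((h4.add (h.B.const_mul (2 * k))).add (h.C.const_mul 2))
  have h2' := hasD_conjTwo hx h h2
  have h4' := hasD_conjFour hx h h4
  have hd := ((hasD_angBoundary (k := -k) hx h0 h2' h4').sub (hasD_angBoundary (k := k) hx h0 h2 h4)).add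
    ((dw.mul dw).const_mul (2 * k))
  refine HasD.congr_d hd ?_
  have e0 : Dt v₀ x = d₀ := h0.eq
  have e2 : Dt v₂ x = d₂ := h2.eq
  have e4 : Dt v₄ x = d₄ := h4.eq
  have e2' : Dt (conjTwo k v₂ A) x = _ := h2'.eq
  have e4' : Dt (conjFour k v₄ B C) x = _ := h4'.eq
  have ht := (tanHalf_pos hx).ne'
  simp only [modeAng, e0, e2, e4, e2', e4']
  simp only [conjTwo, conjFour, cscTheta, cotTheta]
  rw [sinTheta_eq_tanHalf hx, cosTheta_eq_tanHalf hx]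
  field_simp
  ring

end prim

/-! ### Cutoffs of small energy near the axis -/

/-- Cutoffs near the axis with small Dirichlet integral on a ball. -/
theorem exists_axis_cut {δ η R : ℝ} (hδ : 0 < δ) (hη : 0 < η) (hR : 0 ≤ R) :
    ∃ χ : E3 → ℝ, ContDiff ℝ 1 χ ∧ (∀ x, 0 ≤ χ x ∧ χ x ≤ 1) ∧ IsPhiIndependent χ ∧
      (∃ ε, 0 < ε ∧ ∀ x, axisSq x < ε → χ x = 0) ∧ (∀ x, δ ≤ axisSq x → χ x = 1) ∧
      ∫ x in Metric.closedBall 0 R, ∑ i, pd i χ x ^ 2 ≤ η := by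
  obtain ⟨K, hK0, hK⟩ := exists_bound_deriv_smoothTransition
  set B := Metric.closedBall (0 : E3) R
  let one : E3 → ℝ := B.indicator fun _ => 1
  have hone : ∀ x, one x = 0 ∨ one x = 1 := fun x => by
    by_cases hx : x ∈ B
    · exact Or.inr (Set.indicator_of_mem hx _)
    · exact Or.inl (Set.indicator_of_notMem hx _)
  have hmem : MemLp one 2 volume :=
    memLp_indicator_const 2 Metric.isClosed_closedBall.measurableSet 1
    (Or.inr measure_closedBall_lt_top.ne)
  have hlim := IntTendsto.sum Finset.univ fun i _ => (l2Tendsto_pd_axisCutAvg_mul hmem (M := 1)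
    (fun x => by rcases hone x with h | h <;> simp [h]) hR (fun x hx =>
      Set.indicator_of_notMem (by simpa [B] using hx) _) i).sq
  have h0 := hlim.tendsto
  simp only [ne_eq, OfNat.ofNat_ne_zero, not_false_eq_true, zero_pow, Finset.sum_const_zero,
    integral_zero] at h0
  have ev1 : ∀ᶠ N in atTop, (2 * K) ^ 2 *
      ∫ x, ∑ i, (pd i (axisCutAvg N) x * one x) ^ 2 ≤ η := by
    have := h0.const_mul ((2 * K) ^ 2)
    rw [mul_zero] at this
    exact (this.eventually (gt_mem_nhds hη)).mono fun N h => h.le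
  -- `axisCutAvg N` increases with the distance to the axis, so that it exceeds `1 / 2` on
  -- `δ ≤ axisSq` if it does so at one point with `axisSq = δ`; a step function then makes it `1`
  let y : E3 := !₂[Real.sqrt δ, 0, 0]
  have hy : axisSq y = δ := by simp [axisSq, y, Real.sq_sqrt hδ.le]
  have ev2 : ∀ᶠ N in atTop, 1 / 2 < axisCutAvg N y :=
    (tendsto_axisCutAvg (x := y) (by rw [offAxis, Set.mem_ofPred_eq, hy]; exact hδ)).eventually
      (lt_mem_nhds (by norm_num))
  obtain ⟨N, hN1, hN2⟩ := (ev1.and ev2).exists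
  have hs : ContDiff ℝ ∞ fun x => 2 * axisCutAvg N x := contDiff_const.mul (contDiff_axisCutAvg N)
  refine ⟨fun x => Real.smoothTransition (2 * axisCutAvg N x), ?_, fun x =>
    ⟨Real.smoothTransition.nonneg _, Real.smoothTransition.le_one _⟩, fun x y h1 h2 => ?_,
    ⟨(4 ^ N)⁻¹, by positivity, fun x hx => ?_⟩, fun x hx => ?_, ?_⟩
  · exact (Real.smoothTransition.contDiff.comp hs).of_le (by exact_mod_cast le_top)
  · simp only [axisCutAvg, axisCut, axisSq_eq, h1, h2]
  · have : (4 : ℝ) ^ N * axisSq x ≤ 1 := by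
      rw [← le_div_iff₀' (by positivity), one_div]; exact hx.le
    simp only [axisCutAvg_eq_zero this, mul_zero, Real.smoothTransition.zero]
  · refine Real.smoothTransition.one_of_one_le ?_
    have : axisCutAvg N y ≤ axisCutAvg N x := by
      refine mul_le_mul_of_nonneg_left (Finset.sum_le_sum fun j _ => ?_) (by positivity)
      refine Real.smoothTransition.monotone ?_
      rw [hy]
      gcongr
    linarith
  · have e : ∀ i x, pd i (fun x => Real.smoothTransition (2 * axisCutAvg N x)) x
        = deriv Real.smoothTransition (2 * axisCutAvg N x) * (2 * pd i (axisCutAvg N) x) := by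
      intro i x
      rw [pd_comp (Real.smoothTransition.contDiff.differentiable (n := 1) (by norm_num))
        (hs.differentiable (by norm_num)) i x]
      congr 1
      rw [pd, fderiv_const_mul ((contDiff_axisCutAvg N).differentiable (by norm_num) x)]
      simp [pd]
    rw [← integral_indicator Metric.isClosed_closedBall.measurableSet]
    refine le_trans ?_ hN1
    rw [← integral_const_mul]
    refine integral_mono_of_nonneg (ae_of_all _ fun x => Set.indicator_nonneg
      (fun z _ => Finset.sum_nonneg fun i _ => sq_nonneg _) x) ((hlim.int N).const_mul _)
      (ae_of_all _ fun x => ?_)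
    by_cases hx : x ∈ B
    · simp only [one, Set.indicator_of_mem hx, mul_one, e]
      rw [show (Metric.closedBall (0 : E3) R) = B from rfl, Set.indicator_of_mem hx, Finset.mul_sum]
      refine Finset.sum_le_sum fun i _ => ?_
      have h1 : deriv Real.smoothTransition (2 * axisCutAvg N x) ^ 2 ≤ K ^ 2 :=
        sq_le_sq' (by linarith [(abs_le.1 (hK (2 * axisCutAvg N x)).1).1])
          (abs_le.1 (hK (2 * axisCutAvg N x)).1).2
      nlinarith [sq_nonneg (pd i (axisCutAvg N) x)]
    · rw [show (Metric.closedBall (0 : E3) R) = B from rfl, Set.indicator_of_notMem hx]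
      positivity

/-! ### Behaviour of the transformed components near the axis -/

/-- Closed forms of the transformed components, of their derivatives along meridians and of the
primitives at points near the axis, where `v₀`, `v₂`, `v₄` vanish and the potentials are the
multiples `α`, `β`, `γ` of `tan (θ / 2) ^ k`. They are continuous functions `F i` of `α`, `β`, `γ`
and `tan (θ / 2)`, hence bounded as `θ → 0`. -/
theorem exists_nearAxis_forms {k : ℕ} (hk : k = 1 ∨ k = 2) :
    ∃ F : Fin 7 → ℝ × ℝ × ℝ × ℝ → ℝ, (∀ i, Continuous (F i)) ∧ (∀ i t, F i (0, 0, 0, t) = 0) ∧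
      ∀ (v₀ v₂ v₄ A B C : E3 → ℝ) (x : E3) (α β γ : ℝ), x ∈ offAxis → v₀ x = 0 → v₂ x = 0 →
        v₄ x = 0 → A x = α * tanHalf x ^ k → B x = β * tanHalf x ^ k → C x = γ * tanHalf x ^ k →
        conjTwo k v₂ A x = F 0 (α, β, γ, tanHalf x) ∧
        conjFour k v₄ B C x = F 1 (α, β, γ, tanHalf x) ∧
        2 * k * (cscTheta x * ((k * cscTheta x - cotTheta x) * A x))
          = F 2 (α, β, γ, tanHalf x) ∧
        4 * k * (k * cscTheta x * B x)
          + 4 * k * ((-(cscTheta x * cotTheta x) * (k * cscTheta x - cotTheta x)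
            + cscTheta x * (cscTheta x ^ 2 - k * (cscTheta x * cotTheta x)))
              * (C x - cosTheta x * B x)
          + cscTheta x * (k * cscTheta x - cotTheta x)
            * (k * cscTheta x * (C x - cosTheta x * B x) + sinTheta x * B x))
          = F 3 (α, β, γ, tanHalf x) ∧
        cscTheta x * (2 * k * (A x * A x)) = F 4 (α, β, γ, tanHalf x) ∧
        cscTheta x * primFour k v₄ B C x = F 5 (α, β, γ, tanHalf x) ∧
        cscTheta x * primAng k v₀ v₂ v₄ A B C x = F 6 (α, β, γ, tanHalf x) := by
  have hne : ∀ t : ℝ, 1 + t ^ 2 ≠ 0 := fun t => by positivity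
  rcases hk with rfl | rfl
  · refine ⟨![fun p => p.1 * (1 + p.2.2.2 ^ 2),
      fun p => 2 * (p.2.1 + p.2.2.1) * p.2.2.2 * (1 + p.2.2.2 ^ 2),
      fun p => p.1 * p.2.2.2 * (1 + p.2.2.2 ^ 2),
      fun p => (p.2.1 + p.2.2.1) * (1 + 3 * p.2.2.2 ^ 2) * (1 + p.2.2.2 ^ 2),
      fun p => (1 + p.2.2.2 ^ 2) * p.2.2.2 * p.1 ^ 2,
      fun p => (2 * p.2.2.2 / (1 + p.2.2.2 ^ 2) * (p.2.1 * p.2.2.2)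
          + (p.2.2.1 * (1 + p.2.2.2 ^ 2) - p.2.1 * (1 - p.2.2.2 ^ 2)))
          * (2 * (p.2.1 + p.2.2.1) * p.2.2.2 * (1 + p.2.2.2 ^ 2))
        - (p.2.2.1 * (1 + p.2.2.2 ^ 2) - p.2.1 * (1 - p.2.2.2 ^ 2))
          * (2 * (p.2.1 + p.2.2.1) * p.2.2.2),
      fun p => p.2.2.2 * (p.1 * (1 + p.2.2.2 ^ 2)) ^ 2
        - 2 * (p.1 * (1 + p.2.2.2 ^ 2)) * (2 * (p.2.1 + p.2.2.1) * p.2.2.2 * (1 + p.2.2.2 ^ 2))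
        - (1 - 3 * p.2.2.2 ^ 2) * (2 * (p.2.1 + p.2.2.1) ^ 2 * p.2.2.2 * (1 + p.2.2.2 ^ 2) ^ 2)
        + 4 * (1 + p.2.2.2 ^ 2) * p.2.2.2 * (p.1 + p.2.1 + p.2.2.1) ^ 2], ?_, ?_, ?_⟩
    · intro i
      fin_cases i <;> simp <;> fun_prop (disch := intros; positivity)
    · intro i t
      fin_cases i <;> simp
    · intro v₀ v₂ v₄ A B C x α β γ hx h0 h2 h4 hA hB hC
      have ht := (tanHalf_pos hx).ne'
      have hsin := sinTheta_eq_tanHalf hx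
      have hcos := cosTheta_eq_tanHalf hx
      refine ⟨?_, ?_, ?_, ?_, ?_, ?_, ?_⟩ <;>
      simp only [conjTwo, conjFour, primFour, primAng, angBoundary, cscTheta, cotTheta, h0, h2, h4,
        hA, hB, hC, hsin, hcos, Matrix.cons_val_zero, Matrix.cons_val_one, Matrix.cons_val,
        Nat.cast_one, pow_one] <;> field_simp <;> ring
  · refine ⟨![fun p => 2 * p.1 * p.2.2.2 * (1 + p.2.2.2 ^ 2),
      fun p => 2 * ((p.2.2.1 - p.2.1) + (4 * p.2.2.1 + 2 * p.2.1) * p.2.2.2 ^ 2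
        + 3 * (p.2.2.1 + p.2.1) * p.2.2.2 ^ 4),
      fun p => p.1 * (1 + 3 * p.2.2.2 ^ 2) * (1 + p.2.2.2 ^ 2),
      fun p => (1 + p.2.2.2 ^ 2) * ((8 * p.2.2.1 + 4 * p.2.1) * p.2.2.2
        + 12 * (p.2.2.1 + p.2.1) * p.2.2.2 ^ 3),
      fun p => 2 * (1 + p.2.2.2 ^ 2) * p.2.2.2 ^ 3 * p.1 ^ 2,
      fun p => (2 * p.2.2.2 / (1 + p.2.2.2 ^ 2) * (p.2.1 * p.2.2.2 ^ 2)
          + 2 * p.2.2.2 * (p.2.2.1 * (1 + p.2.2.2 ^ 2) - p.2.1 * (1 - p.2.2.2 ^ 2)))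
          * (2 * ((p.2.2.1 - p.2.1) + (4 * p.2.2.1 + 2 * p.2.1) * p.2.2.2 ^ 2
            + 3 * (p.2.2.1 + p.2.1) * p.2.2.2 ^ 4))
        - 2 * p.2.2.2 * (p.2.2.1 * (1 + p.2.2.2 ^ 2) - p.2.1 * (1 - p.2.2.2 ^ 2))
          * ((4 * p.2.1 + 2 * p.2.2.1) * p.2.2.2 ^ 2),
      fun p => (1 + 3 * p.2.2.2 ^ 2) * (2 * p.1 ^ 2 * p.2.2.2 * (1 + p.2.2.2 ^ 2) ^ 2)
        - 2 * (2 * p.1 * p.2.2.2 * (1 + p.2.2.2 ^ 2))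
          * (2 * ((p.2.2.1 - p.2.1) + (4 * p.2.2.1 + 2 * p.2.1) * p.2.2.2 ^ 2
            + 3 * (p.2.2.1 + p.2.1) * p.2.2.2 ^ 4))
        + 2 * p.2.2.2 * (2 * ((p.2.2.1 - p.2.1) + (4 * p.2.2.1 + 2 * p.2.1) * p.2.2.2 ^ 2
            + 3 * (p.2.2.1 + p.2.1) * p.2.2.2 ^ 4)) ^ 2
        + 8 * (1 + p.2.2.2 ^ 2) * p.2.2.2 ^ 3 * (p.1 + 2 * p.2.1 + p.2.2.1) ^ 2], ?_, ?_, ?_⟩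
    · intro i
      fin_cases i <;> simp <;> fun_prop (disch := intros; positivity)
    · intro i t
      fin_cases i <;> simp
    · intro v₀ v₂ v₄ A B C x α β γ hx h0 h2 h4 hA hB hC
      have ht := (tanHalf_pos hx).ne'
      have hsin := sinTheta_eq_tanHalf hx
      have hcos := cosTheta_eq_tanHalf hx
      refine ⟨?_, ?_, ?_, ?_, ?_, ?_, ?_⟩ <;>
      simp only [conjTwo, conjFour, primFour, primAng, angBoundary, cscTheta, cotTheta, h0, h2, h4,
        hA, hB, hC, hsin, hcos, Matrix.cons_val_zero, Matrix.cons_val_one, Matrix.cons_val,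
        Nat.cast_ofNat] <;> field_simp <;> ring

/-! ### Fields of azimuthal order `k` -/

/-- The pair `(cos kφ, sin kφ)`, by the addition theorem; the azimuth itself is not continuous off
the axis. -/
noncomputable def azim : ℕ → E3 → ℝ × ℝ
  | 0, _ => (1, 0)
  | k + 1, x => ((azim k x).1 * cosPhi x - (azim k x).2 * sinPhi x,
      (azim k x).2 * cosPhi x + (azim k x).1 * sinPhi x)

theorem azim_sq_add (k : ℕ) {x : E3} (hx : x ∈ offAxis) :
    (azim k x).1 ^ 2 + (azim k x).2 ^ 2 = 1 := by
  induction k with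
  | zero => simp [azim]
  | succ k ih =>
    simp only [azim]
    linear_combination (cosPhi x ^ 2 + sinPhi x ^ 2) * ih + cosPhi_sq_add hx

theorem smoothOff_azim (k : ℕ) {n : WithTop ℕ∞} :
    SmoothOff n (fun x => (azim k x).1) ∧ SmoothOff n (fun x => (azim k x).2) := by
  induction k with
  | zero => exact ⟨.const 1, .const 0⟩
  | succ k ih =>
    exact ⟨(ih.1.mul .cosPhi).sub (ih.2.mul .sinPhi), (ih.2.mul .cosPhi).add (ih.1.mul .sinPhi)⟩

/-- The pair `(C, S)` has at `x` the derivatives of a pair `(cos (kφ + φ₀), sin (kφ + φ₀))`. -/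
structure IsAzim (k : ℝ) (C S : E3 → ℝ) (x : E3) : Prop where
  cr : HasD (eR x) C 0 x
  sr : HasD (eR x) S 0 x
  ct : HasD (eT x) C 0 x
  st : HasD (eT x) S 0 x
  cp : HasD (eP x) C (-(k * S x)) x
  sp : HasD (eP x) S (k * C x) x

theorem IsAzim.rotate {k : ℝ} {C S : E3 → ℝ} {x : E3} (h : IsAzim k C S x) :
    IsAzim k (fun y => - S y) C x where
  cr := h.sr.neg.congr_d neg_zero
  sr := h.cr
  ct := h.st.neg.congr_d neg_zero
  st := h.ct
  cp := h.sp.neg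
  sp := h.cp.congr_d (by ring)

theorem isAzim_azim (k : ℕ) {x : E3} (hx : x ∈ offAxis) :
    IsAzim k (fun x => (azim k x).1) (fun x => (azim k x).2) x := by
  induction k with
  | zero =>
    constructor <;> exact (HasD.const _).congr_d (by simp [azim])
  | succ k ih =>
    obtain ⟨c1, c2, c3⟩ := hasD_cosPhi hx
    obtain ⟨s1, s2, s3⟩ := hasD_sinPhi hx
    exact ⟨((ih.cr.mul c1).sub (ih.sr.mul s1)).congr_d (by ring),
      ((ih.sr.mul c1).add (ih.cr.mul s1)).congr_d (by ring),
      ((ih.ct.mul c2).sub (ih.st.mul s2)).congr_d (by ring),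
      ((ih.st.mul c2).add (ih.ct.mul s2)).congr_d (by ring),
      ((ih.cp.mul c3).sub (ih.sp.mul s3)).congr_d (by simp [azim]; ring),
      ((ih.sp.mul c3).add (ih.cp.mul s3)).congr_d (by simp [azim]; ring)⟩

/-- The components of the real field with coefficients `(v₀, v₂, v₄)` and `(v₀, v₂', v₄')` on the
modes `k` and `-k`. -/
noncomputable def modeField (C S v₀ v₂ v₄ v₂' v₄' : E3 → ℝ) : Fin 5 → E3 → ℝ :=
  ![fun x => v₀ x * C x, fun x => 1 / 2 * ((v₂ x - v₂' x) * S x),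
    fun x => 1 / 2 * ((v₂ x + v₂' x) * C x), fun x => 1 / 2 * ((v₄ x - v₄' x) * S x),
    fun x => 1 / 2 * ((v₄ x + v₄' x) * C x)]

section modeField

variable {C S v₀ v₂ v₄ v₂' v₄' : E3 → ℝ}

theorem isTest_modeField (hC : SmoothOff 1 C) (hS : SmoothOff 1 S) (h0 : IsTest v₀)
    (h2 : IsTest v₂) (h4 : IsTest v₄) (h2' : IsTest v₂') (h4' : IsTest v₄') (i : Fin 5) :
    IsTest (modeField C S v₀ v₂ v₄ v₂' v₄' i) := by
  have key : ∀ {f g : E3 → ℝ}, IsTest f → SmoothOff 1 g → IsTest fun x => f x * g x :=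
    fun hf hg => by simpa only [mul_comm] using IsTest.mul_left hg hf
  fin_cases i
  · exact key h0 hC
  · exact (key (h2.sub h2') hS).const_mul _
  · exact (key (h2.add h2') hC).const_mul _
  · exact (key (h4.sub h4') hS).const_mul _
  · exact (key (h4.add h4') hC).const_mul _

/-- The energy densities of the field and of its rotation by a quarter of a period add up to a
`φ`-independent function when `C² + S² = 1`. -/
theorem frameEnergy_modeField (a b c : ℝ) (u : ℝ → ℝ) {k : ℝ} {x : E3} (h : IsAzim k C S x)
    (h0 : DifferentiableAt ℝ v₀ x) (h2 : DifferentiableAt ℝ v₂ x) (h4 : DifferentiableAt ℝ v₄ x)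
    (h2' : DifferentiableAt ℝ v₂' x) (h4' : DifferentiableAt ℝ v₄' x)
    (p0 : Dp v₀ x = 0) (p2 : Dp v₂ x = 0) (p4 : Dp v₄ x = 0) (p2' : Dp v₂' x = 0)
    (p4' : Dp v₄' x = 0) :
    frameEnergy a b c u (modeField C S v₀ v₂ v₄ v₂' v₄') x
      + frameEnergy a b c u (modeField (fun y => - S y) C v₀ v₂ v₄ v₂' v₄') x
      = 1 / 2 * ((C x ^ 2 + S x ^ 2) * (modeEnergy a b c u k v₀ v₂ v₄ x
        + modeEnergy a b c u (-k) v₀ v₂' v₄' x)) := by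
  have hd : ∀ {f : E3 → ℝ} (e : E3), DifferentiableAt ℝ f x → HasD e f (fderiv ℝ f x e) x :=
    fun e hf => ⟨hf, rfl⟩
  have main : ∀ {C S : E3 → ℝ}, IsAzim k C S x →
      frameEnergy a b c u (modeField C S v₀ v₂ v₄ v₂' v₄') x
      = 1 / 3 * Dr v₀ x ^ 2 * C x ^ 2 + 1 / 4 * ((Dr v₂ x - Dr v₂' x) ^ 2 * S x ^ 2
          + (Dr v₂ x + Dr v₂' x) ^ 2 * C x ^ 2 + (Dr v₄ x - Dr v₄' x) ^ 2 * S x ^ 2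
          + (Dr v₄ x + Dr v₄' x) ^ 2 * C x ^ 2)
        + 1 / ‖x‖ ^ 2 * (1 / 3 * ((Dt v₀ x + 3 / 2 * (v₂ x + v₂' x)) ^ 2 * C x ^ 2
            + (-(k * cscTheta x * v₀ x) + 3 / 2 * (v₂ x - v₂' x)) ^ 2 * S x ^ 2)
          + 1 / 4 * ((Dt v₂ x - Dt v₂' x - (v₄ x - v₄' x)) ^ 2 * S x ^ 2
            + (Dt v₂ x + Dt v₂' x - (v₄ x + v₄' x) - 2 * v₀ x) ^ 2 * C x ^ 2
            + (Dt v₄ x - Dt v₄' x + (v₂ x - v₂' x)) ^ 2 * S x ^ 2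
            + (Dt v₄ x + Dt v₄' x + (v₂ x + v₂' x)) ^ 2 * C x ^ 2
            + (k * cscTheta x * (v₂ x - v₂' x) + (v₄ x + v₄' x) - 2 * v₀ x
              + cotTheta x * (v₂ x + v₂' x)) ^ 2 * C x ^ 2
            + (-(k * cscTheta x * (v₂ x + v₂' x)) - (v₄ x - v₄' x)
              - cotTheta x * (v₂ x - v₂' x)) ^ 2 * S x ^ 2
            + (k * cscTheta x * (v₄ x - v₄' x) + 2 * cotTheta x * (v₄ x + v₄' x)
              + (v₂ x + v₂' x)) ^ 2 * C x ^ 2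
            + (-(k * cscTheta x * (v₄ x + v₄' x)) - 2 * cotTheta x * (v₄ x - v₄' x)
              - (v₂ x - v₂' x)) ^ 2 * S x ^ 2))
        + (1 / 3 * fHat a b c (u ‖x‖) * v₀ x ^ 2 * C x ^ 2
          + 1 / 4 * (fMid a b c (u ‖x‖) * ((v₂ x - v₂' x) ^ 2 * S x ^ 2
              + (v₂ x + v₂' x) ^ 2 * C x ^ 2)
            + fTilde a b c (u ‖x‖) * ((v₄ x - v₄' x) ^ 2 * S x ^ 2
              + (v₄ x + v₄' x) ^ 2 * C x ^ 2))) := by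
    intro C S h
    have dir : ∀ {e : E3} {c' s' : ℝ}, HasD e C c' x → HasD e S s' x →
        fderiv ℝ (fun x => v₀ x * C x) x e = fderiv ℝ v₀ x e * C x + v₀ x * c' ∧
        fderiv ℝ (fun x => 1 / 2 * ((v₂ x - v₂' x) * S x)) x e
          = 1 / 2 * ((fderiv ℝ v₂ x e - fderiv ℝ v₂' x e) * S x + (v₂ x - v₂' x) * s') ∧
        fderiv ℝ (fun x => 1 / 2 * ((v₂ x + v₂' x) * C x)) x e
          = 1 / 2 * ((fderiv ℝ v₂ x e + fderiv ℝ v₂' x e) * C x + (v₂ x + v₂' x) * c') ∧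
        fderiv ℝ (fun x => 1 / 2 * ((v₄ x - v₄' x) * S x)) x e
          = 1 / 2 * ((fderiv ℝ v₄ x e - fderiv ℝ v₄' x e) * S x + (v₄ x - v₄' x) * s') ∧
        fderiv ℝ (fun x => 1 / 2 * ((v₄ x + v₄' x) * C x)) x e
          = 1 / 2 * ((fderiv ℝ v₄ x e + fderiv ℝ v₄' x e) * C x + (v₄ x + v₄' x) * c') :=
      fun hC hS => ⟨((hd _ h0).mul hC).eq,
        ((((hd _ h2).sub (hd _ h2')).mul hS).const_mul _).eq,
        ((((hd _ h2).add (hd _ h2')).mul hC).const_mul _).eq,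
        ((((hd _ h4).sub (hd _ h4')).mul hS).const_mul _).eq,
        ((((hd _ h4).add (hd _ h4')).mul hC).const_mul _).eq⟩
    obtain ⟨r0, r1, r2, r3, r4⟩ := dir h.cr h.sr
    obtain ⟨t0, t1, t2, t3, t4⟩ := dir h.ct h.st
    obtain ⟨q0, q1, q2, q3, q4⟩ := dir h.cp h.sp
    simp only [Dp] at p0 p2 p4 p2' p4'
    simp only [frameEnergy, compSq, compBulk, compR, compT, compP, modeField,
      Matrix.cons_val_zero, Matrix.cons_val_one, Matrix.cons_val, Dr, Dt, Dp, r0, r1, r2, r3, r4,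
      t0, t1, t2, t3, t4, q0, q1, q2, q3, q4, p0, p2, p4, p2', p4']
    ring
  rw [main h, main h.rotate]
  simp only [modeEnergy, modeAng]
  ring

end modeField

theorem integrable_frameEnergy {a b c : ℝ} {u : ℝ → ℝ} (hu : IsProfile a b c u)
    {w : Fin 5 → E3 → ℝ} (hw : ∀ i, IsTest (w i)) :
    Integrable (frameEnergy a b c u w) volume := by
  have cκ : ContinuousOn (fun x : E3 => 1 / ‖x‖ ^ 2) offAxis :=
    (SmoothOff.inv_norm_sq (n := 0)).continuousOn
  have cs : ContinuousOn cscTheta offAxis := (SmoothOff.cscTheta (n := 0)).continuousOn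
  have ct : ContinuousOn cotTheta offAxis := (SmoothOff.cotTheta (n := 0)).continuousOn
  have cc : ∀ r : ℝ, ContinuousOn (fun _ : E3 => r) offAxis := fun r => continuousOn_const
  have c2t : ContinuousOn (fun x => 2 * cotTheta x) offAxis := (cc 2).mul ct
  have cu : ∀ {q : ℝ → ℝ}, Continuous q → ContinuousOn (fun x : E3 => q (u ‖x‖)) offAxis :=
    fun hq => (hq.comp hu.continuous_comp_norm).continuousOn
  have sq : ∀ {f : E3 → ℝ}, ContCpt f → ContCpt fun x => f x * f x := fun hf =>
    ContCpt.mul_left hf.cont hf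
  have T := fun i => (hw i).contCpt
  have R := fun i => (hw i).contCpt_Dr
  have Θ := fun i => (hw i).contCpt_Dt
  have P := fun i => (hw i).contCpt_Dp.mul_left cs
  have hcomp : ∀ {f : Fin 5 → E3 → ℝ}, (∀ i, ContCpt (f i)) →
      ContCpt fun x => compSq fun i => f i x := fun {f} hf => by
    have h := (((((sq (hf 0)).mul_left (cc (1 / 3))).add (sq (hf 1))).add (sq (hf 2))).add
      (sq (hf 3))).add (sq (hf 4))
    simpa only [compSq, pow_two, mul_assoc] using h
  have hR : ContCpt fun x => compSq (compR w x) := hcomp R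
  have hT : ContCpt fun x => compSq (compT w x) := by
    have h : ∀ i, ContCpt fun x => compT w x i := fun i => by
      fin_cases i
      · exact (Θ 0).add ((T 2).mul_left (cc 3))
      · exact (Θ 1).sub (T 3)
      · exact ((Θ 2).sub (T 4)).sub (T 0)
      · exact (Θ 3).add (T 1)
      · exact (Θ 4).add (T 2)
    exact hcomp h
  have hP : ContCpt fun x => compSq (compP w x) := by
    have h : ∀ i, ContCpt fun x => compP w x i := fun i => by
      fin_cases i
      · exact (P 0).add ((T 1).mul_left (cc 3))
      · exact (((P 1).add (T 4)).sub (T 0)).add ((T 2).mul_left ct)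
      · exact ((P 2).sub (T 3)).sub ((T 1).mul_left ct)
      · exact ((P 3).add ((T 4).mul_left c2t)).add (T 2)
      · exact ((P 4).sub ((T 3).mul_left c2t)).sub (T 1)
    exact hcomp h
  have hB : ContCpt fun x => compBulk a b c (u ‖x‖) fun i => w i x := by
    have h := (((sq (T 0)).mul_left ((cc (1 / 3)).mul (cu (continuous_fHat a b c)))).add
      (((sq (T 1)).add (sq (T 2))).mul_left (cu (continuous_fMid a b c)))).add
      (((sq (T 3)).add (sq (T 4))).mul_left (cu (continuous_fTilde a b c)))
    simpa only [compBulk, pow_two, Pi.mul_apply] using h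
  have h := (hR.add ((hT.add hP).mul_left cκ)).add hB
  exact h.cpt.integrable h.cont

theorem IsPhiIndependent.Dp_eq_zero {v : E3 → ℝ} (hv : IsPhiIndependent v) {x : E3}
    (hx : x ∈ offAxis) (hd : DifferentiableAt ℝ v x) : Dp v x = 0 := by
  obtain ⟨β, hβ⟩ := exists_angle hx
  have e0 : MeltingHedgehog.axisPoint β x = x := by
    have h := hβ 0
    rw [zero_add] at h
    rw [← h, axisRotation_apply]
    ext i
    fin_cases i <;> simp
  have h1 := hasDerivAt_axisPoint β x
  have h2 : HasDerivAt (fun α => v (MeltingHedgehog.axisPoint α x)) (fderiv ℝ v x (eP x)) β := by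
    have := HasFDerivAt.comp_hasDerivAt (f := fun α => MeltingHedgehog.axisPoint α x) β
      (by rw [e0]; exact hd.hasFDerivAt) h1
    rwa [e0] at this
  have h3 : (fun α => v (MeltingHedgehog.axisPoint α x)) = fun _ => v x :=
    funext fun α => hv.axisPoint α x
  rw [h3] at h2
  exact h2.unique (hasDerivAt_const β (v x))

/-- Nonnegativity of the second variation on fields of azimuthal order `k`. -/
theorem SecondVariationNonneg.modes {a b c : ℝ} {u : ℝ → ℝ} (hu : IsProfile a b c u)
    (hQ : SecondVariationNonneg a b c u) (k : ℕ) {v₀ v₂ v₄ v₂' v₄' : E3 → ℝ}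
    (h0 : IsTest v₀) (h2 : IsTest v₂) (h4 : IsTest v₄) (h2' : IsTest v₂') (h4' : IsTest v₄')
    (p0 : IsPhiIndependent v₀) (p2 : IsPhiIndependent v₂) (p4 : IsPhiIndependent v₄)
    (p2' : IsPhiIndependent v₂') (p4' : IsPhiIndependent v₄') :
    0 ≤ (∫ x, modeEnergy a b c u k v₀ v₂ v₄ x) + ∫ x, modeEnergy a b c u (-k) v₀ v₂' v₄' x := by
  have hs := smoothOff_azim k (n := 1)
  have pos : ∀ {C S : E3 → ℝ}, SmoothOff 1 C → SmoothOff 1 S →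
      0 ≤ ∫ x, frameEnergy a b c u (modeField C S v₀ v₂ v₄ v₂' v₄') x := fun hC hS => by
    have hw := isTest_modeField hC hS h0 h2 h4 h2' h4'
    rw [← secondVariation_frameField a b c u hw]
    exact hQ _ (memH1S0_frameField hw)
  have i1 := integrable_modeEnergy hu k h0 h2 h4
  have i2 := integrable_modeEnergy hu (-k) h0 h2' h4'
  have int : ∀ {C S : E3 → ℝ}, SmoothOff 1 C → SmoothOff 1 S →
      Integrable (frameEnergy a b c u (modeField C S v₀ v₂ v₄ v₂' v₄')) volume := fun hC hS =>
    integrable_frameEnergy hu (isTest_modeField hC hS h0 h2 h4 h2' h4')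
  have hsum := add_nonneg (pos hs.1 hs.2) (pos hs.2.neg hs.1)
  rw [← integral_add (int hs.1 hs.2) (int hs.2.neg hs.1)] at hsum
  rw [← integral_add i1 i2]
  have e : ∫ x, (frameEnergy a b c u (modeField (fun x => (azim k x).1) (fun x => (azim k x).2)
        v₀ v₂ v₄ v₂' v₄') x + frameEnergy a b c u (modeField (fun x => - (azim k x).2)
        (fun x => (azim k x).1) v₀ v₂ v₄ v₂' v₄') x)
      = ∫ x, 1 / 2 * (modeEnergy a b c u k v₀ v₂ v₄ x + modeEnergy a b c u (-k) v₀ v₂' v₄' x) := by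
    refine integral_congr_ae ?_
    filter_upwards [ae_mem_offAxis] with x hx
    have d := fun {f : E3 → ℝ} (hf : IsTest f) => hf.smoothOff.differentiableAt hx
    rw [frameEnergy_modeField a b c u (isAzim_azim k hx) (d h0) (d h2) (d h4) (d h2') (d h4')
      (p0.Dp_eq_zero hx (d h0)) (p2.Dp_eq_zero hx (d h2)) (p4.Dp_eq_zero hx (d h4))
      (p2'.Dp_eq_zero hx (d h2')) (p4'.Dp_eq_zero hx (d h4'))]
    simp only [azim_sq_add k hx, one_mul]
  rw [e, integral_const_mul] at hsum
  linarith

/-! ### Comparison of the modes `k` and `-k` -/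

theorem isPhiIndependent_cscTheta : IsPhiIndependent cscTheta := fun x y h1 h2 => by
  rw [cscTheta, cscTheta, sinTheta_eq_of h1 h2]

theorem isPhiIndependent_cotTheta : IsPhiIndependent cotTheta := fun x y h1 h2 => by
  rw [cotTheta, cotTheta, sinTheta_eq_of h1 h2, cosTheta_eq_of h1 h2]

theorem IsPhiIndependent.mul {f g : E3 → ℝ} (hf : IsPhiIndependent f) (hg : IsPhiIndependent g) :
    IsPhiIndependent fun x => f x * g x := fun x y h1 h2 => by
  simp only [hf x y h1 h2, hg x y h1 h2]

theorem potAt_pot (k : ℕ) {v₂ v₄ : E3 → ℝ} (h2 : IsTest v₂) (h4 : IsTest v₄)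
    (p2 : IsPhiIndependent v₂) (p4 : IsPhiIndependent v₄) {x : E3} (hx : x ∈ offAxis) :
    PotAt k v₂ v₄ (pot k v₂) (pot k fun y => cscTheta y * v₄ y) (pot k fun y => cotTheta y * v₄ y)
      x where
  A := hasD_pot_angle k h2 p2 hx
  B := hasD_pot_angle k (.mul_left .cscTheta h4) (isPhiIndependent_cscTheta.mul p4) hx
  C := hasD_pot_angle k (.mul_left .cotTheta h4) (isPhiIndependent_cotTheta.mul p4) hx

theorem hasD_cscTheta_radius {x : E3} (hx : x ∈ offAxis) : HasD (eR x) cscTheta 0 x :=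
  ((HasD.const 1).div (hasD_sinTheta hx).1 (sinTheta_pos hx).ne').congr_d (by simp)

theorem hasD_cotTheta_radius {x : E3} (hx : x ∈ offAxis) : HasD (eR x) cotTheta 0 x :=
  ((hasD_cosTheta hx).1.div (hasD_sinTheta hx).1 (sinTheta_pos hx).ne').congr_d (by simp)

/-- Functions of the polar angle commute with the radial derivative. -/
theorem Dr_mul_left {q v : E3 → ℝ} (hq : ∀ x ∈ offAxis, HasD (eR x) q 0 x) (hv : IsTest v) :
    Dr (fun y => q y * v y) = fun y => q y * Dr v y := by
  obtain ⟨δ, R, hδ, h⟩ := CptOff.iff.1 hv.cptOff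
  have h' : SuppIn δ R fun y => q y * v y := SuppIn.of_eq_zero h fun x hx => by simp [hx]
  funext x
  by_cases hx : x ∈ offAxis
  · have := ((hq x hx).mul (⟨hv.smoothOff.differentiableAt hx, rfl⟩ : HasD (eR x) v (Dr v x) x)).eq
    rw [Dr, this]; ring
  · have hx0 : axisSq x < δ := lt_of_le_of_lt (not_lt.1 hx) hδ
    rw [Dr, Dr, h'.fderiv_eq_zero (Or.inl hx0), SuppIn.fderiv_eq_zero h (Or.inl hx0)]
    simp

/-- The component of order two on the mode `-k` in terms of `v₂`. -/
noncomputable def dualTwo (k : ℕ) (v₂ : E3 → ℝ) : E3 → ℝ := conjTwo k v₂ (pot k v₂)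

/-- The component of order four on the mode `-k` in terms of `v₄`. -/
noncomputable def dualFour (k : ℕ) (v₄ : E3 → ℝ) : E3 → ℝ :=
  conjFour k v₄ (pot k fun y => cscTheta y * v₄ y) (pot k fun y => cotTheta y * v₄ y)

/-- A primitive of `sin θ (dualTwo² - v₂²)` along meridians. -/
noncomputable def dualPrimTwo (k : ℕ) (v₂ : E3 → ℝ) (x : E3) : ℝ :=
  2 * k * (pot k v₂ x * pot k v₂ x)

/-- A primitive of `sin θ (dualFour² - v₄²)` along meridians. -/
noncomputable def dualPrimFour (k : ℕ) (v₄ : E3 → ℝ) : E3 → ℝ :=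
  primFour k v₄ (pot k fun y => cscTheta y * v₄ y) (pot k fun y => cotTheta y * v₄ y)

/-- A primitive along meridians of the difference of the angular energies. -/
noncomputable def dualPrimAng (k : ℕ) (v₀ v₂ v₄ : E3 → ℝ) : E3 → ℝ :=
  primAng k v₀ v₂ v₄ (pot k v₂) (pot k fun y => cscTheta y * v₄ y)
    (pot k fun y => cotTheta y * v₄ y)

/-- A primitive along meridians of `‖x‖² sin θ` times the difference of the energy densities of
the modes `-k` and `k`. -/
noncomputable def dualPrim (a b c : ℝ) (u : ℝ → ℝ) (k : ℕ) (v₀ v₂ v₄ : E3 → ℝ) (x : E3) : ℝ :=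
  ‖x‖ ^ 2 * (dualPrimTwo k (Dr v₂) x + dualPrimFour k (Dr v₄) x) + dualPrimAng k v₀ v₂ v₄ x
    + ‖x‖ ^ 2 * (fMid a b c (u ‖x‖) * dualPrimTwo k v₂ x + fTilde a b c (u ‖x‖) * dualPrimFour k v₄ x)

section smooth

variable {k : ℕ} {v₀ v₂ v₄ : E3 → ℝ}

theorem smoothOff_dualTwo (h2 : IsTest v₂) : SmoothOff 1 (dualTwo k v₂) :=
  h2.smoothOff.add ((SmoothOff.const _).mul (SmoothOff.cscTheta.mul (smoothOff_pot k h2)))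

theorem smoothOff_potDiff (h4 : IsTest v₄) : SmoothOff 1 fun x =>
    pot k (fun y => cotTheta y * v₄ y) x - cosTheta x * pot k (fun y => cscTheta y * v₄ y) x :=
  (smoothOff_pot k (.mul_left .cotTheta h4)).sub
    (SmoothOff.cosTheta.mul (smoothOff_pot k (.mul_left .cscTheta h4)))

theorem smoothOff_dualFour (h4 : IsTest v₄) : SmoothOff 1 (dualFour k v₄) :=
  (h4.smoothOff.add ((SmoothOff.const _).mul (smoothOff_pot k (.mul_left .cscTheta h4)))).add
    ((SmoothOff.const _).mul ((SmoothOff.cscTheta.mul (((SmoothOff.const _).mul .cscTheta).sub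
      .cotTheta)).mul (smoothOff_potDiff h4)))

theorem smoothOff_dualPrimTwo (h2 : IsTest v₂) : SmoothOff 1 (dualPrimTwo k v₂) :=
  (SmoothOff.const _).mul ((smoothOff_pot k h2).mul (smoothOff_pot k h2))

theorem smoothOff_dualPrimFour (h4 : IsTest v₄) : SmoothOff 1 (dualPrimFour k v₄) := by
  have hB := smoothOff_pot k (.mul_left .cscTheta h4)
  have hC := smoothOff_pot k (.mul_left .cotTheta h4)
  have hh := smoothOff_potDiff (k := k) h4
  exact ((((SmoothOff.sinTheta.mul ((SmoothOff.sinTheta.mul hB).add ((SmoothOff.const _).mul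
    (SmoothOff.cscTheta.mul hh)))).mul (smoothOff_dualFour h4)).sub
    ((SmoothOff.sinTheta.mul (SmoothOff.sinTheta.mul hB)).mul h4.smoothOff)).sub
    ((SmoothOff.const _).mul (hh.mul ((h4.smoothOff.add ((SmoothOff.const _).mul hB)).add
      ((SmoothOff.const _).mul hC)))))

theorem smoothOff_angBoundary {κ : ℝ} (h0 : SmoothOff 1 v₀) (h2 : SmoothOff 1 v₂)
    (h4 : SmoothOff 1 v₄) : SmoothOff 1 (angBoundary κ v₀ v₂ v₄) :=
  (((((SmoothOff.cosTheta.add (.const κ)).mul (h2.mul h2)).neg.sub ((SmoothOff.const _).mul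
    (SmoothOff.sinTheta.mul (h2.mul h4)))).sub ((((SmoothOff.const _).mul .cosTheta).add
    (.const κ)).mul (h4.mul h4))).sub ((SmoothOff.const _).mul (h0.mul h0))).add
    ((SmoothOff.const _).mul (SmoothOff.sinTheta.mul (h0.mul h2)))

theorem smoothOff_dualPrimAng (h0 : IsTest v₀) (h2 : IsTest v₂) (h4 : IsTest v₄) :
    SmoothOff 1 (dualPrimAng k v₀ v₂ v₄) := by
  have hB := smoothOff_pot k (.mul_left .cscTheta h4)
  have hC := smoothOff_pot k (.mul_left .cotTheta h4)
  have hw := ((SmoothOff.const 2).mul (smoothOff_pot k h2)).add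
    ((h4.smoothOff.add ((SmoothOff.const (2 * k)).mul hB)).add ((SmoothOff.const 2).mul hC))
  exact ((smoothOff_angBoundary h0.smoothOff (smoothOff_dualTwo h2) (smoothOff_dualFour h4)).sub
    (smoothOff_angBoundary h0.smoothOff h2.smoothOff h4.smoothOff)).add
    ((SmoothOff.const _).mul (hw.mul hw))

theorem IsProfile.contDiffAt {a b c : ℝ} {u : ℝ → ℝ} (hu : IsProfile a b c u) {r : ℝ}
    (hr : 0 < r) : ContDiffAt ℝ 1 u r :=
  (hu.contDiffOn.contDiffAt (Ioi_mem_nhds hr)).of_le (by norm_num)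

theorem IsProfile.smoothOff_comp {a b c : ℝ} {u : ℝ → ℝ} (hu : IsProfile a b c u) {g : ℝ → ℝ}
    (hg : ContDiff ℝ 1 g) : SmoothOff 1 fun x => g (u ‖x‖) := fun x hx =>
  hg.contDiffAt.comp x ((hu.contDiffAt (norm_pos_of_mem_offAxis hx)).comp x (SmoothOff.norm x hx))

theorem IsProfile.hasD_comp {a b c : ℝ} {u : ℝ → ℝ} (hu : IsProfile a b c u) {g : ℝ → ℝ}
    (hg : ContDiff ℝ 1 g) {x : E3} (hx : x ∈ offAxis) : HasD (eT x) (fun x => g (u ‖x‖)) 0 x := by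
  have hd := ((hg.contDiffAt.comp ‖x‖ (hu.contDiffAt (norm_pos_of_mem_offAxis hx))).differentiableAt
    (by norm_num)).hasDerivAt
  exact (HasD.comp hd (hasD_norm_frame hx).2.1).congr_d (mul_zero _)

theorem contDiff_fMid (a b c : ℝ) : ContDiff ℝ 1 (fMid a b c) := by unfold fMid; fun_prop
theorem contDiff_fTilde (a b c : ℝ) : ContDiff ℝ 1 (fTilde a b c) := by unfold fTilde; fun_prop

theorem smoothOff_dualPrim {a b c : ℝ} {u : ℝ → ℝ} (hu : IsProfile a b c u) (h0 : IsTest v₀)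
    (h2 : IsTest v₂) (h4 : IsTest v₄) (d2 : IsTest (Dr v₂)) (d4 : IsTest (Dr v₄)) :
    SmoothOff 1 (dualPrim a b c u k v₀ v₂ v₄) :=
  (((SmoothOff.norm.pow 2).mul ((smoothOff_dualPrimTwo d2).add (smoothOff_dualPrimFour d4))).add
    (smoothOff_dualPrimAng h0 h2 h4)).add ((SmoothOff.norm.pow 2).mul
    (((hu.smoothOff_comp (contDiff_fMid a b c)).mul (smoothOff_dualPrimTwo h2)).add
      ((hu.smoothOff_comp (contDiff_fTilde a b c)).mul (smoothOff_dualPrimFour h4))))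

end smooth

section derivative

variable {k : ℕ} {v₀ v₂ v₄ : E3 → ℝ} {x : E3}

theorem hasD_dualTwo_radius (hx : x ∈ offAxis) (h2 : IsTest v₂) :
    HasD (eR x) (dualTwo k v₂) (dualTwo k (Dr v₂) x) x :=
  (HasD.add (d := Dr v₂ x) ⟨h2.smoothOff.differentiableAt hx, rfl⟩
    (((hasD_cscTheta_radius hx).mul (hasD_pot_radius k h2 hx)).const_mul
    (2 * k))).congr_d (by
      simp only [dualTwo, conjTwo]; ring)

theorem hasD_dualFour_radius (hx : x ∈ offAxis) (h4 : IsTest v₄) :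
    HasD (eR x) (dualFour k v₄) (dualFour k (Dr v₄) x) x := by
  have hB := hasD_pot_radius k (.mul_left .cscTheta h4) hx
  have hC := hasD_pot_radius k (.mul_left .cotTheta h4) hx
  rw [Dr_mul_left (fun _ => hasD_cscTheta_radius) h4] at hB
  rw [Dr_mul_left (fun _ => hasD_cotTheta_radius) h4] at hC
  have ds := hasD_cscTheta_radius hx
  exact ((HasD.add (d := Dr v₄ x) ⟨h4.smoothOff.differentiableAt hx, rfl⟩ (hB.const_mul (4 * k))).add
    (((ds.mul ((ds.const_mul (k : ℝ)).sub (hasD_cotTheta_radius hx))).mul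
    (hC.sub ((hasD_cosTheta hx).1.mul hB))).const_mul (4 * k))).congr_d (by
      simp only [dualFour, conjFour]; ring)

/-- The difference of the energy densities of the modes `-k` and `k` is a `θ`-divergence. -/
theorem hasD_dualPrim {a b c : ℝ} {u : ℝ → ℝ} (hu : IsProfile a b c u) (hx : x ∈ offAxis)
    (h0 : IsTest v₀) (h2 : IsTest v₂) (h4 : IsTest v₄) (d2 : IsTest (Dr v₂)) (d4 : IsTest (Dr v₄))
    (p2 : IsPhiIndependent v₂) (p4 : IsPhiIndependent v₄) :
    HasD (eT x) (dualPrim a b c u k v₀ v₂ v₄) (sinTheta x * ‖x‖ ^ 2 *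
      (modeEnergy a b c u (-k) v₀ (dualTwo k v₂) (dualFour k v₄) x
        - modeEnergy a b c u k v₀ v₂ v₄ x)) x := by
  have hd := fun {f : E3 → ℝ} (hf : IsTest f) =>
    (⟨hf.smoothOff.differentiableAt hx, rfl⟩ : HasD (eT x) f (Dt f x) x)
  have P := potAt_pot k h2 h4 p2 p4 hx
  have P' := potAt_pot k d2 d4 (p2.Dr h2) (p4.Dr h4) hx
  have n2 := (hasD_norm_frame hx).2.1.pow 2
  have key := ((n2.mul ((hasD_primTwo hx P').add (hasD_primFour hx P' (hd d4)))).add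
    (hasD_primAng hx P (hd h0) (hd h2) (hd h4))).add (n2.mul
      (((hu.hasD_comp (contDiff_fMid a b c) hx).mul (hasD_primTwo hx P)).add
        ((hu.hasD_comp (contDiff_fTilde a b c) hx).mul (hasD_primFour hx P (hd h4)))))
  refine HasD.congr_d key ?_
  have e2 : Dr (dualTwo k v₂) x = dualTwo k (Dr v₂) x := (hasD_dualTwo_radius hx h2).eq
  have e4 : Dr (dualFour k v₄) x = dualFour k (Dr v₄) x := (hasD_dualFour_radius hx h4).eq
  have hr := (norm_pos_of_mem_offAxis hx).ne'
  rw [modeEnergy, modeEnergy, e2, e4]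
  simp only [dualTwo, dualFour]
  generalize conjTwo _ v₂ _ x = y2
  generalize conjFour _ v₄ _ _ x = y4
  generalize conjTwo _ (Dr v₂) _ x = z2
  generalize conjFour _ (Dr v₄) _ _ x = z4
  generalize modeAng (-(k : ℝ)) _ _ _ x = m1
  generalize modeAng (k : ℝ) _ _ _ x = m2
  field_simp
  ring

end derivative

theorem SuppIn.eq_zero {δ R : ℝ} {f : E3 → ℝ} (hf : SuppIn δ R f) {x : E3}
    (hx : axisSq x < δ ∨ R < ‖x‖) : f x = 0 := (hf.eventually hx).eq_of_nhds

theorem axisSq_le_norm_sq (x : E3) : axisSq x ≤ ‖x‖ ^ 2 := by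
  rw [axisSq_eq]; linarith [sq_nonneg (x 2)]

/-- Near the axis the transformed components, their derivatives along meridians, and the
primitives divided by `sin θ` are bounded. -/
theorem exists_bound_dual {k : ℕ} (hk : k = 1 ∨ k = 2) {v₂ v₄ : E3 → ℝ} (h2 : IsTest v₂)
    (h4 : IsTest v₄) (p2 : IsPhiIndependent v₂) (p4 : IsPhiIndependent v₄) {δ R : ℝ}
    (s2 : SuppIn δ R v₂) (s4 : SuppIn δ R v₄) :
    ∃ M, 0 ≤ M ∧ ∀ x ∈ offAxis, axisSq x < δ → ∀ v₀ : E3 → ℝ, v₀ x = 0 →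
      |dualTwo k v₂ x| ≤ M ∧ |dualFour k v₄ x| ≤ M ∧ |Dt (dualTwo k v₂) x| ≤ M ∧
      |Dt (dualFour k v₄) x| ≤ M ∧ |cscTheta x * dualPrimTwo k v₂ x| ≤ M ∧
      |cscTheta x * dualPrimFour k v₄ x| ≤ M ∧ |cscTheta x * dualPrimAng k v₀ v₂ v₄ x| ≤ M := by
  obtain ⟨F, hF, hF0, hform⟩ := exists_nearAxis_forms hk
  obtain ⟨Ma, ha⟩ := exists_pot_eq k h2 s2
  obtain ⟨Mb, hb⟩ := exists_pot_eq k (.mul_left .cscTheta h4)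
    (s4.of_eq_zero (g := fun y => cscTheta y * v₄ y) fun x hx => by simp [hx])
  obtain ⟨Mc, hc⟩ := exists_pot_eq k (.mul_left .cotTheta h4)
    (s4.of_eq_zero (g := fun y => cotTheta y * v₄ y) fun x hx => by simp [hx])
  let K : Set (ℝ × ℝ × ℝ × ℝ) :=
    Set.Icc (-Ma) Ma ×ˢ Set.Icc (-Mb) Mb ×ˢ Set.Icc (-Mc) Mc ×ˢ Set.Icc 0 1
  have hK : IsCompact K := isCompact_Icc.prod (isCompact_Icc.prod (isCompact_Icc.prod isCompact_Icc))
  choose m hm using fun i => hK.exists_bound_of_continuousOn (hF i).continuousOn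
  refine ⟨∑ i, |m i|, Finset.sum_nonneg fun i _ => abs_nonneg _, fun x hx hδ v₀ hv₀ => ?_⟩
  have z2 := s2.eq_zero (Or.inl hδ)
  have z4 := s4.eq_zero (Or.inl hδ)
  have D2 : HasD (eT x) v₂ 0 x :=
    ⟨h2.smoothOff.differentiableAt hx, by rw [s2.fderiv_eq_zero (Or.inl hδ)]; rfl⟩
  have D4 : HasD (eT x) v₄ 0 x :=
    ⟨h4.smoothOff.differentiableAt hx, by rw [s4.fderiv_eq_zero (Or.inl hδ)]; rfl⟩
  obtain ⟨α, hα, eA, cA⟩ := ha x hx hδ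
  obtain ⟨β, hβ, eB, cB⟩ := hb x hx hδ
  obtain ⟨γ, hγ, eC, cC⟩ := hc x hx hδ
  have P := potAt_pot k h2 h4 p2 p4 hx
  obtain ⟨f0, f1, f2, f3, f4, f5, f6⟩ := hform v₀ v₂ v₄ _ _ _ x α β γ hx hv₀ z2 z4 eA eB eC
  have hb : ∀ i, |F i (α, β, γ, tanHalf x)| ≤ ∑ i, |m i| := fun i => by
    by_cases hc0 : cosTheta x ≤ 0
    · rw [cA hc0, cB hc0, cC hc0, hF0]
      simpa using Finset.sum_nonneg fun i _ => abs_nonneg (m i)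
    · have ht1 : tanHalf x ≤ 1 := by
        rw [tanHalf, div_le_one (one_add_cosTheta_pos hx)]
        nlinarith [sinTheta_sq_add hx, sinTheta_pos hx]
      have hmem : (α, β, γ, tanHalf x) ∈ K :=
        ⟨abs_le.1 hα, abs_le.1 hβ, abs_le.1 hγ, (tanHalf_pos hx).le, ht1⟩
      exact ((hm i _ hmem).trans (le_abs_self _)).trans
        (Finset.single_le_sum (fun i _ => abs_nonneg (m i)) (Finset.mem_univ i))
  refine ⟨?_, ?_, ?_, ?_, ?_, ?_, ?_⟩
  · rw [dualTwo, f0]; exact hb 0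
  · rw [dualFour, f1]; exact hb 1
  · have e : Dt (dualTwo k v₂) x = _ := (hasD_conjTwo hx P D2).eq
    rw [e, z2, zero_add, add_zero, f2]
    exact hb 2
  · have e : Dt (dualFour k v₄) x = _ := (hasD_conjFour hx P D4).eq
    rw [e, z4, mul_zero, add_zero, zero_add, f3]
    exact hb 3
  · rw [dualPrimTwo, f4]; exact hb 4
  · rw [dualPrimFour, f5]; exact hb 5
  · rw [dualPrimAng, f6]; exact hb 6

section vanish

variable {k : ℕ} {v₀ v₂ v₄ : E3 → ℝ} {δ R : ℝ} {x : E3}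

theorem dualTwo_eq_zero (s2 : SuppIn δ R v₂) (hx : ‖x‖ ^ 2 < δ ∨ R < ‖x‖) :
    dualTwo k v₂ x = 0 ∧ dualPrimTwo k v₂ x = 0 := by
  have z2 := s2.eq_zero (hx.imp_left (axisSq_le_norm_sq x).trans_lt)
  have hA := pot_eq_zero k s2 hx
  simp [dualTwo, conjTwo, dualPrimTwo, z2, hA]

theorem dualFour_eq_zero (s4 : SuppIn δ R v₄) (hx : ‖x‖ ^ 2 < δ ∨ R < ‖x‖) :
    dualFour k v₄ x = 0 ∧ dualPrimFour k v₄ x = 0 := by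
  have z4 := s4.eq_zero (hx.imp_left (axisSq_le_norm_sq x).trans_lt)
  have hB := pot_eq_zero k
    (s4.of_eq_zero (g := fun y => cscTheta y * v₄ y) fun x hx => by simp [hx]) hx
  have hC := pot_eq_zero k
    (s4.of_eq_zero (g := fun y => cotTheta y * v₄ y) fun x hx => by simp [hx]) hx
  simp [dualFour, conjFour, dualPrimFour, primFour, z4, hB, hC]

theorem dualPrim_eq_zero (a b c : ℝ) (u : ℝ → ℝ) (s0 : SuppIn δ R v₀) (s2 : SuppIn δ R v₂)
    (s4 : SuppIn δ R v₄) (hx : ‖x‖ ^ 2 < δ ∨ R < ‖x‖) :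
    dualPrim a b c u k v₀ v₂ v₄ x = 0 := by
  have hx' := hx.imp_left (axisSq_le_norm_sq x).trans_lt
  have z0 := s0.eq_zero hx'
  have z2 := s2.eq_zero hx'
  have z4 := s4.eq_zero hx'
  have hA := pot_eq_zero k s2 hx
  have hB := pot_eq_zero k
    (s4.of_eq_zero (g := fun y => cscTheta y * v₄ y) fun x hx => by simp [hx]) hx
  have hC := pot_eq_zero k
    (s4.of_eq_zero (g := fun y => cotTheta y * v₄ y) fun x hx => by simp [hx]) hx
  have e1 := (dualTwo_eq_zero (k := k) (s2.dir eR) hx).2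
  have e2 := (dualFour_eq_zero (k := k) (s4.dir eR) hx).2
  have e3 := (dualTwo_eq_zero (k := k) s2 hx).2
  have e4 := (dualFour_eq_zero (k := k) s4 hx).2
  have e5 : dualPrimAng k v₀ v₂ v₄ x = 0 := by
    simp [dualPrimAng, primAng, angBoundary, conjTwo, conjFour, z0, z2, z4, hA, hB, hC]
  change ‖x‖ ^ 2 * (dualPrimTwo k (fun x => fderiv ℝ v₂ x (eR x)) x
    + dualPrimFour k (fun x => fderiv ℝ v₄ x (eR x)) x) + dualPrimAng k v₀ v₂ v₄ x
    + ‖x‖ ^ 2 * (fMid a b c (u ‖x‖) * dualPrimTwo k v₂ x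
      + fTilde a b c (u ‖x‖) * dualPrimFour k v₄ x) = 0
  rw [e1, e2, e3, e4, e5]
  ring

end vanish

/-- The terms with the derivatives `r`, `t` of the cutoff `χ`, where `g` bounds the squared
gradient. -/
theorem cut_error_le {χ r t i A B C g η P Q S d : ℝ} (hχ : 0 ≤ χ ∧ χ ≤ 1) (hη : 0 < η)
    (hA : |A| ≤ P) (hB : |B| ≤ Q) (hC0 : 0 ≤ C) (hC : C ≤ S) (hg : r ^ 2 + i * t ^ 2 ≤ g)
    (hi : 0 ≤ i) (hid : i ≤ d) :
    2 * χ * r * A + 2 * χ * t * i * B + (r ^ 2 + i * t ^ 2) * C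
      ≤ (P + Q * (1 + d) + S) * (η + (1 / η + 1) * g) := by
  have hη' : 0 < 1 / η := by positivity
  have hit : 0 ≤ i * t ^ 2 := by positivity
  have hrg : r ^ 2 ≤ g := by linarith
  have htg : i * t ^ 2 ≤ g := by nlinarith [sq_nonneg r]
  have hg0 : 0 ≤ g := (sq_nonneg r).trans hrg
  have hP : 0 ≤ P := (abs_nonneg A).trans hA
  have hQ : 0 ≤ Q := (abs_nonneg B).trans hB
  -- Young's inequality for the terms linear in the derivatives of `χ`
  have young : ∀ y z T : ℝ, |z| ≤ T → 2 * χ * y * z ≤ T * (η + 1 / η * y ^ 2) := fun y z T hz => by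
    have h1 : 2 * |y| ≤ η + 1 / η * y ^ 2 := by
      rw [← sub_nonneg, show η + 1 / η * y ^ 2 - 2 * |y| = 1 / η * (|y| - η) ^ 2 by
        rw [← sq_abs y]; field_simp; ring]
      positivity
    have h2 : 2 * χ * y * z ≤ 2 * |y| * |z| := by
      calc 2 * χ * y * z ≤ |2 * χ * y * z| := le_abs_self _
        _ = χ * (2 * |y| * |z|) := by
          rw [abs_mul, abs_mul, abs_mul, abs_of_nonneg hχ.1, abs_of_pos (zero_lt_two)]; ring
        _ ≤ _ := mul_le_of_le_one_left (by positivity) hχ.2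
    calc 2 * χ * y * z ≤ 2 * |y| * |z| := h2
      _ ≤ (η + 1 / η * y ^ 2) * T := mul_le_mul h1 hz (abs_nonneg _) (by positivity)
      _ = _ := mul_comm _ _
  set G := η + (1 / η + 1) * g with hG
  have hG0 : 0 ≤ G := by positivity
  have k0 : 1 / η * g ≤ (1 / η + 1) * g := by linarith
  have k1 : η + 1 / η * r ^ 2 ≤ G := by
    have := mul_le_mul_of_nonneg_left hrg hη'.le
    linarith
  have k2 : i * (η + 1 / η * t ^ 2) ≤ (1 + d) * G := by
    have h1 := mul_le_mul_of_nonneg_left htg hη'.le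
    have h2 : i * η ≤ d * G := mul_le_mul hid
      (by rw [hG]; linarith [mul_nonneg (by positivity : 0 ≤ 1 / η + 1) hg0]) hη.le (hi.trans hid)
    have h3 : i * (1 / η * t ^ 2) ≤ G := by linarith
    linarith
  have k3 : (r ^ 2 + i * t ^ 2) * C ≤ S * G := by
    rw [mul_comm S]
    refine mul_le_mul (hg.trans ?_) hC hC0 hG0
    rw [hG]; linarith [mul_nonneg hη'.le hg0]
  have Y1 := (young r A P hA).trans (mul_le_mul_of_nonneg_left k1 hP)
  have Y2 := (mul_le_mul_of_nonneg_left (young t B Q hB) hi)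
  have Y3 := mul_le_mul_of_nonneg_left k2 hQ
  linarith

/-- The energy density of the mode `-k` on the transformed components, cut off near the axis by
`χ`: up to a divergence, it is the energy density of the mode `k` plus terms with a derivative of
`χ`, the coefficients of which are bounded. -/
theorem modeEnergy_cut_le {a b c : ℝ} {u : ℝ → ℝ} (hu : IsProfile a b c u) {k : ℕ}
    (hk : k = 1 ∨ k = 2) {v₀ v₂ v₄ : E3 → ℝ} (h0 : IsTest v₀) (h2 : IsTest v₂) (h4 : IsTest v₄)
    (d2 : IsTest (Dr v₂)) (d4 : IsTest (Dr v₄)) (p2 : IsPhiIndependent v₂)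
    (p4 : IsPhiIndependent v₄) {δ R : ℝ} (hδ : 0 < δ) (s0 : SuppIn δ R v₀) (s2 : SuppIn δ R v₂)
    (s4 : SuppIn δ R v₄) :
    ∃ M, 0 ≤ M ∧ ∀ χ : E3 → ℝ, ContDiff ℝ 1 χ → (∀ x, 0 ≤ χ x ∧ χ x ≤ 1) →
      (∀ x, δ / 2 ≤ axisSq x → χ x = 1) → ∀ η, 0 < η → ∀ x ∈ offAxis,
      modeEnergy a b c u (-k) v₀ (fun y => χ y * dualTwo k v₂ y) (fun y => χ y * dualFour k v₄ y) x
        - modeEnergy a b c u k v₀ v₂ v₄ x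
        - 1 / ‖x‖ ^ 2 * (Dt (fun y => χ y * (χ y * (cscTheta y * dualPrim a b c u k v₀ v₂ v₄ y))) x
          + cotTheta x * (χ x * (χ x * (cscTheta x * dualPrim a b c u k v₀ v₂ v₄ x))))
      ≤ (Metric.closedBall 0 R).indicator
        (fun x => M * (η + (1 / η + 1) * ∑ i, pd i χ x ^ 2)) x := by
  obtain ⟨M₁, hM₁, b₁⟩ := exists_bound_dual hk h2 h4 p2 p4 s2 s4
  obtain ⟨M₂, hM₂, b₂⟩ := exists_bound_dual hk d2 d4 (p2.Dr h2) (p4.Dr h4) (s2.dir eR) (s4.dir eR)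
  obtain ⟨N₁, hN₁⟩ := hu.exists_bound_comp (continuous_fMid a b c)
  obtain ⟨N₂, hN₂⟩ := hu.exists_bound_comp (continuous_fTilde a b c)
  have hN₁0 : 0 ≤ N₁ := (abs_nonneg _).trans (hN₁ 0)
  have hN₂0 : 0 ≤ N₂ := (abs_nonneg _).trans (hN₂ 0)
  let Mz := R ^ 2 * (M₂ + M₂) + M₁ + R ^ 2 * (N₁ * M₁ + N₂ * M₁)
  have hMz : 0 ≤ Mz := by positivity
  refine ⟨2 * M₁ * M₂ + (2 * M₁ ^ 2 + Mz) * (1 + 1 / δ) + 2 * M₁ ^ 2, by positivity,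
    fun χ hχ hχ01 hχ1 η hη x hx => ?_⟩
  set Z := dualPrim a b c u k v₀ v₂ v₄ with hZ
  set c₂ := dualTwo k v₂ with hc₂
  set c₄ := dualFour k v₄ with hc₄
  have hd : ∀ (e : E3) {f : E3 → ℝ}, SmoothOff 1 f → HasD e f (fderiv ℝ f x e) x :=
    fun e f hf => ⟨hf.differentiableAt hx, rfl⟩
  have Sχ : SmoothOff 1 χ := .of_contDiff hχ
  have S2 : SmoothOff 1 c₂ := smoothOff_dualTwo h2
  have S4 : SmoothOff 1 c₄ := smoothOff_dualFour h4
  have r2 : Dr (fun y => χ y * c₂ y) x = Dr χ x * c₂ x + χ x * Dr c₂ x :=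
    ((hd (eR x) Sχ).mul (hd _ S2)).eq
  have r4 : Dr (fun y => χ y * c₄ y) x = Dr χ x * c₄ x + χ x * Dr c₄ x :=
    ((hd (eR x) Sχ).mul (hd _ S4)).eq
  have t2 : Dt (fun y => χ y * c₂ y) x = Dt χ x * c₂ x + χ x * Dt c₂ x :=
    ((hd (eT x) Sχ).mul (hd _ S2)).eq
  have t4 : Dt (fun y => χ y * c₄ y) x = Dt χ x * c₄ x + χ x * Dt c₄ x :=
    ((hd (eT x) Sχ).mul (hd _ S4)).eq
  have hZd := hasD_dualPrim (k := k) hu hx h0 h2 h4 d2 d4 p2 p4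
  rw [← hZ, ← hc₂, ← hc₄] at hZd
  have tX : Dt (fun y => χ y * (χ y * (cscTheta y * Z y))) x
      = Dt χ x * (χ x * (cscTheta x * Z x)) + χ x * (Dt χ x * (cscTheta x * Z x)
        + χ x * (-(cscTheta x * cotTheta x) * Z x + cscTheta x * (sinTheta x * ‖x‖ ^ 2 *
          (modeEnergy a b c u (-k) v₀ c₂ c₄ x - modeEnergy a b c u k v₀ v₂ v₄ x)))) :=
    ((hd (eT x) Sχ).mul ((hd (eT x) Sχ).mul ((hasD_cscTheta hx).mul hZd))).eq
  have hr := norm_pos_of_mem_offAxis hx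
  have hs := sinTheta_pos hx
  have hcs : cscTheta x * sinTheta x = 1 := by rw [cscTheta]; field_simp
  -- the divergence term equals `χ²` times the difference of the densities plus a remainder
  have tX' : 1 / ‖x‖ ^ 2 * (Dt (fun y => χ y * (χ y * (cscTheta y * Z y))) x
        + cotTheta x * (χ x * (χ x * (cscTheta x * Z x))))
      = χ x ^ 2 * (modeEnergy a b c u (-k) v₀ c₂ c₄ x - modeEnergy a b c u k v₀ v₂ v₄ x)
        + 2 * χ x * Dt χ x * (1 / ‖x‖ ^ 2) * (cscTheta x * Z x) := by
    have hrr : 1 / ‖x‖ ^ 2 * ‖x‖ ^ 2 = 1 := by field_simp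
    rw [tX]
    linear_combination (χ x ^ 2 * (modeEnergy a b c u (-k) v₀ c₂ c₄ x
      - modeEnergy a b c u k v₀ v₂ v₄ x)) * (cscTheta x * sinTheta x * hrr + hcs)
  rw [tX']
  have hind : 0 ≤ (Metric.closedBall 0 R).indicator
      (fun x => (2 * M₁ * M₂ + (2 * M₁ ^ 2 + Mz) * (1 + 1 / δ) + 2 * M₁ ^ 2) *
        (η + (1 / η + 1) * ∑ i, pd i χ x ^ 2)) x :=
    Set.indicator_nonneg (fun y _ => by positivity) x
  -- where `χ` need not be `1`, the functions `v₀`, `v₂`, `v₄` vanish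
  by_cases hcase : axisSq x < δ
  swap
  · have hx1 : χ x = 1 := hχ1 x (by linarith [not_lt.1 hcase])
    have ho : IsOpen {y : E3 | δ / 2 < axisSq y} :=
      isOpen_lt continuous_const (contDiff_axisSq (n := 0)).continuous
    have hev : χ =ᶠ[𝓝 x] fun _ => 1 := by
      filter_upwards [ho.mem_nhds (show δ / 2 < axisSq x by linarith [not_lt.1 hcase])] with y hy
      exact hχ1 y (le_of_lt hy)
    have hf : fderiv ℝ χ x = 0 := by rw [hev.fderiv_eq]; simp
    have e1 : Dr χ x = 0 := by rw [Dr, hf]; rfl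
    have e2 : Dt χ x = 0 := by rw [Dt, hf]; rfl
    refine le_trans (le_of_eq ?_) hind
    simp only [modeEnergy, modeAng, r2, r4, t2, t4, hx1, e1, e2]
    ring
  have z0 := s0.eq_zero (Or.inl hcase)
  have z2 := s2.eq_zero (Or.inl hcase)
  have z4 := s4.eq_zero (Or.inl hcase)
  have f0 := s0.fderiv_eq_zero (Or.inl hcase)
  have f2 := s2.fderiv_eq_zero (Or.inl hcase)
  have f4 := s4.fderiv_eq_zero (Or.inl hcase)
  have rem : modeEnergy a b c u (-k) v₀ (fun y => χ y * c₂ y) (fun y => χ y * c₄ y) x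
        - modeEnergy a b c u k v₀ v₂ v₄ x
        - (χ x ^ 2 * (modeEnergy a b c u (-k) v₀ c₂ c₄ x - modeEnergy a b c u k v₀ v₂ v₄ x)
          + 2 * χ x * Dt χ x * (1 / ‖x‖ ^ 2) * (cscTheta x * Z x))
      = 2 * χ x * Dr χ x * (c₂ x * Dr c₂ x + c₄ x * Dr c₄ x)
        + 2 * χ x * Dt χ x * (1 / ‖x‖ ^ 2) * (c₂ x * Dt c₂ x + c₄ x * Dt c₄ x - cscTheta x * Z x)
        + (Dr χ x ^ 2 + 1 / ‖x‖ ^ 2 * Dt χ x ^ 2) * (c₂ x ^ 2 + c₄ x ^ 2) := by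
    have g0 : Dr v₀ x = 0 := by rw [Dr, f0]; rfl
    have g0' : Dt v₀ x = 0 := by rw [Dt, f0]; rfl
    have g2 : Dr v₂ x = 0 := by rw [Dr, f2]; rfl
    have g2' : Dt v₂ x = 0 := by rw [Dt, f2]; rfl
    have g4 : Dr v₄ x = 0 := by rw [Dr, f4]; rfl
    have g4' : Dt v₄ x = 0 := by rw [Dt, f4]; rfl
    simp only [modeEnergy, modeAng, r2, r4, t2, t4, z0, z2, z4, g0, g0', g2, g2', g4, g4']
    ring
  rw [rem]
  by_cases hout : ‖x‖ ^ 2 < δ ∨ R < ‖x‖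
  · refine le_trans (le_of_eq ?_) hind
    rw [hc₂, hc₄, hZ, (dualTwo_eq_zero s2 hout).1, (dualFour_eq_zero s4 hout).1,
      dualPrim_eq_zero a b c u s0 s2 s4 hout]
    ring
  push Not at hout
  rw [Set.indicator_of_mem (by simpa using hout.2)]
  obtain ⟨q1, q2, q3, q4, q5, q6, q7⟩ := b₁ x hx hcase v₀ z0
  obtain ⟨w1, w2, -, -, w5, w6, -⟩ := b₂ x hx hcase v₀ z0
  have eD2 : Dr c₂ x = dualTwo k (Dr v₂) x := (hasD_dualTwo_radius hx h2).eq
  have eD4 : Dr c₄ x = dualFour k (Dr v₄) x := (hasD_dualFour_radius hx h4).eq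
  have mulb : ∀ {p q P Q : ℝ}, |p| ≤ P → |q| ≤ Q → |p * q| ≤ P * Q := fun hp hq => by
    rw [abs_mul]; exact mul_le_mul hp hq (abs_nonneg _) ((abs_nonneg _).trans hp)
  have addb : ∀ {p q P Q : ℝ}, |p| ≤ P → |q| ≤ Q → |p + q| ≤ P + Q := fun hp hq =>
    (abs_add_le _ _).trans (add_le_add hp hq)
  have bA : |c₂ x * Dr c₂ x + c₄ x * Dr c₄ x| ≤ 2 * M₁ * M₂ := by
    rw [eD2, eD4]
    exact (addb (mulb q1 w1) (mulb q2 w2)).trans (le_of_eq (by ring))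
  have hR2 : |‖x‖ ^ 2| ≤ R ^ 2 := by
    rw [abs_of_nonneg (by positivity)]
    exact pow_le_pow_left₀ hr.le hout.2 2
  have bZ : |cscTheta x * Z x| ≤ Mz := by
    have e : cscTheta x * Z x = ‖x‖ ^ 2 * (cscTheta x * dualPrimTwo k (Dr v₂) x
        + cscTheta x * dualPrimFour k (Dr v₄) x) + cscTheta x * dualPrimAng k v₀ v₂ v₄ x
        + ‖x‖ ^ 2 * (fMid a b c (u ‖x‖) * (cscTheta x * dualPrimTwo k v₂ x)
          + fTilde a b c (u ‖x‖) * (cscTheta x * dualPrimFour k v₄ x)) := by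
      rw [hZ, dualPrim]; ring
    rw [e]
    exact addb (addb (mulb hR2 (addb w5 w6)) q7)
      (mulb hR2 (addb (mulb (hN₁ x) q5) (mulb (hN₂ x) q6)))
  have bB : |c₂ x * Dt c₂ x + c₄ x * Dt c₄ x - cscTheta x * Z x| ≤ 2 * M₁ ^ 2 + Mz := by
    rw [sub_eq_add_neg]
    refine (addb (addb (mulb q1 q3) (mulb q2 q4)) ((abs_neg _).le.trans bZ)).trans (le_of_eq ?_)
    ring
  have bC : c₂ x ^ 2 + c₄ x ^ 2 ≤ 2 * M₁ ^ 2 := by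
    have := sq_le_sq' (abs_le.1 q1).1 (abs_le.1 q1).2
    have := sq_le_sq' (abs_le.1 q2).1 (abs_le.1 q2).2
    linarith
  have hg := sum_sq_pd (f := χ) hx
  set g := ∑ i, pd i χ x ^ 2 with hgdef
  have hgr : Dr χ x ^ 2 + 1 / ‖x‖ ^ 2 * Dt χ x ^ 2 ≤ g := by
    rw [hg]
    have : 0 ≤ 1 / ‖x‖ ^ 2 * (fderiv ℝ χ x (eP x) / sinTheta x) ^ 2 := by positivity
    simp only [Dr, Dt]
    linarith
  have hinv : 0 ≤ 1 / ‖x‖ ^ 2 := by positivity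
  have hinvδ : 1 / ‖x‖ ^ 2 ≤ 1 / δ := one_div_le_one_div_of_le hδ hout.1
  exact cut_error_le (hχ01 x) hη bA bB (by positivity) bC hgr hinv hinvδ

theorem SuppIn.mono {δ δ' R R' : ℝ} {f : E3 → ℝ} (hf : SuppIn δ R f) (hδ : δ' ≤ δ) (hR : R ≤ R') :
    SuppIn δ' R' f := fun x hx => ⟨hδ.trans (hf x hx).1, (hf x hx).2.trans hR⟩

theorem exists_suppIn {v₀ v₂ v₄ : E3 → ℝ} (h0 : IsTest v₀) (h2 : IsTest v₂) (h4 : IsTest v₄) :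
    ∃ δ R, 0 < δ ∧ 0 ≤ R ∧ SuppIn δ R v₀ ∧ SuppIn δ R v₂ ∧ SuppIn δ R v₄ := by
  obtain ⟨δ₀, R₀, p0, s0⟩ := CptOff.iff.1 h0.cptOff
  obtain ⟨δ₂, R₂, p2, s2⟩ := CptOff.iff.1 h2.cptOff
  obtain ⟨δ₄, R₄, p4, s4⟩ := CptOff.iff.1 h4.cptOff
  have m0 : R₀ ≤ |R₀| + |R₂| + |R₄| := by
    linarith [le_abs_self R₀, abs_nonneg R₂, abs_nonneg R₄]
  have m2 : R₂ ≤ |R₀| + |R₂| + |R₄| := by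
    linarith [le_abs_self R₂, abs_nonneg R₀, abs_nonneg R₄]
  have m4 : R₄ ≤ |R₀| + |R₂| + |R₄| := by
    linarith [le_abs_self R₄, abs_nonneg R₂, abs_nonneg R₀]
  exact ⟨min δ₀ (min δ₂ δ₄), |R₀| + |R₂| + |R₄|, lt_min p0 (lt_min p2 p4), by positivity,
    SuppIn.mono s0 (min_le_left _ _) m0,
    SuppIn.mono s2 ((min_le_right _ _).trans (min_le_left _ _)) m2,
    SuppIn.mono s4 ((min_le_right _ _).trans (min_le_right _ _)) m4⟩

theorem isPhiIndependent_cosTheta : IsPhiIndependent cosTheta := fun _ _ h1 h2 =>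
  cosTheta_eq_of h1 h2

theorem isPhiIndependent_dualTwo (k : ℕ) {v₂ : E3 → ℝ} (p2 : IsPhiIndependent v₂) :
    IsPhiIndependent (dualTwo k v₂) := fun x y h1 h2 => by
  simp only [dualTwo, conjTwo, p2 x y h1 h2, isPhiIndependent_cscTheta x y h1 h2,
    isPhiIndependent_pot k v₂ x y h1 h2]

theorem isPhiIndependent_dualFour (k : ℕ) {v₄ : E3 → ℝ} (p4 : IsPhiIndependent v₄) :
    IsPhiIndependent (dualFour k v₄) := fun x y h1 h2 => by
  simp only [dualFour, conjFour, p4 x y h1 h2, isPhiIndependent_cscTheta x y h1 h2,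
    isPhiIndependent_cotTheta x y h1 h2, isPhiIndependent_cosTheta x y h1 h2,
    isPhiIndependent_pot k _ x y h1 h2]

theorem integrable_Dt_add_cot {X : E3 → ℝ} (hX : IsTest X) :
    Integrable (fun x => 1 / ‖x‖ ^ 2 * (Dt X x + cotTheta x * X x)) volume := by
  refine CptOff.integrable (CptOff.mul_left (hX.cptOff.Dt.add hX.cptOff.mul_left)) ?_
  have hX0 : SmoothOff 0 X := fun x hx => (hX.smoothOff x hx).of_le (by norm_num)
  exact (SmoothOff.inv_norm_sq.mul ((hX.smoothOff.Dt (by norm_num)).add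
    (SmoothOff.cotTheta.mul hX0))).continuousOn (n := 0)

/-- For `k = 1, 2` the energy of the mode `k` is nonnegative: a competitor on the mode `-k` with
nearly the same energy is obtained by cutting off the transformed components near the axis. -/
theorem SecondVariationNonneg.integral_modeEnergy_nonneg {a b c : ℝ} {u : ℝ → ℝ}
    (hu : IsProfile a b c u) (hQ : SecondVariationNonneg a b c u) {k : ℕ} (hk : k = 1 ∨ k = 2)
    {v₀ v₂ v₄ : E3 → ℝ} (h0 : IsTest v₀) (h2 : IsTest v₂) (h4 : IsTest v₄)
    (d2 : IsTest (Dr v₂)) (d4 : IsTest (Dr v₄)) (p0 : IsPhiIndependent v₀)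
    (p2 : IsPhiIndependent v₂) (p4 : IsPhiIndependent v₄) :
    0 ≤ ∫ x, modeEnergy a b c u k v₀ v₂ v₄ x := by
  obtain ⟨δ, R, hδ, hR, s0, s2, s4⟩ := exists_suppIn h0 h2 h4
  obtain ⟨M, hM, hcut⟩ := modeEnergy_cut_le hu hk h0 h2 h4 d2 d4 p2 p4 hδ s0 s2 s4
  set B := Metric.closedBall (0 : E3) R with hB
  set I := ∫ x, modeEnergy a b c u k v₀ v₂ v₄ x with hI
  have hBfin : volume B ≠ ⊤ := measure_closedBall_lt_top.ne
  -- a cutoff with Dirichlet integral at most `η²`, and Young's inequality with the parameter `η`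
  have key : ∀ η, 0 < η → 0 ≤ 2 * I + M * (η * volume.real B + (1 / η + 1) * η ^ 2) := by
    intro η hη
    obtain ⟨χ, hχ, hχ01, hχp, ⟨ε, hε, hχ0⟩, hχ1, hχd⟩ :=
      exists_axis_cut (half_pos hδ) (pow_pos hη 2) hR
    have Sχ : SmoothOff 1 χ := .of_contDiff hχ
    have cut : ∀ g : E3 → ℝ, SmoothOff 1 g → (∀ x, R < ‖x‖ → g x = 0) →
        IsTest fun x => χ x * g x := fun g hg hgR => by
      refine CptOff.isTest (CptOff.iff.2 ⟨ε, R, hε, fun x hx => ?_⟩) (Sχ.mul hg)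
      refine ⟨not_lt.1 fun h => hx (by rw [hχ0 x h, zero_mul]),
        not_lt.1 fun h => hx (by rw [hgR x h, mul_zero])⟩
    have t2 := cut _ (smoothOff_dualTwo (k := k) h2) fun x hx => (dualTwo_eq_zero s2 (Or.inr hx)).1
    have t4 := cut _ (smoothOff_dualFour (k := k) h4)
      fun x hx => (dualFour_eq_zero s4 (Or.inr hx)).1
    have hX := IsTest.mul_left Sχ (cut _ (SmoothOff.cscTheta.mul
      (smoothOff_dualPrim (k := k) hu h0 h2 h4 d2 d4)) fun x hx => by
        rw [dualPrim_eq_zero a b c u s0 s2 s4 (Or.inr hx), mul_zero])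
    have hpos := hQ.modes hu k h0 h2 h4 t2 t4 p0 p2 p4
      (hχp.mul (isPhiIndependent_dualTwo k p2)) (hχp.mul (isPhiIndependent_dualFour k p4))
    have i1 := integrable_modeEnergy hu k h0 h2 h4
    have i2 := integrable_modeEnergy hu (-k) h0 t2 t4
    have iX := integrable_Dt_add_cot hX
    have iG : IntegrableOn (fun x => ∑ i, pd i χ x ^ 2) B volume :=
      (continuous_finsetSum _ fun i _ => (continuous_pd hχ i).pow 2).continuousOn.integrableOn_compact
        (isCompact_closedBall 0 R)
    have iC : IntegrableOn (fun _ : E3 => η) B volume := integrableOn_const hBfin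
    have iE : IntegrableOn (fun x => M * (η + (1 / η + 1) * ∑ i, pd i χ x ^ 2)) B volume :=
      (iC.add (iG.const_mul _)).const_mul _
    have hle := integral_mono_ae ((i2.sub i1).sub iX)
      (iE.integrable_indicator Metric.isClosed_closedBall.measurableSet)
      (ae_mem_offAxis.mono fun x hx => hcut χ hχ hχ01 hχ1 η hη x hx)
    rw [integral_sub' (i2.sub i1) iX, integral_Dt_add_cot hX, sub_zero, integral_sub' i2 i1,
      integral_indicator Metric.isClosed_closedBall.measurableSet, integral_const_mul,
      integral_add iC.integrable (iG.const_mul _), integral_const_mul,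
      setIntegral_const, smul_eq_mul] at hle
    have hd : M * (volume.real B * η + (1 / η + 1) * ∫ x in B, ∑ i, pd i χ x ^ 2)
        ≤ M * (η * volume.real B + (1 / η + 1) * η ^ 2) := by
      rw [mul_comm (volume.real B)]
      gcongr
    linarith
  have lim : Tendsto (fun η : ℝ => 2 * I + M * (η * volume.real B + (η + η ^ 2))) (𝓝[>] 0)
      (𝓝 (2 * I)) := by
    have : Continuous fun η : ℝ => 2 * I + M * (η * volume.real B + (η + η ^ 2)) := by fun_prop
    exact (this.tendsto' 0 _ (by simp)).mono_left nhdsWithin_le_nhds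
  have := ge_of_tendsto lim (by
    filter_upwards [self_mem_nhdsWithin] with η hη
    have hη0 : (η : ℝ) ≠ 0 := (Set.mem_Ioi.1 hη).ne'
    have := key η hη
    rwa [show (1 / η + 1) * η ^ 2 = η + η ^ 2 by field_simp] at this)
  linarith

/-- Nonnegativity of the second variation implies that of `Φ₀, Φ₁, Φ₂`. -/
theorem phiNonneg_of_secondVariationNonneg {a b c : ℝ} {u : ℝ → ℝ} (hu : IsProfile a b c u)
    (hQ : SecondVariationNonneg a b c u) {k : ℕ} (hk : k ≤ 2) : PhiNonneg a b c u k := by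
  refine phiNonneg_of_test hu fun v₀ v₂ v₄ h0 h2 h4 _ s2 s4 p0 p2 p4 => ?_
  rw [← (integral_modeEnergy hu k h0 h2 h4).2]
  rcases Nat.eq_zero_or_pos k with rfl | hk0
  · have := hQ.modes hu 0 h0 h2 h4 h2 h4 p0 p2 p4 p2 p4
    rw [Nat.cast_zero, neg_zero] at this
    rw [Nat.cast_zero]
    linarith
  · have smooth : ∀ {v : E3 → ℝ}, ContDiff ℝ ∞ v → SmoothOff 2 v := fun h =>
      .of_contDiff (contDiff_infty.1 h 2)
    exact hQ.integral_modeEnergy_nonneg hu (by omega) h0 h2 h4 (isTest_Dr h2 (smooth s2))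
      (isTest_Dr h4 (smooth s4)) p0 p2 p4

end MeltingHedgehog

theorem proposition3p2 (a b c : ℝ) (ha : 0 < a) (hb : 0 < b) (hc : 0 < c)
    (u : ℝ → ℝ) (hu : MeltingHedgehog.IsProfile a b c u) :
    MeltingHedgehog.SecondVariationNonneg a b c u ↔
      MeltingHedgehog.PhiNonneg a b c u 0 ∧
      MeltingHedgehog.PhiNonneg a b c u 1 ∧
      MeltingHedgehog.PhiNonneg a b c u 2 := by
  constructor
  · intro hQ
    exact ⟨MeltingHedgehog.phiNonneg_of_secondVariationNonneg hu hQ (by norm_num),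
      MeltingHedgehog.phiNonneg_of_secondVariationNonneg hu hQ (by norm_num),
      MeltingHedgehog.phiNonneg_of_secondVariationNonneg hu hQ le_rfl⟩
  · rintro ⟨h0, h1, h2⟩
    refine MeltingHedgehog.secondVariationNonneg_of_phiNonneg hu fun k hk => ?_
    interval_cases k
    exacts [h0, h1, h2]
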